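/- Let $n\ge 1$ and $0<a_1<\cdots<a_{n+1}$, put $a_0=0$, and consider billiards inside the nondegenerate ellipsoid $\sum_{i=1}^{n+1}x_i^2/a_i=1$ of $\mathbb R^{n+1}$. Its nonsingular caustic space is $$\Lambda=\{\lambda\in\mathbb R^n: 0<\lambda_1<\cdots<\lambda_n,\ \lambda_i\in(a_{i-1},a_i)\cup(a_i,a_{i+1})\ (1\le i\le n)\}.$$ For $\lambda\in\Lambda$ let $0=c_0<c_1<\cdots<c_{2n+1}$ be the increasing enumeration of $0,a_1,\dots,a_{n+1},\lambda_1,\dots,\lambda_n$, let $T(s)=\prod_{i=1}^{2n+1}(c_i-s)$, $K_{ij}=\int_{c_{2j}}^{c_{2j+1}}s^i\,T(s)^{-1/2}\,ds$ and $K_j=(K_{0j},\dots,K_{n-1,j})^t$. The frequency $\omega(\lambda)\in\mathbb R^n$ is the unique solution of $K_0+2\sum_{j=1}^n(-1)^j\omega_jK_j=0$ (it exists and is unique for every $\lambda\in\Lambda$); for $n=0$ it is the empty vector. Let $\Lambda^k$ be the union of the relatively open $k$-dimensional faces of (the components of) $\Lambda$, that is, the set of $\lambda\in\partial\Lambda$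 whose coordinates take exactly $k$ distinct values outside $\{a_0,\dots,a_{n+1}\}$. Put $G=\{\lambda\in\Lambda^{n-1}:\lambda_1=0\}$, $S_j=\{\lambda\in\Lambda^{n-1}:\lambda_j=a_j\}$, $S=\bigcup_{j=1}^nS_j$, $R=\Lambda^{n-1}\setminus(G\cup S)$ and $G_*=\{(\lambda_2,\dots,\lambda_n):(0,\lambda_2,\dots,\lambda_n)\in G\}$. For $\lambda\in S_j$ and $t$ near $a_j$ let $\lambda^{j,t}$ be $\lambda$ with $j$-th component replaced by $t$. A map on a subset of $\mathbb R^p$ is called analytic if near each point of the subset it is the restriction of an analytic map defined near that point in $\mathbb R^p$. Then the following holds. 1. $\omega$ is analytic in $\Lambda$. 2. $\omega$ extends to a continuous map, again denoted $\omega$, on $\bar\Lambda=\Lambda\cup\partial\Lambda$, such that: (a) $\omega=0$ on $\bar G$. (b) $R$ is the union of the sets $R_l^{+}=\{\lambda\in\Lambda^{n-1}:\lambda_l=a_{l+1}\}$ ($1\le l\le n$), $R_l^{-}=\{\lambda\in\Lambda^{n-1}:\lambda_{l+1}=a_l\}$ and $R_l^{=}=\{\lambda\in\Lambda^{n-1}:\lambda_l=\lambda_{l+1}\}$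 ($1\le l\le n-1$). On each of them $c_{2l}=c_{2l+1}=:c^*$ and, with $T^R(s)=\prod_{i\ne2l,2l+1}(c_i-s)$, the component $\omega_l$ is given explicitly in terms of the other components by $$\int_0^{c_1}\!\frac{ds}{|c^*-s|\sqrt{T^R(s)}}+2\sum_{j\ne l}(-1)^j\omega_j\int_{c_{2j}}^{c_{2j+1}}\!\frac{ds}{|c^*-s|\sqrt{T^R(s)}}+\frac{(-1)^l2\pi\,\omega_l}{\sqrt{-T^R(c^*)}}=0,$$ and on the closure of each of these sets $\omega_l$ is the continuous extension of this explicit expression. (c) $\omega_1=1/2$ on $\bar S_1$. (d) $\omega_l=\omega_{l-1}$ on $\bar S_l$, for $2\le l\le n$. (e) On $\bar S_l$, and on the closures of $R_l^{\pm}$, $R_l^{=}$, the free components $(\omega_i)_{i\ne l}$ are the (extended) frequency, in dimension $n-1$, of the section of the ellipsoid by a coordinate hyperplane $\{x_p=0\}$, whose parameters are $(a_i)_{i\neq p}$, at a caustic parameter $\lambda'$ in the closure of the nonsingular caustic space of that section, namely: on $\bar S_l$, $p=l$ and $\lambda'=(\lambda_i)_{i\ne l}$; on $\overline{R_l^+}$,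 $p=l+1$ and $\lambda'=(\lambda_i)_{i\ne l}$; on $\overline{R_l^-}$, $p=l$ and $\lambda'=(\lambda_i)_{i\ne l+1}$; on $\overline{R_l^=}$, $p=l$ and $\lambda'=(\lambda_1,\dots,\lambda_{l-1},a_l,\lambda_{l+2},\dots,\lambda_n)$. Moreover, for $1\le k\le n-1$, the restriction of the extended map to any connected component of $\Lambda^k$ is analytic. 3. There are analytic maps $\kappa^G:G_*\to\mathbb R^n$, with positive components, and $\kappa^S:S\to\mathbb R^n$ such that: (a) for every $(\lambda_2,\dots,\lambda_n)\in G_*$, $\ \omega(\lambda)=\kappa^G(\lambda_2,\dots,\lambda_n)\lambda_1^{1/2}+O(\lambda_1^{3/2})$ as $\lambda_1\to0^+$; (b) for every $1\le j\le n$ and $\lambda\in S_j$, $\ \omega(\lambda^{j,t})-\omega(\lambda)=\dfrac{\kappa^S(\lambda)}{\log|a_j-t|}+o\!\left(\dfrac1{\log|a_j-t|}\right)$ as $t\to a_j$ (from both sides); (c) for every $\lambda^R\in R$, $\ \omega(\lambda)-\omega(\lambda^R)=O(\lambda-\lambda^R)$ as $\lambda\to\lambda^R$, $\lambda\in\Lambda$.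 -/

import Mathlib

open Set Filter Topology Asymptotics

namespace EllipsoidBilliard

/-- The numbers `0, a₁, …, aₙ₊₁` (the convention `a₀ = 0`).  The ellipsoid in `ℝⁿ⁺¹` is
`∑ xᵢ² / aᵢ = 1`; it is encoded by `a : Fin (n + 1) → ℝ` (so `a i` is `aᵢ₊₁`), and the caustic
parameters by `lam : Fin n → ℝ` (so `lam i` is `λᵢ₊₁`). -/
def withZero {n : ℕ} (a : Fin (n + 1) → ℝ) : Fin (n + 2) → ℝ := Fin.cons 0 a

/-- The nonsingular caustic space `Λ`: `0 < λ₁ < ⋯ < λₙ` and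
`λᵢ ∈ (aᵢ₋₁, aᵢ) ∪ (aᵢ, aᵢ₊₁)` with `a₀ = 0`. -/
def causticSpace {n : ℕ} (a : Fin (n + 1) → ℝ) : Set (Fin n → ℝ) :=
  {lam | StrictMono lam ∧ (∀ i, 0 < lam i) ∧
    ∀ i, lam i ∈ Ioo (withZero a i.castSucc.castSucc) (a i.castSucc) ∪
      Ioo (a i.castSucc) (a i.succ)}

/-- The even-numbered members `c₀ = 0, c₂, …, c₂ₙ` of the increasing enumeration
`0 = c₀ ≤ c₁ ≤ ⋯ ≤ c₂ₙ₊₁` of `0`, the `aᵢ` and the `λᵢ`: one has `c₂ⱼ = max (aⱼ, λⱼ)` for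
`j ≥ 1` (see `bands_sorted` and `bands_range`). -/
def cEven {n : ℕ} (a : Fin (n + 1) → ℝ) (lam : Fin n → ℝ) : Fin (n + 1) → ℝ :=
  Fin.cons 0 (fun i => max (a i.castSucc) (lam i))

/-- The odd-numbered members `c₁, c₃, …, c₂ₙ₊₁` of the same enumeration:
`c₂ⱼ₊₁ = min (aⱼ₊₁, λⱼ₊₁)` for `j < n` and `c₂ₙ₊₁ = aₙ₊₁`. -/
def cOdd {n : ℕ} (a : Fin (n + 1) → ℝ) (lam : Fin n → ℝ) : Fin (n + 1) → ℝ :=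
  Fin.snoc (α := fun _ => ℝ) (fun i => min (a i.castSucc) (lam i)) (a (Fin.last n))

/-- On `Λ` the numbers really are enumerated increasingly: `c₂ⱼ < c₂ⱼ₊₁` and
`c₂ⱼ₊₁ < c₂ⱼ₊₂`. -/
theorem bands_sorted {n : ℕ} {a : Fin (n + 1) → ℝ} {lam : Fin n → ℝ} (ha : StrictMono a)
    (ha0 : ∀ i, 0 < a i) (h : lam ∈ causticSpace a) :
    (∀ j, cEven a lam j < cOdd a lam j) ∧
      ∀ i : Fin n, cOdd a lam i.castSucc < cEven a lam i.succ := by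
  obtain ⟨hm, hp, hI⟩ := h
  have hup : ∀ i : Fin n, lam i < a i.succ := by
    intro i
    rcases hI i with h | h
    · exact h.2.trans (ha Fin.castSucc_lt_succ)
    · exact h.2
  have hlow : ∀ i k : Fin n, i.succ = k.castSucc → a i.castSucc < lam k := by
    intro i k hik
    have hk : a i.castSucc ≤ withZero a k.castSucc.castSucc := by
      rw [← hik]
      simp [withZero]
    rcases hI k with h | h
    · exact hk.trans_lt h.1
    · refine lt_trans (ha ?_) h.1
      rw [← hik]
      exact Fin.castSucc_lt_succ
  constructor
  · intro j
    refine Fin.cases ?_ (fun i => ?_) j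
    · refine Fin.lastCases (motive := fun j => j = 0 → cEven a lam j < cOdd a lam j)
        ?_ (fun k => ?_) (0 : Fin (n + 1)) rfl
      · intro h0
        rw [h0]
        simp only [cEven, Fin.cons_zero]
        rw [← h0]
        simpa [cOdd] using ha0 _
      · intro h0
        simp only [cOdd, Fin.snoc_castSucc]
        rw [h0]
        simp only [cEven, Fin.cons_zero]
        exact lt_min (ha0 _) (hp k)
    · refine Fin.lastCases (motive := fun j => j = i.succ → cEven a lam j < cOdd a lam j)
        ?_ (fun k => ?_) i.succ rfl
      · intro h0
        rw [h0]
        simp only [cEven, Fin.cons_succ]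
        rw [← h0]
        simp only [cOdd, Fin.snoc_last]
        rw [h0]
        exact max_lt (ha Fin.castSucc_lt_succ) (hup i)
      · intro h0
        simp only [cOdd, Fin.snoc_castSucc]
        rw [h0]
        simp only [cEven, Fin.cons_succ]
        have hik : i < k := by
          rw [Fin.lt_def]
          have := congrArg Fin.val h0
          simp at this
          omega
        refine max_lt (lt_min (ha Fin.castSucc_lt_succ) (hlow i k h0.symm))
          (lt_min (hup i) (hm hik))
  · intro i
    simp only [cEven, cOdd, Fin.snoc_castSucc, Fin.cons_succ]
    rw [min_lt_max]
    rcases hI i with h | h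
    · exact h.2.ne'
    · exact h.1.ne

/-- The numbers `c₁, …, c₂ₙ₊₁` are exactly the `aᵢ` and the `λᵢ`. -/
theorem bands_range {n : ℕ} (a : Fin (n + 1) → ℝ) (lam : Fin n → ℝ) :
    range (cOdd a lam) ∪ range (fun i : Fin n => cEven a lam i.succ) = range a ∪ range lam := by
  ext x
  simp only [mem_union, mem_range, Fin.exists_fin_succ', cOdd, cEven, Fin.snoc_castSucc,
    Fin.snoc_last, Fin.cons_succ]
  constructor
  · rintro ((⟨i, rfl⟩ | rfl) | ⟨i, rfl⟩)
    · rcases min_choice (a i.castSucc) (lam i) with h | h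
      · exact Or.inl (Or.inl ⟨i, h.symm⟩)
      · exact Or.inr ⟨i, h.symm⟩
    · exact Or.inl (Or.inr rfl)
    · rcases max_choice (a i.castSucc) (lam i) with h | h
      · exact Or.inl (Or.inl ⟨i, h.symm⟩)
      · exact Or.inr ⟨i, h.symm⟩
  · rintro ((⟨i, rfl⟩ | rfl) | ⟨i, rfl⟩)
    · rcases le_total (a i.castSucc) (lam i) with h | h
      · exact Or.inl (Or.inl ⟨i, min_eq_left h⟩)
      · exact Or.inr ⟨i, max_eq_left h⟩
    · exact Or.inl (Or.inr rfl)
    · rcases le_total (a i.castSucc) (lam i) with h | h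
      · exact Or.inr ⟨i, max_eq_right h⟩
      · exact Or.inl (Or.inl ⟨i, min_eq_right h⟩)

/-- `T(s) = ∏ (cᵢ - s)`, the product over all the `aᵢ` and the `λᵢ`. -/
def T {n : ℕ} (a : Fin (n + 1) → ℝ) (lam : Fin n → ℝ) (s : ℝ) : ℝ :=
  (∏ i, (a i - s)) * ∏ i, (lam i - s)

/-- `Kᵢⱼ = ∫ sⁱ / √T(s) ds` over `(c₂ⱼ, c₂ⱼ₊₁)`. -/
noncomputable def K {n : ℕ} (a : Fin (n + 1) → ℝ) (lam : Fin n → ℝ) (i : ℕ)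
    (j : Fin (n + 1)) : ℝ :=
  ∫ s in (cEven a lam j)..(cOdd a lam j), s ^ i / √(T a lam s)

/-- The linear system `K₀ + 2 ∑ⱼ (-1)ʲ ωⱼ Kⱼ = 0` in `ℝⁿ`; `w j` is `ωⱼ₊₁`. -/
def IsFrequency {n : ℕ} (a : Fin (n + 1) → ℝ) (lam w : Fin n → ℝ) : Prop :=
  ∀ i : Fin n, K a lam i 0 + 2 * ∑ j : Fin n, (-1) ^ ((j : ℕ) + 1) * w j * K a lam i j.succ = 0

open Classical in
/-- The frequency map: the unique solution of the linear system. -/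
noncomputable def frequencyMap {n : ℕ} (a : Fin (n + 1) → ℝ) (lam : Fin n → ℝ) : Fin n → ℝ :=
  if h : ∃! w, IsFrequency a lam w then h.choose else 0

/-- The extended frequency map: its value at a point `x` of the closure of `Λ` is the limit of the
frequency map at `x` from within `Λ`. -/
noncomputable def extFrequencyMap {n : ℕ} (a : Fin (n + 1) → ℝ) : (Fin n → ℝ) → (Fin n → ℝ) :=
  extendFrom (causticSpace a) (frequencyMap a)

/-- The `k`-dimensional border `Λᵏ` of `Λ`.  The components of `Λ` are products of intervals and
triangles `aᵢ < λᵢ < λᵢ₊₁ < aᵢ₊₁`; the dimension of the (relatively open) face containing a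
boundary point is the number of distinct values taken by its coordinates outside
`{0, a₁, …, aₙ₊₁}`. -/
def border {n : ℕ} (a : Fin (n + 1) → ℝ) (k : ℕ) : Set (Fin n → ℝ) :=
  {lam | lam ∈ frontier (causticSpace a) ∧ (range lam \ range (withZero a)).ncard = k}

/-- `G`: the codimension one border points with `λ₁ = 0` (from here on `n = m + 1`). -/
def geodesicFaces {m : ℕ} (a : Fin (m + 2) → ℝ) : Set (Fin (m + 1) → ℝ) :=
  {lam | lam ∈ border a m ∧ lam 0 = 0}

/-- `S_j`: the codimension one border points with `λⱼ = aⱼ`. -/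
def singularFaces {m : ℕ} (a : Fin (m + 2) → ℝ) (j : Fin (m + 1)) : Set (Fin (m + 1) → ℝ) :=
  {lam | lam ∈ border a m ∧ lam j = a j.castSucc}

/-- `R`: the remaining part of the codimension one border. -/
def regularFaces {m : ℕ} (a : Fin (m + 2) → ℝ) : Set (Fin (m + 1) → ℝ) :=
  border a m \ (geodesicFaces a ∪ ⋃ j, singularFaces a j)

/-- `G_*`: the points `(λ₂, …, λₙ)` with `(0, λ₂, …, λₙ) ∈ G`. -/
def geodesicSpace {m : ℕ} (a : Fin (m + 2) → ℝ) : Set (Fin m → ℝ) :=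
  {x | (Fin.cons 0 x : Fin (m + 1) → ℝ) ∈ geodesicFaces a}

/-- The three kinds of regular collapse: `λ_l = a_{l+1}` (`upper`), `λ_{l+1} = a_l` (`lower`),
`λ_l = λ_{l+1}` (`diag`). In all three the colliding members of the enumeration are
`c_{2l}` and `c_{2l+1}`. -/
inductive RegularKind (m : ℕ) : Type
  | upper (l : Fin (m + 1)) : RegularKind m
  | lower (l : Fin m) : RegularKind m
  | diag (l : Fin m) : RegularKind m

namespace RegularKind

variable {m : ℕ}

/-- The index `l` of the collapse (shifted by one, as all indices). -/
def idx : RegularKind m → Fin (m + 1)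
  | upper l => l
  | lower l => l.castSucc
  | diag l => l.castSucc

/-- The part of the codimension one border where the collapse takes place. -/
def face (a : Fin (m + 2) → ℝ) : RegularKind m → Set (Fin (m + 1) → ℝ)
  | upper l => {lam | lam ∈ border a m ∧ lam l = a l.succ}
  | lower l => {lam | lam ∈ border a m ∧ lam l.succ = a l.castSucc.castSucc}
  | diag l => {lam | lam ∈ border a m ∧ lam l.castSucc = lam l.succ}

/-- The common value `c^*` of the colliding members. -/
def value (lam : Fin (m + 1) → ℝ) : RegularKind m → ℝ
  | upper l => lam l
  | lower l => lam l.succ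
  | diag l => lam l.succ

/-- The number of the coordinate hyperplane by which the ellipsoid is cut. -/
def hyperplane : RegularKind m → Fin (m + 2)
  | upper l => l.succ
  | lower l => l.castSucc.castSucc
  | diag l => l.castSucc.castSucc

/-- The squared semi-axes of the section of the ellipsoid by that coordinate hyperplane. -/
def sectionAxes (a : Fin (m + 2) → ℝ) (F : RegularKind m) : Fin (m + 1) → ℝ :=
  fun i => a (F.hyperplane.succAbove i)

/-- The caustic parameters for the section. The axes of the section together with these
parameters are the `aᵢ` and `λᵢ` with the colliding pair removed: `{a_{l+1}, λ_l}` for `upper`,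
`{a_l, λ_{l+1}}` for `lower`, and `{λ_l, λ_{l+1}}` for `diag` (where `a_l`, no longer a squared
semi-axis of the section, becomes a caustic parameter). -/
noncomputable def sectionCaustics (a : Fin (m + 2) → ℝ) (lam : Fin (m + 1) → ℝ) :
    RegularKind m → Fin m → ℝ
  | upper l => fun i => lam (l.succAbove i)
  | lower l => fun i => lam (l.succ.succAbove i)
  | diag l => fun i =>
      (Function.update lam l.castSucc (a l.castSucc.castSucc)) (l.succ.succAbove i)

/-- The explicit expression of the `l`-th component `ω_l` through the vector `w` of the other
components, obtained by solving
`∫_{c₀}^{c₁} ds / (|c^*-s| √T^R(s)) + 2 ∑_{j ≠ l} (-1)^j ω_j ∫_{c_{2j}}^{c_{2j+1}} ds / (|c^*-s| √T^R(s))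
  + (-1)^l 2 π ω_l / √(-T^R(c^*)) = 0`,
where `T^R` is the product of all `cᵢ - s` except for the colliding pair (with this pair removed
from the list, the remaining intervals `(c_{2j}, c_{2j+1})`, `j ≠ l`, are those of the section).
In the code `l` is `F.idx + 1`, so `-(-1)^l` reads `(-1) ^ F.idx`. -/
noncomputable def collapsedComponent (a : Fin (m + 2) → ℝ) (lam : Fin (m + 1) → ℝ)
    (F : RegularKind m) (w : Fin m → ℝ) : ℝ :=
  let a' := F.sectionAxes a
  let lam' := F.sectionCaustics a lam
  let v := F.value lam
  let J : Fin (m + 1) → ℝ := fun j =>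
    ∫ s in (cEven a' lam' j)..(cOdd a' lam' j), 1 / (|v - s| * √(T a' lam' s))
  (-1) ^ (F.idx : ℕ) * (√(-T a' lam' v) / (2 * Real.pi)) *
    (J 0 + 2 * ∑ i : Fin m, (-1) ^ ((F.idx.succAbove i : ℕ) + 1) * w i * J i.succ)

end RegularKind

/-- The restriction of `f` to `A` is analytic: near each point of `A` it is the restriction of an
analytic function of the ambient space. For a relatively open subset `A` of an affine subspace
this means that `f` is analytic in affine coordinates on `A`. -/
def AnalyticAlong {p q : ℕ} (f : (Fin p → ℝ) → (Fin q → ℝ)) (A : Set (Fin p → ℝ)) : Prop :=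
  ∀ x ∈ A, ∃ g : (Fin p → ℝ) → (Fin q → ℝ), AnalyticAt ℝ g x ∧ ∀ᶠ y in 𝓝[A] x, f y = g y

end EllipsoidBilliard

/-! ### Alternating moment systems and the sign rule -/

namespace EllipsoidBilliard

/-! Divide the linear system by 2 and put ω₀ = 1/2. It then says that ∑ⱼ (-1)ʲ ωⱼ ∫ p(s) T(s)^(-1/2)
ds = 0 for every polynomial p of degree < n, where the j-th integral runs over the band (c₂ⱼ,
c₂ⱼ₊₁), 0 ≤ j ≤ n. The n + 1 bands are separated by n gaps. The main tool is a choice of p. If p has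
a simple root in each gap across which a vector v keeps its sign, and no other roots, then all terms
(-1)ʲ vⱼ ∫ p have the same sign, so a vanishing sum has only vanishing terms. The degree of p is < n
as soon as v changes sign somewhere. This gives uniqueness of the frequency (`IsKernel.eq_zero`),
its positivity (`IsKernel.pos`) and, in a version allowing closed gaps
(`eq_zero_of_alternating_sums`), uniqueness of its limits.

Regular behaviour. The substitution s = c₂ⱼ + (c₂ⱼ₊₁ - c₂ⱼ) sin² φ turns the moments into integrals
over a fixed interval of functions N / √|Q|, which depend analytically on the endpoints as long as
the gaps stay open, even if a band j ≥ 1 shrinks to a point. The first band only contributes an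
extra factor √c₁, so that ω = √c₁ times an analytic vector with positive components
(`bandFrequency_eq_smul`, `RegularBands.scaledFrequency_pos`); this settles everything about G. If
the band l has collapsed to c*, the test functions (s - c*) p do not see it and reproduce the system
of the section (`RegularBands.extendedFrequency_removeBand`), while p = 1 yields ω_l
(`RegularBands.bandFrequency_collapsed`).

Singular behaviour. If λⱼ → aⱼ a gap closes and moments diverge logarithmically. Integrating sⁱ
T(s)^(-1/2) along the boundary of the upper half plane gives a linear relation between the moments
of the bands and those of the negative half line (`IsBands.negMoment_add`). It implies ωⱼ < 1/2, and
it allows a constant c to be subtracted from all ωⱼ at the cost of a bounded term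
(`IsBands.sum_sub_mul`). With c the frequency of one band at the closing gap, the only divergent
mass left is that of the other band, so its coefficient, the difference of the two frequencies,
tends to 0 (`LimBands.tendsto_sub`).

Continuity up to the border. The frequencies stay in a compact cube, so it suffices that two limits
along ultrafilters coincide (`LimBands.eq_of_tendsto`). Polynomials with a root in every closed gap
have bounded masses, and passing to the limit gives alternating systems to which the sign argument
applies. One degeneration is delicate: if a gap collapses together with both bands next to it, the
two masses need not converge separately. With the root at a suitable point of the gap their sum
does, by a substitution of Boole type (`integral_boole_add`), and the sum is all that matters
because both frequencies have the same limit.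

Asymptotics at S. There a band of the section is pinched at α = aⱼ. Its right half has mass
asymptotic to -ρ log |α - t| with ρ > 0, so p = 1 determines the jump of the frequency across the
gap to leading order 1 / log |α - t|. The test functions (s - α) sⁱ give the system of the section
with a right hand side proportional to this jump up to O(|α - t|), and inverting the matrix of the
section gives the other coefficients.

Analyticity on lower dimensional faces follows by induction on the dimension: a coordinate λ_l = a_l
is removed by passing to a section, and without such coordinates the explicit formula is analytic,
or the frequency vanishes because λ₁ = 0. -/

open Polynomial in
/-- The value at a polynomial of the linear functional with the given moments. -/
noncomputable def mom (α : ℕ → ℝ) : ℝ[X] →ₗ[ℝ] ℝ :=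
  Polynomial.lsum fun i => (LinearMap.mulRight ℝ (α i))

theorem mom_apply (α : ℕ → ℝ) (p : Polynomial ℝ) : mom α p = p.sum fun i c => c * α i := by
  simp [mom, Polynomial.lsum_apply]

theorem mom_eq_sum (α : ℕ → ℝ) {p : Polynomial ℝ} {n : ℕ} (h : p.natDegree < n) :
    mom α p = ∑ i : Fin n, p.coeff i * α i := by
  rw [mom_apply, Polynomial.sum_over_range' p (fun i => by simp) n h, Finset.sum_range]

/-- The sign of `∏ i ∈ C, (s - g i)` on the `j`-th band, where `g i` lies in the `i`-th gap. -/
def gapSign {n : ℕ} (C : Finset (Fin n)) (j : Fin (n + 1)) : ℝ :=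
  (-1) ^ (C.filter fun i => j ≤ i.castSucc).card

theorem gapSign_mul_self {n : ℕ} (C : Finset (Fin n)) (j : Fin (n + 1)) :
    gapSign C j * gapSign C j = 1 := by
  simp [gapSign, ← mul_pow]

theorem gapSign_eq_or {n : ℕ} (C : Finset (Fin n)) (j : Fin (n + 1)) :
    gapSign C j = 1 ∨ gapSign C j = -1 := neg_one_pow_eq_or ℝ _

/-- Crossing a gap flips the sign exactly if the polynomial has its root there. With `gapSign_last`
this determines all signs by induction from the right, where every factor is positive. -/
theorem gapSign_castSucc {n : ℕ} (C : Finset (Fin n)) (i : Fin n) :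
    gapSign C i.castSucc = (if i ∈ C then -1 else 1) * gapSign C i.succ := by
  have key : (C.filter fun k => i.castSucc ≤ k.castSucc) =
      (C.filter fun k => i.succ ≤ k.castSucc) ∪ (if i ∈ C then {i} else ∅) := by
    ext k
    by_cases hi : i ∈ C
    · simp only [hi, if_true, Finset.mem_union, Finset.mem_filter, Finset.mem_singleton,
        Fin.le_def, Fin.val_castSucc, Fin.val_succ]
      constructor
      · rintro ⟨h1, h2⟩
        rcases h2.lt_or_eq with h | h
        · exact Or.inl ⟨h1, h⟩
        · exact Or.inr (Fin.ext h.symm)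
      · rintro (⟨h1, h2⟩ | rfl)
        · exact ⟨h1, by omega⟩
        · exact ⟨hi, le_rfl⟩
    · simp only [hi, if_false, Finset.union_empty, Finset.mem_filter, Fin.le_def,
        Fin.val_castSucc, Fin.val_succ]
      constructor
      · rintro ⟨h1, h2⟩
        refine ⟨h1, ?_⟩
        rcases h2.lt_or_eq with h | h
        · exact h
        · exact absurd (by rwa [Fin.ext h]) hi
      · rintro ⟨h1, h2⟩
        exact ⟨h1, by omega⟩
  unfold gapSign
  rw [key, Finset.card_union_of_disjoint]
  · split_ifs <;> simp [pow_succ]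
  · rw [Finset.disjoint_left]
    intro k hk
    split_ifs
    · simp only [Finset.mem_filter, Fin.le_def, Fin.val_castSucc, Fin.val_succ] at hk
      intro h
      rw [Finset.mem_singleton] at h
      subst h
      omega
    · simp

theorem gapSign_last {n : ℕ} (C : Finset (Fin n)) : gapSign C (Fin.last n) = 1 := by
  have : (C.filter fun i => Fin.last n ≤ i.castSucc) = ∅ := by
    ext k
    simp only [Finset.mem_filter, Fin.le_def, Fin.val_last, Fin.val_castSucc]
    have := k.2
    constructor
    · rintro ⟨-, h⟩
      omega
    · simp
  simp [gapSign]

/-- Sign rule: with roots in the gaps at which `δ` does not change sign, the polynomial takes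
on the `j`-th band the sign `(-1) ^ j δ j`, up to a common factor. -/
theorem alternating_mul_gapSign {n : ℕ} (δ : Fin (n + 1) → ℝ) (hδ : ∀ j, δ j = 1 ∨ δ j = -1)
    (j : Fin (n + 1)) :
    (-1) ^ (j : ℕ) * gapSign (Finset.univ.filter fun i : Fin n => δ i.castSucc = δ i.succ) j =
      (-1) ^ n * δ (Fin.last n) * δ j := by
  induction j using Fin.reverseInduction with
  | last => 
    rw [gapSign_last]
    rcases hδ (Fin.last n) with h | h <;> simp [h]
  | cast i ih =>
    rw [gapSign_castSucc]
    simp only [Finset.mem_filter, Finset.mem_univ, true_and]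
    simp only [Fin.val_succ, pow_succ] at ih
    split_ifs with h
    · rw [h, ← ih, Fin.val_castSucc]
      ring
    · have h2 : δ i.castSucc = - δ i.succ := by
        rcases hδ i.castSucc with h1 | h1 <;> rcases hδ i.succ with h3 | h3 <;> simp_all
      rw [h2, mul_neg, ← ih, Fin.val_castSucc]
      ring

/-- By `alternating_mul_gapSign` the sum is, up to a common sign, ∑ δⱼ vⱼ Yⱼ, whose terms are all
nonnegative. Hence each of them vanishes. -/
theorem mul_eq_zero_of_alternating_sum {n : ℕ} (Y : Fin (n + 1) → ℝ) (v δ : Fin (n + 1) → ℝ)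
    (hδ : ∀ j, δ j = 1 ∨ δ j = -1) (hδv : ∀ j, 0 ≤ δ j * v j) (hY : ∀ j, 0 ≤ Y j)
    (hsum : ∑ j : Fin (n + 1), (-1) ^ (j : ℕ) * v j *
      (gapSign (Finset.univ.filter fun i : Fin n => δ i.castSucc = δ i.succ) j * Y j) = 0) :
    ∀ j, v j * Y j = 0 := by
  have h1 : ∑ j, δ j * v j * Y j = 0 := by
    have h2 : (-1) ^ n * δ (Fin.last n) * ∑ j, δ j * v j * Y j = 0 := by
      rw [← hsum, Finset.mul_sum]
      refine Finset.sum_congr rfl fun j _ => ?_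
      linear_combination -(v j * Y j) * alternating_mul_gapSign δ hδ j
    have h3 : (-1 : ℝ) ^ n * δ (Fin.last n) ≠ 0 := by
      rcases hδ (Fin.last n) with h | h <;> simp [h]
    exact (mul_eq_zero.1 h2).resolve_left h3
  intro j
  have h4 := (Finset.sum_eq_zero_iff_of_nonneg
    (fun j _ => mul_nonneg (hδv j) (hY j))).1 h1 j (Finset.mem_univ j)
  have h5 : δ j ≠ 0 := by rcases hδ j with h | h <;> simp [h]
  rw [mul_assoc] at h4
  exact (mul_eq_zero.1 h4).resolve_left h5

/-- Uniqueness for alternating systems; `S` is a set of closed gaps. -/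
theorem eq_zero_of_alternating_sums {n : ℕ} (S : Finset (Fin n))
    (Y : Fin (n + 1) → Finset (Fin n) → ℝ) (hY : ∀ j C, S ⊆ C → 0 ≤ Y j C)
    (v : Fin (n + 1) → ℝ) (h0 : v 0 = 0) (hS : ∀ i ∈ S, v i.castSucc = v i.succ)
    (hne : ∀ j, v j ≠ 0 → ∃ k, v k = v j ∧ ∀ C, S ⊆ C → Y k C ≠ 0)
    (hsum : ∀ C, S ⊆ C → C ≠ Finset.univ →
      ∑ j : Fin (n + 1), (-1) ^ (j : ℕ) * v j * (gapSign C j * Y j C) = 0) : v = 0 := by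
  -- Nonnegativity is proved for all admissible `v` at once, since the hypotheses are invariant
  -- under `v ↦ -v`; the two applications together give `v = 0`.
  have main : ∀ v : Fin (n + 1) → ℝ, v 0 = 0 → (∀ i ∈ S, v i.castSucc = v i.succ) →
      (∀ j, v j ≠ 0 → ∃ k, v k = v j ∧ ∀ C, S ⊆ C → Y k C ≠ 0) →
      (∀ C, S ⊆ C → C ≠ Finset.univ →
        ∑ j : Fin (n + 1), (-1) ^ (j : ℕ) * v j * (gapSign C j * Y j C) = 0) →
      ∀ j, 0 ≤ v j := by
    intro v h0 hS hne hsum j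
    by_contra! hj
    -- The band `j` may carry no mass; the contradiction is drawn from a band `k` with the same
    -- value of `v` and nonzero mass.
    obtain ⟨k, hk, hYk⟩ := hne j hj.ne
    let δ : Fin (n + 1) → ℝ := fun j => if 0 ≤ v j then 1 else -1
    have hδ : ∀ j, δ j = 1 ∨ δ j = -1 := fun j => by
      by_cases h : 0 ≤ v j <;> simp [δ, h]
    have hδv : ∀ j, 0 ≤ δ j * v j := fun j => by
      by_cases h : 0 ≤ v j
      · simp [δ, h]
      · simp only [δ, h, if_false]; push Not at h; linarith
    -- Across a closed gap `v` does not change, so the sign rule automatically places a root there.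
    have hSC : S ⊆ Finset.univ.filter fun i : Fin n => δ i.castSucc = δ i.succ := by
      intro i hi
      simp [δ, hS i hi]
    -- Since `v 0 = 0` counts as positive and `v j < 0`, there is a sign change in some gap, so not
    -- all gaps contain roots.
    have hCu : (Finset.univ.filter fun i : Fin n => δ i.castSucc = δ i.succ) ≠ Finset.univ := by
      intro h
      have h1 : ∀ j, δ j = 1 := by
        intro j
        induction j using Fin.induction with
        | zero => simp [δ, h0]
        | succ i ih =>
          have : i ∈ Finset.univ.filter fun i : Fin n => δ i.castSucc = δ i.succ := by
            rw [h]; simp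
          rw [← (Finset.mem_filter.1 this).2, ih]
      have h2 := h1 j
      simp only [δ, hj.not_ge, if_false] at h2
      norm_num at h2
    have := mul_eq_zero_of_alternating_sum (fun j => Y j _) v δ hδ hδv (fun j => hY j _ hSC)
      (hsum _ hSC hCu) k
    rw [hk] at this
    rcases mul_eq_zero.1 this with h | h
    · exact hj.ne h
    · exact hYk _ hSC h
  funext j
  refine le_antisymm ?_ (main v h0 hS hne hsum j)
  have := main (fun j => -v j) (by simp [h0]) (fun i hi => by simp [hS i hi])
    (fun j hj => by
      obtain ⟨k, hk, h⟩ := hne j (by simpa using hj)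
      exact ⟨k, by simp [hk], h⟩)
    (fun C hC hCu => by
      have := hsum C hC hCu
      rw [← neg_eq_zero, ← Finset.sum_neg_distrib] at this
      rw [← this]
      exact Finset.sum_congr rfl fun j _ => by ring) j
  simpa using this

/-- Positivity for alternating systems. -/
theorem pos_of_alternating_sums {n : ℕ}
    (Y : Fin (n + 1) → Finset (Fin n) → ℝ) (hY : ∀ j C, C ≠ Finset.univ → 0 < Y j C)
    (v : Fin (n + 1) → ℝ) (h0 : 0 < v 0)
    (hsum : ∀ C, C ≠ Finset.univ →
      ∑ j : Fin (n + 1), (-1) ^ (j : ℕ) * v j * (gapSign C j * Y j C) = 0) (j : Fin (n + 1)) :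
    0 < v j := by
  by_contra! hj
  -- Here zero counts as negative, so that `v j ≤ 0 < v 0` forces a sign change; the contradiction
  -- comes from the strictly positive term of index 0.
  let δ : Fin (n + 1) → ℝ := fun j => if 0 < v j then 1 else -1
  have hδ : ∀ j, δ j = 1 ∨ δ j = -1 := fun j => by
    by_cases h : 0 < v j <;> simp [δ, h]
  have hδv : ∀ j, 0 ≤ δ j * v j := fun j => by
    by_cases h : 0 < v j
    · simp [δ, h, h.le]
    · simp only [δ, h, if_false]; push Not at h; linarith
  have hCu : (Finset.univ.filter fun i : Fin n => δ i.castSucc = δ i.succ) ≠ Finset.univ := by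
    intro h
    have h1 : ∀ j, δ j = 1 := by
      intro j
      induction j using Fin.induction with
      | zero => simp [δ, h0]
      | succ i ih =>
        have : i ∈ Finset.univ.filter fun i : Fin n => δ i.castSucc = δ i.succ := by
          rw [h]; simp
        rw [← (Finset.mem_filter.1 this).2, ih]
    have h2 := h1 j
    simp only [δ, hj.not_gt, if_false] at h2
    norm_num at h2
  have := mul_eq_zero_of_alternating_sum (fun j => Y j _) v δ hδ hδv (fun j => (hY j _ hCu).le)
    (hsum _ hCu) 0
  exact (mul_pos h0 (hY 0 _ hCu)).ne' this

open Polynomial in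
/-- The polynomial with roots `g i` for `i ∈ C`. -/
noncomputable def gapPoly {n : ℕ} (g : Fin n → ℝ) (C : Finset (Fin n)) : ℝ[X] :=
  ∏ i ∈ C, (X - Polynomial.C (g i))

theorem gapPoly_natDegree {n : ℕ} (g : Fin n → ℝ) {C : Finset (Fin n)} (hC : C ≠ Finset.univ) :
    (gapPoly g C).natDegree < n := by
  have h := Polynomial.natDegree_prod_le C (fun i => Polynomial.X - Polynomial.C (g i))
  simp only [Polynomial.natDegree_X_sub_C, Finset.sum_const, smul_eq_mul, mul_one] at h
  refine lt_of_le_of_lt h ?_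
  have := Finset.card_lt_card (Finset.ssubset_univ_iff.2 hC)
  simpa using this

theorem gapPoly_eval {n : ℕ} (g : Fin n → ℝ) (C : Finset (Fin n)) (s : ℝ) :
    (gapPoly g C).eval s = ∏ i ∈ C, (s - g i) := by
  simp [gapPoly, Polynomial.eval_prod]

/-- The linear system with moments `α j i`, in homogeneous form. -/
def IsKernel {n : ℕ} (α : Fin (n + 1) → ℕ → ℝ) (v : Fin (n + 1) → ℝ) : Prop :=
  ∀ i : Fin n, ∑ j : Fin (n + 1), (-1) ^ (j : ℕ) * v j * α j i = 0

theorem IsKernel.poly {n : ℕ} {α : Fin (n + 1) → ℕ → ℝ} {v : Fin (n + 1) → ℝ}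
    (h : IsKernel α v) {p : Polynomial ℝ} (hp : p.natDegree < n) :
    ∑ j : Fin (n + 1), (-1) ^ (j : ℕ) * v j * mom (α j) p = 0 := by
  simp_rw [mom_eq_sum _ hp, Finset.mul_sum]
  rw [Finset.sum_comm]
  refine Finset.sum_eq_zero fun i _ => ?_
  rw [← mul_zero (p.coeff i), ← h i, Finset.mul_sum]
  exact Finset.sum_congr rfl fun j _ => by ring

/-- The moments belong to functionals positive on consecutive bands separated by `g i`. -/
def BandPositive {n : ℕ} (α : Fin (n + 1) → ℕ → ℝ) (g : Fin n → ℝ) (j : Fin (n + 1)) : Prop :=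
  ∀ C : Finset (Fin n), C ≠ Finset.univ → 0 < gapSign C j * mom (α j) (gapPoly g C)

/-- No positivity is needed on the band 0, since `v 0 = 0` removes it from the sums. The statement
therefore also covers a first band that has shrunk to the point 0. -/
theorem IsKernel.eq_zero {n : ℕ} {α : Fin (n + 1) → ℕ → ℝ} {g : Fin n → ℝ}
    (hα : ∀ j, j ≠ 0 → BandPositive α g j) {v : Fin (n + 1) → ℝ} (h : IsKernel α v)
    (h0 : v 0 = 0) : v = 0 := by
  -- The value 1 is a dummy: the entries with `j = 0` are multiplied by `v 0 = 0`, and `C = univ`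
  -- never occurs in a sum.
  refine eq_zero_of_alternating_sums ∅ (fun j C => if j = 0 ∨ C = Finset.univ then 1 else
    gapSign C j * mom (α j) (gapPoly g C)) ?_ v h0 (by simp) ?_ ?_
  · intro j C _
    split_ifs with hj
    · norm_num
    · push Not at hj
      exact (hα j hj.1 C hj.2).le
  · intro j hj
    refine ⟨j, rfl, fun C _ => ?_⟩
    split_ifs with hj
    · norm_num
    · push Not at hj
      exact (hα j hj.1 C hj.2).ne'
  · intro C _ hC
    rw [← h.poly (gapPoly_natDegree g hC)]
    refine Finset.sum_congr rfl fun j _ => ?_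
    by_cases hj : j = 0
    · subst hj
      simp [h0]
    · simp only [hj, hC, or_self, if_false]
      rw [← mul_assoc (gapSign C j), gapSign_mul_self, one_mul]

theorem IsKernel.pos {n : ℕ} {α : Fin (n + 1) → ℕ → ℝ} {g : Fin n → ℝ}
    (hα : ∀ j, BandPositive α g j) {v : Fin (n + 1) → ℝ} (h : IsKernel α v)
    (h0 : 0 < v 0) (j : Fin (n + 1)) : 0 < v j := by
  refine pos_of_alternating_sums (fun j C => gapSign C j * mom (α j) (gapPoly g C))
    (fun j => hα j) v h0 (fun C hC => ?_) j
  rw [← h.poly (gapPoly_natDegree g hC)]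
  refine Finset.sum_congr rfl fun j _ => ?_
  rw [← mul_assoc (gapSign C j), gapSign_mul_self, one_mul]

/-- The matrix of the inhomogeneous system. -/
def freqMatrix {n : ℕ} (α : Fin (n + 1) → ℕ → ℝ) : Matrix (Fin n) (Fin n) ℝ :=
  Matrix.of fun i j => (-1) ^ ((j : ℕ) + 1) * α j.succ i

theorem isKernel_cons {n : ℕ} {α : Fin (n + 1) → ℕ → ℝ} {c : ℝ} {w : Fin n → ℝ} :
    IsKernel α (Fin.cons c w : Fin (n + 1) → ℝ) ↔
      (freqMatrix α).mulVec w = fun i : Fin n => -(c * α 0 i) := by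
  rw [funext_iff]
  refine forall_congr' fun i => ?_
  rw [Fin.sum_univ_succ, eq_neg_iff_add_eq_zero, add_comm]
  simp only [Matrix.mulVec, dotProduct, freqMatrix, Matrix.of_apply]
  simp only [Fin.val_zero, pow_zero, Fin.cons_zero, one_mul, Fin.val_succ, Fin.cons_succ]
  refine iff_of_eq (congrArg (fun x => x + _ = 0) (Finset.sum_congr rfl fun j _ => ?_))
  ring

theorem freqMatrix_det_ne_zero {n : ℕ} {α : Fin (n + 1) → ℕ → ℝ} {g : Fin n → ℝ}
    (hα : ∀ j, j ≠ 0 → BandPositive α g j) : (freqMatrix α).det ≠ 0 := by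
  intro h
  obtain ⟨v, hv, hMv⟩ := Matrix.exists_mulVec_eq_zero_iff.2 h
  have : IsKernel α (Fin.cons 0 v : Fin (n + 1) → ℝ) := by
    rw [isKernel_cons, hMv]
    ext
    simp
  have h0 := this.eq_zero hα (by simp)
  refine hv (funext fun j => ?_)
  simpa using congrFun h0 j.succ

/-- The solution of the inhomogeneous system. -/
noncomputable def solution {n : ℕ} (c : ℝ) (α : Fin (n + 1) → ℕ → ℝ) : Fin n → ℝ :=
  (freqMatrix α)⁻¹.mulVec fun i : Fin n => -(c * α 0 i)

theorem isKernel_cons_iff {n : ℕ} {α : Fin (n + 1) → ℕ → ℝ} (h : (freqMatrix α).det ≠ 0) {c : ℝ}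
    {w : Fin n → ℝ} : IsKernel α (Fin.cons c w : Fin (n + 1) → ℝ) ↔ w = solution c α := by
  have hu : IsUnit (freqMatrix α).det := isUnit_iff_ne_zero.2 h
  rw [isKernel_cons, solution]
  constructor
  · intro h1
    rw [← h1, Matrix.mulVec_mulVec, Matrix.nonsing_inv_mul _ hu, Matrix.one_mulVec]
  · rintro rfl
    rw [Matrix.mulVec_mulVec, Matrix.mul_nonsing_inv _ hu, Matrix.one_mulVec]

end EllipsoidBilliard

/-! ### Analyticity of integrals of N / √|Q| -/

namespace EllipsoidBilliard

section ContinuousMapAnalytic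

variable {K : Type*} [TopologicalSpace K] [CompactSpace K] [Nonempty K]

/-- The binomial series of (1 - u)^(-1/2) has the same coefficients in the Banach algebra C(K, ℝ) as
in ℝ, hence the same radius of convergence, which is at least 1. Evaluation at a point is continuous
and multiplicative, so the sum is the pointwise function. -/
theorem exists_analyticAt_one_sub_rpow :
    ∃ H : C(K, ℝ) → C(K, ℝ), AnalyticAt ℝ H 0 ∧
      ∀ᶠ u in 𝓝 (0 : C(K, ℝ)), ∀ t, H u t = 1 / (1 - u t) ^ (1 / 2 : ℝ) := by
  set c : ℕ → ℝ := fun n ↦ Ring.choose ((1 / 2 : ℝ) + n - 1) n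
  have h0 := Real.one_div_one_sub_rpow_hasFPowerSeriesOnBall_zero (1 / 2)
  have hr : (FormalMultilinearSeries.ofScalars C(K, ℝ) c).radius =
      (FormalMultilinearSeries.ofScalars ℝ c).radius := by
    refine le_antisymm (FormalMultilinearSeries.radius_le_of_le fun n => ?_)
      (FormalMultilinearSeries.radius_le_of_le fun n => ?_)
    · rw [FormalMultilinearSeries.ofScalars_norm, FormalMultilinearSeries.ofScalars_norm]
    · rw [FormalMultilinearSeries.ofScalars_norm, FormalMultilinearSeries.ofScalars_norm]
  have hr1 : 1 ≤ (FormalMultilinearSeries.ofScalars C(K, ℝ) c).radius := by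
    rw [hr]
    exact h0.r_le
  have hK := (FormalMultilinearSeries.ofScalars C(K, ℝ) c).hasFPowerSeriesOnBall
    (lt_of_lt_of_le one_pos hr1)
  refine ⟨_, hK.analyticAt, ?_⟩
  filter_upwards [Metric.ball_mem_nhds (0 : C(K, ℝ)) one_pos] with u hu t
  have hu1 : ‖u‖ < 1 := by simpa using hu
  have hut : ‖u t‖ < 1 := (u.norm_coe_le_norm t).trans_lt hu1
  have hs := hK.hasSum (y := u) (by
    refine Metric.eball_subset_eball hr1 ?_
    simpa [enorm_eq_nnnorm, ← NNReal.coe_lt_coe] using hu1)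
  have hs1 := h0.hasSum (y := u t) (by
    simpa [enorm_eq_nnnorm, ← NNReal.coe_lt_coe] using hut)
  simp only [zero_add, FormalMultilinearSeries.ofScalars_apply_eq] at hs hs1
  have hs2 := (ContinuousMap.evalCLM ℝ t).hasSum hs
  simp only [map_smul, ContinuousMap.evalCLM_apply,
    ContinuousMap.pow_apply] at hs2
  exact hs2.unique hs1

/-- Write F y = F x · (1 - U y) with U x = 0. Then |F y|^(-1/2) = |F x|^(-1/2) (1 - U y)^(-1/2),
where the first factor is a fixed element of C(K, ℝ) and the second one is given by the binomial
series. -/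
theorem exists_analyticAt_rsqrt {V : Type*} [NormedAddCommGroup V] [NormedSpace ℝ V]
    {F : V → C(K, ℝ)} {x : V} (hF : AnalyticAt ℝ F x) (h : ∀ t, F x t ≠ 0) :
    ∃ G : V → C(K, ℝ), AnalyticAt ℝ G x ∧ ∀ᶠ y in 𝓝 x, ∀ t, G y t = (√|F y t|)⁻¹ := by
  obtain ⟨H, hH, hHe⟩ := exists_analyticAt_one_sub_rpow (K := K)
  let f : C(K, ℝ) := F x
  let fi : C(K, ℝ) := ⟨fun t => (f t)⁻¹, f.continuous.inv₀ h⟩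
  let fs : C(K, ℝ) := ⟨fun t => (√|f t|)⁻¹, by
    refine Continuous.inv₀ (by fun_prop) fun t => ?_
    exact (Real.sqrt_pos.2 (abs_pos.2 (h t))).ne'⟩
  let U : V → C(K, ℝ) := fun y => 1 - F y * fi
  have hU : AnalyticAt ℝ U x := analyticAt_const.sub (hF.mul analyticAt_const)
  have hUx : U x = 0 := by
    ext t
    simp [U, fi, f, h t]
  have hHU : AnalyticAt ℝ (fun y => H (U y)) x := by
    rw [← hUx] at hH
    exact hH.comp hU
  refine ⟨fun y => fs * H (U y), analyticAt_const.mul hHU, ?_⟩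
  have hUt : Tendsto U (𝓝 x) (𝓝 0) := by
    rw [← hUx]
    exact hU.continuousAt
  have h1 : ∀ᶠ y in 𝓝 x, ‖U y‖ < 1 := by
    exact hUt.norm.eventually_lt_const (by simp)
  filter_upwards [hUt.eventually hHe, h1] with y hy hy1 t
  have ht : ‖U y t‖ < 1 := ((U y).norm_coe_le_norm t).trans_lt hy1
  have e1 : 1 - U y t = F y t / f t := by simp [U, fi, div_eq_mul_inv]
  have e2 : 0 < F y t / f t := by
    rw [← e1]
    have := (abs_lt.1 (by simpa using ht : |U y t| < 1)).2
    linarith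
  have e3 : |F y t| = |f t| * (F y t / f t) := by
    rw [← abs_of_pos e2, ← abs_mul, mul_div_cancel₀ _ (h t)]
  rw [ContinuousMap.mul_apply, hy t, e1, ← Real.sqrt_eq_rpow, e3, Real.sqrt_mul (abs_nonneg _)]
  simp [fs, mul_comm]

end ContinuousMapAnalytic

section Integral

variable {a b : ℝ}

/-- Integration over an interval of continuous functions on it. -/
noncomputable def intervalCLM (hab : a ≤ b) : C(Icc a b, ℝ) →L[ℝ] ℝ :=
  LinearMap.mkContinuous
    { toFun := fun f => ∫ t in a..b, f (projIcc a b hab t)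
      map_add' := fun f g => by
        simp only [ContinuousMap.add_apply]
        exact intervalIntegral.integral_add
          (Continuous.intervalIntegrable (by fun_prop) _ _)
          (Continuous.intervalIntegrable (by fun_prop) _ _)
      map_smul' := fun c f => by simp }
    |b - a| (fun f => by
      rw [mul_comm]
      exact intervalIntegral.norm_integral_le_of_norm_le_const fun t _ => f.norm_coe_le_norm _)

theorem intervalCLM_apply (hab : a ≤ b) (f : C(Icc a b, ℝ)) :
    intervalCLM hab f = ∫ t in a..b, f (projIcc a b hab t) := rfl

theorem intervalCLM_eq (hab : a ≤ b) (f : C(Icc a b, ℝ)) {g : ℝ → ℝ}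
    (h : ∀ t : Icc a b, g t = f t) : ∫ t in a..b, g t = intervalCLM hab f := by
  rw [intervalCLM_apply]
  refine intervalIntegral.integral_congr fun t ht => ?_
  rw [uIcc_of_le hab] at ht
  simp only [projIcc_of_mem hab ht]
  exact h ⟨t, ht⟩

/-- The integrand is an analytic map into C([a, b], ℝ) and integration is a continuous linear
functional on that space; no differentiation under the integral sign is needed. -/
theorem analyticAt_integral_rsqrt (hab : a ≤ b) {V : Type*} [NormedAddCommGroup V]
    [NormedSpace ℝ V] {N Q : V → C(Icc a b, ℝ)} {x : V} (hN : AnalyticAt ℝ N x)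
    (hQ : AnalyticAt ℝ Q x) (hne : ∀ t, Q x t ≠ 0) {f : V → ℝ → ℝ}
    (hf : ∀ᶠ y in 𝓝 x, ∀ t : Icc a b, f y t = N y t * (√|Q y t|)⁻¹) :
    AnalyticAt ℝ (fun y => ∫ t in a..b, f y t) x := by
  have : Nonempty (Icc a b) := ⟨⟨a, left_mem_Icc.2 hab⟩⟩
  obtain ⟨G, hG, hGe⟩ := exists_analyticAt_rsqrt hQ hne
  have h1 : AnalyticAt ℝ (fun y => intervalCLM hab (N y * G y)) x :=
    ((intervalCLM hab).analyticAt _).comp (hN.mul hG)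
  refine h1.congr ?_
  filter_upwards [hf, hGe] with y hy hGy
  refine (intervalCLM_eq hab _ fun t => ?_).symm
  rw [hy t, ContinuousMap.mul_apply, hGy t]

end Integral

end EllipsoidBilliard

/-! ### Band moments on a fixed interval, existence and uniqueness of the frequency -/

namespace EllipsoidBilliard

open MeasureTheory in
/-- The substitution `s = e + (o - e) sin² φ`. -/
theorem integral_div_sqrt_eq {e o : ℝ} (h : e < o) (g : ℝ → ℝ) :
    ∫ s in e..o, g s / √((s - e) * (o - s)) =
      ∫ φ in (0 : ℝ)..(Real.pi / 2), 2 * g (e + (o - e) * Real.sin φ ^ 2) := by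
  have hpi : (0 : ℝ) < Real.pi / 2 := by positivity
  have hmono : StrictMonoOn (fun φ : ℝ => e + (o - e) * Real.sin φ ^ 2) (Icc 0 (Real.pi / 2)) := by
    intro x hx y hy hxy
    have h1 : Real.sin x < Real.sin y :=
      Real.strictMonoOn_sin ⟨by linarith [hx.1], hx.2⟩ ⟨by linarith [hy.1], hy.2⟩ hxy
    have h2 : 0 ≤ Real.sin x := Real.sin_nonneg_of_nonneg_of_le_pi hx.1 (by linarith [hx.2])
    have h3 : Real.sin x ^ 2 < Real.sin y ^ 2 := pow_lt_pow_left₀ h1 h2 (by norm_num)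
    have h4 : 0 < o - e := sub_pos.2 h
    dsimp only
    gcongr
  have himg : (fun φ : ℝ => e + (o - e) * Real.sin φ ^ 2) '' Ioo 0 (Real.pi / 2) = Ioo e o := by
    rw [ContinuousOn.image_Ioo_of_strictMonoOn hpi.le (by fun_prop) hmono]
    simp
  rw [intervalIntegral.integral_of_le h.le, intervalIntegral.integral_of_le hpi.le,
    integral_Ioc_eq_integral_Ioo, integral_Ioc_eq_integral_Ioo, ← himg,
    integral_image_eq_integral_abs_deriv_smul measurableSet_Ioo
      (f' := fun φ => (o - e) * (2 * Real.sin φ * Real.cos φ))]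
  · refine setIntegral_congr_fun measurableSet_Ioo fun φ hφ => ?_
    have hs : 0 < Real.sin φ := Real.sin_pos_of_pos_of_lt_pi hφ.1 (by linarith [hφ.2, Real.pi_pos])
    have hc : 0 < Real.cos φ := Real.cos_pos_of_mem_Ioo ⟨by linarith [hφ.1], hφ.2⟩
    have hoe : 0 < o - e := sub_pos.2 h
    have h1 : √((e + (o - e) * Real.sin φ ^ 2 - e) * (o - (e + (o - e) * Real.sin φ ^ 2))) =
        (o - e) * Real.sin φ * Real.cos φ := by
      rw [← Real.sqrt_sq (by positivity : 0 ≤ (o - e) * Real.sin φ * Real.cos φ)]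
      congr 1
      rw [mul_pow _ (Real.cos φ), Real.cos_sq']
      ring
    simp only [smul_eq_mul]
    rw [h1, abs_of_pos (by positivity)]
    field_simp
  · intro φ _
    have := ((Real.hasDerivAt_sin φ).pow 2).const_mul (o - e) |>.const_add e
    refine HasDerivAt.hasDerivWithinAt ?_
    convert! this using 1
    simp
  · exact hmono.injOn.mono Ioo_subset_Icc_self

variable {n : ℕ}

/-- The product of all roots minus `s`. -/
def rootProd (E O : Fin (n + 1) → ℝ) (s : ℝ) : ℝ :=
  (∏ k, (O k - s)) * ∏ i : Fin n, (E i.succ - s)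

/-- The product of all endpoints minus `s`, except for those of the `j`-th band. -/
def otherProd (E O : Fin (n + 1) → ℝ) (j : Fin (n + 1)) (s : ℝ) : ℝ :=
  ∏ i : Fin n, ((E (j.succAbove i) - s) * (O (j.succAbove i) - s))

/-- A point of the `j`-th band. -/
noncomputable def bandPt (E O : Fin (n + 1) → ℝ) (j : Fin (n + 1)) (φ : ℝ) : ℝ :=
  E j + (O j - E j) * Real.sin φ ^ 2

/-- The density on the `j`-th band in the variable `φ`. -/
noncomputable def bandWeight (E O : Fin (n + 1) → ℝ) (j : Fin (n + 1)) (s : ℝ) : ℝ :=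
  2 * (√|s| * (√|otherProd E O j s|)⁻¹)

/-- The moments of the `j`-th band. -/
noncomputable def bandMoment (E O : Fin (n + 1) → ℝ) (j : Fin (n + 1)) (i : ℕ) : ℝ :=
  ∫ φ in (0 : ℝ)..(Real.pi / 2), bandPt E O j φ ^ i * bandWeight E O j (bandPt E O j φ)

/-- The factor `s` supplies the missing root c₀ = 0, after which the roots pair up into bands. This
explains the factor √|s| in `bandWeight`. -/
theorem rootProd_mul (E O : Fin (n + 1) → ℝ) (h0 : E 0 = 0) (j : Fin (n + 1)) (s : ℝ) :
    rootProd E O s * s = (s - E j) * (O j - s) * otherProd E O j s := by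
  have h1 : ∏ k, (E k - s) = -s * ∏ i : Fin n, (E i.succ - s) := by
    rw [Fin.prod_univ_succ, h0, zero_sub]
  have h2 : (∏ k, (E k - s)) * ∏ k, (O k - s) =
      (E j - s) * (O j - s) * otherProd E O j s := by
    rw [Fin.prod_univ_succAbove _ j, Fin.prod_univ_succAbove _ j, otherProd,
      Finset.prod_mul_distrib]
    ring
  rw [rootProd]
  linear_combination -h2 + (∏ k, (O k - s)) * h1

/-- Weakly ordered endpoints `0 = E₀ ≤ O₀ ≤ E₁ ≤ O₁ ≤ ⋯` with `E₁ > 0`. -/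
structure WeakBands (E O : Fin (n + 1) → ℝ) : Prop where
  zero : E 0 = 0
  band : ∀ j, E j ≤ O j
  gap : ∀ i : Fin n, O i.castSucc ≤ E i.succ
  pos : ∀ i : Fin n, 0 < E i.succ

/-- Weakly ordered endpoints with open gaps. -/
structure RegularBands (E O : Fin (n + 1) → ℝ) : Prop extends WeakBands E O where
  gap_lt : ∀ i : Fin n, O i.castSucc < E i.succ

/-- Strictly ordered endpoints. -/
structure IsBands (E O : Fin (n + 1) → ℝ) : Prop extends RegularBands E O where
  band_lt : ∀ j, E j < O j

theorem WeakBands.mono {E O : Fin (n + 1) → ℝ} (h : WeakBands E O) : Monotone E :=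
  Fin.monotone_iff_le_succ.2 fun i => (h.band _).trans (h.gap i)

theorem WeakBands.le_of_lt {E O : Fin (n + 1) → ℝ} (h : WeakBands E O) {j k : Fin (n + 1)}
    (hjk : j < k) : O j ≤ E k := by
  obtain ⟨i, rfl⟩ := Fin.exists_castSucc_eq.2 (Fin.ne_last_of_lt hjk)
  exact (h.gap i).trans (h.mono (Fin.castSucc_lt_iff_succ_le.1 hjk))

theorem WeakBands.le_castSucc {E O : Fin (n + 1) → ℝ} (h : WeakBands E O) {j : Fin (n + 1)}
    {i : Fin n} (hji : j ≤ i.castSucc) : O j ≤ O i.castSucc := by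
  rcases hji.lt_or_eq with h1 | h1
  · exact (h.le_of_lt h1).trans (h.band _)
  · rw [h1]

theorem WeakBands.succ_le {E O : Fin (n + 1) → ℝ} (h : WeakBands E O) {j : Fin (n + 1)}
    {i : Fin n} (hji : i.castSucc < j) : E i.succ ≤ E j :=
  h.mono (Fin.castSucc_lt_iff_succ_le.1 hji)

theorem WeakBands.nonneg {E O : Fin (n + 1) → ℝ} (h : WeakBands E O) (j : Fin (n + 1)) :
    0 ≤ E j := by
  rw [← h.zero]
  exact h.mono (Fin.zero_le j)

/-- No endpoint of another band lies on the `j`-th band. -/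
def FreeBand (E O : Fin (n + 1) → ℝ) (j : Fin (n + 1)) : Prop :=
  ∀ s ∈ Icc (E j) (O j), otherProd E O j s ≠ 0

/-- Because of the weak order all other endpoints lie beyond the two adjacent gaps, so only these
have to be open. -/
theorem FreeBand.of_gaps {E O : Fin (n + 1) → ℝ} (h : WeakBands E O) {j : Fin (n + 1)}
    (hg : ∀ i : Fin n, i.castSucc = j ∨ i.succ = j → O i.castSucc < E i.succ) :
    FreeBand E O j := by
  intro s hs
  rw [otherProd, Finset.prod_ne_zero_iff]
  intro i _
  rcases lt_or_ge i.castSucc j with hij | hij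
  · rw [Fin.succAbove_of_castSucc_lt _ _ hij]
    have h1 : O i.castSucc < E j := by
      rcases (Fin.castSucc_lt_iff_succ_le.1 hij).lt_or_eq with h2 | h2
      · obtain ⟨k, rfl⟩ := Fin.exists_succ_eq.2 (Fin.ne_zero_of_lt h2)
        calc O i.castSucc ≤ O k.castSucc := h.le_castSucc (by
              rw [Fin.lt_def] at h2
              rw [Fin.le_def]
              simp at h2 ⊢
              omega)
          _ < E k.succ := hg k (Or.inr rfl)
      · rw [← h2]
        exact hg i (Or.inr h2)
    have h2 := h.band i.castSucc
    exact mul_ne_zero (by linarith [hs.1]) (by linarith [hs.1])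
  · rw [Fin.succAbove_of_le_castSucc _ _ hij]
    have h1 : O j < E i.succ := by
      rcases hij.lt_or_eq with h2 | h2
      · obtain ⟨k, rfl⟩ := Fin.exists_castSucc_eq.2 (Fin.ne_last_of_lt h2)
        calc O k.castSucc < E k.succ := hg k (Or.inl rfl)
          _ ≤ E i.succ := h.mono (by
              rw [Fin.lt_def] at h2
              rw [Fin.le_def]
              simp at h2 ⊢
              omega)
      · rw [h2]
        exact hg i (Or.inl h2.symm)
    have h2 := h.band i.succ
    exact mul_ne_zero (by linarith [hs.2]) (by linarith [hs.2])

theorem RegularBands.freeBand {E O : Fin (n + 1) → ℝ} (h : RegularBands E O) (j : Fin (n + 1)) :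
    FreeBand E O j := FreeBand.of_gaps h.toWeakBands fun i _ => h.gap_lt i

theorem bandPt_mem {E O : Fin (n + 1) → ℝ} {j : Fin (n + 1)} (h : E j ≤ O j) (φ : ℝ) :
    bandPt E O j φ ∈ Icc (E j) (O j) := by
  have h1 := sq_nonneg (Real.sin φ)
  have h2 := Real.sin_sq_le_one φ
  have h3 : 0 ≤ O j - E j := sub_nonneg.2 h
  constructor
  · simp only [bandPt]
    nlinarith
  · simp only [bandPt]
    nlinarith

theorem bandPt_mem_Ioo {E O : Fin (n + 1) → ℝ} {j : Fin (n + 1)} (h : E j < O j) {φ : ℝ}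
    (hφ : φ ∈ Ioo 0 (Real.pi / 2)) : bandPt E O j φ ∈ Ioo (E j) (O j) := by
  have hs : 0 < Real.sin φ := Real.sin_pos_of_pos_of_lt_pi hφ.1 (by linarith [hφ.2, Real.pi_pos])
  have hc : 0 < Real.cos φ := Real.cos_pos_of_mem_Ioo ⟨by linarith [hφ.1, Real.pi_pos], hφ.2⟩
  have h2 : Real.sin φ ^ 2 < 1 := by rw [Real.sin_sq]; nlinarith
  have h3 : 0 < O j - E j := sub_pos.2 h
  constructor
  · simp only [bandPt]
    have : 0 < (O j - E j) * Real.sin φ ^ 2 := by positivity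
    linarith
  · simp only [bandPt]
    nlinarith

theorem continuous_otherProd (E O : Fin (n + 1) → ℝ) (j : Fin (n + 1)) :
    Continuous (otherProd E O j) := by
  unfold otherProd
  fun_prop

theorem continuous_bandPt (E O : Fin (n + 1) → ℝ) (j : Fin (n + 1)) :
    Continuous (bandPt E O j) := by
  unfold bandPt
  fun_prop

theorem FreeBand.continuous_weight {E O : Fin (n + 1) → ℝ} {j : Fin (n + 1)}
    (hf : FreeBand E O j) (h : E j ≤ O j) :
    Continuous fun φ => bandWeight E O j (bandPt E O j φ) := by
  have h1 := continuous_otherProd E O j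
  have h2 := continuous_bandPt E O j
  unfold bandWeight
  refine continuous_const.mul (Continuous.mul (by fun_prop) (Continuous.inv₀ (by fun_prop) ?_))
  intro φ
  exact (Real.sqrt_pos.2 (abs_pos.2 (hf _ (bandPt_mem h φ)))).ne'

theorem FreeBand.mom_eq {E O : Fin (n + 1) → ℝ} {j : Fin (n + 1)}
    (hf : FreeBand E O j) (h : E j ≤ O j) (p : Polynomial ℝ) :
    mom (bandMoment E O j) p = ∫ φ in (0 : ℝ)..(Real.pi / 2),
      p.eval (bandPt E O j φ) * bandWeight E O j (bandPt E O j φ) := by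
  have h1 := hf.continuous_weight h
  have h2 := continuous_bandPt E O j
  rw [mom_eq_sum _ (Nat.lt_succ_self _)]
  simp_rw [Polynomial.eval_eq_sum_range, Finset.sum_mul, bandMoment, Finset.sum_range]
  rw [intervalIntegral.integral_finsetSum]
  · refine Finset.sum_congr rfl fun i _ => ?_
    rw [← intervalIntegral.integral_const_mul]
    simp_rw [mul_assoc]
  · intro i _
    refine Continuous.intervalIntegrable ?_ _ _
    fun_prop

theorem gapSign_mul_prod {n : ℕ} (g : Fin n → ℝ) (C : Finset (Fin n)) (j : Fin (n + 1)) {s : ℝ}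
    (h1 : ∀ i ∈ C, j ≤ i.castSucc → s ≤ g i) (h2 : ∀ i ∈ C, i.castSucc < j → g i ≤ s) :
    gapSign C j * ∏ i ∈ C, (s - g i) = ∏ i ∈ C, |s - g i| := by
  have : gapSign C j = ∏ i ∈ C, (if j ≤ i.castSucc then (-1 : ℝ) else 1) := by
    rw [Finset.prod_ite, Finset.prod_const, Finset.prod_const_one, mul_one]
    rfl
  rw [this, ← Finset.prod_mul_distrib]
  refine Finset.prod_congr rfl fun i hi => ?_
  split_ifs with hij
  · rw [abs_of_nonpos (by linarith [h1 i hi hij])]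
    ring
  · rw [abs_of_nonneg (by linarith [h2 i hi (not_le.1 hij)]), one_mul]

/-- The factor `gapSign C j` turns the polynomial into its absolute value along the band, and the
weight is positive; collapsed bands are allowed. -/
theorem FreeBand.bandPositive {E O : Fin (n + 1) → ℝ} {j : Fin (n + 1)}
    (hf : FreeBand E O j) (h : E j ≤ O j) (g : Fin n → ℝ)
    (hpos : ∀ φ ∈ Ioo 0 (Real.pi / 2), bandPt E O j φ ≠ 0)
    (h1 : ∀ i : Fin n, j ≤ i.castSucc → ∀ φ ∈ Ioo 0 (Real.pi / 2), bandPt E O j φ < g i)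
    (h2 : ∀ i : Fin n, i.castSucc < j → ∀ φ ∈ Ioo 0 (Real.pi / 2), g i < bandPt E O j φ) :
    BandPositive (bandMoment E O) g j := by
  intro C _
  have h3 := hf.continuous_weight h
  have h4 := continuous_bandPt E O j
  rw [hf.mom_eq h, ← intervalIntegral.integral_const_mul]
  refine intervalIntegral.intervalIntegral_pos_of_pos_on
    (Continuous.intervalIntegrable (by fun_prop) _ _) ?_ (by positivity)
  intro φ hφ
  rw [gapPoly_eval, ← mul_assoc, gapSign_mul_prod g C j (fun i _ hi => (h1 i hi φ hφ).le)
    (fun i _ hi => (h2 i hi φ hφ).le)]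
  refine mul_pos (Finset.prod_pos fun i _ => abs_pos.2 (sub_ne_zero.2 ?_)) ?_
  · rcases le_or_gt j i.castSucc with hi | hi
    · exact (h1 i hi φ hφ).ne
    · exact (h2 i hi φ hφ).ne'
  · have h5 := abs_pos.2 (hf _ (bandPt_mem h φ))
    have h6 := abs_pos.2 (hpos φ hφ)
    unfold bandWeight
    positivity

theorem IsBands.bandPositive {E O : Fin (n + 1) → ℝ} (h : IsBands E O) {g : Fin n → ℝ}
    (hg : ∀ i, g i ∈ Icc (O i.castSucc) (E i.succ)) (j : Fin (n + 1)) :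
    BandPositive (bandMoment E O) g j := by
  refine (h.freeBand j).bandPositive (h.band j) g ?_ ?_ ?_
  · intro φ hφ
    have := bandPt_mem_Ioo (h.band_lt j) hφ
    exact ((h.nonneg j).trans_lt this.1).ne'
  · intro i hi φ hφ
    exact (bandPt_mem_Ioo (h.band_lt j) hφ).2.trans_le ((h.le_castSucc hi).trans (hg i).1)
  · intro i hi φ hφ
    exact ((hg i).2.trans (h.succ_le hi)).trans_lt (bandPt_mem_Ioo (h.band_lt j) hφ).1

theorem integral_band_eq {E O : Fin (n + 1) → ℝ} (h : WeakBands E O) {j : Fin (n + 1)}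
    (hj : E j < O j) (g : ℝ → ℝ) :
    ∫ s in (E j)..(O j), g s / √|rootProd E O s| = ∫ φ in (0 : ℝ)..(Real.pi / 2),
      g (bandPt E O j φ) * bandWeight E O j (bandPt E O j φ) := by
  have h1 := integral_div_sqrt_eq hj fun s => g s * (√|s| * (√|otherProd E O j s|)⁻¹)
  unfold bandWeight bandPt
  simp_rw [mul_left_comm (g _) 2]
  rw [← h1]
  refine intervalIntegral.integral_congr_ae (Filter.Eventually.of_forall fun s hs => ?_)
  rw [uIoc_of_le hj.le] at hs
  have hs0 : 0 < s := (h.nonneg j).trans_lt hs.1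
  have h2 : |rootProd E O s| = (s - E j) * (O j - s) * |otherProd E O j s| / |s| := by
    rw [eq_div_iff (abs_pos.2 hs0.ne').ne', ← abs_mul, rootProd_mul E O h.zero j, abs_mul,
      abs_of_nonneg (mul_nonneg (by linarith [hs.1]) (by linarith [hs.2]))]
  rw [h2, Real.sqrt_div (mul_nonneg (mul_nonneg (by linarith [hs.1]) (by linarith [hs.2]))
    (abs_nonneg _)), Real.sqrt_mul (mul_nonneg (by linarith [hs.1]) (by linarith [hs.2]))]
  have := (Real.sqrt_pos.2 (abs_pos.2 hs0.ne')).ne'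
  field_simp

theorem rootProd_eq_prod_gaps (E O : Fin (n + 1) → ℝ) (s : ℝ) :
    rootProd E O s = (O (Fin.last n) - s) *
      ∏ i : Fin n, ((O i.castSucc - s) * (E i.succ - s)) := by
  rw [rootProd, Fin.prod_univ_castSucc, Finset.prod_mul_distrib]
  ring

theorem WeakBands.rootProd_nonneg {E O : Fin (n + 1) → ℝ} (h : WeakBands E O) {j : Fin (n + 1)}
    {s : ℝ} (hs : s ∈ Icc (E j) (O j)) : 0 ≤ rootProd E O s := by
  rw [rootProd_eq_prod_gaps]
  have hl : O j ≤ O (Fin.last n) := by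
    rcases (Fin.le_last j).lt_or_eq with h1 | h1
    · exact (h.le_of_lt h1).trans (h.band _)
    · rw [h1]
  refine mul_nonneg (by linarith [hs.2]) (Finset.prod_nonneg fun i _ => ?_)
  have h2 := h.gap i
  rcases le_or_gt j i.castSucc with hi | hi
  · have := h.le_castSucc hi
    exact mul_nonneg (by linarith [hs.2]) (by linarith [hs.2])
  · have := h.succ_le hi
    exact mul_nonneg_of_nonpos_of_nonpos (by linarith [hs.1]) (by linarith [hs.1])

theorem T_eq_rootProd (a : Fin (n + 1) → ℝ) (lam : Fin n → ℝ) (s : ℝ) :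
    T a lam s = rootProd (cEven a lam) (cOdd a lam) s := by
  rw [rootProd_eq_prod_gaps, T, Fin.prod_univ_castSucc, mul_comm (∏ i : Fin n, _) _, mul_assoc,
    ← Finset.prod_mul_distrib]
  simp only [cOdd, Fin.snoc_last, cEven, Fin.snoc_castSucc, Fin.cons_succ]
  congr 1
  refine Finset.prod_congr rfl fun i _ => ?_
  rcases le_total (a i.castSucc) (lam i) with h | h
  · rw [min_eq_left h, max_eq_right h]
  · rw [min_eq_right h, max_eq_left h, mul_comm]

theorem isBands_of_mem {a : Fin (n + 1) → ℝ} {lam : Fin n → ℝ} (ha : StrictMono a)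
    (ha0 : ∀ i, 0 < a i) (h : lam ∈ causticSpace a) : IsBands (cEven a lam) (cOdd a lam) where
  zero := rfl
  band j := ((bands_sorted ha ha0 h).1 j).le
  gap i := ((bands_sorted ha ha0 h).2 i).le
  pos i := by
    simp only [cEven, Fin.cons_succ]
    exact lt_max_of_lt_left (ha0 _)
  gap_lt := (bands_sorted ha ha0 h).2
  band_lt := (bands_sorted ha ha0 h).1

theorem K_eq_bandMoment {a : Fin (n + 1) → ℝ} {lam : Fin n → ℝ} (ha : StrictMono a)
    (ha0 : ∀ i, 0 < a i) (h : lam ∈ causticSpace a) (i : ℕ) (j : Fin (n + 1)) :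
    K a lam i j = bandMoment (cEven a lam) (cOdd a lam) j i := by
  have hb := isBands_of_mem ha ha0 h
  rw [bandMoment, ← integral_band_eq hb.toWeakBands (hb.band_lt j) fun s => s ^ i, K]
  refine intervalIntegral.integral_congr fun s hs => ?_
  rw [uIcc_of_le (hb.band j)] at hs
  rw [T_eq_rootProd, abs_of_nonneg (hb.rootProd_nonneg hs)]

/-- Halving the equations puts the band 0 on the same footing as the others, with the fixed
coefficient ω₀ = 1/2. -/
theorem isFrequency_iff {a : Fin (n + 1) → ℝ} {lam : Fin n → ℝ} (ha : StrictMono a)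
    (ha0 : ∀ i, 0 < a i) (h : lam ∈ causticSpace a) (w : Fin n → ℝ) :
    IsFrequency a lam w ↔ IsKernel (bandMoment (cEven a lam) (cOdd a lam))
      (Fin.cons (1 / 2) w : Fin (n + 1) → ℝ) := by
  refine forall_congr' fun i => ?_
  rw [Fin.sum_univ_succ]
  simp only [K_eq_bandMoment ha ha0 h, Fin.val_zero, pow_zero, Fin.cons_zero, Fin.val_succ,
    Fin.cons_succ]
  constructor <;> intro h <;> linarith

/-- The frequency as a function of the endpoints of the bands. -/
noncomputable def bandFrequency (E O : Fin (n + 1) → ℝ) : Fin n → ℝ :=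
  solution (1 / 2) (bandMoment E O)

/-- The weight of a band involves only the other endpoints and √|s|, so it stays positive if the
band `j ≠ 0` collapses. The midpoints of the open gaps still separate the bands strictly. For `j =
0` this would fail, since √|s| vanishes if the band shrinks to 0. -/
theorem RegularBands.bandPositive_of_ne_zero {E O : Fin (n + 1) → ℝ} (h : RegularBands E O)
    {j : Fin (n + 1)} (hj : j ≠ 0) :
    BandPositive (bandMoment E O) (fun i => (O i.castSucc + E i.succ) / 2) j := by
  refine (h.freeBand j).bandPositive (h.band j) _ ?_ ?_ ?_
  · intro φ _
    obtain ⟨k, rfl⟩ := Fin.exists_succ_eq.2 hj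
    exact ((h.pos k).trans_le (bandPt_mem (h.band _) φ).1).ne'
  · intro i hi φ _
    have h1 := (bandPt_mem (h.band j) φ).2
    have h2 := h.le_castSucc hi
    have h3 := h.gap_lt i
    linarith
  · intro i hi φ _
    have h1 := (bandPt_mem (h.band j) φ).1
    have h2 := h.succ_le hi
    have h3 := h.gap_lt i
    linarith

theorem RegularBands.det_ne_zero {E O : Fin (n + 1) → ℝ} (h : RegularBands E O) :
    (freqMatrix (bandMoment E O)).det ≠ 0 :=
  freqMatrix_det_ne_zero fun _ hj => h.bandPositive_of_ne_zero hj

theorem RegularBands.isKernel_iff {E O : Fin (n + 1) → ℝ} (h : RegularBands E O) (w : Fin n → ℝ) :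
    IsKernel (bandMoment E O) (Fin.cons (1 / 2) w : Fin (n + 1) → ℝ) ↔ w = bandFrequency E O :=
  isKernel_cons_iff h.det_ne_zero

theorem isFrequency_iff_eq {a : Fin (n + 1) → ℝ} {lam : Fin n → ℝ} (ha : StrictMono a)
    (ha0 : ∀ i, 0 < a i) (h : lam ∈ causticSpace a) (w : Fin n → ℝ) :
    IsFrequency a lam w ↔ w = bandFrequency (cEven a lam) (cOdd a lam) := by
  rw [isFrequency_iff ha ha0 h, (isBands_of_mem ha ha0 h).isKernel_iff]

theorem existsUnique_isFrequency {a : Fin (n + 1) → ℝ} {lam : Fin n → ℝ} (ha : StrictMono a)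
    (ha0 : ∀ i, 0 < a i) (h : lam ∈ causticSpace a) : ∃! w, IsFrequency a lam w :=
  ⟨_, (isFrequency_iff_eq ha ha0 h _).2 rfl, fun w hw => (isFrequency_iff_eq ha ha0 h w).1 hw⟩

theorem frequencyMap_eq {a : Fin (n + 1) → ℝ} {lam : Fin n → ℝ} (ha : StrictMono a)
    (ha0 : ∀ i, 0 < a i) (h : lam ∈ causticSpace a) :
    frequencyMap a lam = bandFrequency (cEven a lam) (cOdd a lam) := by
  have hu := existsUnique_isFrequency ha ha0 h
  rw [frequencyMap, dif_pos hu]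
  exact (isFrequency_iff_eq ha ha0 h _).1 hu.choose_spec.1

end EllipsoidBilliard

/-! ### Analytic dependence of the frequency on the endpoints -/

namespace EllipsoidBilliard

section Analytic

variable {V : Type*} [NormedAddCommGroup V] [NormedSpace ℝ V] {x : V} {n : ℕ}

theorem analyticAt_det {ι : Type*} [Fintype ι] [DecidableEq ι] {M : V → Matrix ι ι ℝ}
    (hM : ∀ i j, AnalyticAt ℝ (fun y => M y i j) x) : AnalyticAt ℝ (fun y => (M y).det) x := by
  simp_rw [Matrix.det_apply]
  refine Finset.analyticAt_fun_sum _ fun σ _ => ?_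
  exact (Finset.analyticAt_fun_prod _ fun i _ => hM _ _).const_smul

/-- Cramer's rule writes the components as quotients of determinants, which are polynomials in the
entries. -/
theorem analyticAt_inv_mulVec {ι : Type*} [Fintype ι] [DecidableEq ι] {M : V → Matrix ι ι ℝ}
    {b : V → ι → ℝ} (hM : ∀ i j, AnalyticAt ℝ (fun y => M y i j) x)
    (hb : ∀ i, AnalyticAt ℝ (fun y => b y i) x) (hdet : (M x).det ≠ 0) :
    AnalyticAt ℝ (fun y => (M y)⁻¹.mulVec (b y)) x := by
  have h1 := analyticAt_det hM
  have h2 : ∀ᶠ y in 𝓝 x, (M y).det ≠ 0 := h1.continuousAt.eventually_ne hdet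
  rw [analyticAt_pi_iff]
  intro i
  have h3 : AnalyticAt ℝ (fun y => ((M y).det)⁻¹ * ((M y).updateCol i (b y)).det) x := by
    refine (h1.inv hdet).mul (analyticAt_det fun k l => ?_)
    simp only [Matrix.updateCol_apply]
    split_ifs
    · exact hb k
    · exact hM k l
  refine h3.congr ?_
  filter_upwards [h2] with y hy
  have h4 := congrFun (Matrix.det_smul_inv_mulVec_eq_cramer (M y) (b y)
    (isUnit_iff_ne_zero.2 hy)) i
  rw [Pi.smul_apply, smul_eq_mul, Matrix.cramer_apply] at h4
  rw [← h4, inv_mul_cancel_left₀ hy]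

theorem analyticAt_solution {c : ℝ} {α : V → Fin (n + 1) → ℕ → ℝ}
    (hα : ∀ j i, AnalyticAt ℝ (fun y => α y j i) x) (hdet : (freqMatrix (α x)).det ≠ 0) :
    AnalyticAt ℝ (fun y => solution c (α y)) x := by
  refine analyticAt_inv_mulVec (fun i j => ?_) (fun i => ?_) hdet
  · simp only [freqMatrix, Matrix.of_apply]
    exact analyticAt_const.mul (hα _ _)
  · exact (analyticAt_const.mul (hα _ _)).neg

/-- The variable `sin² φ` as a continuous function. -/
noncomputable def sinSq : C(Icc (0 : ℝ) (Real.pi / 2), ℝ) :=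
  ⟨fun φ => Real.sin φ ^ 2, by fun_prop⟩

/-- The parametrization of a band as a continuous function. -/
noncomputable def bandMap (E O : Fin (n + 1) → ℝ) (j : Fin (n + 1)) :
    C(Icc (0 : ℝ) (Real.pi / 2), ℝ) :=
  algebraMap ℝ _ (E j) + algebraMap ℝ _ (O j - E j) * sinSq

theorem bandMap_apply (E O : Fin (n + 1) → ℝ) (j : Fin (n + 1)) (φ : Icc (0 : ℝ) (Real.pi / 2)) :
    bandMap E O j φ = bandPt E O j φ := rfl

/-- The product of the other endpoints, along the band, as a continuous function. -/
noncomputable def otherMap (E O : Fin (n + 1) → ℝ) (j : Fin (n + 1)) :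
    C(Icc (0 : ℝ) (Real.pi / 2), ℝ) :=
  ∏ i : Fin n, ((algebraMap ℝ _ (E (j.succAbove i)) - bandMap E O j) *
    (algebraMap ℝ _ (O (j.succAbove i)) - bandMap E O j))

theorem otherMap_apply (E O : Fin (n + 1) → ℝ) (j : Fin (n + 1))
    (φ : Icc (0 : ℝ) (Real.pi / 2)) :
    otherMap E O j φ = otherProd E O j (bandPt E O j φ) := by
  rw [otherMap, ContinuousMap.prod_apply, otherProd]
  rfl

variable {E O : V → Fin (n + 1) → ℝ}

theorem analyticAt_algebraMap {A : Type*} [NormedRing A] [NormedAlgebra ℝ A] {f : V → ℝ}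
    (hf : AnalyticAt ℝ f x) : AnalyticAt ℝ (fun y => algebraMap ℝ A (f y)) x :=
  ((algebraMapCLM ℝ A).analyticAt _).comp hf

theorem analyticAt_bandMap (hE : ∀ k, AnalyticAt ℝ (fun y => E y k) x)
    (hO : ∀ k, AnalyticAt ℝ (fun y => O y k) x) (j : Fin (n + 1)) :
    AnalyticAt ℝ (fun y => bandMap (E y) (O y) j) x :=
  (analyticAt_algebraMap (hE j)).add
    ((analyticAt_algebraMap ((hO j).sub (hE j))).mul analyticAt_const)

theorem analyticAt_otherMap (hE : ∀ k, AnalyticAt ℝ (fun y => E y k) x)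
    (hO : ∀ k, AnalyticAt ℝ (fun y => O y k) x) (j : Fin (n + 1)) :
    AnalyticAt ℝ (fun y => otherMap (E y) (O y) j) x := by
  refine Finset.analyticAt_fun_prod _ fun i _ => ?_
  have h := analyticAt_bandMap hE hO j
  exact ((analyticAt_algebraMap (hE _)).sub h).mul ((analyticAt_algebraMap (hO _)).sub h)

/-- On a positive band √s = s / √s, which brings the weight into the form N / √|Q| with N and Q
polynomial in the endpoints. This is why the left endpoint must not be 0. -/
theorem analyticAt_bandMoment (hE : ∀ k, AnalyticAt ℝ (fun y => E y k) x)
    (hO : ∀ k, AnalyticAt ℝ (fun y => O y k) x) {j : Fin (n + 1)} (hj : E x j ≤ O x j)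
    (hpos : 0 < E x j) (hf : FreeBand (E x) (O x) j) (i : ℕ) :
    AnalyticAt ℝ (fun y => bandMoment (E y) (O y) j i) x := by
  have h1 := analyticAt_bandMap hE hO j
  have h2 := analyticAt_otherMap hE hO j
  have e1 : ∀ᶠ y in 𝓝 x, 0 < E y j := (hE j).continuousAt.eventually_const_lt hpos
  have e2 : ∀ᶠ y in 𝓝 x, 0 < O y j :=
    (hO j).continuousAt.eventually_const_lt (hpos.trans_le hj)
  refine analyticAt_integral_rsqrt (by positivity)
    (N := fun y => 2 * (bandMap (E y) (O y) j ^ i * bandMap (E y) (O y) j))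
    (Q := fun y => bandMap (E y) (O y) j * otherMap (E y) (O y) j)
    (analyticAt_const.mul ((h1.pow i).mul h1)) (h1.mul h2) (fun t => ?_) ?_
  · rw [ContinuousMap.mul_apply, bandMap_apply, otherMap_apply]
    have hm := bandPt_mem hj (t : ℝ)
    exact mul_ne_zero (hpos.trans_le hm.1).ne' (hf _ hm)
  · filter_upwards [e1, e2] with y hy1 hy2 t
    -- For `y` near `x` the endpoints need not be in the right order, but the point is still a
    -- convex combination of two positive numbers.
    have hs : 0 < bandPt (E y) (O y) j t := by
      have h3 := sq_nonneg (Real.sin t)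
      have h4 := Real.sin_sq_le_one t
      unfold bandPt
      rcases h4.lt_or_eq with h5 | h5
      · nlinarith [mul_pos hy1 (sub_pos.2 h5), mul_nonneg hy2.le h3]
      · rw [h5]
        linarith
    simp only [ContinuousMap.mul_apply, ContinuousMap.pow_apply, bandMap_apply, otherMap_apply]
    have h6 : (√|bandPt (E y) (O y) j t|) ≠ 0 := (Real.sqrt_pos.2 (abs_pos.2 hs.ne')).ne'
    rw [abs_mul, Real.sqrt_mul (abs_nonneg _), mul_inv, bandWeight]
    have h7 : bandPt (E y) (O y) j t =
      √|bandPt (E y) (O y) j t| * √|bandPt (E y) (O y) j t| := by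
      rw [Real.mul_self_sqrt (abs_nonneg _), abs_of_pos hs]
    have h8 : (2 : C(Icc (0 : ℝ) (Real.pi / 2), ℝ)) t = 2 := rfl
    rw [h8]
    generalize √|bandPt (E y) (O y) j t| = r at *
    rw [h7]
    field_simp

/-- The moments of the first band, divided by the square root of its length. -/
noncomputable def firstMoment (E O : Fin (n + 1) → ℝ) (i : ℕ) : ℝ :=
  ∫ φ in (0 : ℝ)..(Real.pi / 2), bandPt E O 0 φ ^ i *
    (2 * (Real.sin φ * (√|otherProd E O 0 (bandPt E O 0 φ)|)⁻¹))

/-- With left endpoint 0 one has √s = √O₀ sin φ. So √O₀ is the only part of the first moment that is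
not analytic at O₀ = 0. -/
theorem bandMoment_zero {E O : Fin (n + 1) → ℝ} (h0 : E 0 = 0) (i : ℕ) :
    bandMoment E O 0 i = √(|O 0|) * firstMoment E O i := by
  rw [bandMoment, firstMoment, ← intervalIntegral.integral_const_mul]
  refine intervalIntegral.integral_congr fun φ hφ => ?_
  rw [uIcc_of_le (by positivity)] at hφ
  have hs : 0 ≤ Real.sin φ :=
    Real.sin_nonneg_of_nonneg_of_le_pi hφ.1 (by linarith [hφ.2, Real.pi_pos])
  have : √|bandPt E O 0 φ| = √|O 0| * Real.sin φ := by
    rw [bandPt, h0, zero_add, sub_zero, abs_mul, Real.sqrt_mul (abs_nonneg _), abs_pow,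
      Real.sqrt_sq (abs_nonneg _), abs_of_nonneg hs]
  simp only [bandWeight, this]
  ring

theorem analyticAt_firstMoment (hE : ∀ k, AnalyticAt ℝ (fun y => E y k) x)
    (hO : ∀ k, AnalyticAt ℝ (fun y => O y k) x) (hj : E x 0 ≤ O x 0)
    (hf : FreeBand (E x) (O x) 0) (i : ℕ) :
    AnalyticAt ℝ (fun y => firstMoment (E y) (O y) i) x := by
  let si : C(Icc (0 : ℝ) (Real.pi / 2), ℝ) := ⟨fun φ => 2 * Real.sin φ, by fun_prop⟩
  have h1 := analyticAt_bandMap hE hO 0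
  have h2 := analyticAt_otherMap hE hO 0
  refine analyticAt_integral_rsqrt (by positivity)
    (N := fun y => bandMap (E y) (O y) 0 ^ i * si)
    (Q := fun y => otherMap (E y) (O y) 0)
    ((h1.pow i).mul analyticAt_const) h2 (fun t => ?_) (Eventually.of_forall fun y t => ?_)
  · rw [otherMap_apply]
    exact hf _ (bandPt_mem hj (t : ℝ))
  · simp only [ContinuousMap.mul_apply, ContinuousMap.pow_apply, bandMap_apply, otherMap_apply]
    have : si t = 2 * Real.sin t := rfl
    rw [this]
    ring

end Analytic

variable {n : ℕ}

/-- The moments of all bands, those of the first one without the factor `√O₀`. -/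
noncomputable def scaledMoment (E O : Fin (n + 1) → ℝ) : Fin (n + 1) → ℕ → ℝ :=
  Fin.cons (firstMoment E O) fun j => bandMoment E O j.succ

/-- The frequency without the factor `√O₀`. -/
noncomputable def scaledFrequency (E O : Fin (n + 1) → ℝ) : Fin n → ℝ :=
  solution (1 / 2) (scaledMoment E O)

theorem freqMatrix_scaledMoment (E O : Fin (n + 1) → ℝ) :
    freqMatrix (scaledMoment E O) = freqMatrix (bandMoment E O) := rfl

/-- The band 0 enters the inhomogeneous system only through its right hand side, so the factor √O₀
passes to the solution. -/
theorem bandFrequency_eq_smul {E O : Fin (n + 1) → ℝ} (h0 : E 0 = 0) :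
    bandFrequency E O = √|O 0| • scaledFrequency E O := by
  rw [bandFrequency, scaledFrequency, solution, solution, freqMatrix_scaledMoment,
    ← Matrix.mulVec_smul]
  congr 1
  funext i
  rw [bandMoment_zero h0, Pi.smul_apply, scaledMoment, Fin.cons_zero, smul_eq_mul]
  ring

theorem RegularBands.analyticAt_scaledFrequency {V : Type*} [NormedAddCommGroup V]
    [NormedSpace ℝ V] {x : V} {E O : V → Fin (n + 1) → ℝ} (h : RegularBands (E x) (O x))
    (hE : ∀ k, AnalyticAt ℝ (fun y => E y k) x) (hO : ∀ k, AnalyticAt ℝ (fun y => O y k) x) :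
    AnalyticAt ℝ (fun y => scaledFrequency (E y) (O y)) x := by
  refine analyticAt_solution (fun j i => ?_) ?_
  · induction j using Fin.cases with
    | zero => exact analyticAt_firstMoment hE hO (h.band 0) (h.freeBand 0) i
    | succ j => exact analyticAt_bandMoment hE hO (h.band _) (h.pos j) (h.freeBand _) i
  · rw [freqMatrix_scaledMoment]
    exact h.det_ne_zero

theorem mom_firstMoment {E O : Fin (n + 1) → ℝ} (hf : FreeBand E O 0) (h : E 0 ≤ O 0)
    (p : Polynomial ℝ) : mom (firstMoment E O) p = ∫ φ in (0 : ℝ)..(Real.pi / 2),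
      p.eval (bandPt E O 0 φ) *
        (2 * (Real.sin φ * (√|otherProd E O 0 (bandPt E O 0 φ)|)⁻¹)) := by
  have h2 := continuous_bandPt E O 0
  have h3 := continuous_otherProd E O 0
  have h1 : Continuous fun φ => (√|otherProd E O 0 (bandPt E O 0 φ)|)⁻¹ := by
    refine Continuous.inv₀ (by fun_prop) fun φ => ?_
    exact (Real.sqrt_pos.2 (abs_pos.2 (hf _ (bandPt_mem h φ)))).ne'
  rw [mom_eq_sum _ (Nat.lt_succ_self _)]
  simp_rw [Polynomial.eval_eq_sum_range, Finset.sum_mul, firstMoment, Finset.sum_range]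
  rw [intervalIntegral.integral_finsetSum]
  · refine Finset.sum_congr rfl fun i _ => ?_
    rw [← intervalIntegral.integral_const_mul]
    refine intervalIntegral.integral_congr fun φ _ => ?_
    ring
  · intro i _
    refine Continuous.intervalIntegrable ?_ _ _
    fun_prop

/-- The scaled first moments have the density sin φ times a positive function, so they are positive
functionals even if the first band has shrunk to 0, and `IsKernel.pos` applies. -/
theorem RegularBands.scaledFrequency_pos {E O : Fin (n + 1) → ℝ} (h : RegularBands E O)
    (i : Fin n) : 0 < scaledFrequency E O i := by
  have hk : IsKernel (scaledMoment E O)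
      (Fin.cons (1 / 2) (scaledFrequency E O) : Fin (n + 1) → ℝ) :=
    (isKernel_cons_iff (by rw [freqMatrix_scaledMoment]; exact h.det_ne_zero)).2 rfl
  have h1 := hk.pos (g := fun i => (O i.castSucc + E i.succ) / 2) ?_ (by simp) i.succ
  · simpa using h1
  intro j
  induction j using Fin.cases with
  | succ j => exact h.bandPositive_of_ne_zero (Fin.succ_ne_zero j)
  | zero =>
    intro C _
    have h2 := continuous_bandPt E O 0
    have h3 := continuous_otherProd E O 0
    have h1 : Continuous fun φ => (√|otherProd E O 0 (bandPt E O 0 φ)|)⁻¹ := by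
      refine Continuous.inv₀ (by fun_prop) fun φ => ?_
      exact (Real.sqrt_pos.2 (abs_pos.2 (h.freeBand 0 _ (bandPt_mem (h.band 0) φ)))).ne'
    rw [scaledMoment, Fin.cons_zero, mom_firstMoment (h.freeBand 0) (h.band 0),
      ← intervalIntegral.integral_const_mul]
    refine intervalIntegral.intervalIntegral_pos_of_pos_on
      (Continuous.intervalIntegrable (by fun_prop) _ _) ?_ (by positivity)
    intro φ hφ
    have hm := bandPt_mem (h.band 0) φ
    have hlt : ∀ i : Fin n, bandPt E O 0 φ < (O i.castSucc + E i.succ) / 2 := fun i => by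
      have h4 := h.gap_lt i
      have h5 := h.le_castSucc (Fin.zero_le i.castSucc)
      linarith [hm.2]
    rw [gapPoly_eval, ← mul_assoc, gapSign_mul_prod _ C 0 (fun i _ _ => (hlt i).le)
      (fun i _ hi => absurd hi (Fin.not_lt_zero _))]
    refine mul_pos (Finset.prod_pos fun i _ => abs_pos.2 (sub_ne_zero.2 (hlt i).ne)) ?_
    have h5 := abs_pos.2 (h.freeBand 0 _ hm)
    have h6 : 0 < Real.sin φ :=
      Real.sin_pos_of_pos_of_lt_pi hφ.1 (by linarith [hφ.2, Real.pi_pos])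
    positivity

end EllipsoidBilliard

/-! ### A contour integral in the upper half plane -/

namespace EllipsoidBilliard

section Contour

open MeasureTheory Complex

variable {ι : Type*} [Fintype ι]

/-- The function `zⁱ / √∏ (z - c k)` on the closed upper half plane. -/
noncomputable def rootFun (c : ι → ℝ) (i : ℕ) (z : ℂ) : ℂ :=
  z ^ i * ∏ k, (z - c k) ^ (-(1 / 2) : ℂ)

/-- A bound for `rootFun` near the real axis. -/
noncomputable def rootBound (c : ι → ℝ) (i : ℕ) (s : ℝ) : ℝ :=
  (1 + |s|) ^ i * ∏ k, |s - c k| ^ (-(1 / 2) : ℝ)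

theorem norm_cpow_neg_half {z : ℂ} (hz : z ≠ 0) :
    ‖z ^ (-(1 / 2) : ℂ)‖ = ‖z‖ ^ (-(1 / 2) : ℝ) := by
  rw [Complex.norm_cpow_of_ne_zero hz]
  have h1 : (-(1 / 2) : ℂ).re = -(1 / 2) := by norm_num
  have h2 : (-(1 / 2) : ℂ).im = 0 := by norm_num
  rw [h1, h2, mul_zero, Real.exp_zero, div_one]

/-- Moving up from the real axis only increases the distances to the real roots, which enter with a
negative exponent. The bound does not depend on the height, as needed for dominated convergence. -/
theorem norm_rootFun_le_rootBound (c : ι → ℝ) (i : ℕ) {s ε : ℝ} (hs : ∀ k, s ≠ c k)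
    (hε : 0 ≤ ε) (hε1 : ε ≤ 1) : ‖rootFun c i (s + ε * I)‖ ≤ rootBound c i s := by
  rw [rootFun, norm_mul, norm_pow, norm_prod, rootBound]
  have h1 : ‖(s + ε * I : ℂ)‖ ≤ 1 + |s| := by
    refine (norm_add_le _ _).trans ?_
    rw [norm_mul, norm_I, mul_one, Complex.norm_real, Complex.norm_real, Real.norm_eq_abs,
      Real.norm_eq_abs, abs_of_nonneg hε]
    linarith
  refine mul_le_mul (pow_le_pow_left₀ (norm_nonneg _) h1 i)
    (Finset.prod_le_prod (fun _ _ => norm_nonneg _) fun k _ => ?_)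
    (Finset.prod_nonneg fun _ _ => norm_nonneg _) (by positivity)
  have h2 : |s - c k| ≤ ‖(s + ε * I - c k : ℂ)‖ := by
    refine le_trans (le_of_eq ?_) (Complex.abs_re_le_norm _)
    simp
  have h3 : 0 < |s - c k| := abs_pos.2 (sub_ne_zero.2 (hs k))
  have h4 : (s + ε * I - c k : ℂ) ≠ 0 := norm_pos_iff.1 (h3.trans_le h2)
  rw [norm_cpow_neg_half h4]
  exact Real.rpow_le_rpow_of_nonpos h3 h2 (by norm_num)

/-- The degree count: the exponent i - N/2 is at most -3/2, which is integrable at infinity. The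
factors 2r and r/2 are the bounds for |z| and |z - c| far away from the roots. -/
theorem rpow_far_le {i N : ℕ} (hN : 2 * i + 3 ≤ N) {r : ℝ} (hr : 1 ≤ r) :
    (2 * r) ^ i * ((r / 2) ^ (-(1 / 2) : ℝ)) ^ N ≤ 2 ^ (i + N) * r ^ (-(3 / 2) : ℝ) := by
  have h0 : 0 < r := by linarith
  have h1 : ((r / 2) ^ (-(1 / 2) : ℝ)) ^ N = (2 ^ (1 / 2 : ℝ)) ^ N * r ^ (-(N / 2) : ℝ) := by
    rw [Real.div_rpow h0.le (by norm_num), Real.rpow_neg (by norm_num : (0 : ℝ) ≤ 2), div_inv_eq_mul,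
      mul_pow, mul_comm, ← Real.rpow_natCast (r ^ _), ← Real.rpow_mul h0.le]
    congr 2
    ring
  have h2 : (2 : ℝ) ^ (1 / 2 : ℝ) ≤ 2 := by
    calc (2 : ℝ) ^ (1 / 2 : ℝ) ≤ 2 ^ (1 : ℝ) :=
          Real.rpow_le_rpow_of_exponent_le (by norm_num) (by norm_num)
      _ = 2 := Real.rpow_one 2
  have h3 : r ^ i * r ^ (-(N / 2) : ℝ) ≤ r ^ (-(3 / 2) : ℝ) := by
    rw [← Real.rpow_natCast, ← Real.rpow_add h0]
    refine Real.rpow_le_rpow_of_exponent_le hr ?_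
    have : (2 * i + 3 : ℝ) ≤ N := by exact_mod_cast hN
    linarith
  rw [h1, mul_pow, pow_add]
  calc 2 ^ i * r ^ i * ((2 ^ (1 / 2 : ℝ)) ^ N * r ^ (-(N / 2) : ℝ))
      = 2 ^ i * (2 ^ (1 / 2 : ℝ)) ^ N * (r ^ i * r ^ (-(N / 2) : ℝ)) := by ring
    _ ≤ 2 ^ i * 2 ^ N * r ^ (-(3 / 2) : ℝ) := by gcongr

theorem exists_norm_rootFun_le (c : ι → ℝ) {i : ℕ} (hN : 2 * i + 3 ≤ Fintype.card ι) :
    ∃ R K : ℝ, 1 ≤ R ∧ (∀ z : ℂ, R ≤ ‖z‖ → ‖rootFun c i z‖ ≤ K * ‖z‖ ^ (-(3 / 2) : ℝ)) ∧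
      ∀ s : ℝ, R ≤ |s| → |rootBound c i s| ≤ K * |s| ^ (-(3 / 2) : ℝ) := by
  -- This radius guarantees |c k| ≤ ‖z‖ / 2, hence ‖z - c k‖ ≥ ‖z‖ / 2.
  refine ⟨1 + 2 * ∑ k, |c k|, 2 ^ (i + Fintype.card ι),
    by have : 0 ≤ ∑ k, |c k| := Finset.sum_nonneg fun _ _ => abs_nonneg _
       linarith, fun z hz => ?_, fun s hs => ?_⟩
  · have h0 : 0 ≤ ∑ k, |c k| := Finset.sum_nonneg fun _ _ => abs_nonneg _
    have h1 : 1 ≤ ‖z‖ := by linarith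
    refine le_trans ?_ (rpow_far_le hN h1)
    rw [rootFun, norm_mul, norm_pow, norm_prod, ← Finset.card_univ, ← Finset.prod_const]
    refine mul_le_mul (pow_le_pow_left₀ (norm_nonneg _) (by linarith) i)
      (Finset.prod_le_prod (fun _ _ => norm_nonneg _) fun k _ => ?_)
      (Finset.prod_nonneg fun _ _ => norm_nonneg _) (by positivity)
    have h2 : |c k| ≤ ∑ k, |c k| :=
      Finset.single_le_sum (f := fun k => |c k|) (fun _ _ => abs_nonneg _) (Finset.mem_univ k)
    have h3 : ‖z‖ / 2 ≤ ‖z - c k‖ := by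
      have := norm_sub_norm_le z (c k)
      rw [Complex.norm_real, Real.norm_eq_abs] at this
      linarith
    have h4 : z - c k ≠ 0 := norm_pos_iff.1 (by linarith)
    rw [norm_cpow_neg_half h4]
    exact Real.rpow_le_rpow_of_nonpos (by linarith) h3 (by norm_num)
  · have h0 : 0 ≤ ∑ k, |c k| := Finset.sum_nonneg fun _ _ => abs_nonneg _
    have h1 : 1 ≤ |s| := by linarith
    refine le_trans ?_ (rpow_far_le hN h1)
    rw [rootBound, abs_mul, abs_pow, Finset.abs_prod, ← Finset.card_univ, ← Finset.prod_const]
    refine mul_le_mul (pow_le_pow_left₀ (abs_nonneg _) ?_ i)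
      (Finset.prod_le_prod (fun _ _ => abs_nonneg _) fun k _ => ?_)
      (Finset.prod_nonneg fun _ _ => abs_nonneg _) (by positivity)
    · rw [abs_of_nonneg (by positivity)]
      linarith
    have h2 : |c k| ≤ ∑ k, |c k| :=
      Finset.single_le_sum (f := fun k => |c k|) (fun _ _ => abs_nonneg _) (Finset.mem_univ k)
    have h3 : |s| / 2 ≤ |s - c k| := by
      have := abs_sub_abs_le_abs_sub s (c k)
      linarith
    rw [abs_of_nonneg (by positivity)]
    exact Real.rpow_le_rpow_of_nonpos (by linarith) h3 (by norm_num)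

theorem integrableAt_abs_rpow (c s : ℝ) :
    IntegrableAtFilter (fun x => |x - c| ^ (-(1 / 2) : ℝ)) (𝓝 s) := by
  have h1 : ∀ b : ℝ, 0 ≤ b → IntervalIntegrable (fun x => |x| ^ (-(1 / 2) : ℝ)) volume 0 b := by
    intro b hb
    refine IntervalIntegrable.congr (f := fun x => x ^ (-(1 / 2) : ℝ)) ?_
      (intervalIntegral.intervalIntegrable_rpow' (by norm_num))
    intro x hx
    rw [uIoc_of_le hb] at hx
    simp only [abs_of_pos hx.1]
  have h2 : ∀ b : ℝ, 0 ≤ b → IntervalIntegrable (fun x => |x| ^ (-(1 / 2) : ℝ)) volume (-b) b := by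
    intro b hb
    refine IntervalIntegrable.trans (b := 0) ?_ (h1 b hb)
    rw [IntervalIntegrable.iff_comp_neg]
    simpa using (h1 b hb).symm
  refine ⟨Ioo (s - 1) (s + 1), Ioo_mem_nhds (by linarith) (by linarith), ?_⟩
  have h3 := (h2 (|s - c| + 1) (by positivity)).comp_sub_right c
  rw [intervalIntegrable_iff_integrableOn_Ioc_of_le
    (by have := abs_nonneg (s - c); linarith)] at h3
  refine h3.mono_set fun x hx => ?_
  have h4 := neg_abs_le (s - c)
  have h5 := le_abs_self (s - c)
  constructor
  · linarith [hx.1]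
  · linarith [hx.2]

/-- The roots are distinct, so near each of them only one factor |s - c|^(-1/2) is unbounded, and it
is locally integrable. At infinity the bound decays like |s|^(-3/2). -/
theorem integrable_rootBound {c : ι → ℝ} (hc : Function.Injective c) {i : ℕ}
    (hN : 2 * i + 3 ≤ Fintype.card ι) : Integrable (rootBound c i) := by
  classical
  have hcont : ∀ (s : ℝ) (t : Finset ι), (∀ k ∈ t, s ≠ c k) →
      ContinuousAt (fun x => (1 + |x|) ^ i * ∏ k ∈ t, |x - c k| ^ (-(1 / 2) : ℝ)) s := by
    intro s t ht
    refine ContinuousAt.mul (by fun_prop) (tendsto_finsetProd _ fun k hk => ?_)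
    refine ContinuousAt.rpow_const (by fun_prop) (Or.inl ?_)
    exact abs_ne_zero.2 (sub_ne_zero.2 (ht k hk))
  have hmeas : ∀ t : Finset ι, Measurable
      (fun x : ℝ => (1 + |x|) ^ i * ∏ k ∈ t, |x - c k| ^ (-(1 / 2) : ℝ)) := by
    intro t
    refine Measurable.mul (by fun_prop) (Finset.measurable_fun_prod _ fun k _ => ?_)
    fun_prop
  have hloc : LocallyIntegrable (rootBound c i) := by
    intro s
    by_cases h : ∃ k, s = c k
    · obtain ⟨k, hk⟩ := h
      have h1 := hcont s (Finset.univ.erase k) (fun l hl => by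
        rw [hk]
        exact fun h => (Finset.ne_of_mem_erase hl) (hc h).symm)
      have h2 : rootBound c i = fun x => ((1 + |x|) ^ i *
          ∏ l ∈ Finset.univ.erase k, |x - c l| ^ (-(1 / 2) : ℝ)) * |x - c k| ^ (-(1 / 2) : ℝ) := by
        funext x
        rw [rootBound, ← Finset.mul_prod_erase _ _ (Finset.mem_univ k)]
        ring
      rw [h2]
      obtain ⟨U, hU, hUi⟩ := integrableAt_abs_rpow (c k) s
      have h3 := h1.norm.eventually_le_const (lt_add_one _)
      set b := ‖(1 + |s|) ^ i * ∏ l ∈ Finset.univ.erase k, |s - c l| ^ (-(1 / 2) : ℝ)‖ + 1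
      obtain ⟨W, hW, hWo, hsW⟩ := eventually_nhds_iff.1 h3
      refine ⟨U ∩ W, inter_mem hU (hWo.mem_nhds hsW), ?_⟩
      refine Integrable.bdd_mul (c := b) (hUi.mono_set inter_subset_left)
        ((hmeas _).aestronglyMeasurable) ?_
      have h4 : ∀ᵐ x ∂volume.restrict W, ‖(1 + |x|) ^ i *
          ∏ l ∈ Finset.univ.erase k, |x - c l| ^ (-(1 / 2) : ℝ)‖ ≤ b :=
        (ae_restrict_iff' hWo.measurableSet).2 (Eventually.of_forall hW)
      exact ae_restrict_of_ae_restrict_of_subset inter_subset_right h4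
    · push Not at h
      have h1 : Tendsto (rootBound c i) (𝓝 s) (𝓝 (rootBound c i s)) :=
        hcont s Finset.univ fun k _ => h k
      exact h1.integrableAtFilter ⟨univ, univ_mem, (hmeas _).aestronglyMeasurable⟩
        (volume.finiteAt_nhds s)
  obtain ⟨R, K, hR, -, hK⟩ := exists_norm_rootFun_le c hN
  refine hloc.integrable_of_isBigO_atBot_atTop (g := fun s => |s| ^ (-(3 / 2) : ℝ))
    (g' := fun s => |s| ^ (-(3 / 2) : ℝ)) ?_ ?_ ?_ ?_
  · refine IsBigO.of_bound K ?_
    filter_upwards [eventually_le_atBot (-R)] with s hs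
    rw [Real.norm_eq_abs, Real.norm_eq_abs, abs_of_nonneg (a := |s| ^ _) (by positivity)]
    exact hK s (by rw [abs_of_nonpos (by linarith)]; linarith)
  · refine ⟨Iio (-1), Iio_mem_atBot _, ?_⟩
    have h1 := integrableOn_Ioi_rpow_of_lt (a := -(3 / 2)) (by norm_num) one_pos
    have h2 := ((Measure.measurePreserving_neg (volume : Measure ℝ)).integrableOn_comp_preimage
      (Homeomorph.neg ℝ).measurableEmbedding).2 h1
    have h3 : (fun x : ℝ => -x) ⁻¹' Ioi 1 = Iio (-1) := by
      ext x
      simp [lt_neg]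
    have h4 : IntegrableOn ((fun s : ℝ => s ^ (-(3 / 2) : ℝ)) ∘ fun x => -x) (Iio (-1)) := by
      rw [← h3]
      exact h2
    refine h4.congr_fun (fun s hs => ?_) measurableSet_Iio
    simp only [mem_Iio] at hs
    simp only [Function.comp_apply, abs_of_neg (show s < 0 by linarith)]
  · refine IsBigO.of_bound K ?_
    filter_upwards [eventually_ge_atTop R] with s hs
    rw [Real.norm_eq_abs, Real.norm_eq_abs, abs_of_nonneg (a := |s| ^ _) (by positivity)]
    exact hK s (by rw [abs_of_nonneg (by linarith)]; linarith)
  · refine ⟨Ioi 1, Ioi_mem_atTop _, ?_⟩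
    have h1 := integrableOn_Ioi_rpow_of_lt (a := -(3 / 2)) (by norm_num) one_pos
    refine h1.congr_fun (fun s hs => ?_) measurableSet_Ioi
    simp only [mem_Ioi] at hs
    simp only [abs_of_pos (show 0 < s by linarith)]

theorem differentiableAt_rootFun (c : ι → ℝ) (i : ℕ) {z : ℂ} (hz : 0 < z.im) :
    DifferentiableAt ℂ (rootFun c i) z := by
  unfold rootFun
  refine DifferentiableAt.mul (by fun_prop) (DifferentiableAt.fun_finsetProd fun k _ => ?_)
  refine DifferentiableAt.cpow_const (by fun_prop) ?_
  right
  simpa using hz.ne'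

theorem ae_ne_roots (c : ι → ℝ) : ∀ᵐ s : ℝ, ∀ k, s ≠ c k := by
  rw [ae_all_iff]
  intro k
  exact Measure.ae_ne _ _

theorem integrable_rootFun_shift {c : ι → ℝ} (hc : Function.Injective c) {i : ℕ}
    (hN : 2 * i + 3 ≤ Fintype.card ι) {ε : ℝ} (h0 : 0 < ε) (h1 : ε ≤ 1) :
    Integrable fun s : ℝ => rootFun c i (s + ε * I) := by
  refine (integrable_rootBound hc hN).mono' (Continuous.aestronglyMeasurable ?_) ?_
  · rw [continuous_iff_continuousAt]
    intro s
    have h2 : ContinuousAt (rootFun c i) (s + ε * I) :=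
      (differentiableAt_rootFun c i (by simpa using h0)).continuousAt
    exact ContinuousAt.comp (f := fun s : ℝ => (s + ε * I : ℂ)) h2 (by fun_prop)
  · filter_upwards [ae_ne_roots c] with s hs
    exact norm_rootFun_le_rootBound c i hs h0.le h1

/-- Cauchy's theorem on the rectangle [-r, r] × [ε, r], as r → ∞. -/
theorem integral_rootFun_shift {c : ι → ℝ} (hc : Function.Injective c) {i : ℕ}
    (hN : 2 * i + 3 ≤ Fintype.card ι) {ε : ℝ} (h0 : 0 < ε) (h1 : ε ≤ 1) :
    ∫ s : ℝ, rootFun c i (s + ε * I) = 0 := by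
  have hlim := intervalIntegral_tendsto_integral (integrable_rootFun_shift hc hN h0 h1)
    tendsto_neg_atTop_atBot tendsto_id
  refine tendsto_nhds_unique hlim ?_
  obtain ⟨R, K, hR, hK, -⟩ := exists_norm_rootFun_le c hN
  have hK' : ∀ r : ℝ, R ≤ r → ∀ z : ℂ, r ≤ ‖z‖ → ‖rootFun c i z‖ ≤ |K| * r ^ (-(3 / 2) : ℝ) := by
    intro r hr z hz
    refine (hK z (hr.trans hz)).trans ?_
    have : ‖z‖ ^ (-(3 / 2) : ℝ) ≤ r ^ (-(3 / 2) : ℝ) :=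
      Real.rpow_le_rpow_of_nonpos (by linarith) hz (by norm_num)
    have h2 : 0 ≤ ‖z‖ ^ (-(3 / 2) : ℝ) := by positivity
    have h3 := le_abs_self K
    have h4 := abs_nonneg K
    nlinarith
  -- The upper side has length 2r and the vertical sides at most r each; together with the bound |K|
  -- r^(-3/2) this gives the constant 4 and the exponent -1/2.
  have hz : Tendsto (fun r : ℝ => 4 * |K| * r ^ (-(1 / 2) : ℝ)) atTop (𝓝 0) := by
    rw [← mul_zero (4 * |K|)]
    exact (tendsto_rpow_neg_atTop (by norm_num)).const_mul _
  refine squeeze_zero_norm' ?_ hz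
  filter_upwards [eventually_ge_atTop R] with r hr
  have hr0 : 0 < r := by linarith
  have hrect := integral_boundary_rect_eq_zero_of_differentiableOn (rootFun c i)
    (-r + ε * I) (r + r * I) (fun z hz => by
      refine (differentiableAt_rootFun c i ?_).differentiableWithinAt
      have h2 := hz.2
      simp only [mem_preimage] at h2
      have h3 : (-r + ε * I : ℂ).im = ε := by simp
      have h4 : (r + r * I : ℂ).im = r := by simp
      rw [h3, h4, uIcc_of_le (by linarith)] at h2
      exact h0.trans_le h2.1)
  have e1 : (-r + ε * I : ℂ).re = -r := by simp
  have e2 : (-r + ε * I : ℂ).im = ε := by simp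
  have e3 : (r + r * I : ℂ).re = r := by simp
  have e4 : (r + r * I : ℂ).im = r := by simp
  rw [e1, e2, e3, e4] at hrect
  have b1 : ‖∫ x in (-r)..r, rootFun c i (x + r * I)‖ ≤ |K| * r ^ (-(3 / 2) : ℝ) * |r - -r| := by
    refine intervalIntegral.norm_integral_le_of_norm_le_const fun x _ => hK' r hr _ ?_
    refine le_trans ?_ (Complex.abs_im_le_norm _)
    simp [abs_of_pos hr0]
  have b2 : ‖∫ y in ε..r, rootFun c i (r + y * I)‖ ≤ |K| * r ^ (-(3 / 2) : ℝ) * |r - ε| := by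
    refine intervalIntegral.norm_integral_le_of_norm_le_const fun x _ => hK' r hr _ ?_
    refine le_trans ?_ (Complex.abs_re_le_norm _)
    simp [abs_of_pos hr0]
  have b3 : ‖∫ y in ε..r, rootFun c i ((-r : ℝ) + y * I)‖ ≤
      |K| * r ^ (-(3 / 2) : ℝ) * |r - ε| := by
    refine intervalIntegral.norm_integral_le_of_norm_le_const fun x _ => hK' r hr _ ?_
    refine le_trans ?_ (Complex.abs_re_le_norm _)
    simp [abs_of_pos hr0]
  have h5 : ∫ x in (-r)..r, rootFun c i (x + ε * I) =
      (∫ x in (-r)..r, rootFun c i (x + r * I)) -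
        I * (∫ y in ε..r, rootFun c i (r + y * I)) +
        I * (∫ y in ε..r, rootFun c i ((-r : ℝ) + y * I)) := by
    simp only [smul_eq_mul] at hrect
    linear_combination hrect
  have h6 : r ^ (-(3 / 2) : ℝ) * r = r ^ (-(1 / 2) : ℝ) := by
    nth_rewrite 2 [← Real.rpow_one r]
    rw [← Real.rpow_add hr0]
    norm_num
  have h7 : ‖∫ x in (-r)..r, rootFun c i (x + ε * I)‖ ≤
      |K| * r ^ (-(3 / 2) : ℝ) * |r - -r| + |K| * r ^ (-(3 / 2) : ℝ) * |r - ε| +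
        |K| * r ^ (-(3 / 2) : ℝ) * |r - ε| := by
    rw [h5]
    refine (norm_add_le _ _).trans (add_le_add ((norm_sub_le _ _).trans (add_le_add b1 ?_)) ?_)
    · rw [norm_mul, norm_I, one_mul]
      exact b2
    · rw [norm_mul, norm_I, one_mul]
      exact b3
  refine h7.trans ?_
  rw [abs_of_nonneg (by linarith : 0 ≤ r - -r), abs_of_nonneg (by linarith : 0 ≤ r - ε), ← h6]
  have h8 : 0 ≤ |K| * r ^ (-(3 / 2) : ℝ) := by positivity
  nlinarith

/-- The principal branch takes the argument π on the negative axis, so it is continuous there from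
above; approaching from the upper half plane gives the literal boundary values of `rootFun`. -/
theorem tendsto_rootFun_shift (c : ι → ℝ) (i : ℕ) {s : ℝ} (hs : ∀ k, s ≠ c k) :
    Tendsto (fun ε : ℝ => rootFun c i (s + ε * I)) (𝓝[>] 0) (𝓝 (rootFun c i s)) := by
  unfold rootFun
  have h0 : Tendsto (fun ε : ℝ => (s + ε * I : ℂ)) (𝓝[>] 0) (𝓝 s) := by
    have : Continuous fun ε : ℝ => (s + ε * I : ℂ) := by fun_prop
    have h := this.tendsto 0
    simp only [ofReal_zero, zero_mul, add_zero] at h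
    exact h.mono_left nhdsWithin_le_nhds
  refine (h0.pow i).mul (tendsto_finsetProd _ fun k _ => ?_)
  have h1 : (s - c k : ℂ) ≠ 0 := by
    rw [← ofReal_sub]
    exact_mod_cast sub_ne_zero.2 (hs k)
  have h2 : Tendsto (fun ε : ℝ => (s + ε * I - c k : ℂ)) (𝓝[>] 0) (𝓝 (s - c k)) :=
    h0.sub tendsto_const_nhds
  have h3 : ∀ᶠ ε : ℝ in 𝓝[>] 0, (s + ε * I - c k : ℂ) ≠ 0 := h2.eventually_ne h1
  rcases lt_or_gt_of_ne (sub_ne_zero.2 (hs k)) with h | h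
  · have hlog := continuousWithinAt_log_of_re_neg_of_im_zero (z := (s - c k : ℂ))
      (by simpa using h) (by simp)
    have h4 : Tendsto (fun ε : ℝ => (s + ε * I - c k : ℂ)) (𝓝[>] 0)
        (𝓝[{z : ℂ | 0 ≤ z.im}] (s - c k)) := by
      refine tendsto_nhdsWithin_iff.2 ⟨h2, ?_⟩
      filter_upwards [self_mem_nhdsWithin] with ε hε
      simpa using (le_of_lt hε)
    have h5 := (hlog.tendsto.comp h4).mul_const (-(1 / 2) : ℂ)
    have h6 := (Complex.continuous_exp.tendsto _).comp h5
    rw [cpow_def_of_ne_zero h1]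
    refine h6.congr' ?_
    filter_upwards [h3] with ε hε
    rw [cpow_def_of_ne_zero hε]
    rfl
  · have : ContinuousAt (fun z : ℂ => z ^ (-(1 / 2) : ℂ)) (s - c k) :=
      continuousAt_cpow_const (Or.inl (by simpa using h))
    exact this.tendsto.comp h2

/-- Let the height of the line tend to 0, dominated by `rootBound`. -/
theorem integral_rootFun {c : ι → ℝ} (hc : Function.Injective c) {i : ℕ}
    (hN : 2 * i + 3 ≤ Fintype.card ι) :
    Integrable (fun s : ℝ => rootFun c i s) ∧ ∫ s : ℝ, rootFun c i s = 0 := by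
  have hev : ∀ᶠ ε : ℝ in 𝓝[>] 0, 0 < ε ∧ ε ≤ 1 := by
    filter_upwards [Ioo_mem_nhdsGT (zero_lt_one' ℝ)] with ε hε
    exact ⟨hε.1, hε.2.le⟩
  have hpt : ∀ᵐ s : ℝ, Tendsto (fun ε : ℝ => rootFun c i (s + ε * I)) (𝓝[>] 0)
      (𝓝 (rootFun c i s)) := by
    filter_upwards [ae_ne_roots c] with s hs
    exact tendsto_rootFun_shift c i hs
  have hbd : ∀ᶠ ε : ℝ in 𝓝[>] 0, ∀ᵐ s : ℝ, ‖rootFun c i (s + ε * I)‖ ≤ rootBound c i s := by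
    filter_upwards [hev] with ε hε
    filter_upwards [ae_ne_roots c] with s hs
    exact norm_rootFun_le_rootBound c i hs hε.1.le hε.2
  have hmeas : ∀ᶠ ε : ℝ in 𝓝[>] 0,
      AEStronglyMeasurable fun s : ℝ => rootFun c i (s + ε * I) := by
    filter_upwards [hev] with ε hε
    exact (integrable_rootFun_shift hc hN hε.1 hε.2).aestronglyMeasurable
  have hlim := tendsto_integral_filter_of_dominated_convergence (rootBound c i) hmeas hbd
    (integrable_rootBound hc hN) hpt
  constructor
  · refine (integrable_rootBound hc hN).mono' ?_ ?_
    · unfold rootFun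
      refine Measurable.aestronglyMeasurable ?_
      refine Measurable.mul (by fun_prop) (Finset.measurable_fun_prod _ fun k _ => ?_)
      exact Measurable.pow_const (by fun_prop) _
    · filter_upwards [ae_ne_roots c] with s hs
      simpa using norm_rootFun_le_rootBound c i hs le_rfl zero_le_one
  · refine tendsto_nhds_unique hlim (tendsto_const_nhds.congr' ?_)
    filter_upwards [hev] with ε hε
    exact (integral_rootFun_shift hc hN hε.1 hε.2).symm

end Contour

end EllipsoidBilliard

/-! ### The relation between the bands and the negative half line -/

namespace EllipsoidBilliard

variable {n : ℕ}

theorem RegularBands.lt_of_lt {E O : Fin (n + 1) → ℝ} (h : RegularBands E O) {j k : Fin (n + 1)}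
    (hjk : j < k) : O j < E k := by
  obtain ⟨i, rfl⟩ := Fin.exists_castSucc_eq.2 (Fin.ne_last_of_lt hjk)
  exact (h.gap_lt i).trans_le (h.mono (Fin.castSucc_lt_iff_succ_le.1 hjk))

theorem RegularBands.ne {E O : Fin (n + 1) → ℝ} (h : IsBands E O) (j k : Fin (n + 1)) :
    O j ≠ E k := by
  rcases lt_or_ge j k with hjk | hjk
  · exact (h.lt_of_lt hjk).ne
  · exact ((h.mono hjk).trans_lt (h.band_lt j)).ne'

theorem IsBands.strictMono_left {E O : Fin (n + 1) → ℝ} (h : IsBands E O) : StrictMono E :=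
  fun j _ hjk => (h.band_lt j).trans (h.lt_of_lt hjk)

theorem IsBands.strictMono_right {E O : Fin (n + 1) → ℝ} (h : IsBands E O) : StrictMono O :=
  fun _ k hjk => (h.lt_of_lt hjk).trans (h.band_lt k)

/-- All endpoints other than `0`. -/
def roots (E O : Fin (n + 1) → ℝ) : Fin (n + 1) ⊕ Fin n → ℝ := Sum.elim O fun i => E i.succ

theorem IsBands.injective_roots {E O : Fin (n + 1) → ℝ} (h : IsBands E O) :
    Function.Injective (roots E O) := by
  refine Function.Injective.sumElim h.strictMono_right.injective ?_ fun j k => ?_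
  · exact h.strictMono_left.injective.comp (Fin.succ_injective n)
  · exact RegularBands.ne h j k.succ

theorem card_roots {i : ℕ} (hi : i < n) : 2 * i + 3 ≤ Fintype.card (Fin (n + 1) ⊕ Fin n) := by
  simp only [Fintype.card_sum, Fintype.card_fin]
  omega

open Complex in
theorem cpow_neg_half_of_pos {x : ℝ} (hx : 0 < x) :
    (x : ℂ) ^ (-(1 / 2) : ℂ) = ((√|x|)⁻¹ : ℝ) := by
  have : (-(1 / 2) : ℂ) = ((-(1 / 2) : ℝ) : ℂ) := by push_cast; ring
  rw [this, ← ofReal_cpow hx.le, Real.rpow_neg hx.le, ← Real.sqrt_eq_rpow, abs_of_pos hx]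

open Complex in
theorem cpow_neg_half_of_neg {x : ℝ} (hx : x < 0) :
    (x : ℂ) ^ (-(1 / 2) : ℂ) = -I * ((√|x|)⁻¹ : ℝ) := by
  have h3 := cpow_neg_half_of_pos (neg_pos.2 hx)
  rw [abs_neg] at h3
  rw [← h3, ofReal_cpow_of_nonpos hx.le]
  have : (Real.pi : ℂ) * I * -(1 / 2) = -(Real.pi / 2 * I) := by ring
  rw [this, exp_neg, exp_pi_div_two_mul_I, inv_I, mul_comm]
  push_cast
  rfl

theorem rootFun_roots (E O : Fin (n + 1) → ℝ) (i : ℕ) (z : ℂ) :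
    rootFun (roots E O) i z = z ^ i * ((∏ k, (z - O k) ^ (-(1 / 2) : ℂ)) *
      ∏ k : Fin n, (z - E k.succ) ^ (-(1 / 2) : ℂ)) := by
  simp [rootFun, roots]

theorem sqrt_abs_rootProd (E O : Fin (n + 1) → ℝ) (s : ℝ) :
    (√|rootProd E O s|)⁻¹ = (∏ k, (√|s - O k|)⁻¹) * ∏ k : Fin n, (√|s - E k.succ|)⁻¹ := by
  simp only [rootProd, abs_mul, Finset.abs_prod, Finset.prod_inv_distrib, ← mul_inv]
  rw [Real.sqrt_mul (Finset.prod_nonneg fun _ _ => abs_nonneg _), Real.sqrt_prod,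
    Real.sqrt_prod]
  · simp only [abs_sub_comm s]
  · exact fun _ _ => abs_nonneg _
  · exact fun _ _ => abs_nonneg _

theorem gapSign_univ (j : Fin (n + 1)) :
    gapSign Finset.univ j = (-1) ^ n * (-1) ^ (j : ℕ) := by
  have := alternating_mul_gapSign (fun _ : Fin (n + 1) => 1) (fun _ => Or.inl rfl) j
  simp only [Finset.filter_true, mul_one] at this
  rw [← this, mul_comm, ← mul_assoc, ← mul_pow]
  simp

open Complex in
theorem rootFun_of_band {E O : Fin (n + 1) → ℝ} (h : IsBands E O) (i : ℕ) {j : Fin (n + 1)} {s : ℝ}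
    (h1 : s < O j) (h2 : ∀ k : Fin n, k.castSucc < j → E k.succ < s) :
    rootFun (roots E O) i s =
      -I * ((-1) ^ n * (-1) ^ (j : ℕ) * (s ^ i * (√|rootProd E O s|)⁻¹) : ℝ) := by
  rw [rootFun_roots, sqrt_abs_rootProd, ← gapSign_univ, Fin.prod_univ_castSucc,
    Fin.prod_univ_castSucc]
  have hl : s < O (Fin.last n) := h1.trans_le (h.strictMono_right.monotone (Fin.le_last _))
  have hP : (∏ k : Fin n, ((s : ℂ) - O k.castSucc) ^ (-(1 / 2) : ℂ)) *
      ∏ k : Fin n, ((s : ℂ) - E k.succ) ^ (-(1 / 2) : ℂ) =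
      ((gapSign Finset.univ j * ((∏ k : Fin n, (√|s - O k.castSucc|)⁻¹) *
        ∏ k : Fin n, (√|s - E k.succ|)⁻¹) : ℝ) : ℂ) := by
    have : gapSign Finset.univ j = ∏ i : Fin n, (if j ≤ i.castSucc then (-1 : ℝ) else 1) := by
      rw [Finset.prod_ite, Finset.prod_const, Finset.prod_const_one, mul_one]
      rfl
    rw [this, ← Finset.prod_mul_distrib, ← Finset.prod_mul_distrib, ← Finset.prod_mul_distrib,
      ofReal_prod]
    refine Finset.prod_congr rfl fun k _ => ?_
    rw [← ofReal_sub, ← ofReal_sub]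
    split_ifs with hk
    · have h3 : s < O k.castSucc := h1.trans_le (h.strictMono_right.monotone hk)
      rw [cpow_neg_half_of_neg (sub_neg.2 h3),
        cpow_neg_half_of_neg (sub_neg.2 (h3.trans (h.gap_lt k)))]
      push_cast
      linear_combination ((√|s - O k.castSucc| : ℂ)⁻¹ * (√|s - E k.succ| : ℂ)⁻¹) * I_sq
    · have h3 := h2 k (not_le.1 hk)
      rw [cpow_neg_half_of_pos (sub_pos.2 h3),
        cpow_neg_half_of_pos (sub_pos.2 ((h.gap_lt k).trans h3))]
      push_cast
      ring
  have h4 : ((s : ℂ) - O (Fin.last n)) ^ (-(1 / 2) : ℂ) = -I * ((√|s - O (Fin.last n)|)⁻¹ : ℝ) := by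
    rw [← ofReal_sub, cpow_neg_half_of_neg (sub_neg.2 hl)]
  rw [h4]
  calc _ = (s : ℂ) ^ i * ((∏ k : Fin n, ((s : ℂ) - O k.castSucc) ^ (-(1 / 2) : ℂ)) *
      ∏ k : Fin n, ((s : ℂ) - E k.succ) ^ (-(1 / 2) : ℂ)) *
      (-I * ((√|s - O (Fin.last n)|)⁻¹ : ℝ)) := by ring
    _ = _ := by
      rw [hP]
      push_cast
      ring

open Complex in
-- Outside the bands and to the right of O₀ both endpoints of each later band lie on the same side
-- of `s`, so the factors -i occur in pairs and the value is real.
theorem im_rootFun_of_gap {E O : Fin (n + 1) → ℝ} (i : ℕ) {s : ℝ}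
    (h1 : O 0 < s) (h2 : ∀ k : Fin n, (s < E k.succ ∧ s < O k.succ) ∨
      (E k.succ < s ∧ O k.succ < s)) : (rootFun (roots E O) i s).im = 0 := by
  suffices h : ∃ r : ℝ, rootFun (roots E O) i s = r by
    obtain ⟨r, hr⟩ := h
    rw [hr, ofReal_im]
  have h3 : ∀ k : Fin n, ∃ r : ℝ, ((s : ℂ) - O k.succ) ^ (-(1 / 2) : ℂ) *
      ((s : ℂ) - E k.succ) ^ (-(1 / 2) : ℂ) = r := by
    intro k
    rw [← ofReal_sub, ← ofReal_sub]
    rcases h2 k with h | h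
    · rw [cpow_neg_half_of_neg (sub_neg.2 h.1), cpow_neg_half_of_neg (sub_neg.2 h.2)]
      refine ⟨-((√|s - O k.succ|)⁻¹ * (√|s - E k.succ|)⁻¹), ?_⟩
      push_cast
      linear_combination ((√|s - O k.succ| : ℂ)⁻¹ * (√|s - E k.succ| : ℂ)⁻¹) * I_sq
    · rw [cpow_neg_half_of_pos (sub_pos.2 h.1), cpow_neg_half_of_pos (sub_pos.2 h.2)]
      exact ⟨_, (ofReal_mul _ _).symm⟩
  choose r hr using h3
  refine ⟨s ^ i * ((√|s - O 0|)⁻¹ * ∏ k, r k), ?_⟩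
  rw [rootFun_roots, Fin.prod_univ_succ, mul_assoc (_ ^ _) (∏ k : Fin n, _),
    ← Finset.prod_mul_distrib]
  simp_rw [hr]
  rw [← ofReal_sub, cpow_neg_half_of_pos (sub_pos.2 h1)]
  push_cast
  rfl

/-- The density `sⁱ / √|T(s)|`. -/
noncomputable def density (E O : Fin (n + 1) → ℝ) (i : ℕ) (s : ℝ) : ℝ :=
  s ^ i * (√|rootProd E O s|)⁻¹

/-- The moments on the negative half line. -/
noncomputable def negMoment (E O : Fin (n + 1) → ℝ) (i : ℕ) : ℝ :=
  ∫ s in Iio 0, density E O i s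

open MeasureTheory

theorem IsBands.integrable_density {E O : Fin (n + 1) → ℝ} (h : IsBands E O) {i : ℕ} (hi : i < n) :
    Integrable (density E O i) := by
  have h1 := (integral_rootFun h.injective_roots (card_roots hi)).1
  refine h1.norm.mono ?_ ?_
  · refine Measurable.aestronglyMeasurable ?_
    unfold density rootProd
    fun_prop
  · filter_upwards [ae_ne_roots (roots E O)] with s hs
    have h2 : ∀ k, s ≠ O k := fun k => hs (Sum.inl k)
    have h3 : ∀ k : Fin n, s ≠ E k.succ := fun k => hs (Sum.inr k)
    have h4 : ∀ x : ℝ, x ≠ 0 → ‖(x : ℂ) ^ (-(1 / 2) : ℂ)‖ = (√|x|)⁻¹ := by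
      intro x hx
      rcases hx.lt_or_gt with h | h
      · rw [cpow_neg_half_of_neg h]
        simp
      · rw [cpow_neg_half_of_pos h]
        simp
    rw [norm_norm, rootFun_roots, density, sqrt_abs_rootProd]
    simp only [norm_mul, norm_pow, norm_prod, Complex.norm_real, ← Complex.ofReal_sub]
    simp only [h4 _ (sub_ne_zero.2 (h2 _)), h4 _ (sub_ne_zero.2 (h3 _))]
    simp [abs_of_nonneg (Real.sqrt_nonneg _)]

theorem IsBands.bandMoment_eq {E O : Fin (n + 1) → ℝ} (h : IsBands E O) (j : Fin (n + 1)) (i : ℕ) :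
    bandMoment E O j i = ∫ s in Ioo (E j) (O j), density E O i s := by
  rw [bandMoment, ← integral_band_eq h.toWeakBands (h.band_lt j) fun s => s ^ i,
    intervalIntegral.integral_of_le (h.band j), integral_Ioc_eq_integral_Ioo]
  rfl

/-- Take the imaginary part of the vanishing integral over the real line. The gaps contribute
nothing, the bands contribute with alternating signs, and the negative half line has the sign of the
first band. -/
theorem IsBands.negMoment_add {E O : Fin (n + 1) → ℝ} (h : IsBands E O) {i : ℕ} (hi : i < n) :
    negMoment E O i + ∑ j : Fin (n + 1), (-1) ^ (j : ℕ) * bandMoment E O j i = 0 := by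
  obtain ⟨h1, h2⟩ := integral_rootFun h.injective_roots (card_roots hi)
  have hd := h.integrable_density hi
  have h3 : ∫ s : ℝ, (rootFun (roots E O) i s).im = 0 := by
    have := integral_im h1
    simp only [RCLike.im_to_complex] at this
    rw [this, h2, Complex.zero_im]
  have h4 : ∀ᵐ s : ℝ, (rootFun (roots E O) i s).im = -(-1) ^ n *
      ((Iio 0).indicator (density E O i) s +
        ∑ j : Fin (n + 1), (-1) ^ (j : ℕ) * (Ioo (E j) (O j)).indicator (density E O i) s) := by
    -- The roots and 0 form a null set; off it every point lies in the half line, in one open band,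
    -- or in none of these.
    filter_upwards [ae_ne_roots (roots E O), Measure.ae_ne volume (0 : ℝ)] with s hs hs0
    have hO : ∀ k, s ≠ O k := fun k => hs (Sum.inl k)
    have hE : ∀ k : Fin n, s ≠ E k.succ := fun k => hs (Sum.inr k)
    have hb : ∀ j, s < O j → (∀ k : Fin n, k.castSucc < j → E k.succ < s) →
        (rootFun (roots E O) i s).im = -(-1) ^ n * ((-1) ^ (j : ℕ) * density E O i s) := by
      intro j h5 h6
      rw [rootFun_of_band h i h5 h6, neg_mul, Complex.neg_im, Complex.I_mul_im, Complex.ofReal_re,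
        density]
      ring
    rcases hs0.lt_or_gt with h5 | h5
    · rw [hb 0 (h5.trans ?_) (fun k hk => absurd hk (Fin.not_lt_zero _)),
        indicator_of_mem (mem_Iio.2 h5), Finset.sum_eq_zero, Fin.val_zero, pow_zero, one_mul,
        add_zero]
      · intro j _
        rw [indicator_of_notMem, mul_zero]
        exact fun hj => absurd hj.1 (by linarith [h.nonneg j])
      · have := h.band_lt 0
        rwa [h.zero] at this
    rw [indicator_of_notMem (by simp [h5.le]), zero_add]
    by_cases h6 : ∃ j, s ∈ Ioo (E j) (O j)
    · obtain ⟨j, hj⟩ := h6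
      rw [hb j hj.2 fun k hk => (h.succ_le hk).trans_lt hj.1, Finset.sum_eq_single j,
        indicator_of_mem hj]
      · intro k _ hkj
        rw [indicator_of_notMem, mul_zero]
        intro hk
        rcases hkj.lt_or_gt with h7 | h7
        · linarith [h.lt_of_lt h7, hk.2, hj.1]
        · linarith [h.lt_of_lt h7, hk.1, hj.2]
      · simp
    · push Not at h6
      rw [Finset.sum_eq_zero, mul_zero]
      · have h7 : ∀ j, s < E j ∨ O j < s := by
          intro j
          by_contra! h8
          have h9 : s ≠ E j := by
            refine Fin.cases ?_ (fun k => ?_) j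
            · rw [h.zero]
              exact h5.ne'
            · exact hE k
          exact h6 j ⟨lt_of_le_of_ne h8.1 h9.symm, lt_of_le_of_ne h8.2 (hO j)⟩
        refine im_rootFun_of_gap i ?_ fun k => ?_
        · refine (h7 0).resolve_left ?_
          rw [h.zero]
          exact h5.not_gt
        · rcases h7 k.succ with h8 | h8
          · exact Or.inl ⟨h8, h8.trans (h.band_lt _)⟩
          · exact Or.inr ⟨(h.band_lt _).trans h8, h8⟩
      · intro j _
        rw [indicator_of_notMem (h6 j), mul_zero]
  rw [integral_congr_ae h4, integral_const_mul, integral_add, integral_finsetSum] at h3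
  · simp_rw [integral_const_mul, integral_indicator measurableSet_Ioo] at h3
    rw [integral_indicator measurableSet_Iio] at h3
    simp_rw [← h.bandMoment_eq] at h3
    exact (mul_eq_zero.1 h3).resolve_left (by simp)
  · exact fun j _ => (hd.indicator measurableSet_Ioo).const_mul _
  · exact hd.indicator measurableSet_Iio
  · exact integrable_finsetSum _ fun j _ => (hd.indicator measurableSet_Ioo).const_mul _

end EllipsoidBilliard

/-! ### Masses of gap polynomials and bounds uniform under degeneration -/

namespace EllipsoidBilliard

variable {n : ℕ} {E O : Fin (n + 1) → ℝ}

/-- The contribution of the `i`-th gap and the `k`-th band to the density on another band. -/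
noncomputable def gapFactor (E O : Fin (n + 1) → ℝ) (g : Fin n → ℝ) (C : Finset (Fin n))
    (k : Fin (n + 1)) (i : Fin n) (s : ℝ) : ℝ :=
  (if i ∈ C then |s - g i| else 1) * (√|E k - s| * √|O k - s|)⁻¹

/-- The density of the integral of `|gapPoly g C|` over the `j`-th band. -/
noncomputable def gapDensity (E O : Fin (n + 1) → ℝ) (g : Fin n → ℝ) (C : Finset (Fin n))
    (j : Fin (n + 1)) (s : ℝ) : ℝ :=
  2 * (√|s| * ∏ i, gapFactor E O g C (j.succAbove i) i s)

/-- The integral of `|gapPoly g C|` over the `j`-th band. -/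
noncomputable def gapMass (E O : Fin (n + 1) → ℝ) (g : Fin n → ℝ) (C : Finset (Fin n))
    (j : Fin (n + 1)) : ℝ :=
  ∫ φ in (0 : ℝ)..(Real.pi / 2), gapDensity E O g C j (bandPt E O j φ)

theorem gapFactor_nonneg (g : Fin n → ℝ) (C : Finset (Fin n)) (k : Fin (n + 1)) (i : Fin n)
    (s : ℝ) : 0 ≤ gapFactor E O g C k i s := by
  unfold gapFactor
  split_ifs <;> positivity

theorem gapDensity_nonneg (g : Fin n → ℝ) (C : Finset (Fin n)) (j : Fin (n + 1))
    (s : ℝ) : 0 ≤ gapDensity E O g C j s :=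
  mul_nonneg (by norm_num) (mul_nonneg (Real.sqrt_nonneg _)
    (Finset.prod_nonneg fun _ _ => gapFactor_nonneg _ _ _ _ _))

theorem gapMass_nonneg (g : Fin n → ℝ) (C : Finset (Fin n)) (j : Fin (n + 1)) :
    0 ≤ gapMass E O g C j :=
  intervalIntegral.integral_nonneg (by positivity) fun _ _ => gapDensity_nonneg _ _ _ _

theorem gapDensity_eq (g : Fin n → ℝ) (C : Finset (Fin n)) (j : Fin (n + 1)) (s : ℝ) :
    gapDensity E O g C j s = (∏ i ∈ C, |s - g i|) * bandWeight E O j s := by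
  have h1 : √|otherProd E O j s| =
      ∏ i : Fin n, (√|E (j.succAbove i) - s| * √|O (j.succAbove i) - s|) := by
    rw [otherProd, Finset.abs_prod, Real.sqrt_prod _ fun _ _ => abs_nonneg _]
    simp_rw [abs_mul, Real.sqrt_mul (abs_nonneg _)]
  simp only [gapDensity, gapFactor, bandWeight, h1]
  rw [Finset.prod_mul_distrib, Finset.prod_ite_mem, Finset.univ_inter, Finset.prod_inv_distrib]
  ring

theorem FreeBand.gapMass_eq {j : Fin (n + 1)} (hf : FreeBand E O j) (h : E j ≤ O j)
    {g : Fin n → ℝ} {C : Finset (Fin n)}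
    (h1 : ∀ i ∈ C, j ≤ i.castSucc → O j ≤ g i) (h2 : ∀ i ∈ C, i.castSucc < j → g i ≤ E j) :
    gapSign C j * mom (bandMoment E O j) (gapPoly g C) = gapMass E O g C j := by
  rw [hf.mom_eq h, ← intervalIntegral.integral_const_mul, gapMass]
  refine intervalIntegral.integral_congr fun φ _ => ?_
  have h3 := bandPt_mem h φ
  simp only [gapDensity_eq]
  rw [gapPoly_eval, ← mul_assoc, gapSign_mul_prod g C j (fun i hi hj => h3.2.trans (h1 i hi hj))
    (fun i hi hj => (h2 i hi hj).trans h3.1)]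

theorem RegularBands.gapMass_eq (h : RegularBands E O) {g : Fin n → ℝ}
    (hg : ∀ i, g i ∈ Icc (O i.castSucc) (E i.succ)) (C : Finset (Fin n)) (j : Fin (n + 1)) :
    gapSign C j * mom (bandMoment E O j) (gapPoly g C) = gapMass E O g C j :=
  (h.freeBand j).gapMass_eq (h.band j) (fun i _ hi => (h.le_castSucc hi).trans (hg i).1)
    fun i _ hi => (hg i).2.trans (h.succ_le hi)

theorem RegularBands.abs_mom_gapPoly (h : RegularBands E O) {g : Fin n → ℝ}
    (hg : ∀ i, g i ∈ Icc (O i.castSucc) (E i.succ)) (C : Finset (Fin n)) (j : Fin (n + 1)) :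
    |mom (bandMoment E O j) (gapPoly g C)| = gapMass E O g C j := by
  rw [← h.gapMass_eq hg]
  rcases gapSign_eq_or C j with h1 | h1 <;> rw [h1]
  · rw [one_mul, abs_of_nonneg]
    have := gapMass_nonneg (E := E) (O := O) g C j
    rwa [← h.gapMass_eq hg, h1, one_mul] at this
  · rw [neg_one_mul, abs_of_nonpos]
    have := gapMass_nonneg (E := E) (O := O) g C j
    rw [← h.gapMass_eq hg, h1] at this
    linarith

/-- `j.succAbove i` is the band next to the i-th gap on the side away from the band `j`. Seen from
the band `j`, the gap comes first, so its points are nearer than both endpoints of that band. In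
this way each gap is matched with one band other than `j`. -/
theorem WeakBands.abs_sub_le (h : WeakBands E O) {j : Fin (n + 1)} {s : ℝ}
    (hs : s ∈ Icc (E j) (O j)) {i : Fin n} {x : ℝ} (hx : x ∈ Icc (O i.castSucc) (E i.succ)) :
    |s - x| ≤ |E (j.succAbove i) - s| ∧ |s - x| ≤ |O (j.succAbove i) - s| := by
  rcases lt_or_ge i.castSucc j with hij | hij
  · rw [Fin.succAbove_of_castSucc_lt _ _ hij]
    have h1 := h.succ_le hij
    have h2 := h.band i.castSucc
    rw [abs_of_nonneg (by linarith [hx.2, hs.1]), abs_of_nonpos (by linarith [hx.1, hx.2, hs.1]),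
      abs_of_nonpos (by linarith [hx.1, hx.2, hs.1])]
    constructor <;> linarith [hx.1]
  · rw [Fin.succAbove_of_le_castSucc _ _ hij]
    have h1 := h.le_castSucc hij
    have h2 := h.band i.succ
    rw [abs_of_nonpos (by linarith [hx.1, hs.2]), abs_of_nonneg (by linarith [hx.1, hx.2, hs.2]),
      abs_of_nonneg (by linarith [hx.1, hx.2, hs.2])]
    constructor <;> linarith [hx.2]

/-- A root in the gap compensates the two inverse square roots of the band behind it, however small
the gap may be. -/
theorem gapFactor_le_one {g : Fin n → ℝ} {C : Finset (Fin n)} {k : Fin (n + 1)} {i : Fin n} {s : ℝ}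
    (hi : i ∈ C) (h1 : |s - g i| ≤ |E k - s|) (h2 : |s - g i| ≤ |O k - s|) :
    gapFactor E O g C k i s ≤ 1 := by
  rw [gapFactor, if_pos hi]
  refine mul_inv_le_one_of_le₀ ?_ (by positivity)
  calc |s - g i| = √|s - g i| * √|s - g i| := (Real.mul_self_sqrt (abs_nonneg _)).symm
    _ ≤ _ := by gcongr

theorem gapFactor_le_inv {g : Fin n → ℝ} {C : Finset (Fin n)} {k : Fin (n + 1)} {i : Fin n} {s ε : ℝ}
    (hi : i ∉ C) (hε : 0 < ε) (h1 : ε ≤ |E k - s|) (h2 : ε ≤ |O k - s|) :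
    gapFactor E O g C k i s ≤ ε⁻¹ := by
  rw [gapFactor, if_neg hi, one_mul]
  gcongr
  calc ε = √ε * √ε := (Real.mul_self_sqrt hε.le).symm
    _ ≤ _ := by gcongr

theorem WeakBands.half_gap_le (h : WeakBands E O) {j : Fin (n + 1)} {s : ℝ}
    (hs : s ∈ Icc (E j) (O j)) {i : Fin n} {ε : ℝ} (hε : 2 * ε ≤ E i.succ - O i.castSucc) :
    ε ≤ |E (j.succAbove i) - s| ∧ ε ≤ |O (j.succAbove i) - s| := by
  have h1 := h.abs_sub_le hs (left_mem_Icc.2 (h.gap i))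
  have h2 := h.abs_sub_le hs (right_mem_Icc.2 (h.gap i))
  have h3 := le_abs_self (s - O i.castSucc)
  have h4 := neg_abs_le (s - E i.succ)
  constructor
  · linarith [h1.1, h2.1]
  · linarith [h1.2, h2.2]

theorem WeakBands.gapDensity_le (h : WeakBands E O) {g : Fin n → ℝ}
    (hg : ∀ i, g i ∈ Icc (O i.castSucc) (E i.succ)) {C : Finset (Fin n)} {j : Fin (n + 1)} {s ε M : ℝ}
    (hs : s ∈ Icc (E j) (O j)) (hε : 0 < ε) (hε1 : ε ≤ 1) (hM : O j ≤ M)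
    (hC : ∀ i ∉ C, ε ≤ |E (j.succAbove i) - s| ∧ ε ≤ |O (j.succAbove i) - s|) :
    gapDensity E O g C j s ≤ 2 * (√M * (ε⁻¹) ^ n) := by
  have h1 : ∏ i, gapFactor E O g C (j.succAbove i) i s ≤ ∏ _i : Fin n, ε⁻¹ := by
    refine Finset.prod_le_prod (fun i _ => gapFactor_nonneg _ _ _ _ _) fun i _ => ?_
    by_cases hi : i ∈ C
    · have := h.abs_sub_le hs (hg i)
      exact (gapFactor_le_one hi this.1 this.2).trans ((one_le_inv₀ hε).2 hε1)
    · exact gapFactor_le_inv hi hε (hC i hi).1 (hC i hi).2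
  rw [Finset.prod_const, Finset.card_univ, Fintype.card_fin] at h1
  have h2 := (h.nonneg j).trans hs.1
  have h3 : 0 ≤ ∏ i, gapFactor E O g C (j.succAbove i) i s :=
    Finset.prod_nonneg fun i _ => gapFactor_nonneg _ _ _ _ _
  unfold gapDensity
  gcongr
  rw [abs_of_nonneg h2]
  exact hs.2.trans hM

theorem gapMass_le {g : Fin n → ℝ} {C : Finset (Fin n)} {j : Fin (n + 1)} {M : ℝ}
    (h : E j ≤ O j) (hM : ∀ s ∈ Icc (E j) (O j), gapDensity E O g C j s ≤ M) :
    gapMass E O g C j ≤ M * (Real.pi / 2) := by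
  have h1 := intervalIntegral.norm_integral_le_of_norm_le_const (a := 0) (b := Real.pi / 2) (C := M)
    (f := fun φ => gapDensity E O g C j (bandPt E O j φ)) fun φ _ => by
      rw [Real.norm_of_nonneg (gapDensity_nonneg _ _ _ _)]
      exact hM _ (bandPt_mem h φ)
  rw [sub_zero, abs_of_nonneg (by positivity)] at h1
  exact (le_abs_self _).trans h1

open MeasureTheory

theorem IsBands.mom_negMoment (h : IsBands E O) {p : Polynomial ℝ} (hp : p.natDegree < n) :
    IntegrableOn (fun s => p.eval s * (√|rootProd E O s|)⁻¹) (Iio 0) ∧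
    mom (negMoment E O) p = ∫ s in Iio 0, p.eval s * (√|rootProd E O s|)⁻¹ := by
  have h1 : ∀ s, p.eval s * (√|rootProd E O s|)⁻¹ = ∑ i : Fin n, p.coeff i * density E O i s := by
    intro s
    rw [Polynomial.eval_eq_sum_range' hp, Finset.sum_range, Finset.sum_mul]
    exact Finset.sum_congr rfl fun i _ => by rw [density, mul_assoc]
  have h2 : ∀ i : Fin n, IntegrableOn (fun s => p.coeff i * density E O i s) (Iio 0) :=
    fun i => ((h.integrable_density i.2).const_mul _).integrableOn
  simp_rw [h1]
  refine ⟨integrable_finsetSum _ fun i _ => h2 i, ?_⟩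
  rw [integral_finsetSum _ fun i _ => h2 i, mom_eq_sum _ hp]
  simp_rw [integral_const_mul]
  rfl

theorem IsBands.rootProd_pos (h : IsBands E O) {s : ℝ} (hs : s < 0) : 0 < rootProd E O s := by
  refine mul_pos (Finset.prod_pos fun k _ => ?_) (Finset.prod_pos fun i _ => ?_)
  · linarith [h.nonneg k, h.band k]
  · linarith [h.pos i]

theorem IsBands.gapPoint_nonneg (h : IsBands E O) {g : Fin n → ℝ}
    (hg : ∀ i, g i ∈ Icc (O i.castSucc) (E i.succ)) (i : Fin n) : 0 ≤ g i := by
  linarith [h.nonneg i.castSucc, h.band i.castSucc, (hg i).1]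

/-- The negative half line lies to the left of all gaps, just as the band 0 does, so the sign is the
one of that band. -/
theorem IsBands.gapSign_mul_mom_negMoment (h : IsBands E O) {g : Fin n → ℝ}
    (hg : ∀ i, g i ∈ Icc (O i.castSucc) (E i.succ)) {C : Finset (Fin n)} (hC : C ≠ Finset.univ) :
    gapSign C 0 * mom (negMoment E O) (gapPoly g C) =
      ∫ s in Iio 0, (∏ i ∈ C, |s - g i|) * (√|rootProd E O s|)⁻¹ := by
  rw [(h.mom_negMoment (gapPoly_natDegree g hC)).2, ← integral_const_mul]
  refine setIntegral_congr_fun measurableSet_Iio fun s hs => ?_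
  have hs' : s < 0 := hs
  rw [gapPoly_eval, ← mul_assoc, gapSign_mul_prod g C 0
    (fun i _ _ => (hs'.le.trans (h.gapPoint_nonneg hg i)))
    (fun i _ hi => absurd hi (Fin.not_lt_zero _))]

theorem IsBands.negMoment_pos (h : IsBands E O) {g : Fin n → ℝ}
    (hg : ∀ i, g i ∈ Icc (O i.castSucc) (E i.succ)) {C : Finset (Fin n)} (hC : C ≠ Finset.univ) :
    0 < gapSign C 0 * mom (negMoment E O) (gapPoly g C) := by
  have h1 : ∀ s ∈ Iio (0 : ℝ), 0 < (∏ i ∈ C, |s - g i|) * (√|rootProd E O s|)⁻¹ := by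
    intro s hs
    have h2 := h.rootProd_pos hs
    refine mul_pos (Finset.prod_pos fun i _ => abs_pos.2 ?_) (by positivity)
    have := h.gapPoint_nonneg hg i
    rw [mem_Iio] at hs
    linarith
  rw [h.gapSign_mul_mom_negMoment hg hC, setIntegral_pos_iff_support_of_nonneg_ae]
  · have h2 : Iio (0 : ℝ) ⊆ Function.support
        (fun s => (∏ i ∈ C, |s - g i|) * (√|rootProd E O s|)⁻¹) := fun s hs => (h1 s hs).ne'
    rw [inter_eq_self_of_subset_right h2]
    simp
  · exact (ae_restrict_mem measurableSet_Iio).mono fun s hs => (h1 s hs).le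
  · refine IntegrableOn.congr_fun
      ((h.mom_negMoment (gapPoly_natDegree g hC)).1.const_mul (gapSign C 0)) ?_ measurableSet_Iio
    intro s hs
    have hs' : s < 0 := hs
    dsimp only
    rw [gapPoly_eval, ← mul_assoc, gapSign_mul_prod g C 0
      (fun i _ _ => (hs'.le.trans (h.gapPoint_nonneg hg i)))
      (fun i _ hi => absurd hi (Fin.not_lt_zero _))]

theorem IsBands.negMoment_poly (h : IsBands E O) {p : Polynomial ℝ} (hp : p.natDegree < n) :
    mom (negMoment E O) p + ∑ j : Fin (n + 1), (-1) ^ (j : ℕ) * mom (bandMoment E O j) p = 0 := by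
  simp_rw [mom_eq_sum _ hp, Finset.mul_sum]
  rw [Finset.sum_comm, ← Finset.sum_add_distrib]
  refine Finset.sum_eq_zero fun i _ => ?_
  rw [← mul_zero (p.coeff i), ← h.negMoment_add i.2, mul_add, Finset.mul_sum]
  congr 1
  exact Finset.sum_congr rfl fun j _ => by ring

/-- The frequency preceded by `1 / 2`. -/
noncomputable def extendedFrequency (E O : Fin (n + 1) → ℝ) : Fin (n + 1) → ℝ :=
  Fin.cons (1 / 2) (bandFrequency E O)

theorem RegularBands.isKernel (h : RegularBands E O) :
    IsKernel (bandMoment E O) (extendedFrequency E O) :=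
  (h.isKernel_iff _).2 rfl

/-- Subtract `c` times `negMoment_poly` from the kernel equation. Taking `c` to be the frequency of
one band removes this band and leaves a term on the half line, which stays bounded when gaps or
bands collapse. -/
theorem IsBands.sum_sub_mul (h : IsBands E O) {p : Polynomial ℝ} (hp : p.natDegree < n) (c : ℝ) :
    ∑ j : Fin (n + 1), (-1) ^ (j : ℕ) * (extendedFrequency E O j - c) * mom (bandMoment E O j) p =
      c * mom (negMoment E O) p := by
  have h1 := h.isKernel.poly hp
  have h2 := h.negMoment_poly hp
  have h3 : ∑ j : Fin (n + 1), (-1) ^ (j : ℕ) * (extendedFrequency E O j - c) *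
      mom (bandMoment E O j) p = (∑ j : Fin (n + 1), (-1) ^ (j : ℕ) * extendedFrequency E O j *
      mom (bandMoment E O j) p) -
        c * ∑ j : Fin (n + 1), (-1) ^ (j : ℕ) * mom (bandMoment E O j) p := by
    rw [Finset.mul_sum, ← Finset.sum_sub_distrib]
    exact Finset.sum_congr rfl fun j _ => by ring
  rw [h3, h1]
  linear_combination -c * h2

theorem IsBands.bandFrequency_pos (h : IsBands E O) (i : Fin n) : 0 < bandFrequency E O i := by
  have h1 := h.isKernel.pos (fun j => h.bandPositive (g := fun i => O i.castSucc)
    (fun i => left_mem_Icc.2 (h.gap i)) j) (by simp [extendedFrequency]) i.succ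
  simpa [extendedFrequency] using h1

/-- The numbers 1/2 - ωⱼ solve the same system with the first band replaced by the negative half
line. This functional is positive too, so the positivity lemma applies again. -/
theorem IsBands.bandFrequency_lt (h : IsBands E O) (i : Fin n) : bandFrequency E O i < 1 / 2 := by
  have hg : ∀ i : Fin n, O i.castSucc ∈ Icc (O i.castSucc) (E i.succ) :=
    fun i => left_mem_Icc.2 (h.gap i)
  let α : Fin (n + 1) → ℕ → ℝ := Fin.cons (negMoment E O) fun i => bandMoment E O i.succ
  have hk : IsKernel α (Fin.cons (1 / 2) fun i => 1 / 2 - bandFrequency E O i) := by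
    intro i
    have h1 := h.isKernel i
    have h2 := h.negMoment_add i.2
    rw [Fin.sum_univ_succ] at h1 h2 ⊢
    have h3 : ∑ j : Fin n, (-1) ^ ((j.succ : Fin (n + 1)) : ℕ) *
        (Fin.cons (1 / 2) fun i => 1 / 2 - bandFrequency E O i : Fin (n + 1) → ℝ) j.succ *
        α j.succ i = 1 / 2 * ∑ j : Fin n, (-1) ^ ((j.succ : Fin (n + 1)) : ℕ) *
        bandMoment E O j.succ i - ∑ j : Fin n, (-1) ^ ((j.succ : Fin (n + 1)) : ℕ) *
        extendedFrequency E O j.succ * bandMoment E O j.succ i := by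
      rw [Finset.mul_sum, ← Finset.sum_sub_distrib]
      refine Finset.sum_congr rfl fun j _ => ?_
      simp only [extendedFrequency, Fin.cons_succ, α]
      ring
    rw [h3]
    simp only [extendedFrequency, Fin.cons_zero, α, Fin.val_zero, pow_zero] at h1 h2 ⊢
    linear_combination 1 / 2 * h2 - h1
  have h1 := hk.pos (g := fun i => O i.castSucc) ?_ (by simp) i.succ
  · simp only [Fin.cons_succ] at h1
    linarith
  · intro j
    induction j using Fin.cases with
    | zero => exact fun C hC => h.negMoment_pos hg hC
    | succ k => exact h.bandPositive hg k.succ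

theorem IsBands.extendedFrequency_mem (h : IsBands E O) (j : Fin (n + 1)) :
    extendedFrequency E O j ∈ Icc 0 (1 / 2) := by
  induction j using Fin.cases with
  | zero => simp [extendedFrequency]
  | succ i =>
    simp only [extendedFrequency, Fin.cons_succ]
    exact ⟨(h.bandFrequency_pos i).le, (h.bandFrequency_lt i).le⟩

theorem integrableOn_negMajorant {e : ℝ} (he : 0 < e) :
    IntegrableOn (fun s : ℝ => (√|s|)⁻¹ * (e - s)⁻¹) (Iio 0) := by
  -- The majorant is compared with `rootBound` for the three roots 0, e, 2e; the constant √2 comes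
  -- from 2e - s ≤ 2 (e - s) for negative s.
  have hc : Function.Injective (![0, e, 2 * e] : Fin 3 → ℝ) := by
    intro i j hij
    fin_cases i <;> fin_cases j <;> simp at hij ⊢ <;> linarith
  have h1 := integrable_rootBound (i := 0) hc (by simp)
  refine Integrable.mono' (h1.integrableOn.const_mul (√2)) ?_ ?_
  · exact Measurable.aestronglyMeasurable (by fun_prop)
  · refine (ae_restrict_mem measurableSet_Iio).mono fun s hs => ?_
    have hs : s < 0 := hs
    have h2 : ∀ x : ℝ, |x| ^ (-(1 / 2) : ℝ) = (√|x|)⁻¹ := fun x => by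
      rw [Real.rpow_neg (abs_nonneg _), Real.sqrt_eq_rpow]
    rw [rootBound, Fin.prod_univ_three, h2, h2, h2, Real.norm_of_nonneg
      (mul_nonneg (by positivity) (inv_nonneg.2 (by linarith)))]
    simp only [Matrix.cons_val_zero, Matrix.cons_val_one, Matrix.cons_val, sub_zero, pow_zero,
      one_mul]
    rw [mul_assoc (√|s|)⁻¹, mul_left_comm]
    refine mul_le_mul_of_nonneg_left ?_ (by positivity)
    rw [abs_of_neg (by linarith : s - e < 0), abs_of_neg (by linarith : s - 2 * e < 0),
      ← mul_inv, ← Real.sqrt_mul (by linarith), ← div_eq_mul_inv, inv_eq_one_div,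
      div_le_div_iff₀ (by linarith) (Real.sqrt_pos.2 (mul_pos (by linarith) (by linarith))), one_mul]
    rw [Real.sqrt_le_left (mul_nonneg (by positivity) (by linarith)), mul_pow, Real.sq_sqrt (by norm_num)]
    nlinarith

/-- A gap outside `C` has no root to compensate it, and its factor provides the decay (e - s)⁻¹. The
other factors are at most e⁻¹, and the first endpoint contributes the singularity at 0. -/
theorem IsBands.negDensity_le (h : IsBands E O) {e s : ℝ} (he : 0 < e) (he1 : e ≤ 1)
    (hE : ∀ i : Fin n, e ≤ E i.succ) {g : Fin n → ℝ}
    (hg : ∀ i, g i ∈ Icc (O i.castSucc) (E i.succ)) {C : Finset (Fin n)} (hC : C ≠ Finset.univ)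
    (hs : s < 0) : (∏ i ∈ C, |s - g i|) * (√|rootProd E O s|)⁻¹ ≤
      e⁻¹ ^ n * ((√|s|)⁻¹ * (e - s)⁻¹) := by
  obtain ⟨i₀, hi₀⟩ : ∃ i, i ∉ C := by
    by_contra! h1
    exact hC (Finset.eq_univ_of_forall h1)
  have h1 : (∏ i ∈ C, |s - g i|) * (√|rootProd E O s|)⁻¹ = (√|s - O 0|)⁻¹ *
      ∏ i : Fin n, gapFactor E O g C i.succ i s := by
    simp only [gapFactor]
    rw [sqrt_abs_rootProd, Finset.prod_mul_distrib, Finset.prod_ite_mem, Finset.univ_inter,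
      Fin.prod_univ_succ]
    simp only [abs_sub_comm s (O _), abs_sub_comm s (E _), mul_inv, Finset.prod_mul_distrib]
    ring
  have hg0 := h.gapPoint_nonneg hg
  have hbound : ∀ i : Fin n, e - s ≤ |E i.succ - s| ∧ e - s ≤ |O i.succ - s| := by
    intro i
    have h2 := hE i
    have h3 := h.band i.succ
    rw [abs_of_pos (by linarith), abs_of_pos (by linarith)]
    constructor <;> linarith
  have h2 : ∏ i : Fin n, gapFactor E O g C i.succ i s ≤ (e - s)⁻¹ * e⁻¹ ^ (n - 1) := by
    rw [← Finset.mul_prod_erase _ _ (Finset.mem_univ i₀)]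
    refine mul_le_mul (gapFactor_le_inv hi₀ (by linarith) (hbound i₀).1 (hbound i₀).2) ?_
      (Finset.prod_nonneg fun _ _ => gapFactor_nonneg _ _ _ _ _) (inv_nonneg.2 (by linarith))
    refine (Finset.prod_le_prod (fun _ _ => gapFactor_nonneg _ _ _ _ _)
      (g := fun _ => e⁻¹) fun i _ => ?_).trans ?_
    · by_cases hi : i ∈ C
      · refine (gapFactor_le_one hi ?_ ?_).trans ((one_le_inv₀ he).2 he1)
        all_goals
          have h2 := hg0 i
          have h3 := (hg i).2
          have h4 := h.band i.succ
          rw [abs_of_neg (by linarith), abs_of_pos (by linarith)]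
          linarith
      · refine gapFactor_le_inv hi he ?_ ?_
        · linarith [(hbound i).1]
        · linarith [(hbound i).2]
    · simp
  have h3 : (√|s - O 0|)⁻¹ ≤ (√|s|)⁻¹ := by
    have h4 := h.band 0
    rw [h.zero] at h4
    have : 0 < |s| := abs_pos.2 hs.ne
    refine inv_anti₀ (Real.sqrt_pos.2 this) (Real.sqrt_le_sqrt ?_)
    rw [abs_of_neg hs, abs_of_neg (by linarith)]
    linarith
  have h4 : e⁻¹ ^ (n - 1) ≤ e⁻¹ ^ n := pow_le_pow_right₀ ((one_le_inv₀ he).2 he1) (Nat.sub_le _ _)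
  have h5 : 0 ≤ (e - s)⁻¹ := inv_nonneg.2 (by linarith)
  rw [h1]
  calc _ ≤ (√|s|)⁻¹ * ((e - s)⁻¹ * e⁻¹ ^ n) := by
        gcongr
        · exact Finset.prod_nonneg fun _ _ => gapFactor_nonneg _ _ _ _ _
        · exact h2.trans (by gcongr)
    _ = _ := by ring

/-- Only the lower bound `e` for the left endpoints after the first one enters, so the constant
survives collapsing gaps and bands. -/
theorem exists_abs_mom_negMoment_le {e : ℝ} (he : 0 < e) (he1 : e ≤ 1) : ∃ K : ℝ,
    ∀ E O : Fin (n + 1) → ℝ, IsBands E O → (∀ i : Fin n, e ≤ E i.succ) → ∀ g : Fin n → ℝ,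
    (∀ i, g i ∈ Icc (O i.castSucc) (E i.succ)) → ∀ C : Finset (Fin n), C ≠ Finset.univ →
    |mom (negMoment E O) (gapPoly g C)| ≤ K := by
  refine ⟨∫ s in Iio 0, e⁻¹ ^ n * ((√|s|)⁻¹ * (e - s)⁻¹), fun E O h hE g hg C hC => ?_⟩
  have h1 : |mom (negMoment E O) (gapPoly g C)| = |gapSign C 0 * mom (negMoment E O) (gapPoly g C)| := by
    rcases gapSign_eq_or C 0 with h2 | h2 <;> rw [h2] <;> simp
  rw [h1, h.gapSign_mul_mom_negMoment hg hC, ← Real.norm_eq_abs]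
  refine norm_integral_le_of_norm_le ((integrableOn_negMajorant he).const_mul _) ?_
  refine (ae_restrict_mem measurableSet_Iio).mono fun s hs => ?_
  rw [Real.norm_of_nonneg (mul_nonneg (Finset.prod_nonneg fun _ _ => abs_nonneg _) (by positivity))]
  exact h.negDensity_le he he1 hE hg hC hs

end EllipsoidBilliard

/-! ### Limits of band systems with closed gaps -/

namespace EllipsoidBilliard

variable {n : ℕ}

/-- Limits of systems of bands in which no two distinct gaps collapse to the same point. -/
structure LimBands (E O : Fin (n + 1) → ℝ) : Prop extends WeakBands E O where
  sep : ∀ i i' : Fin n, i < i' → O i.castSucc < E i'.succ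

/-- The gaps which have collapsed. -/
noncomputable def closedGaps (E O : Fin (n + 1) → ℝ) : Finset (Fin n) :=
  Finset.univ.filter fun i => O i.castSucc = E i.succ

theorem mem_closedGaps {E O : Fin (n + 1) → ℝ} {i : Fin n} :
    i ∈ closedGaps E O ↔ O i.castSucc = E i.succ := by
  simp [closedGaps]

/-- Pairs of endpoint vectors. -/
abbrev Endpoints (n : ℕ) : Type := (Fin (n + 1) → ℝ) × (Fin (n + 1) → ℝ)

/-- Nearby nondegenerate systems of bands. -/
def nhdsBands (c₀ : Endpoints n) : Filter (Endpoints n) := 𝓝[{c | IsBands c.1 c.2}] c₀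

/-- A point of the `i`-th gap. In a collapsed gap it is chosen such that both neighbouring
bands together have a mass not depending on the details of the collapse. -/
noncomputable def gapPoint (c₀ c : Endpoints n) (i : Fin n) : ℝ :=
  if c₀.2 i.castSucc = c₀.1 i.succ then
    c.2 i.castSucc + (c.1 i.succ - c.2 i.castSucc) * ((c.2 i.castSucc - c.1 i.castSucc) /
      ((c.2 i.castSucc - c.1 i.castSucc) + (c.2 i.succ - c.1 i.succ)))
  else (c₀.2 i.castSucc + c₀.1 i.succ) / 2

theorem nhdsBands_le (c₀ : Endpoints n) : nhdsBands c₀ ≤ 𝓝 c₀ := nhdsWithin_le_nhds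

theorem eventually_isBands (c₀ : Endpoints n) : ∀ᶠ c in nhdsBands c₀, IsBands c.1 c.2 :=
  self_mem_nhdsWithin

theorem tendsto_left (c₀ : Endpoints n) (j : Fin (n + 1)) :
    Tendsto (fun c : Endpoints n => c.1 j) (nhdsBands c₀) (𝓝 (c₀.1 j)) :=
  ((continuous_apply j).comp continuous_fst).continuousAt.mono_left (nhdsBands_le c₀)

theorem tendsto_right (c₀ : Endpoints n) (j : Fin (n + 1)) :
    Tendsto (fun c : Endpoints n => c.2 j) (nhdsBands c₀) (𝓝 (c₀.2 j)) :=
  ((continuous_apply j).comp continuous_snd).continuousAt.mono_left (nhdsBands_le c₀)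

theorem gapRatio_mem {x y : ℝ} (hx : 0 < x) (hy : 0 < y) : x / (x + y) ∈ Icc (0 : ℝ) 1 :=
  ⟨by positivity, by rw [div_le_one (by positivity)]; linarith⟩

theorem eventually_gapPoint_mem {c₀ : Endpoints n} (h₀ : WeakBands c₀.1 c₀.2) :
    ∀ᶠ c in nhdsBands c₀, ∀ i, gapPoint c₀ c i ∈ Icc (c.2 i.castSucc) (c.1 i.succ) := by
  rw [eventually_all]
  intro i
  unfold gapPoint
  split_ifs with hi
  · filter_upwards [eventually_isBands c₀] with c hc
    have h1 := gapRatio_mem (sub_pos.2 (hc.band_lt i.castSucc)) (sub_pos.2 (hc.band_lt i.succ))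
    have h2 := sub_pos.2 (hc.gap_lt i)
    constructor
    · have := mul_nonneg h2.le h1.1
      linarith
    · have := mul_le_of_le_one_right h2.le h1.2
      linarith
  · have h1 : c₀.2 i.castSucc < c₀.1 i.succ := lt_of_le_of_ne (h₀.gap i) hi
    filter_upwards [(tendsto_right c₀ i.castSucc).eventually_lt_const
      (show c₀.2 i.castSucc < (c₀.2 i.castSucc + c₀.1 i.succ) / 2 by linarith),
      (tendsto_left c₀ i.succ).eventually_const_lt
      (show (c₀.2 i.castSucc + c₀.1 i.succ) / 2 < c₀.1 i.succ by linarith)] with c h2 h3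
    exact ⟨h2.le, h3.le⟩

theorem tendsto_gapPoint {c₀ : Endpoints n} (h₀ : WeakBands c₀.1 c₀.2) (i : Fin n) :
    Tendsto (fun c => gapPoint c₀ c i) (nhdsBands c₀)
      (𝓝 ((c₀.2 i.castSucc + c₀.1 i.succ) / 2)) := by
  by_cases hi : c₀.2 i.castSucc = c₀.1 i.succ
  · have h1 := tendsto_right c₀ i.castSucc
    have h2 := tendsto_left c₀ i.succ
    rw [← hi] at h2 ⊢
    rw [add_self_div_two]
    refine tendsto_of_tendsto_of_tendsto_of_le_of_le' h1 h2 ?_ ?_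
    · exact (eventually_gapPoint_mem h₀).mono fun c hc => (hc i).1
    · exact (eventually_gapPoint_mem h₀).mono fun c hc => (hc i).2
  · simp only [gapPoint, if_neg hi]
    exact tendsto_const_nhds

/-- Finitely many strict inequalities hold at the limit; a common `ε` makes them uniform nearby.
Only the gaps open in the limit are bounded below individually; for two different gaps the distance
from the left end of the earlier one to the right end of the later one is bounded below. -/
theorem LimBands.exists_eps {c₀ : Endpoints n} (h₀ : LimBands c₀.1 c₀.2) : ∃ ε : ℝ, 0 < ε ∧
    ε ≤ 1 ∧ ∀ᶠ c in nhdsBands c₀, (∀ i ∉ closedGaps c₀.1 c₀.2, 2 * ε ≤ c.1 i.succ - c.2 i.castSucc) ∧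
      (∀ i i' : Fin n, i < i' → ε ≤ c.1 i'.succ - c.2 i.castSucc) ∧ ∀ i : Fin n, ε ≤ c.1 i.succ := by
  have hsmall : ∀ x : ℝ, 0 < x → ∀ᶠ ε in 𝓝[>] (0 : ℝ), 2 * ε < x := by
    intro x hx
    have : Tendsto (fun ε : ℝ => 2 * ε) (𝓝[>] 0) (𝓝 0) := by
      refine Tendsto.mono_left ?_ nhdsWithin_le_nhds
      have h : Continuous fun ε : ℝ => 2 * ε := by fun_prop
      simpa using h.tendsto 0
    exact this.eventually_lt_const hx
  have e1 : ∀ᶠ ε in 𝓝[>] (0 : ℝ), ∀ i ∉ closedGaps c₀.1 c₀.2,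
      2 * ε < c₀.1 i.succ - c₀.2 i.castSucc := by
    rw [eventually_all]
    intro i
    by_cases hi : i ∈ closedGaps c₀.1 c₀.2
    · exact Eventually.of_forall fun ε h => absurd hi h
    · refine (hsmall _ ?_).mono fun ε h _ => h
      exact sub_pos.2 (lt_of_le_of_ne (h₀.gap i) (mt mem_closedGaps.2 hi))
  have e2 : ∀ᶠ ε in 𝓝[>] (0 : ℝ), ∀ i i' : Fin n, i < i' →
      2 * ε < c₀.1 i'.succ - c₀.2 i.castSucc := by
    simp only [eventually_all]
    exact fun i i' hi => hsmall _ (sub_pos.2 (h₀.sep i i' hi))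
  have e3 : ∀ᶠ ε in 𝓝[>] (0 : ℝ), ∀ i : Fin n, 2 * ε < c₀.1 i.succ := by
    rw [eventually_all]
    exact fun i => hsmall _ (h₀.pos i)
  obtain ⟨ε, h1, h2, h3, h4, h5⟩ := (e1.and (e2.and (e3.and ((hsmall 2 (by norm_num)).and
    self_mem_nhdsWithin)))).exists
  have h5 : 0 < ε := h5
  refine ⟨ε, h5, by linarith, ?_⟩
  have hsub : ∀ i i' : Fin n, Tendsto (fun c : Endpoints n => c.1 i'.succ - c.2 i.castSucc)
      (nhdsBands c₀) (𝓝 (c₀.1 i'.succ - c₀.2 i.castSucc)) :=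
    fun i i' => (tendsto_left c₀ _).sub (tendsto_right c₀ _)
  refine Eventually.and ?_ (Eventually.and ?_ ?_)
  · rw [eventually_all]
    intro i
    by_cases hi : i ∈ closedGaps c₀.1 c₀.2
    · exact Eventually.of_forall fun ε h => absurd hi h
    · exact ((hsub i i).eventually_const_lt (h1 i hi)).mono fun c hc _ => hc.le
  · simp only [eventually_all]
    intro i i' hi
    exact ((hsub i i').eventually_const_lt (h2 i i' hi)).mono fun c hc => by linarith
  · rw [eventually_all]
    intro i
    exact ((tendsto_left c₀ _).eventually_const_lt (h3 i)).mono fun c hc => by linarith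

theorem WeakBands.le_last {E O : Fin (n + 1) → ℝ} (h : WeakBands E O) (j : Fin (n + 1)) :
    O j ≤ O (Fin.last n) := by
  rcases (Fin.le_last j).lt_or_eq with h1 | h1
  · exact (h.le_of_lt h1).trans (h.band _)
  · rw [h1]

theorem eventually_right_le (c₀ : Endpoints n) :
    ∀ᶠ c in nhdsBands c₀, ∀ j, c.2 j ≤ |c₀.2 (Fin.last n)| + 1 := by
  filter_upwards [eventually_isBands c₀, (tendsto_right c₀ (Fin.last n)).eventually_lt_const
    (show c₀.2 (Fin.last n) < |c₀.2 (Fin.last n)| + 1 by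
      linarith [le_abs_self (c₀.2 (Fin.last n))])] with c hc h1 j
  exact (hc.le_last j).trans h1.le

/-- If the band is not adjacent to the i-th gap, another gap lies between them, and the two gaps
together have at least the width `ε`. -/
theorem WeakBands.sep_le {E O : Fin (n + 1) → ℝ} (h : WeakBands E O) {ε : ℝ}
    (hε : ∀ i i' : Fin n, i < i' → ε ≤ E i'.succ - O i.castSucc) {i : Fin n} {j : Fin (n + 1)}
    (h1 : i.castSucc ≠ j) (h2 : i.succ ≠ j) {s : ℝ} (hs : s ∈ Icc (E j) (O j)) :
    ε ≤ |E (j.succAbove i) - s| ∧ ε ≤ |O (j.succAbove i) - s| := by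
  rcases lt_or_ge i.castSucc j with hij | hij
  · rw [Fin.succAbove_of_castSucc_lt _ _ hij]
    have h3 : i.succ < j := lt_of_le_of_ne (Fin.castSucc_lt_iff_succ_le.1 hij) h2
    obtain ⟨i', rfl⟩ := Fin.exists_succ_eq.2 (Fin.ne_zero_of_lt h3)
    have h4 := hε i i' (Fin.succ_lt_succ_iff.1 h3)
    have h5 := h.band i.castSucc
    constructor
    · rw [abs_sub_comm]
      exact le_trans (by linarith [hs.1]) (le_abs_self _)
    · rw [abs_sub_comm]
      exact le_trans (by linarith [hs.1]) (le_abs_self _)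
  · rw [Fin.succAbove_of_le_castSucc _ _ hij]
    have h3 : j < i.castSucc := lt_of_le_of_ne hij h1.symm
    obtain ⟨i', rfl⟩ := Fin.exists_castSucc_eq.2 (Fin.ne_last_of_lt h3)
    have h4 := hε i' i (Fin.castSucc_lt_castSucc_iff.1 h3)
    have h5 := h.band i.succ
    constructor
    · exact le_trans (by linarith [hs.2]) (le_abs_self _)
    · exact le_trans (by linarith [hs.2]) (le_abs_self _)

/-- A closed gap without a root is harmful only for the two bands next to it; from all others it is
separated by `sep`. Hence the restriction on `j`. -/
theorem LimBands.exists_gapDensity_le {c₀ : Endpoints n} (h₀ : LimBands c₀.1 c₀.2) :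
    ∃ K : ℝ, ∀ᶠ c in nhdsBands c₀, ∀ (C : Finset (Fin n)) (j : Fin (n + 1)),
      (∀ i ∉ C, i ∈ closedGaps c₀.1 c₀.2 → i.castSucc ≠ j ∧ i.succ ≠ j) →
      ∀ s ∈ Icc (c.1 j) (c.2 j), gapDensity c.1 c.2 (gapPoint c₀ c) C j s ≤ K := by
  obtain ⟨ε, h1, h2, h3⟩ := h₀.exists_eps
  refine ⟨2 * (√(|c₀.2 (Fin.last n)| + 1) * (ε⁻¹) ^ n), ?_⟩
  filter_upwards [h3, eventually_isBands c₀, eventually_right_le c₀,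
    eventually_gapPoint_mem h₀.toWeakBands] with c h4 hc h5 h6 C j hC s hs
  refine hc.gapDensity_le h6 hs h1 h2 (h5 j) fun i hi => ?_
  by_cases hiS : i ∈ closedGaps c₀.1 c₀.2
  · exact hc.sep_le h4.2.1 (hC i hi hiS).1 (hC i hi hiS).2 hs
  · exact hc.half_gap_le hs (h4.1 i hiS)

theorem LimBands.exists_gapMass_le {c₀ : Endpoints n} (h₀ : LimBands c₀.1 c₀.2) :
    ∃ K : ℝ, ∀ᶠ c in nhdsBands c₀, ∀ (C : Finset (Fin n)) (j : Fin (n + 1)),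
      (∀ i ∉ C, i ∈ closedGaps c₀.1 c₀.2 → i.castSucc ≠ j ∧ i.succ ≠ j) →
      gapMass c.1 c.2 (gapPoint c₀ c) C j ≤ K := by
  obtain ⟨K, hK⟩ := h₀.exists_gapDensity_le
  refine ⟨K * (Real.pi / 2), ?_⟩
  filter_upwards [hK, eventually_isBands c₀] with c h1 hc C j hC
  exact gapMass_le (hc.band j) (h1 C j hC)

theorem FreeBand.continuous_gapDensity {E O : Fin (n + 1) → ℝ} {j : Fin (n + 1)}
    (hf : FreeBand E O j) (h : E j ≤ O j) (g : Fin n → ℝ) (C : Finset (Fin n)) :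
    Continuous fun φ => gapDensity E O g C j (bandPt E O j φ) := by
  simp_rw [gapDensity_eq]
  have := continuous_bandPt E O j
  exact Continuous.mul (by fun_prop) (hf.continuous_weight h)

theorem sqrt_inv_le_gapFactor {E O : Fin (n + 1) → ℝ} {g : Fin n → ℝ} {C : Finset (Fin n)}
    {k : Fin (n + 1)} {i : Fin n} {s η M : ℝ} (hη1 : η ≤ 1)
    (hi : i ∈ C → η ≤ |s - g i|) (hE0 : E k ≠ s) (hO0 : O k ≠ s)
    (hE : |E k - s| ≤ M) (hO : |O k - s| ≤ M) : η / M ≤ gapFactor E O g C k i s := by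
  have h1 : 0 < √|E k - s| := Real.sqrt_pos.2 (abs_pos.2 (sub_ne_zero.2 hE0))
  have h2 : 0 < √|O k - s| := Real.sqrt_pos.2 (abs_pos.2 (sub_ne_zero.2 hO0))
  have hM : 0 ≤ M := (abs_nonneg _).trans hE
  have h3 : √|E k - s| * √|O k - s| ≤ M := by
    calc _ ≤ √M * √M := by gcongr
      _ = M := Real.mul_self_sqrt hM
  rw [gapFactor, div_eq_mul_inv]
  refine mul_le_mul ?_ (inv_anti₀ (by positivity) h3) (by positivity) ?_
  · split_ifs with h
    · exact hi h
    · exact hη1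
  · split_ifs <;> positivity

theorem FreeBand.ne {E O : Fin (n + 1) → ℝ} {j : Fin (n + 1)} (hf : FreeBand E O j) {s : ℝ}
    (hs : s ∈ Icc (E j) (O j)) (i : Fin n) : E (j.succAbove i) ≠ s ∧ O (j.succAbove i) ≠ s := by
  have h := hf s hs
  rw [otherProd, Finset.prod_ne_zero_iff] at h
  have h1 := h i (Finset.mem_univ i)
  exact ⟨sub_ne_zero.1 (left_ne_zero_of_mul h1), sub_ne_zero.1 (right_ne_zero_of_mul h1)⟩

end EllipsoidBilliard

/-! ### Logarithmic divergence at a closed gap -/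

namespace EllipsoidBilliard

variable {n : ℕ}

theorem LimBands.gapPoint_ne {E O : Fin (n + 1) → ℝ} (h : LimBands E O) {l i : Fin n}
    (hl : l ∈ closedGaps E O) (hi : i ∈ closedGaps E O) (hil : i ≠ l) :
    (O i.castSucc + E i.succ) / 2 ≠ E l.succ := by
  rw [mem_closedGaps] at hl hi
  rcases hil.lt_or_gt with h1 | h1
  · have := h.sep i l h1
    linarith
  · have := h.sep l i h1
    linarith

theorem abs_sub_le_of_mem {x y M : ℝ} (hx : x ∈ Icc 0 M) (hy : y ∈ Icc 0 M) : |x - y| ≤ M :=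
  abs_le.2 ⟨by linarith [hx.1, hy.2], by linarith [hx.2, hy.1]⟩

/-- Without a root in the l-th gap nothing cancels the singularity at its left end, so on the band
to its right the density is at least a multiple of the inverse square root of the distance to that
end. The roots in the other closed gaps stay away from there. -/
theorem LimBands.exists_le_gapDensity {c₀ : Endpoints n} (h₀ : LimBands c₀.1 c₀.2) {l : Fin n}
    (hl : l ∈ closedGaps c₀.1 c₀.2) : ∃ κ η : ℝ, 0 < κ ∧ 0 < η ∧ ∀ᶠ c in nhdsBands c₀,
      ∀ s ∈ Icc (c.1 l.succ) (c.2 l.succ), s ≤ c₀.1 l.succ + η →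
      κ * (√(s - c.2 l.castSucc))⁻¹ ≤
        gapDensity c.1 c.2 (gapPoint c₀ c) ((closedGaps c₀.1 c₀.2).erase l) l.succ s := by
  set S := closedGaps c₀.1 c₀.2 with hS
  obtain ⟨ε, hε, -, hev⟩ := h₀.exists_eps
  set M := |c₀.2 (Fin.last n)| + 1 with hM
  have hM0 : 0 < M := by positivity
  -- The margin 3η leaves η after moving from the collapse point to `s` (at most η) and from the
  -- limit gap point to the actual one (less than η).
  obtain ⟨η, h1, h2, h3⟩ : ∃ η : ℝ, 0 < η ∧ η ≤ 1 ∧ ∀ i ∈ S, i ≠ l →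
      3 * η < |c₀.1 l.succ - (c₀.2 i.castSucc + c₀.1 i.succ) / 2| := by
    have hsmall : ∀ x : ℝ, 0 < x → ∀ᶠ ε in 𝓝[>] (0 : ℝ), 3 * ε < x := by
      intro x hx
      have : Tendsto (fun ε : ℝ => 3 * ε) (𝓝[>] 0) (𝓝 0) := by
        refine Tendsto.mono_left ?_ nhdsWithin_le_nhds
        have h : Continuous fun ε : ℝ => 3 * ε := by fun_prop
        simpa using h.tendsto 0
      exact this.eventually_lt_const hx
    have e1 : ∀ᶠ η in 𝓝[>] (0 : ℝ), ∀ i ∈ S, i ≠ l →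
        3 * η < |c₀.1 l.succ - (c₀.2 i.castSucc + c₀.1 i.succ) / 2| := by
      rw [eventually_all]
      intro i
      by_cases hi : i ∈ S ∧ i ≠ l
      · exact (hsmall _ (abs_pos.2 (sub_ne_zero.2
          (h₀.gapPoint_ne hl hi.1 hi.2).symm))).mono fun η h _ _ => h
      · exact Eventually.of_forall fun η h4 h5 => absurd ⟨h4, h5⟩ hi
    obtain ⟨η, h1, h2, h3⟩ := (e1.and ((hsmall 3 (by norm_num)).and self_mem_nhdsWithin)).exists
    exact ⟨η, h3, by linarith, h1⟩
  refine ⟨2 * (√ε * ((√M)⁻¹ * ∏ _i ∈ Finset.univ.erase l, η / M)), η, ?_, h1, ?_⟩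
  · have : 0 < ∏ _i ∈ Finset.univ.erase l, η / M := Finset.prod_pos fun _ _ => by positivity
    positivity
  have e2 : ∀ᶠ c in nhdsBands c₀, ∀ i,
      |gapPoint c₀ c i - (c₀.2 i.castSucc + c₀.1 i.succ) / 2| < η := by
    rw [eventually_all]
    intro i
    exact (tendsto_gapPoint h₀.toWeakBands i).eventually (Metric.ball_mem_nhds _ h1)
  filter_upwards [hev, eventually_isBands c₀, eventually_right_le c₀, e2,
    (tendsto_left c₀ l.succ).eventually_const_lt (show c₀.1 l.succ - η < c₀.1 l.succ by linarith)]
    with c h4 hc h5 h6 h7 s hs hsη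
  have hs0 : s ∈ Icc 0 M := ⟨(hc.nonneg _).trans hs.1, hs.2.trans (h5 _)⟩
  have hE : ∀ k, c.1 k ∈ Icc 0 M := fun k => ⟨hc.nonneg k, (hc.band k).trans (h5 k)⟩
  have hO : ∀ k, c.2 k ∈ Icc 0 M := fun k => ⟨(hc.nonneg k).trans (hc.band k), h5 k⟩
  have hOl : c.2 l.castSucc < s := (hc.gap_lt l).trans_le hs.1
  have hEl : c.1 l.castSucc < s := (hc.band_lt _).trans hOl
  have hne := (hc.freeBand l.succ).ne hs
  have hfac : ∀ i ∈ Finset.univ.erase l, η / M ≤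
      gapFactor c.1 c.2 (gapPoint c₀ c) (S.erase l) (l.succ.succAbove i) i s := by
    intro i hi
    rw [Finset.mem_erase] at hi
    refine sqrt_inv_le_gapFactor h2 (fun hiS => ?_) (hne i).1 (hne i).2
      (abs_sub_le_of_mem (hE _) hs0) (abs_sub_le_of_mem (hO _) hs0)
    have h8 := h3 i (Finset.mem_of_mem_erase hiS) hi.1
    have h9 := h6 i
    have h10 : |c₀.1 l.succ - s| ≤ η := abs_le.2 ⟨by linarith, by linarith [hs.1]⟩
    have h11 := abs_sub_le (c₀.1 l.succ) s ((c₀.2 i.castSucc + c₀.1 i.succ) / 2)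
    have h12 := abs_sub_le s (gapPoint c₀ c i) ((c₀.2 i.castSucc + c₀.1 i.succ) / 2)
    linarith
  have hl1 : (√M)⁻¹ * (√(s - c.2 l.castSucc))⁻¹ ≤
      gapFactor c.1 c.2 (gapPoint c₀ c) (S.erase l) (l.succ.succAbove l) l s := by
    rw [gapFactor, if_neg (Finset.notMem_erase l S), one_mul, Fin.succAbove_succ_self, ← mul_inv,
      abs_sub_comm (c.2 _), abs_of_pos (sub_pos.2 hOl)]
    have h8 : 0 < √|c.1 l.castSucc - s| := Real.sqrt_pos.2 (abs_pos.2 (sub_ne_zero.2 hEl.ne))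
    have h9 : 0 < √(s - c.2 l.castSucc) := Real.sqrt_pos.2 (sub_pos.2 hOl)
    refine inv_anti₀ (by positivity) ?_
    gcongr
    exact abs_sub_le_of_mem (hE _) hs0
  have hε' : √ε ≤ √|s| := by
    gcongr
    exact (h4.2.2 l).trans (hs.1.trans (le_abs_self _))
  rw [gapDensity, ← Finset.mul_prod_erase _ _ (Finset.mem_univ l)]
  have h13 : ∏ _i ∈ Finset.univ.erase l, η / M ≤ ∏ i ∈ Finset.univ.erase l,
      gapFactor c.1 c.2 (gapPoint c₀ c) (S.erase l) (l.succ.succAbove i) i s :=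
    Finset.prod_le_prod (fun _ _ => by positivity) hfac
  have h14 : 0 ≤ ∏ _i ∈ Finset.univ.erase l, η / M := Finset.prod_nonneg fun _ _ => by positivity
  calc _ = 2 * (√ε * (((√M)⁻¹ * (√(s - c.2 l.castSucc))⁻¹) *
        ∏ _i ∈ Finset.univ.erase l, η / M)) := by ring
    _ ≤ _ := by
      gcongr
      exact gapFactor_nonneg _ _ _ _ _

/-- In the variable φ the distance to the left end of the gap is at most δ + M φ², with δ the width
of the gap. For φ ≥ √δ this is at most (1 + M) φ², so the mass is at least a multiple of ∫ dφ / φ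
from √δ to a fixed θ, which is log (θ / √δ). -/
theorem LimBands.tendsto_gapMass_atTop {c₀ : Endpoints n} (h₀ : LimBands c₀.1 c₀.2) {l : Fin n}
    (hl : l ∈ closedGaps c₀.1 c₀.2) : Tendsto (fun c : Endpoints n =>
      gapMass c.1 c.2 (gapPoint c₀ c) ((closedGaps c₀.1 c₀.2).erase l) l.succ)
      (nhdsBands c₀) atTop := by
  obtain ⟨κ, η, hκ, hη, hev⟩ := h₀.exists_le_gapDensity hl
  set M := |c₀.2 (Fin.last n)| + 1 with hM
  have hM0 : 0 < M := by positivity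
  -- With M θ² ≤ η / 2 and the left endpoint within η / 2 of its limit, the points with φ ≤ θ stay
  -- in the range of the lower bound.
  obtain ⟨θ, hθ0, hθ1, hθ2⟩ : ∃ θ : ℝ, 0 < θ ∧ θ ≤ Real.pi / 2 ∧ M * θ ^ 2 ≤ η / 2 := by
    have h1 : Tendsto (fun θ : ℝ => M * θ ^ 2) (𝓝[>] 0) (𝓝 0) := by
      refine Tendsto.mono_left ?_ nhdsWithin_le_nhds
      have h : Continuous fun ε : ℝ => M * ε ^ 2 := by fun_prop
      simpa using h.tendsto 0
    have h2 : Tendsto (fun θ : ℝ => θ) (𝓝[>] 0) (𝓝 0) := nhdsWithin_le_nhds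
    obtain ⟨θ, h3, h4, h5⟩ := ((h1.eventually_lt_const (show 0 < η / 2 by positivity)).and
      ((h2.eventually_lt_const (show 0 < Real.pi / 2 by positivity)).and self_mem_nhdsWithin)).exists
    exact ⟨θ, h5, h4.le, h3.le⟩
  have hδ : Tendsto (fun c : Endpoints n => √(c.1 l.succ - c.2 l.castSucc)) (nhdsBands c₀)
      (𝓝[>] 0) := by
    rw [tendsto_nhdsWithin_iff]
    constructor
    · have h1 := ((tendsto_left c₀ l.succ).sub (tendsto_right c₀ l.castSucc)).sqrt
      rwa [mem_closedGaps.1 hl, sub_self, Real.sqrt_zero] at h1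
    · filter_upwards [eventually_isBands c₀] with c hc
      exact Real.sqrt_pos.2 (sub_pos.2 (hc.gap_lt l))
  have hlog : Tendsto (fun c : Endpoints n => κ * (√(1 + M))⁻¹ *
      Real.log (θ / √(c.1 l.succ - c.2 l.castSucc))) (nhdsBands c₀) atTop := by
    refine Tendsto.const_mul_atTop (by positivity) (Real.tendsto_log_atTop.comp ?_)
    simp_rw [div_eq_mul_inv]
    exact (tendsto_inv_nhdsGT_zero.comp hδ).const_mul_atTop hθ0
  refine tendsto_atTop_mono' _ ?_ hlog
  filter_upwards [hev, eventually_isBands c₀, eventually_right_le c₀,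
    (tendsto_left c₀ l.succ).eventually_lt_const
      (show c₀.1 l.succ < c₀.1 l.succ + η / 2 by linarith),
    (hδ.mono_right nhdsWithin_le_nhds).eventually_lt_const hθ0] with c h1 hc h5 h6 h7
  set δ := c.1 l.succ - c.2 l.castSucc with hδdef
  have hδ0 : 0 < δ := sub_pos.2 (hc.gap_lt l)
  have hsδ : 0 < √δ := Real.sqrt_pos.2 hδ0
  have hcont := (hc.freeBand l.succ).continuous_gapDensity (hc.band _) (gapPoint c₀ c)
    ((closedGaps c₀.1 c₀.2).erase l)
  have h8 : ∫ φ in √δ..θ, κ * (√(1 + M))⁻¹ * (1 / φ) ≤ ∫ φ in √δ..θ,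
      gapDensity c.1 c.2 (gapPoint c₀ c) ((closedGaps c₀.1 c₀.2).erase l) l.succ
        (bandPt c.1 c.2 l.succ φ) := by
    refine intervalIntegral.integral_mono_on h7.le ?_ (hcont.intervalIntegrable _ _) ?_
    · refine IntervalIntegrable.const_mul ?_ _
      refine ContinuousOn.intervalIntegrable ?_
      rw [uIcc_of_le h7.le]
      exact continuousOn_const.div continuousOn_id fun x hx => (hsδ.trans_le hx.1).ne'
    · intro φ hφ
      have hφ0 : 0 < φ := hsδ.trans_le hφ.1
      have hsin : Real.sin φ ^ 2 ≤ φ ^ 2 := by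
        have ha := Real.sin_le hφ0.le
        have hb := Real.sin_nonneg_of_nonneg_of_le_pi hφ0.le
          (by linarith [hφ.2, Real.pi_pos])
        gcongr
      have hφ2 : φ ^ 2 ≤ θ ^ 2 := by
        have := hφ.2
        gcongr
      have hδφ : δ ≤ φ ^ 2 := by
        have := hφ.1
        rw [← Real.sq_sqrt hδ0.le]
        gcongr
      have hW : c.2 l.succ - c.1 l.succ ≤ M := by linarith [h5 l.succ, hc.nonneg l.succ]
      have hW0 : 0 ≤ c.2 l.succ - c.1 l.succ := sub_nonneg.2 (hc.band _)
      have hmul : (c.2 l.succ - c.1 l.succ) * Real.sin φ ^ 2 ≤ M * φ ^ 2 := by gcongr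
      have hMφ : M * φ ^ 2 ≤ M * θ ^ 2 := by gcongr
      refine le_trans ?_ (h1 _ (bandPt_mem (hc.band _) φ) ?_)
      · rw [mul_assoc]
        refine mul_le_mul_of_nonneg_left ?_ hκ.le
        rw [one_div, ← mul_inv]
        refine inv_anti₀ ?_ ?_
        · have h9 := (bandPt_mem (hc.band l.succ) φ).1
          exact Real.sqrt_pos.2 (by linarith)
        · rw [Real.sqrt_le_left (by positivity), mul_pow, Real.sq_sqrt (by positivity)]
          simp only [bandPt]
          linarith
      · simp only [bandPt]
        linarith
  rw [intervalIntegral.integral_const_mul, integral_one_div_of_pos hsδ hθ0] at h8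
  refine h8.trans ?_
  refine intervalIntegral.integral_mono_interval hsδ.le h7.le hθ1
    (Eventually.of_forall fun φ => gapDensity_nonneg _ _ _ _) (hcont.intervalIntegrable _ _)

/-- Use `sum_sub_mul` with `c` the frequency to the left of the gap and roots in all other closed
gaps. The left band drops out, the remaining masses and the half line term are bounded, and the mass
of the right band tends to infinity; its coefficient is the difference in question. -/
theorem LimBands.tendsto_sub {c₀ : Endpoints n} (h₀ : LimBands c₀.1 c₀.2) {l : Fin n}
    (hl : l ∈ closedGaps c₀.1 c₀.2) : Tendsto (fun c : Endpoints n =>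
      extendedFrequency c.1 c.2 l.succ - extendedFrequency c.1 c.2 l.castSucc)
      (nhdsBands c₀) (𝓝 0) := by
  obtain ⟨ε, hε, hε1, hev⟩ := h₀.exists_eps
  obtain ⟨K, hK⟩ := exists_abs_mom_negMoment_le (n := n) hε hε1
  obtain ⟨K', hK'⟩ := h₀.exists_gapMass_le
  set S := closedGaps c₀.1 c₀.2 with hS
  have hC : S.erase l ≠ Finset.univ := fun h => Finset.notMem_erase l S (h ▸ Finset.mem_univ l)
  have h1 : Tendsto (fun c : Endpoints n => (K + (n + 1) * K') *
      (gapMass c.1 c.2 (gapPoint c₀ c) (S.erase l) l.succ)⁻¹) (nhdsBands c₀) (𝓝 0) := by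
    have := (tendsto_inv_atTop_zero.comp (h₀.tendsto_gapMass_atTop hl)).const_mul (K + (n + 1) * K')
    rwa [mul_zero] at this
  refine squeeze_zero_norm' ?_ h1
  filter_upwards [hev, eventually_isBands c₀, hK', eventually_gapPoint_mem h₀.toWeakBands,
    (h₀.tendsto_gapMass_atTop hl).eventually_gt_atTop 0] with c h2 hc h3 hg h4
  rw [Real.norm_eq_abs, ← div_eq_mul_inv, le_div_iff₀ h4]
  have h5 := hc.sum_sub_mul (gapPoly_natDegree (gapPoint c₀ c) hC)
    (extendedFrequency c.1 c.2 l.castSucc)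
  have hK0 : 0 ≤ K' := (gapMass_nonneg _ _ _).trans
    (h3 Finset.univ 0 fun i hi => absurd (Finset.mem_univ i) hi)
  have h6 := hK c.1 c.2 hc h2.2.2 _ hg _ hC
  have hv := hc.extendedFrequency_mem
  rw [← Finset.add_sum_erase _ _ (Finset.mem_univ l.succ)] at h5
  have h7 : ∀ j ∈ Finset.univ.erase l.succ, |(-1) ^ (j : ℕ) * (extendedFrequency c.1 c.2 j -
      extendedFrequency c.1 c.2 l.castSucc) *
      mom (bandMoment c.1 c.2 j) (gapPoly (gapPoint c₀ c) (S.erase l))| ≤ K' := by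
    intro j hj
    rw [Finset.mem_erase] at hj
    by_cases hjl : j = l.castSucc
    · rw [hjl]
      simpa using hK0
    · rw [abs_mul, abs_mul, abs_pow, abs_neg, abs_one, one_pow, one_mul, hc.abs_mom_gapPoly hg]
      have h8 : |extendedFrequency c.1 c.2 j - extendedFrequency c.1 c.2 l.castSucc| ≤ 1 :=
        (abs_sub_le_of_mem (hv _) (hv _)).trans (by norm_num)
      have h9 := h3 (S.erase l) j fun i hi hiS => by
        have : i = l := by
          by_contra h10
          exact hi (Finset.mem_erase.2 ⟨h10, hiS⟩)
        rw [this]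
        exact ⟨fun h => hjl h.symm, fun h => hj.1 h.symm⟩
      calc _ ≤ 1 * K' := mul_le_mul h8 h9 (gapMass_nonneg _ _ _) zero_le_one
        _ = K' := one_mul _
  have h8 := (Finset.abs_sum_le_sum_abs _ _).trans (Finset.sum_le_sum h7)
  rw [Finset.sum_const, Finset.card_erase_of_mem (Finset.mem_univ _), Finset.card_univ,
    Fintype.card_fin, Nat.add_sub_cancel, nsmul_eq_mul] at h8
  have h9 : |extendedFrequency c.1 c.2 l.castSucc * mom (negMoment c.1 c.2)
      (gapPoly (gapPoint c₀ c) (S.erase l))| ≤ K := by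
    rw [abs_mul, abs_of_nonneg (hv _).1]
    calc _ ≤ 1 * K := mul_le_mul (by linarith [(hv l.castSucc).2]) h6 (abs_nonneg _) zero_le_one
      _ = K := one_mul _
  rw [← hc.abs_mom_gapPoly hg]
  have h10 := eq_sub_of_add_eq h5
  have h11 := congrArg abs h10
  rw [abs_mul, abs_mul, abs_pow, abs_neg, abs_one, one_pow, one_mul] at h11
  rw [h11]
  refine (abs_sub _ _).trans ?_
  linarith

end EllipsoidBilliard

/-! ### A substitution of Boole type for two bands collapsing together -/

namespace EllipsoidBilliard

/-- The map `s ↦ (s - γ) - k / (s - γ)`. -/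
noncomputable def booleMap (γ k s : ℝ) : ℝ := s - γ - k / (s - γ)

theorem booleMap_sub {γ k s t : ℝ} (hs : s ≠ γ) (ht : t ≠ γ) :
    booleMap γ k t - booleMap γ k s = (t - s) * (1 + k / ((s - γ) * (t - γ))) := by
  have h1 := sub_ne_zero.2 hs
  have h2 := sub_ne_zero.2 ht
  unfold booleMap
  field_simp
  ring

open MeasureTheory in
-- On either side of γ the map y = s - γ - k / (s - γ) is increasing with derivative 1 + k / (s -
-- γ)². The function `G` is the reciprocal of this derivative expressed in `y`; the rest is the sine
-- substitution for the image band.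
theorem integral_boole_branch {e o γ k : ℝ} (heo : e < o) (hk : 0 < k) (hγ : γ < e ∨ o < γ)
    (G : ℝ → ℝ) (hG : ∀ s ∈ Ioo e o, G (booleMap γ k s) = (s - γ) ^ 2 / ((s - γ) ^ 2 + k)) :
    ∫ s in e..o, (√((booleMap γ k s - booleMap γ k e) * (booleMap γ k o - booleMap γ k s)))⁻¹ =
      ∫ ψ in (0 : ℝ)..(Real.pi / 2),
        2 * G (booleMap γ k e + (booleMap γ k o - booleMap γ k e) * Real.sin ψ ^ 2) := by
  have hne : ∀ s ∈ Icc e o, s ≠ γ := by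
    rintro s hs rfl
    rcases hγ with h | h
    · exact absurd hs.1 h.not_ge
    · exact absurd hs.2 h.not_ge
  have hprod : ∀ s ∈ Icc e o, ∀ t ∈ Icc e o, 0 < (s - γ) * (t - γ) := by
    intro s hs t ht
    rcases hγ with h | h
    · exact mul_pos (by linarith [hs.1]) (by linarith [ht.1])
    · exact mul_pos_of_neg_of_neg (by linarith [hs.2]) (by linarith [ht.2])
  have hmono : StrictMonoOn (booleMap γ k) (Icc e o) := by
    intro s hs t ht hst
    have h1 := hprod s hs t ht
    have h2 := booleMap_sub (k := k) (hne s hs) (hne t ht)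
    have h3 : 0 < (t - s) * (1 + k / ((s - γ) * (t - γ))) :=
      mul_pos (sub_pos.2 hst) (by positivity)
    linarith
  have hderiv : ∀ s ∈ Ioo e o, HasDerivAt (booleMap γ k) (1 + k / (s - γ) ^ 2) s := by
    intro s hs
    have h1 : HasDerivAt (fun s => s - γ) 1 s := (hasDerivAt_id s).sub_const γ
    have h2 := h1.sub ((hasDerivAt_const s k).div h1 (sub_ne_zero.2 (hne s (Ioo_subset_Icc_self hs))))
    convert! h2 using 1
    ring
  have hcont : ContinuousOn (booleMap γ k) (Icc e o) :=
    (continuousOn_id.sub continuousOn_const).sub (continuousOn_const.div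
      (continuousOn_id.sub continuousOn_const) fun s hs => sub_ne_zero.2 (hne s hs))
  have himg : booleMap γ k '' Ioo e o = Ioo (booleMap γ k e) (booleMap γ k o) :=
    hcont.image_Ioo_of_strictMonoOn heo.le hmono
  have hlt := hmono (left_mem_Icc.2 heo.le) (right_mem_Icc.2 heo.le) heo
  rw [← integral_div_sqrt_eq hlt G, intervalIntegral.integral_of_le heo.le,
    intervalIntegral.integral_of_le hlt.le, integral_Ioc_eq_integral_Ioo,
    integral_Ioc_eq_integral_Ioo, ← himg,
    integral_image_eq_integral_abs_deriv_smul measurableSet_Ioo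
      (fun s hs => (hderiv s hs).hasDerivWithinAt) (hmono.injOn.mono Ioo_subset_Icc_self)]
  refine setIntegral_congr_fun measurableSet_Ioo fun s hs => ?_
  have h1 : 0 < (s - γ) ^ 2 :=
    pow_two (s - γ) ▸ hprod s (Ioo_subset_Icc_self hs) s (Ioo_subset_Icc_self hs)
  simp only [smul_eq_mul]
  have h2 : 0 < (s - γ) ^ 2 + k := by positivity
  have h3 : 1 + k / (s - γ) ^ 2 = ((s - γ) ^ 2 + k) / (s - γ) ^ 2 := by
    rw [add_div, div_self h1.ne']
  have h4 : ((s - γ) ^ 2 + k) / (s - γ) ^ 2 * ((s - γ) ^ 2 / ((s - γ) ^ 2 + k)) = 1 := by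
    rw [div_mul_div_cancel₀ h1.ne', div_self h2.ne']
  rw [hG s hs, abs_of_pos (by positivity), h3, mul_div_assoc', h4, inv_eq_one_div]

/-- The two conditions on `k` say that c₀, c₂ have the same image, and likewise c₁, c₃. Hence the
quartic in `s` is, up to (s - γ)², a quadratic in `y` with the same two roots on both branches. -/
theorem boole_branch_density {c₀ c₁ c₂ c₃ γ k s : ℝ} (hk1 : k = (γ - c₀) * (c₂ - γ))
    (hk2 : k = (γ - c₁) * (c₃ - γ)) (hs : s ≠ γ) (h0 : c₀ ≠ γ) (h1 : c₁ ≠ γ) (h2 : c₂ ≠ γ)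
    (h3 : c₃ ≠ γ) (e o : ℝ) (he : e = c₀ ∨ e = c₂) (ho : o = c₁ ∨ o = c₃) :
    (booleMap γ k s - booleMap γ k e) * (booleMap γ k o - booleMap γ k s) =
      -((s - c₀) * (s - c₁) * (s - c₂) * (s - c₃)) / (s - γ) ^ 2 := by
  have hs := sub_ne_zero.2 hs
  have h0 := sub_ne_zero.2 h0
  have h1 := sub_ne_zero.2 h1
  have h2 := sub_ne_zero.2 h2
  have h3 := sub_ne_zero.2 h3
  have e1 : booleMap γ k s - booleMap γ k e = (s - c₀) * (s - c₂) / (s - γ) := by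
    rcases he with rfl | rfl
    · rw [hk1]
      unfold booleMap
      field_simp
      ring
    · rw [hk1]
      unfold booleMap
      field_simp
      ring
  have e2 : booleMap γ k o - booleMap γ k s = -((s - c₁) * (s - c₃)) / (s - γ) := by
    rcases ho with rfl | rfl
    · rw [hk2]
      unfold booleMap
      field_simp
      ring
    · rw [hk2]
      unfold booleMap
      field_simp
      ring
  rw [e1, e2]
  field_simp

/-- The identity (x - k/x)² + 4k = (x + k/x)², used to express the derivative on each branch through
`y` alone. -/
theorem sqrt_boole_add {x k : ℝ} (hx : x ≠ 0) :
    √((x - k / x) ^ 2 + 4 * k) = |x + k / x| := by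
  rw [← Real.sqrt_sq_eq_abs]
  congr 1
  field_simp
  ring

/-- Four points coming in two pairs: with a suitable `γ` the two bands together have mass `π`. -/
theorem integral_boole_add {c₀ c₁ c₂ c₃ γ : ℝ} (h0 : c₀ < c₁) (h1 : c₁ < γ) (h2 : γ < c₂)
    (h3 : c₂ < c₃) (hk : (γ - c₀) * (c₂ - γ) = (γ - c₁) * (c₃ - γ)) :
    (∫ φ in (0 : ℝ)..(Real.pi / 2), 2 * (|c₀ + (c₁ - c₀) * Real.sin φ ^ 2 - γ| *
        (√|c₂ - (c₀ + (c₁ - c₀) * Real.sin φ ^ 2)| *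
          √|c₃ - (c₀ + (c₁ - c₀) * Real.sin φ ^ 2)|)⁻¹)) +
      (∫ φ in (0 : ℝ)..(Real.pi / 2), 2 * (|c₂ + (c₃ - c₂) * Real.sin φ ^ 2 - γ| *
        (√|c₀ - (c₂ + (c₃ - c₂) * Real.sin φ ^ 2)| *
          √|c₁ - (c₂ + (c₃ - c₂) * Real.sin φ ^ 2)|)⁻¹)) = Real.pi := by
  set k := (γ - c₀) * (c₂ - γ) with hkdef
  have hk0 : 0 < k := mul_pos (by linarith) (by linarith)
  have g0 : c₀ ≠ γ := by linarith
  have g1 : c₁ ≠ γ := h1.ne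
  have g2 : c₂ ≠ γ := h2.ne'
  have g3 : c₃ ≠ γ := by linarith
  -- The two values σ = ∓1 belong to the branches left and right of γ. The reciprocal derivatives at
  -- the two preimages of `y` add up to 1, so the total mass is the integral of the constant 2 over
  -- [0, π/2].
  let G : ℝ → ℝ → ℝ := fun σ y => (1 + σ * (y / √(y ^ 2 + 4 * k))) / 2
  have hGc : ∀ σ, Continuous (G σ) := by
    intro σ
    refine (continuous_const.add (continuous_const.mul (Continuous.div continuous_id
      (by fun_prop) fun y => ?_))).div_const 2
    exact (Real.sqrt_pos.2 (by positivity)).ne'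
  have hA : booleMap γ k c₂ = booleMap γ k c₀ := by
    have e0 := sub_ne_zero.2 g0
    have e2 := sub_ne_zero.2 g2
    rw [hkdef]
    unfold booleMap
    field_simp
    ring
  have hB : booleMap γ k c₃ = booleMap γ k c₁ := by
    have e0 := sub_ne_zero.2 g1
    have e2 := sub_ne_zero.2 g3
    rw [hk]
    unfold booleMap
    field_simp
    ring
  have i1 := integral_boole_branch h0 hk0 (Or.inr h1) (G (-1)) (by
    intro s hs
    have hs0 : s - γ < 0 := by linarith [hs.2]
    have hs1 : s - γ + k / (s - γ) < 0 := add_neg hs0 (div_neg_of_pos_of_neg hk0 hs0)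
    have hs2 := hs0.ne
    have hs3 : 0 < (s - γ) ^ 2 + k := by positivity
    simp only [G, booleMap]
    rw [sqrt_boole_add hs0.ne, abs_of_neg hs1]
    have hs4 : s - γ + k / (s - γ) = ((s - γ) ^ 2 + k) / (s - γ) := by field_simp
    rw [hs4]
    field_simp
    ring)
  have i2 := integral_boole_branch h3 hk0 (Or.inl h2) (G 1) (by
    intro s hs
    have hs0 : 0 < s - γ := by linarith [hs.1]
    have hs1 : 0 < s - γ + k / (s - γ) := by positivity
    have hs3 : 0 < (s - γ) ^ 2 + k := by positivity
    simp only [G, booleMap]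
    rw [sqrt_boole_add hs0.ne', abs_of_pos hs1]
    have hs4 : s - γ + k / (s - γ) = ((s - γ) ^ 2 + k) / (s - γ) := by field_simp
    rw [hs4]
    field_simp
    ring)
  have hD : ∀ e o p q : ℝ, e < o → (γ < e ∨ o < γ) →
      (∀ s ∈ Ioo e o, (booleMap γ k s - booleMap γ k e) * (booleMap γ k o - booleMap γ k s) =
        (s - e) * (o - s) * (|p - s| * |q - s|) / (s - γ) ^ 2) →
      ∫ φ in (0 : ℝ)..(Real.pi / 2), 2 * (|e + (o - e) * Real.sin φ ^ 2 - γ| *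
        (√|p - (e + (o - e) * Real.sin φ ^ 2)| * √|q - (e + (o - e) * Real.sin φ ^ 2)|)⁻¹) =
      ∫ s in e..o, (√((booleMap γ k s - booleMap γ k e) *
        (booleMap γ k o - booleMap γ k s)))⁻¹ := by
    intro e o p q heo hγ hQ
    rw [← integral_div_sqrt_eq heo fun s => |s - γ| * (√|p - s| * √|q - s|)⁻¹]
    rw [intervalIntegral.integral_of_le heo.le, intervalIntegral.integral_of_le heo.le,
      MeasureTheory.integral_Ioc_eq_integral_Ioo, MeasureTheory.integral_Ioc_eq_integral_Ioo]
    refine MeasureTheory.setIntegral_congr_fun measurableSet_Ioo fun s hs => ?_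
    have hse : 0 ≤ (s - e) * (o - s) := mul_nonneg (by linarith [hs.1]) (by linarith [hs.2])
    rw [hQ s hs, Real.sqrt_div (by positivity), Real.sqrt_sq_eq_abs,
      Real.sqrt_mul hse, Real.sqrt_mul (abs_nonneg _), inv_div]
    ring
  rw [hD c₀ c₁ c₂ c₃ h0 (Or.inr h1), hD c₂ c₃ c₀ c₁ h3 (Or.inl h2), i1, i2, hA, hB,
    ← intervalIntegral.integral_add]
  · simp only [G]
    have : ∀ y : ℝ, 2 * ((1 + -1 * (y / √(y ^ 2 + 4 * k))) / 2) +
        2 * ((1 + 1 * (y / √(y ^ 2 + 4 * k))) / 2) = 2 := fun y => by ring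
    simp_rw [this]
    rw [intervalIntegral.integral_const, smul_eq_mul]
    ring
  · refine Continuous.intervalIntegrable ?_ _ _
    exact continuous_const.mul ((hGc _).comp (by fun_prop))
  · refine Continuous.intervalIntegrable ?_ _ _
    exact continuous_const.mul ((hGc _).comp (by fun_prop))
  · intro s hs
    rw [boole_branch_density rfl hk (by linarith [hs.1]) g0 g1 g2 g3 c₂ c₃ (Or.inr rfl) (Or.inr rfl),
      abs_of_neg (by linarith [hs.1]), abs_of_neg (by linarith [hs.1])]
    ring
  · intro s hs
    rw [boole_branch_density rfl hk (by linarith [hs.2]) g0 g1 g2 g3 c₀ c₁ (Or.inl rfl) (Or.inl rfl),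
      abs_of_pos (by linarith [hs.2]), abs_of_pos (by linarith [hs.2])]
    ring

end EllipsoidBilliard

/-! ### Limits of the masses -/

namespace EllipsoidBilliard

variable {n : ℕ}

theorem tendsto_bandPt (c₀ : Endpoints n) (j : Fin (n + 1)) (φ : ℝ) :
    Tendsto (fun c : Endpoints n => bandPt c.1 c.2 j φ) (nhdsBands c₀)
      (𝓝 (bandPt c₀.1 c₀.2 j φ)) :=
  (tendsto_left c₀ j).add (((tendsto_right c₀ j).sub (tendsto_left c₀ j)).mul_const _)

/-- The midpoints of the gaps. -/
noncomputable def gapMid (E O : Fin (n + 1) → ℝ) (i : Fin n) : ℝ := (O i.castSucc + E i.succ) / 2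

theorem tendsto_gapFactor {c₀ : Endpoints n} (h₀ : WeakBands c₀.1 c₀.2) (C : Finset (Fin n))
    {k j : Fin (n + 1)} {i : Fin n} {φ : ℝ} (hE : c₀.1 k ≠ bandPt c₀.1 c₀.2 j φ)
    (hO : c₀.2 k ≠ bandPt c₀.1 c₀.2 j φ) :
    Tendsto (fun c : Endpoints n =>
      gapFactor c.1 c.2 (gapPoint c₀ c) C k i (bandPt c.1 c.2 j φ)) (nhdsBands c₀)
      (𝓝 (gapFactor c₀.1 c₀.2 (gapMid c₀.1 c₀.2) C k i (bandPt c₀.1 c₀.2 j φ))) := by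
  have h1 := tendsto_bandPt c₀ j φ
  have h2 : √|c₀.1 k - bandPt c₀.1 c₀.2 j φ| ≠ 0 :=
    (Real.sqrt_pos.2 (abs_pos.2 (sub_ne_zero.2 hE))).ne'
  have h3 : √|c₀.2 k - bandPt c₀.1 c₀.2 j φ| ≠ 0 :=
    (Real.sqrt_pos.2 (abs_pos.2 (sub_ne_zero.2 hO))).ne'
  unfold gapFactor
  refine Tendsto.mul ?_ (Tendsto.inv₀ (Tendsto.mul ((tendsto_left c₀ k).sub h1).abs.sqrt
    ((tendsto_right c₀ k).sub h1).abs.sqrt) (mul_ne_zero h2 h3))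
  split_ifs with hi
  · exact (h1.sub (tendsto_gapPoint h₀ i)).abs
  · exact tendsto_const_nhds

theorem gapFactor_pos {c₀ : Endpoints n} (h₀ : WeakBands c₀.1 c₀.2) (C : Finset (Fin n))
    {j : Fin (n + 1)} {i : Fin n} {s : ℝ} (hs : s ∈ Icc (c₀.1 j) (c₀.2 j))
    (hE : c₀.1 (j.succAbove i) ≠ s) (hO : c₀.2 (j.succAbove i) ≠ s) :
    0 < gapFactor c₀.1 c₀.2 (gapMid c₀.1 c₀.2) C (j.succAbove i) i s := by
  have h2 : 0 < √|c₀.1 (j.succAbove i) - s| := Real.sqrt_pos.2 (abs_pos.2 (sub_ne_zero.2 hE))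
  have h3 : 0 < √|c₀.2 (j.succAbove i) - s| := Real.sqrt_pos.2 (abs_pos.2 (sub_ne_zero.2 hO))
  unfold gapFactor
  refine mul_pos ?_ (by positivity)
  split_ifs with hi
  · refine abs_pos.2 (sub_ne_zero.2 fun hsg => ?_)
    have hg := h₀.gap i
    unfold gapMid at hsg
    rcases lt_or_ge i.castSucc j with hij | hij
    · rw [Fin.succAbove_of_castSucc_lt _ _ hij] at hO
      have := h₀.succ_le hij
      exact hO (by linarith [hs.1])
    · rw [Fin.succAbove_of_le_castSucc _ _ hij] at hE
      have := h₀.le_castSucc hij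
      exact hE (by linarith [hs.2])
  · norm_num

open MeasureTheory

theorem tendsto_integral_of_bounded {c₀ : Endpoints n} {F : Endpoints n → ℝ → ℝ} {f : ℝ → ℝ} {K : ℝ}
    (hF : ∀ᶠ c in nhdsBands c₀, Continuous (F c))
    (hK : ∀ᶠ c in nhdsBands c₀, ∀ φ, |F c φ| ≤ K)
    (hlim : ∀ φ ∈ Ioo 0 (Real.pi / 2), Tendsto (fun c => F c φ) (nhdsBands c₀) (𝓝 (f φ))) :
    Tendsto (fun c => ∫ φ in (0 : ℝ)..(Real.pi / 2), F c φ) (nhdsBands c₀)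
      (𝓝 (∫ φ in (0 : ℝ)..(Real.pi / 2), f φ)) := by
  have hpi : (0 : ℝ) ≤ Real.pi / 2 := by positivity
  have : (nhdsBands c₀).IsCountablyGenerated := by
    unfold nhdsBands
    infer_instance
  simp_rw [intervalIntegral.integral_of_le hpi, integral_Ioc_eq_integral_Ioo]
  refine tendsto_integral_filter_of_dominated_convergence (fun _ => K) ?_ ?_ ?_ ?_
  · exact hF.mono fun c hc => hc.aestronglyMeasurable
  · exact hK.mono fun c hc => Eventually.of_forall hc
  · exact integrable_const K
  · exact (ae_restrict_mem measurableSet_Ioo).mono hlim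

theorem LimBands.tendsto_gapMass_of_density {c₀ : Endpoints n} (h₀ : LimBands c₀.1 c₀.2)
    {C : Finset (Fin n)} (hC : closedGaps c₀.1 c₀.2 ⊆ C) (j : Fin (n + 1)) {f : ℝ → ℝ}
    (hlim : ∀ φ ∈ Ioo 0 (Real.pi / 2), Tendsto (fun c : Endpoints n =>
      gapDensity c.1 c.2 (gapPoint c₀ c) C j (bandPt c.1 c.2 j φ)) (nhdsBands c₀) (𝓝 (f φ))) :
    Tendsto (fun c : Endpoints n => gapMass c.1 c.2 (gapPoint c₀ c) C j) (nhdsBands c₀)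
      (𝓝 (∫ φ in (0 : ℝ)..(Real.pi / 2), f φ)) := by
  obtain ⟨K, hK⟩ := h₀.exists_gapDensity_le
  refine tendsto_integral_of_bounded (K := K) ?_ ?_ hlim
  · filter_upwards [eventually_isBands c₀] with c hc
    exact (hc.freeBand j).continuous_gapDensity (hc.band j) _ _
  · filter_upwards [hK, eventually_isBands c₀] with c h1 hc φ
    rw [abs_of_nonneg (gapDensity_nonneg _ _ _ _)]
    exact h1 C j (fun i hi hiS => absurd (hC hiS) hi) _ (bandPt_mem (hc.band j) φ)

theorem LimBands.tendsto_gapMass {c₀ : Endpoints n} (h₀ : LimBands c₀.1 c₀.2)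
    {C : Finset (Fin n)} (hC : closedGaps c₀.1 c₀.2 ⊆ C) {j : Fin (n + 1)}
    (hne : ∀ φ ∈ Ioo 0 (Real.pi / 2), ∀ i : Fin n,
      c₀.1 (j.succAbove i) ≠ bandPt c₀.1 c₀.2 j φ ∧ c₀.2 (j.succAbove i) ≠ bandPt c₀.1 c₀.2 j φ) :
    Tendsto (fun c : Endpoints n => gapMass c.1 c.2 (gapPoint c₀ c) C j) (nhdsBands c₀)
      (𝓝 (gapMass c₀.1 c₀.2 (gapMid c₀.1 c₀.2) C j)) := by
  refine h₀.tendsto_gapMass_of_density hC j fun φ hφ => ?_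
  exact (((tendsto_bandPt c₀ j φ).abs.sqrt.mul (tendsto_finsetProd _ fun i _ =>
    tendsto_gapFactor h₀.toWeakBands C (hne φ hφ i).1 (hne φ hφ i).2)).const_mul 2)

theorem LimBands.gapMass_pos {c₀ : Endpoints n} (h₀ : LimBands c₀.1 c₀.2)
    [(nhdsBands c₀).NeBot]
    {C : Finset (Fin n)} (hC : closedGaps c₀.1 c₀.2 ⊆ C) {j : Fin (n + 1)}
    (hne : ∀ φ ∈ Ioo 0 (Real.pi / 2), ∀ i : Fin n,
      c₀.1 (j.succAbove i) ≠ bandPt c₀.1 c₀.2 j φ ∧ c₀.2 (j.succAbove i) ≠ bandPt c₀.1 c₀.2 j φ)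
    (hpos : ∀ φ ∈ Ioo 0 (Real.pi / 2), bandPt c₀.1 c₀.2 j φ ≠ 0) :
    0 < gapMass c₀.1 c₀.2 (gapMid c₀.1 c₀.2) C j := by
  obtain ⟨K, hK⟩ := h₀.exists_gapDensity_le
  have hpi : (0 : ℝ) < Real.pi / 2 := by positivity
  refine intervalIntegral.intervalIntegral_pos_of_pos_on ?_ ?_ hpi
  · rw [intervalIntegrable_iff_integrableOn_Ioo_of_le hpi.le]
    refine Measure.integrableOn_of_bounded (M := K) (by simp) ?_ ?_
    · refine Measurable.aestronglyMeasurable ?_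
      unfold gapDensity gapFactor bandPt
      refine Measurable.const_mul (Measurable.mul (by fun_prop)
        (Finset.measurable_fun_prod _ fun i _ => ?_)) _
      split_ifs <;> fun_prop
    · refine (ae_restrict_mem measurableSet_Ioo).mono fun φ hφ => ?_
      rw [Real.norm_of_nonneg (gapDensity_nonneg _ _ _ _)]
      -- The bound of the nearby densities passes to the limit density, which may be discontinuous
      -- at the ends of the interval.
      refine le_of_tendsto (((tendsto_bandPt c₀ j φ).abs.sqrt.mul (tendsto_finsetProd _ fun i _ =>
        tendsto_gapFactor h₀.toWeakBands C (hne φ hφ i).1 (hne φ hφ i).2)).const_mul 2) ?_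
      filter_upwards [hK, eventually_isBands c₀] with c h1 hc
      exact h1 C j (fun i hi hiS => absurd (hC hiS) hi) _ (bandPt_mem (hc.band j) φ)
  · intro φ hφ
    have h1 : 0 < √|bandPt c₀.1 c₀.2 j φ| := Real.sqrt_pos.2 (abs_pos.2 (hpos φ hφ))
    have h2 : 0 < ∏ i, gapFactor c₀.1 c₀.2 (gapMid c₀.1 c₀.2) C (j.succAbove i) i
        (bandPt c₀.1 c₀.2 j φ) := Finset.prod_pos fun i _ =>
      gapFactor_pos h₀.toWeakBands C (bandPt_mem (h₀.band j) φ) (hne φ hφ i).1 (hne φ hφ i).2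
    unfold gapDensity
    positivity

theorem WeakBands.ne_of_mem_Ioo {E O : Fin (n + 1) → ℝ} (h : WeakBands E O) {j : Fin (n + 1)} {s : ℝ}
    (hs : s ∈ Ioo (E j) (O j)) (i : Fin n) : E (j.succAbove i) ≠ s ∧ O (j.succAbove i) ≠ s := by
  rcases lt_or_ge i.castSucc j with hij | hij
  · rw [Fin.succAbove_of_castSucc_lt _ _ hij]
    have h1 := h.le_of_lt hij
    have h2 := h.band i.castSucc
    exact ⟨by linarith [hs.1], by linarith [hs.1]⟩
  · rw [Fin.succAbove_of_le_castSucc _ _ hij]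
    have h1 := h.le_of_lt (Fin.le_castSucc_iff.1 hij)
    have h2 := h.band i.succ
    exact ⟨by linarith [hs.2], by linarith [hs.2]⟩

/-- A root close to `s` cancels the inverse root of the nearer endpoint and leaves √|s - g|. Unlike
`gapFactor_le_one`, this tends to 0 if `s` approaches the root while the far endpoint stays away. -/
theorem gapFactor_le_left {E O : Fin (n + 1) → ℝ} {g : Fin n → ℝ} {C : Finset (Fin n)}
    {k : Fin (n + 1)} {i : Fin n} {s : ℝ} (hi : i ∈ C) (h : |s - g i| ≤ |O k - s|) :
    gapFactor E O g C k i s ≤ √|s - g i| * (√|E k - s|)⁻¹ := by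
  rw [gapFactor, if_pos hi, mul_inv]
  rcases (abs_nonneg (O k - s)).eq_or_lt with h1 | h1
  · rw [← h1, Real.sqrt_zero, inv_zero, mul_zero, mul_zero]
    positivity
  · have h2 : 0 < √|O k - s| := Real.sqrt_pos.2 h1
    calc |s - g i| * ((√|E k - s|)⁻¹ * (√|O k - s|)⁻¹) =
        √|s - g i| * (√|E k - s|)⁻¹ * (√|s - g i| * (√|O k - s|)⁻¹) := by
          nth_rewrite 1 [← Real.mul_self_sqrt (abs_nonneg (s - g i))]
          ring
      _ ≤ √|s - g i| * (√|E k - s|)⁻¹ * 1 := by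
          gcongr
          rw [← div_eq_mul_inv, div_le_one h2]
          gcongr
      _ = _ := mul_one _

theorem gapFactor_le_right {E O : Fin (n + 1) → ℝ} {g : Fin n → ℝ} {C : Finset (Fin n)}
    {k : Fin (n + 1)} {i : Fin n} {s : ℝ} (hi : i ∈ C) (h : |s - g i| ≤ |E k - s|) :
    gapFactor E O g C k i s ≤ √|s - g i| * (√|O k - s|)⁻¹ := by
  have := gapFactor_le_left (E := O) (O := E) (g := g) (k := k) hi h
  unfold gapFactor at this ⊢
  rwa [mul_comm (√|E k - s|)]

theorem WeakBands.gapDensity_le_mul {E O : Fin (n + 1) → ℝ} (h : WeakBands E O) {g : Fin n → ℝ}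
    (hg : ∀ i, g i ∈ Icc (O i.castSucc) (E i.succ)) {C : Finset (Fin n)} {j : Fin (n + 1)} {s ε M : ℝ}
    (hs : s ∈ Icc (E j) (O j)) (hε : 0 < ε) (hε1 : ε ≤ 1) (hM : O j ≤ M)
    (hC : ∀ i ∉ C, ε ≤ |E (j.succAbove i) - s| ∧ ε ≤ |O (j.succAbove i) - s|) (l : Fin n) :
    gapDensity E O g C j s ≤ 2 * (√M * ∏ _i ∈ Finset.univ.erase l, ε⁻¹) *
      gapFactor E O g C (j.succAbove l) l s := by
  have h1 : ∏ i ∈ Finset.univ.erase l, gapFactor E O g C (j.succAbove i) i s ≤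
      ∏ _i ∈ Finset.univ.erase l, ε⁻¹ := by
    refine Finset.prod_le_prod (fun i _ => gapFactor_nonneg _ _ _ _ _) fun i _ => ?_
    by_cases hi : i ∈ C
    · have := h.abs_sub_le hs (hg i)
      exact (gapFactor_le_one hi this.1 this.2).trans ((one_le_inv₀ hε).2 hε1)
    · exact gapFactor_le_inv hi hε (hC i hi).1 (hC i hi).2
  have h2 := (h.nonneg j).trans hs.1
  have h4 : √|s| ≤ √M := by
    gcongr
    rw [abs_of_nonneg h2]
    exact hs.2.trans hM
  rw [gapDensity, ← Finset.mul_prod_erase _ _ (Finset.mem_univ l)]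
  have h5 := gapFactor_nonneg (E := E) (O := O) g C (j.succAbove l) l s
  have h6 : 0 ≤ ∏ i ∈ Finset.univ.erase l, gapFactor E O g C (j.succAbove i) i s :=
    Finset.prod_nonneg fun i _ => gapFactor_nonneg _ _ _ _ _
  calc _ = 2 * (√|s| * ∏ i ∈ Finset.univ.erase l, gapFactor E O g C (j.succAbove i) i s) *
        gapFactor E O g C (j.succAbove l) l s := by ring
    _ ≤ _ := by gcongr

theorem bandPt_of_eq {E O : Fin (n + 1) → ℝ} {j : Fin (n + 1)} (h : E j = O j) (φ : ℝ) :
    bandPt E O j φ = E j := by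
  simp [bandPt, h]

/-- A collapsing band next to a band that does not collapse carries no mass in the limit. -/
theorem LimBands.tendsto_gapMass_zero {c₀ : Endpoints n} (h₀ : LimBands c₀.1 c₀.2)
    {C : Finset (Fin n)} (hC : closedGaps c₀.1 c₀.2 ⊆ C) {j : Fin (n + 1)} {i : Fin n}
    (hi : i ∈ closedGaps c₀.1 c₀.2) (hj : c₀.1 j = c₀.2 j)
    (hk : i.succ = j ∧ c₀.1 i.castSucc < c₀.2 i.castSucc ∨
      i.castSucc = j ∧ c₀.1 i.succ < c₀.2 i.succ) :
    Tendsto (fun c : Endpoints n => gapMass c.1 c.2 (gapPoint c₀ c) C j) (nhdsBands c₀) (𝓝 0) := by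
  obtain ⟨ε, hε, hε1, hev⟩ := h₀.exists_eps
  have hi' := mem_closedGaps.1 hi
  have hfac : ∀ φ, Tendsto (fun c : Endpoints n => gapFactor c.1 c.2 (gapPoint c₀ c) C
      (j.succAbove i) i (bandPt c.1 c.2 j φ)) (nhdsBands c₀) (𝓝 0) := by
    intro φ
    have h1 := tendsto_bandPt c₀ j φ
    rw [bandPt_of_eq hj] at h1
    have h2 := tendsto_gapPoint h₀.toWeakBands i
    rw [hi', add_self_div_two] at h2
    -- The two cases are mirror images: the band that stays open lies to the left or to the right of
    -- the closed gap.
    rcases hk with ⟨h3, h4⟩ | ⟨h3, h4⟩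
    · have h5 : Tendsto (fun c : Endpoints n => √|bandPt c.1 c.2 j φ - gapPoint c₀ c i| *
          (√|c.1 (j.succAbove i) - bandPt c.1 c.2 j φ|)⁻¹) (nhdsBands c₀) (𝓝 0) := by
        have h6 : √|c₀.1 (j.succAbove i) - c₀.1 j| ≠ 0 := by
          refine (Real.sqrt_pos.2 (abs_pos.2 ?_)).ne'
          rw [← h3, Fin.succAbove_succ_self, ← hi']
          linarith
        have h7 := ((h1.sub h2).abs.sqrt.mul
          (((tendsto_left c₀ (j.succAbove i)).sub h1).abs.sqrt.inv₀ h6))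
        rwa [← h3, sub_self, abs_zero, Real.sqrt_zero, zero_mul, h3] at h7
      refine squeeze_zero' (Eventually.of_forall fun c => gapFactor_nonneg _ _ _ _ _) ?_ h5
      filter_upwards [eventually_isBands c₀, eventually_gapPoint_mem h₀.toWeakBands] with c hc hg
      exact gapFactor_le_left (hC hi) (hc.abs_sub_le (bandPt_mem (hc.band j) φ) (hg i)).2
    · have h5 : Tendsto (fun c : Endpoints n => √|bandPt c.1 c.2 j φ - gapPoint c₀ c i| *
          (√|c.2 (j.succAbove i) - bandPt c.1 c.2 j φ|)⁻¹) (nhdsBands c₀) (𝓝 0) := by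
        have h6 : √|c₀.2 (j.succAbove i) - c₀.1 j| ≠ 0 := by
          refine (Real.sqrt_pos.2 (abs_pos.2 ?_)).ne'
          rw [hj, ← h3, Fin.succAbove_castSucc_self, hi']
          linarith
        have h7 := ((h1.sub h2).abs.sqrt.mul
          (((tendsto_right c₀ (j.succAbove i)).sub h1).abs.sqrt.inv₀ h6))
        rwa [← hi', hj, h3, sub_self, abs_zero, Real.sqrt_zero, zero_mul] at h7
      refine squeeze_zero' (Eventually.of_forall fun c => gapFactor_nonneg _ _ _ _ _) ?_ h5
      filter_upwards [eventually_isBands c₀, eventually_gapPoint_mem h₀.toWeakBands] with c hc hg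
      exact gapFactor_le_right (hC hi) (hc.abs_sub_le (bandPt_mem (hc.band j) φ) (hg i)).1
  have h := h₀.tendsto_gapMass_of_density hC j (f := fun _ => 0) fun φ _ => ?_
  · simpa using h
  · have h1 := (hfac φ).const_mul (2 * (√(|c₀.2 (Fin.last n)| + 1) *
      ∏ _i ∈ Finset.univ.erase i, ε⁻¹))
    rw [mul_zero] at h1
    refine squeeze_zero' (Eventually.of_forall fun c => gapDensity_nonneg _ _ _ _) ?_ h1
    filter_upwards [hev, eventually_isBands c₀, eventually_right_le c₀,
      eventually_gapPoint_mem h₀.toWeakBands] with c h4 hc h5 h6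
    refine hc.gapDensity_le_mul h6 (bandPt_mem (hc.band j) φ) hε hε1 (h5 j) (fun l hl => ?_) i
    by_cases hlS : l ∈ closedGaps c₀.1 c₀.2
    · exact absurd (hC hlS) hl
    · exact hc.half_gap_le (bandPt_mem (hc.band j) φ) (h4.1 l hlS)

end EllipsoidBilliard

/-! ### A gap collapsing together with both neighbouring bands -/

namespace EllipsoidBilliard

variable {n : ℕ}

theorem FreeBand.continuous_gapFactor {E O : Fin (n + 1) → ℝ} {j : Fin (n + 1)}
    (hf : FreeBand E O j) (h : E j ≤ O j) (g : Fin n → ℝ) (C : Finset (Fin n)) (i : Fin n) :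
    Continuous fun φ => gapFactor E O g C (j.succAbove i) i (bandPt E O j φ) := by
  have h1 := continuous_bandPt E O j
  unfold gapFactor
  refine Continuous.mul (by split_ifs <;> fun_prop) (Continuous.inv₀ (by fun_prop) fun φ => ?_)
  have h2 := hf.ne (bandPt_mem h φ) i
  exact mul_ne_zero (Real.sqrt_pos.2 (abs_pos.2 (sub_ne_zero.2 h2.1))).ne'
    (Real.sqrt_pos.2 (abs_pos.2 (sub_ne_zero.2 h2.2))).ne'

theorem succAbove_castSucc_eq {i i' : Fin n} (h : i' ≠ i) :
    i.castSucc.succAbove i' = i.succ.succAbove i' := by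
  rcases h.lt_or_gt with h1 | h1
  · rw [Fin.succAbove_of_castSucc_lt _ _ (Fin.castSucc_lt_castSucc_iff.2 h1),
      Fin.succAbove_of_castSucc_lt _ _ (Fin.castSucc_lt_succ_iff.2 h1.le)]
  · rw [Fin.succAbove_of_le_castSucc _ _ (Fin.castSucc_le_castSucc_iff.2 h1.le),
      Fin.succAbove_of_le_castSucc _ _ (Fin.succ_le_castSucc_iff.2 h1)]

theorem LimBands.ne_of_quad {E O : Fin (n + 1) → ℝ} (h₀ : LimBands E O) {i i' : Fin n}
    (hi : i ∈ closedGaps E O) (hii' : i' ≠ i) :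
    E (i.succ.succAbove i') ≠ E i.succ ∧ O (i.succ.succAbove i') ≠ E i.succ := by
  rw [mem_closedGaps] at hi
  rcases hii'.lt_or_gt with h1 | h1
  · rw [Fin.succAbove_of_castSucc_lt _ _ (Fin.castSucc_lt_succ_iff.2 h1.le)]
    have h2 := h₀.sep _ _ h1
    have h3 := h₀.band i'.castSucc
    exact ⟨by linarith, by linarith⟩
  · rw [Fin.succAbove_of_le_castSucc _ _ (Fin.succ_le_castSucc_iff.2 h1)]
    have h2 := h₀.sep _ _ h1
    have h3 := h₀.band i'.succ
    exact ⟨by linarith, by linarith⟩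

/-- The limit density at a point where two adjacent bands collapse together. -/
noncomputable def quadDensity (c₀ : Endpoints n) (C : Finset (Fin n)) (i : Fin n) : ℝ :=
  √|c₀.1 i.succ| * ∏ i' ∈ Finset.univ.erase i, gapFactor c₀.1 c₀.2 (gapMid c₀.1 c₀.2) C
    (i.succ.succAbove i') i' (c₀.1 i.succ)

theorem LimBands.quadDensity_pos {c₀ : Endpoints n} (h₀ : LimBands c₀.1 c₀.2)
    (C : Finset (Fin n)) {i : Fin n} (hi : i ∈ closedGaps c₀.1 c₀.2) :
    0 < quadDensity c₀ C i := by
  have h1 := h₀.pos i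
  refine mul_pos (Real.sqrt_pos.2 (abs_pos.2 h1.ne')) (Finset.prod_pos fun i' hi' => ?_)
  have h2 := h₀.ne_of_quad hi (Finset.mem_erase.1 hi').1
  exact gapFactor_pos h₀.toWeakBands C (left_mem_Icc.2 (h₀.band _)) h2.1 h2.2

open MeasureTheory

/-- All factors except that of the i-th gap converge to their values at the common limit point. The
remaining factor depends on the details of the collapse and need not converge, so it is kept and
only the difference is controlled. -/
theorem LimBands.tendsto_quad {c₀ : Endpoints n} (h₀ : LimBands c₀.1 c₀.2)
    {C : Finset (Fin n)} (hC : closedGaps c₀.1 c₀.2 ⊆ C) {j : Fin (n + 1)} {i : Fin n}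
    (hi : i ∈ closedGaps c₀.1 c₀.2) (hj : c₀.1 j = c₀.1 i.succ) (hj' : c₀.2 j = c₀.1 i.succ)
    (hij : j = i.castSucc ∨ j = i.succ) :
    Tendsto (fun c : Endpoints n => gapMass c.1 c.2 (gapPoint c₀ c) C j -
      quadDensity c₀ C i * ∫ φ in (0 : ℝ)..(Real.pi / 2), 2 * gapFactor c.1 c.2 (gapPoint c₀ c) C
        (j.succAbove i) i (bandPt c.1 c.2 j φ)) (nhdsBands c₀) (𝓝 0) := by
  obtain ⟨K, hK⟩ := h₀.exists_gapDensity_le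
  have hbd : ∀ᶠ c in nhdsBands c₀, ∀ φ, gapFactor c.1 c.2 (gapPoint c₀ c) C
      (j.succAbove i) i (bandPt c.1 c.2 j φ) ≤ 1 := by
    filter_upwards [eventually_isBands c₀, eventually_gapPoint_mem h₀.toWeakBands] with c hc hg φ
    have := hc.abs_sub_le (bandPt_mem (hc.band j) φ) (hg i)
    exact gapFactor_le_one (hC hi) this.1 this.2
  have h1 := tendsto_integral_of_bounded (c₀ := c₀) (F := fun c φ =>
    gapDensity c.1 c.2 (gapPoint c₀ c) C j (bandPt c.1 c.2 j φ) - quadDensity c₀ C i *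
      (2 * gapFactor c.1 c.2 (gapPoint c₀ c) C (j.succAbove i) i (bandPt c.1 c.2 j φ)))
    (f := fun _ => 0) (K := K + quadDensity c₀ C i * 2) ?_ ?_ ?_
  · rw [intervalIntegral.integral_zero] at h1
    refine h1.congr' ?_
    filter_upwards [eventually_isBands c₀] with c hc
    have h2 := (hc.freeBand j).continuous_gapDensity (hc.band j) (gapPoint c₀ c) C
    have h3 := (hc.freeBand j).continuous_gapFactor (hc.band j) (gapPoint c₀ c) C i
    rw [intervalIntegral.integral_sub (h2.intervalIntegrable _ _)
      (Continuous.intervalIntegrable (by fun_prop) _ _), intervalIntegral.integral_const_mul]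
    rfl
  · filter_upwards [eventually_isBands c₀] with c hc
    have h2 := (hc.freeBand j).continuous_gapDensity (hc.band j) (gapPoint c₀ c) C
    have h3 := (hc.freeBand j).continuous_gapFactor (hc.band j) (gapPoint c₀ c) C i
    fun_prop
  · filter_upwards [hK, eventually_isBands c₀, hbd] with c h2 hc h3 φ
    have h4 := h2 C j (fun i hi hiS => absurd (hC hiS) hi) _ (bandPt_mem (hc.band j) φ)
    have h5 := gapDensity_nonneg (E := c.1) (O := c.2) (gapPoint c₀ c) C j (bandPt c.1 c.2 j φ)
    have h6 := h3 φ
    have h7 := gapFactor_nonneg (E := c.1) (O := c.2) (gapPoint c₀ c) C (j.succAbove i) i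
      (bandPt c.1 c.2 j φ)
    have h8 := (h₀.quadDensity_pos C hi).le
    have h9 : quadDensity c₀ C i * (2 * gapFactor c.1 c.2 (gapPoint c₀ c) C (j.succAbove i) i
      (bandPt c.1 c.2 j φ)) ≤ quadDensity c₀ C i * 2 := by
      gcongr
      linarith
    have h10 : 0 ≤ quadDensity c₀ C i * (2 * gapFactor c.1 c.2 (gapPoint c₀ c) C (j.succAbove i) i
      (bandPt c.1 c.2 j φ)) := by positivity
    exact abs_le.2 ⟨by linarith, by linarith⟩
  · intro φ _
    have hpt : bandPt c₀.1 c₀.2 j φ = c₀.1 i.succ := by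
      rw [bandPt_of_eq (hj.trans hj'.symm), hj]
    have hs : ∀ i', i' ≠ i → j.succAbove i' = i.succ.succAbove i' := by
      intro i' hi'
      rcases hij with rfl | rfl
      · exact succAbove_castSucc_eq hi'
      · rfl
    have h2 : Tendsto (fun c : Endpoints n => √|bandPt c.1 c.2 j φ| *
        ∏ i' ∈ Finset.univ.erase i, gapFactor c.1 c.2 (gapPoint c₀ c) C
          (j.succAbove i') i' (bandPt c.1 c.2 j φ)) (nhdsBands c₀) (𝓝 (quadDensity c₀ C i)) := by
      have h3 := (tendsto_bandPt c₀ j φ).abs.sqrt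
      rw [hpt] at h3
      refine h3.mul (tendsto_finsetProd _ fun i' hi' => ?_)
      have hi'' := (Finset.mem_erase.1 hi').1
      rw [hs i' hi'', ← hpt]
      have h4 := h₀.ne_of_quad hi hi''
      rw [← hpt] at h4
      exact tendsto_gapFactor h₀.toWeakBands C h4.1 h4.2
    have h3 := (h2.sub_const (quadDensity c₀ C i)).abs.const_mul 2
    rw [sub_self, abs_zero, mul_zero] at h3
    refine squeeze_zero_norm' ?_ h3
    filter_upwards [hbd] with c h4
    have h7 := gapFactor_nonneg (E := c.1) (O := c.2) (gapPoint c₀ c) C (j.succAbove i) i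
      (bandPt c.1 c.2 j φ)
    rw [gapDensity, ← Finset.mul_prod_erase _ _ (Finset.mem_univ i), Real.norm_eq_abs]
    set A := ∏ i' ∈ Finset.univ.erase i, gapFactor c.1 c.2 (gapPoint c₀ c) C
          (j.succAbove i') i' (bandPt c.1 c.2 j φ)
    set B := gapFactor c.1 c.2 (gapPoint c₀ c) C (j.succAbove i) i (bandPt c.1 c.2 j φ) with hB
    have h8 : 2 * (√|bandPt c.1 c.2 j φ| * (B * A)) - quadDensity c₀ C i * (2 * B) =
        2 * (√|bandPt c.1 c.2 j φ| * A - quadDensity c₀ C i) * B := by ring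
    rw [h8, abs_mul, abs_mul, abs_of_nonneg h7, abs_two]
    exact mul_le_of_le_one_right (by positivity) (h4 φ)

/-- By `tendsto_quad` the sum of both masses is asymptotic to `quadDensity` times the integral of
`integral_boole_add`, which equals π exactly for this choice of the gap point. -/
theorem LimBands.tendsto_gapMass_add {c₀ : Endpoints n} (h₀ : LimBands c₀.1 c₀.2)
    {C : Finset (Fin n)} (hC : closedGaps c₀.1 c₀.2 ⊆ C) {i : Fin n}
    (hi : i ∈ closedGaps c₀.1 c₀.2) (h1 : c₀.1 i.castSucc = c₀.2 i.castSucc)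
    (h2 : c₀.1 i.succ = c₀.2 i.succ) :
    Tendsto (fun c : Endpoints n => gapMass c.1 c.2 (gapPoint c₀ c) C i.castSucc +
      gapMass c.1 c.2 (gapPoint c₀ c) C i.succ) (nhdsBands c₀)
      (𝓝 (quadDensity c₀ C i * Real.pi)) := by
  have hi' := mem_closedGaps.1 hi
  have h3 := (h₀.tendsto_quad hC hi (h1.trans hi') hi' (Or.inl rfl)).add
    (h₀.tendsto_quad hC hi rfl h2.symm (Or.inr rfl))
  have h4 := h3.add_const (quadDensity c₀ C i * Real.pi)
  rw [add_zero, zero_add] at h4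
  refine h4.congr' ?_
  filter_upwards [eventually_isBands c₀] with c hc
  have hp := sub_pos.2 (hc.band_lt i.castSucc)
  have hq := sub_pos.2 (hc.band_lt i.succ)
  have hd := sub_pos.2 (hc.gap_lt i)
  set p := c.2 i.castSucc - c.1 i.castSucc with hpdef
  set q := c.2 i.succ - c.1 i.succ with hqdef
  set d := c.1 i.succ - c.2 i.castSucc with hddef
  have hγ : gapPoint c₀ c i = c.2 i.castSucc + d * (p / (p + q)) := by
    rw [gapPoint, if_pos hi']
  have hpq : 0 < p + q := by linarith
  have hr : p / (p + q) < 1 := by rw [div_lt_one hpq]; linarith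
  have hr0 : 0 < p / (p + q) := by positivity
  have hdr : d * (p / (p + q)) < d := mul_lt_of_lt_one_right hd hr
  have hdr0 : 0 < d * (p / (p + q)) := by positivity
  have h5 := integral_boole_add (c₀ := c.1 i.castSucc) (c₁ := c.2 i.castSucc) (c₂ := c.1 i.succ)
    (c₃ := c.2 i.succ) (γ := gapPoint c₀ c i) (hc.band_lt _) (by rw [hγ]; linarith)
    -- With lengths p, q of the bands, gap width d and γ at the fraction r of the gap, the condition
    -- reads p (1 - r) = r q; this is the origin of r = p / (p + q) in `gapPoint`.
    (by rw [hγ]; linarith) (hc.band_lt _) (by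
      have e1 : c.1 i.castSucc = c.2 i.castSucc - p := by linarith
      have e2 : c.1 i.succ = c.2 i.castSucc + d := by linarith
      have e3 : c.2 i.succ = c.2 i.castSucc + d + q := by linarith
      rw [hγ, e1, e2, e3]
      field_simp
      ring)
  have h6 : (∫ φ in (0 : ℝ)..(Real.pi / 2), 2 * gapFactor c.1 c.2 (gapPoint c₀ c) C
        (i.castSucc.succAbove i) i (bandPt c.1 c.2 i.castSucc φ)) +
      (∫ φ in (0 : ℝ)..(Real.pi / 2), 2 * gapFactor c.1 c.2 (gapPoint c₀ c) C
        (i.succ.succAbove i) i (bandPt c.1 c.2 i.succ φ)) = Real.pi := by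
    simp only [gapFactor, if_pos (hC hi), Fin.succAbove_castSucc_self, Fin.succAbove_succ_self,
      bandPt]
    exact h5
  linear_combination (-quadDensity c₀ C i) * h6

end EllipsoidBilliard

/-! ### Existence of the limit of the frequency -/

namespace EllipsoidBilliard

variable {n : ℕ}

/-- The `i`-th gap collapses together with both bands next to it. -/
def IsQuad (c₀ : Endpoints n) (i : Fin n) : Prop :=
  i ∈ closedGaps c₀.1 c₀.2 ∧ c₀.1 i.castSucc = c₀.2 i.castSucc ∧ c₀.1 i.succ = c₀.2 i.succ

/-- A collapsed band between two closed gaps would make both gaps sit at the same point, contrary to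
`sep`. Hence the pairs of bands collapsing together are disjoint. -/
theorem LimBands.castSucc_ne_succ {c₀ : Endpoints n} (h₀ : LimBands c₀.1 c₀.2) {i i' : Fin n}
    (hi : IsQuad c₀ i) (hi' : i' ∈ closedGaps c₀.1 c₀.2) : i.castSucc ≠ i'.succ := by
  intro h
  have h1 : i' < i := by
    have := congrArg Fin.val h
    rw [Fin.lt_def]
    simp at this
    omega
  have h2 := h₀.sep _ _ h1
  have h3 := mem_closedGaps.1 hi.1
  have h4 := mem_closedGaps.1 hi'
  have h5 := hi.2.1
  rw [h] at h3 h5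
  linarith

open Classical in
/-- The other band of a pair of bands collapsing together. -/
noncomputable def partner (c₀ : Endpoints n) (j : Fin (n + 1)) : Fin (n + 1) :=
  if h : ∃ i, IsQuad c₀ i ∧ i.castSucc = j then h.choose.succ
  else if h : ∃ i, IsQuad c₀ i ∧ i.succ = j then h.choose.castSucc
  else j

theorem partner_castSucc {c₀ : Endpoints n} {i : Fin n} (hi : IsQuad c₀ i) :
    partner c₀ i.castSucc = i.succ := by
  have h : ∃ k, IsQuad c₀ k ∧ k.castSucc = i.castSucc := ⟨i, hi, rfl⟩
  rw [partner, dif_pos h, Fin.castSucc_injective _ h.choose_spec.2]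

theorem LimBands.partner_succ {c₀ : Endpoints n} (h₀ : LimBands c₀.1 c₀.2) {i : Fin n}
    (hi : IsQuad c₀ i) : partner c₀ i.succ = i.castSucc := by
  have h : ∃ k, IsQuad c₀ k ∧ k.succ = i.succ := ⟨i, hi, rfl⟩
  rw [partner, dif_neg, dif_pos h, Fin.succ_injective _ h.choose_spec.2]
  rintro ⟨k, hk, hki⟩
  exact h₀.castSucc_ne_succ hk hi.1 hki

theorem partner_of_forall {c₀ : Endpoints n} {j : Fin (n + 1)}
    (h : ∀ i, IsQuad c₀ i → i.castSucc ≠ j ∧ i.succ ≠ j) : partner c₀ j = j := by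
  rw [partner, dif_neg, dif_neg]
  · rintro ⟨k, hk, hkj⟩
    exact (h k hk).2 hkj
  · rintro ⟨k, hk, hkj⟩
    exact (h k hk).1 hkj

theorem LimBands.partner_partner {c₀ : Endpoints n} (h₀ : LimBands c₀.1 c₀.2) (j : Fin (n + 1)) :
    partner c₀ (partner c₀ j) = j := by
  by_cases h : ∀ i, IsQuad c₀ i → i.castSucc ≠ j ∧ i.succ ≠ j
  · rw [partner_of_forall h, partner_of_forall h]
  · push Not at h
    obtain ⟨i, hi, hij⟩ := h
    by_cases h1 : i.castSucc = j
    · rw [← h1, partner_castSucc hi, h₀.partner_succ hi]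
    · rw [← hij h1, h₀.partner_succ hi, partner_castSucc hi]

/-- Reindexing by the involution `partner` shows that averaging over partners does not change a sum
whose weights agree on partners. -/
theorem LimBands.sum_partner {c₀ : Endpoints n} (h₀ : LimBands c₀.1 c₀.2)
    {x : Fin (n + 1) → ℝ} (hx : ∀ i, IsQuad c₀ i → x i.castSucc = x i.succ) (y : Fin (n + 1) → ℝ) :
    ∑ j, x j * ((y j + y (partner c₀ j)) / 2) = ∑ j, x j * y j := by
  have hinv : Function.Involutive (partner c₀) := h₀.partner_partner
  have h1 : ∑ j, x j * y (partner c₀ j) = ∑ j, x j * y j := by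
    refine (Fintype.sum_equiv hinv.toPerm _ _ fun j => ?_)
    simp only [Function.Involutive.coe_toPerm]
    congr 1
    by_cases h : ∀ i, IsQuad c₀ i → i.castSucc ≠ j ∧ i.succ ≠ j
    · rw [partner_of_forall h]
    · push Not at h
      obtain ⟨i, hi, hij⟩ := h
      by_cases h1 : i.castSucc = j
      · rw [← h1, partner_castSucc hi, hx i hi]
      · rw [← hij h1, h₀.partner_succ hi, hx i hi]
  have h2 : ∀ j, x j * ((y j + y (partner c₀ j)) / 2) =
      (x j * y j) / 2 + (x j * y (partner c₀ j)) / 2 := fun j => by ring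
  simp_rw [h2]
  rw [Finset.sum_add_distrib, ← Finset.sum_div, ← Finset.sum_div, h1, add_halves]

/-- The mass of a band, averaged over bands collapsing together. -/
noncomputable def meanMass (c₀ : Endpoints n) (C : Finset (Fin n)) (j : Fin (n + 1))
    (c : Endpoints n) : ℝ :=
  (gapMass c.1 c.2 (gapPoint c₀ c) C j + gapMass c.1 c.2 (gapPoint c₀ c) C (partner c₀ j)) / 2

/-- A band of a collapsing pair has half of the joint limit mass. Otherwise, an open band has a
positive limit; a collapsed band between open gaps has as limit its mass at the point, which can
vanish only for `j = 0`; and a collapsed band at a closed gap, whose other neighbour is then open,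
has limit 0. -/
theorem LimBands.exists_tendsto_meanMass {c₀ : Endpoints n} (h₀ : LimBands c₀.1 c₀.2)
    [(nhdsBands c₀).NeBot] {C : Finset (Fin n)} (hC : closedGaps c₀.1 c₀.2 ⊆ C) (j : Fin (n + 1)) :
    ∃ Φ : ℝ, 0 ≤ Φ ∧ Tendsto (meanMass c₀ C j) (nhdsBands c₀) (𝓝 Φ) ∧
      (j ≠ 0 → (∀ i ∈ closedGaps c₀.1 c₀.2, c₀.1 j = c₀.2 j →
        ¬(i.succ = j ∧ c₀.1 i.castSucc < c₀.2 i.castSucc ∨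
          i.castSucc = j ∧ c₀.1 i.succ < c₀.2 i.succ)) → Φ ≠ 0) ∧
      (c₀.1 j < c₀.2 j → Φ ≠ 0) := by
  by_cases h : ∀ i, IsQuad c₀ i → i.castSucc ≠ j ∧ i.succ ≠ j
  · have hm : meanMass c₀ C j = fun c => gapMass c.1 c.2 (gapPoint c₀ c) C j := by
      funext c
      rw [meanMass, partner_of_forall h, add_self_div_two]
    rw [hm]
    by_cases h1 : c₀.1 j < c₀.2 j
    · have hne : ∀ φ ∈ Ioo 0 (Real.pi / 2), ∀ i : Fin n, c₀.1 (j.succAbove i) ≠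
          bandPt c₀.1 c₀.2 j φ ∧ c₀.2 (j.succAbove i) ≠ bandPt c₀.1 c₀.2 j φ :=
        fun φ hφ i => h₀.ne_of_mem_Ioo (bandPt_mem_Ioo h1 hφ) i
      have hpos := h₀.gapMass_pos hC hne fun φ hφ =>
        ((h₀.nonneg j).trans_lt (bandPt_mem_Ioo h1 hφ).1).ne'
      exact ⟨_, gapMass_nonneg _ _ _, h₀.tendsto_gapMass hC hne, fun _ _ => hpos.ne',
        fun _ => hpos.ne'⟩
    have h1 : c₀.1 j = c₀.2 j := le_antisymm (h₀.band j) (not_lt.1 h1)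
    by_cases h2 : ∀ i : Fin n, i.castSucc = j ∨ i.succ = j → i ∉ closedGaps c₀.1 c₀.2
    · have hf : FreeBand c₀.1 c₀.2 j := FreeBand.of_gaps h₀.toWeakBands fun i hi =>
        lt_of_le_of_ne (h₀.gap i) (mt mem_closedGaps.2 (h2 i hi))
      have hne : ∀ φ ∈ Ioo 0 (Real.pi / 2), ∀ i : Fin n, c₀.1 (j.succAbove i) ≠
          bandPt c₀.1 c₀.2 j φ ∧ c₀.2 (j.succAbove i) ≠ bandPt c₀.1 c₀.2 j φ :=
        fun φ _ i => hf.ne (bandPt_mem (h₀.band j) φ) i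
      refine ⟨_, gapMass_nonneg _ _ _, h₀.tendsto_gapMass hC hne, fun hj _ => ?_,
        fun h3 => absurd h1 h3.ne⟩
      refine (h₀.gapMass_pos hC hne fun φ _ => ?_).ne'
      obtain ⟨k, rfl⟩ := Fin.exists_succ_eq.2 hj
      exact ((h₀.pos k).trans_le (bandPt_mem (h₀.band _) φ).1).ne'
    · push Not at h2
      obtain ⟨i, hij, hi⟩ := h2
      have hk : i.succ = j ∧ c₀.1 i.castSucc < c₀.2 i.castSucc ∨
          i.castSucc = j ∧ c₀.1 i.succ < c₀.2 i.succ := by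
        rcases hij with rfl | rfl
        · refine Or.inr ⟨rfl, lt_of_le_of_ne (h₀.band _) fun h3 => ?_⟩
          exact (h i ⟨hi, h1, h3⟩).1 rfl
        · refine Or.inl ⟨rfl, lt_of_le_of_ne (h₀.band _) fun h3 => ?_⟩
          exact (h i ⟨hi, h3, h1⟩).2 rfl
      exact ⟨0, le_rfl, h₀.tendsto_gapMass_zero hC hi h1 hk, fun _ h3 => absurd hk (h3 i hi h1),
        fun h3 => absurd h1 h3.ne⟩
  · push Not at h
    obtain ⟨i, hi, hij⟩ := h
    have hpos := mul_pos (h₀.quadDensity_pos C hi.1) Real.pi_pos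
    have ht := (h₀.tendsto_gapMass_add hC hi.1 hi.2.1 hi.2.2).div_const 2
    have hm : meanMass c₀ C j = fun c => (gapMass c.1 c.2 (gapPoint c₀ c) C i.castSucc +
        gapMass c.1 c.2 (gapPoint c₀ c) C i.succ) / 2 := by
      funext c
      by_cases h1 : i.castSucc = j
      · rw [meanMass, ← h1, partner_castSucc hi]
      · rw [meanMass, ← hij h1, h₀.partner_succ hi, add_comm]
    rw [hm]
    exact ⟨_, by positivity, ht, fun _ _ => by positivity, fun _ => by positivity⟩

theorem IsBands.sum_gapMass {E O : Fin (n + 1) → ℝ} (h : IsBands E O) {g : Fin n → ℝ}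
    (hg : ∀ i, g i ∈ Icc (O i.castSucc) (E i.succ)) {C : Finset (Fin n)} (hC : C ≠ Finset.univ) :
    ∑ j : Fin (n + 1), (-1) ^ (j : ℕ) * extendedFrequency E O j *
      (gapSign C j * gapMass E O g C j) = 0 := by
  rw [← h.isKernel.poly (gapPoly_natDegree g hC)]
  refine Finset.sum_congr rfl fun j _ => ?_
  rw [← h.gapMass_eq hg, ← mul_assoc (gapSign C j), gapSign_mul_self, one_mul]

theorem LimBands.sum_of_tendsto {c₀ : Endpoints n} (h₀ : LimBands c₀.1 c₀.2)
    {C : Finset (Fin n)} (hC : closedGaps c₀.1 c₀.2 ⊆ C) (hCu : C ≠ Finset.univ)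
    {Φ : Fin (n + 1) → ℝ} (hΦ : ∀ j, Tendsto (meanMass c₀ C j) (nhdsBands c₀) (𝓝 (Φ j)))
    (U : Ultrafilter (Endpoints n)) (hU : ↑U ≤ nhdsBands c₀) {v : Fin (n + 1) → ℝ}
    (hv : Tendsto (fun c : Endpoints n => extendedFrequency c.1 c.2) U (𝓝 v))
    (hS : ∀ i ∈ closedGaps c₀.1 c₀.2, v i.castSucc = v i.succ) :
    ∑ j : Fin (n + 1), (-1) ^ (j : ℕ) * v j * (gapSign C j * Φ j) = 0 := by
  obtain ⟨K, hK⟩ := h₀.exists_gapMass_le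
  have h1 : Tendsto (fun c => ∑ j : Fin (n + 1), (-1) ^ (j : ℕ) * v j *
      (gapSign C j * meanMass c₀ C j c)) U
      (𝓝 (∑ j : Fin (n + 1), (-1) ^ (j : ℕ) * v j * (gapSign C j * Φ j))) :=
    tendsto_finsetSum _ fun j _ => (((hΦ j).mono_left hU).const_mul _).const_mul _
  have h2 : Tendsto (fun c : Endpoints n => ∑ j : Fin (n + 1), (-1) ^ (j : ℕ) *
      (v j - extendedFrequency c.1 c.2 j) *
      (gapSign C j * gapMass c.1 c.2 (gapPoint c₀ c) C j)) U (𝓝 0) := by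
    rw [← Finset.sum_const_zero (s := (Finset.univ : Finset (Fin (n + 1))))]
    refine tendsto_finsetSum _ fun j _ => ?_
    have h3 := ((tendsto_pi_nhds.1 hv j).const_sub (v j)).abs.mul_const K
    rw [sub_self, abs_zero, zero_mul] at h3
    refine squeeze_zero_norm' ?_ h3
    filter_upwards [hU hK] with c h4
    have h5 := h4 C j fun i hi hiS => absurd (hC hiS) hi
    have h6 := gapMass_nonneg (E := c.1) (O := c.2) (gapPoint c₀ c) C j
    have h7 : |gapSign C j| = 1 := by
      rcases gapSign_eq_or C j with h | h <;> rw [h] <;> simp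
    rw [Real.norm_eq_abs, abs_mul, abs_mul, abs_mul, abs_pow, abs_neg, abs_one, one_pow, one_mul,
      h7, one_mul, abs_of_nonneg h6]
    gcongr
  refine tendsto_nhds_unique h1 (h2.congr' ?_)
  filter_upwards [hU (eventually_isBands c₀), hU (eventually_gapPoint_mem h₀.toWeakBands)]
    with c hc hg
  have h3 := hc.sum_gapMass hg hCu
  -- Across a gap in `C` both `gapSign` and the alternating sign change, and `v` takes the same
  -- value on both sides, so the weights of the two partners agree.
  have h4 := h₀.sum_partner (x := fun j => (-1) ^ (j : ℕ) * v j * gapSign C j) (fun i hi => by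
    rw [gapSign_castSucc, if_pos (hC hi.1), hS i hi.1]
    simp only [Fin.val_castSucc, Fin.val_succ, pow_succ]
    ring) fun j => gapMass c.1 c.2 (gapPoint c₀ c) C j
  simp only [mul_assoc] at h3 h4 ⊢
  simp only [meanMass]
  rw [h4, ← sub_zero (∑ j : Fin (n + 1), (-1) ^ (j : ℕ) * (v j * _)), ← h3,
    ← Finset.sum_sub_distrib]
  exact Finset.sum_congr rfl fun j _ => by ring

/-- Uniqueness of the limits of the frequency. -/
theorem LimBands.eq_of_tendsto {c₀ : Endpoints n} (h₀ : LimBands c₀.1 c₀.2)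
    (U U' : Ultrafilter (Endpoints n)) (hU : ↑U ≤ nhdsBands c₀) (hU' : ↑U' ≤ nhdsBands c₀)
    {v v' : Fin (n + 1) → ℝ}
    (hv : Tendsto (fun c : Endpoints n => extendedFrequency c.1 c.2) U (𝓝 v))
    (hv' : Tendsto (fun c : Endpoints n => extendedFrequency c.1 c.2) U' (𝓝 v')) : v = v' := by
  have : (nhdsBands c₀).NeBot := NeBot.mono U.neBot hU
  have hS : ∀ (U : Ultrafilter (Endpoints n)), ↑U ≤ nhdsBands c₀ → ∀ v : Fin (n + 1) → ℝ,
      Tendsto (fun c : Endpoints n => extendedFrequency c.1 c.2) U (𝓝 v) →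
      ∀ i ∈ closedGaps c₀.1 c₀.2, v i.castSucc = v i.succ := by
    intro U hU v hv i hi
    have h1 := (tendsto_pi_nhds.1 hv i.succ).sub (tendsto_pi_nhds.1 hv i.castSucc)
    have h2 := tendsto_nhds_unique h1 ((h₀.tendsto_sub hi).mono_left hU)
    linarith
  have hzero : ∀ (U : Ultrafilter (Endpoints n)) (v : Fin (n + 1) → ℝ),
      Tendsto (fun c : Endpoints n => extendedFrequency c.1 c.2) U (𝓝 v) → v 0 = 1 / 2 := by
    intro U v hv
    refine tendsto_nhds_unique (tendsto_pi_nhds.1 hv 0) ?_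
    simp only [extendedFrequency, Fin.cons_zero]
    exact tendsto_const_nhds
  choose Φ hΦ using fun (j : Fin (n + 1)) (C : Finset (Fin n)) (hC : closedGaps c₀.1 c₀.2 ⊆ C) =>
    h₀.exists_tendsto_meanMass hC j
  have hd := eq_zero_of_alternating_sums (closedGaps c₀.1 c₀.2)
    (fun j C => if hC : closedGaps c₀.1 c₀.2 ⊆ C then Φ j C hC else 0) ?_ (fun j => v j - v' j) ?_ ?_ ?_ ?_
  · funext j
    exact sub_eq_zero.1 (congrFun hd j)
  · intro j C hC
    simp only [dif_pos hC]
    exact (hΦ j C hC).1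
  · simp [hzero U v hv, hzero U' v' hv']
  · intro i hi
    rw [hS U hU v hv i hi, hS U' hU' v' hv' i hi]
  · intro j hj
    have hj0 : j ≠ 0 := by
      rintro rfl
      simp [hzero U v hv, hzero U' v' hv'] at hj
    -- If the mass of the band `j` disappears in the limit, the open band across the closed gap has
    -- the same value of `v` and nonzero mass.
    by_cases h : ∃ i ∈ closedGaps c₀.1 c₀.2, c₀.1 j = c₀.2 j ∧
        (i.succ = j ∧ c₀.1 i.castSucc < c₀.2 i.castSucc ∨
          i.castSucc = j ∧ c₀.1 i.succ < c₀.2 i.succ)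
    · obtain ⟨i, hi, hjj, ⟨rfl, h2⟩ | ⟨rfl, h2⟩⟩ := h
      · refine ⟨i.castSucc, ?_, fun C hC => ?_⟩
        · rw [hS U hU v hv i hi, hS U' hU' v' hv' i hi]
        · simp only [dif_pos hC]
          exact (hΦ _ C hC).2.2.2 h2
      · refine ⟨i.succ, ?_, fun C hC => ?_⟩
        · rw [hS U hU v hv i hi, hS U' hU' v' hv' i hi]
        · simp only [dif_pos hC]
          exact (hΦ _ C hC).2.2.2 h2
    · push Not at h
      refine ⟨j, rfl, fun C hC => ?_⟩
      simp only [dif_pos hC]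
      refine (hΦ j C hC).2.2.1 hj0 fun i hi hjj h3 => ?_
      have h4 := h i hi hjj
      rcases h3 with h3 | h3
      · exact (h4.1 h3.1).not_gt h3.2
      · exact (h4.2 h3.1).not_gt h3.2
  · intro C hC hCu
    have h1 := h₀.sum_of_tendsto hC hCu (fun j => (hΦ j C hC).2.1) U hU hv (hS U hU v hv)
    have h2 := h₀.sum_of_tendsto hC hCu (fun j => (hΦ j C hC).2.1) U' hU' hv' (hS U' hU' v' hv')
    simp only [dif_pos hC]
    rw [← sub_zero (0 : ℝ)]
    nth_rewrite 1 [← h1]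
    rw [← h2, ← Finset.sum_sub_distrib]
    exact Finset.sum_congr rfl fun j _ => by ring

/-- The frequency has a limit at every admissible limit system of bands. -/
theorem LimBands.exists_tendsto {c₀ : Endpoints n} (h₀ : LimBands c₀.1 c₀.2) :
    ∃ v : Fin (n + 1) → ℝ,
      Tendsto (fun c : Endpoints n => extendedFrequency c.1 c.2) (nhdsBands c₀) (𝓝 v) := by
  rcases (nhdsBands c₀).eq_or_neBot with h | h
  · exact ⟨0, by rw [h]; exact tendsto_bot⟩
  have hK : IsCompact (Set.pi univ fun _ : Fin (n + 1) => Icc (0 : ℝ) (1 / 2)) :=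
    isCompact_univ_pi fun _ => isCompact_Icc
  have hmem : ∀ᶠ c in nhdsBands c₀, extendedFrequency c.1 c.2 ∈
      Set.pi univ fun _ : Fin (n + 1) => Icc (0 : ℝ) (1 / 2) :=
    (eventually_isBands c₀).mono fun c hc j _ => hc.extendedFrequency_mem j
  -- By compactness there is a cluster point in the cube, and convergence follows from its
  -- uniqueness.
  obtain ⟨v, -, hv⟩ := hK.exists_mapClusterPt (tendsto_principal.2 hmem)
  refine ⟨v, ?_⟩
  refine hK.le_nhds_of_unique_clusterPt hmem fun v' _ hv' => ?_
  rw [← MapClusterPt, mapClusterPt_iff_ultrafilter] at hv'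
  obtain ⟨U, hU, hUv⟩ := mapClusterPt_iff_ultrafilter.1 hv
  obtain ⟨U', hU', hUv'⟩ := hv'
  exact h₀.eq_of_tendsto U' U hU' hU hUv' hUv

end EllipsoidBilliard

/-! ### The closure of the caustic space and the extended frequency map -/

namespace EllipsoidBilliard

variable {n : ℕ}

/-- The closure of the nonsingular caustic space. -/
def weakCaustics (a : Fin (n + 1) → ℝ) : Set (Fin n → ℝ) :=
  {x | Monotone x ∧ ∀ i, withZero a i.castSucc.castSucc ≤ x i ∧ x i ≤ a i.succ}

theorem withZero_mono {a : Fin (n + 1) → ℝ} (ha : StrictMono a) (ha0 : ∀ i, 0 < a i) :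
    StrictMono (withZero a) := by
  refine Fin.strictMono_iff_lt_succ.2 fun i => ?_
  refine Fin.cases ?_ (fun k => ?_) i
  · simpa [withZero] using ha0 0
  · simp only [withZero, Fin.cons_succ, ← Fin.succ_castSucc]
    exact ha Fin.castSucc_lt_succ

theorem withZero_lt {a : Fin (n + 1) → ℝ} (ha : StrictMono a) (ha0 : ∀ i, 0 < a i) (i : Fin n) :
    withZero a i.castSucc.castSucc < a i.castSucc := by
  have h := withZero_mono ha ha0 (show i.castSucc.castSucc < i.castSucc.succ from
    Fin.castSucc_lt_succ)
  simpa [withZero] using h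

theorem isClosed_weakCaustics (a : Fin (n + 1) → ℝ) : IsClosed (weakCaustics a) := by
  have h1 : weakCaustics a = (⋂ (i) (j) (_ : i ≤ j), {x : Fin n → ℝ | x i ≤ x j}) ∩
      ⋂ i, ({x : Fin n → ℝ | withZero a i.castSucc.castSucc ≤ x i} ∩ {x | x i ≤ a i.succ}) := by
    ext x
    simp [weakCaustics, Monotone]
  rw [h1]
  refine IsClosed.inter ?_ (isClosed_iInter fun i => IsClosed.inter ?_ ?_)
  · exact isClosed_iInter fun i => isClosed_iInter fun j => isClosed_iInter fun _ =>
      isClosed_le (continuous_apply i) (continuous_apply j)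
  · exact isClosed_le continuous_const (continuous_apply i)
  · exact isClosed_le (continuous_apply i) continuous_const

theorem causticSpace_subset_weakCaustics {a : Fin (n + 1) → ℝ} (ha : StrictMono a)
    (ha0 : ∀ i, 0 < a i) : causticSpace a ⊆ weakCaustics a := by
  rintro x ⟨h1, -, h3⟩
  refine ⟨h1.monotone, fun i => ?_⟩
  have h4 := withZero_lt ha ha0 i
  have h5 : a i.castSucc < a i.succ := ha Fin.castSucc_lt_succ
  rcases h3 i with h | h
  · exact ⟨h.1.le, by linarith [h.2]⟩
  · exact ⟨by linarith [h.1], h.2.le⟩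

theorem closure_subset_weakCaustics {a : Fin (n + 1) → ℝ} (ha : StrictMono a)
    (ha0 : ∀ i, 0 < a i) : closure (causticSpace a) ⊆ weakCaustics a :=
  closure_minimal (causticSpace_subset_weakCaustics ha ha0) (isClosed_weakCaustics a)

theorem mem_causticSpace_of_lt {a : Fin (n + 1) → ℝ} {x : Fin n → ℝ} (ha0 : ∀ i, 0 < a i)
    (h1 : StrictMono x) (h2 : ∀ i, withZero a i.castSucc.castSucc < x i ∧ x i < a i.succ)
    (h3 : ∀ i, x i ≠ a i.castSucc) : x ∈ causticSpace a := by
  refine ⟨h1, fun i => ?_, fun i => ?_⟩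
  · have h4 : 0 ≤ withZero a i.castSucc.castSucc := by
      refine Fin.cases ?_ (fun k => ?_) i.castSucc.castSucc
      · simp [withZero]
      · simpa [withZero] using (ha0 k).le
    linarith [(h2 i).1]
  · rcases (h3 i).lt_or_gt with h | h
    · exact Or.inl ⟨(h2 i).1, h⟩
    · exact Or.inr ⟨h, (h2 i).2⟩

/-- A generic point in the interior of the convex hull of the caustic space. -/
noncomputable def gapCenter (a : Fin (n + 1) → ℝ) (i : Fin n) : ℝ := (a i.castSucc + a i.succ) / 2

theorem gapCenter_mem {a : Fin (n + 1) → ℝ} (ha : StrictMono a) (i : Fin n) :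
    a i.castSucc < gapCenter a i ∧ gapCenter a i < a i.succ := by
  have h5 : a i.castSucc < a i.succ := ha Fin.castSucc_lt_succ
  unfold gapCenter
  constructor <;> linarith

theorem strictMono_gapCenter {a : Fin (n + 1) → ℝ} (ha : StrictMono a) :
    StrictMono (gapCenter a) := by
  intro i j hij
  have h1 : a i.succ ≤ a j.castSucc :=
    ha.monotone (Fin.castSucc_lt_iff_succ_le.1 (Fin.castSucc_lt_castSucc_iff.2 hij))
  linarith [(gapCenter_mem ha i).2, (gapCenter_mem ha j).1]

/-- The points on the segment from `x` to `μ`. -/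
def segPt (x μ : Fin n → ℝ) (ε : ℝ) : Fin n → ℝ := fun i => (1 - ε) * x i + ε * μ i

theorem tendsto_segPt (x μ : Fin n → ℝ) : Tendsto (segPt x μ) (𝓝[>] 0) (𝓝 x) := by
  refine Tendsto.mono_left ?_ nhdsWithin_le_nhds
  have h : Continuous (segPt x μ) := by
    unfold segPt
    fun_prop
  have h1 := h.tendsto 0
  have h2 : segPt x μ 0 = x := by
    funext i
    simp [segPt]
  rwa [h2] at h1

theorem segPt_strictMono {x μ : Fin n → ℝ} (hx : Monotone x) (hμ : StrictMono μ) {ε : ℝ}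
    (hε : ε ∈ Ioo (0 : ℝ) 1) : StrictMono (segPt x μ ε) := by
  intro i j hij
  have h1 := hx hij.le
  have h2 := hμ hij
  have h3 : 0 ≤ 1 - ε := by linarith [hε.2]
  exact add_lt_add_of_le_of_lt (mul_le_mul_of_nonneg_left h1 h3) (mul_lt_mul_of_pos_left h2 hε.1)

theorem eventually_segPt_ne {x μ : Fin n → ℝ} {i : Fin n} {b : ℝ} (hμ : μ i ≠ b) :
    ∀ᶠ ε in 𝓝[>] (0 : ℝ), segPt x μ ε i ≠ b := by
  by_cases hx : x i = b
  · filter_upwards [self_mem_nhdsWithin] with ε hε h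
    have hε : 0 < ε := hε
    have h1 : ε * (μ i - b) = 0 := by
      rw [segPt, hx] at h
      linear_combination h
    exact (mul_ne_zero hε.ne' (sub_ne_zero.2 hμ)) h1
  · exact ((continuous_apply i).continuousAt.tendsto.comp (tendsto_segPt x μ)).eventually_ne hx

theorem segPt_lt {x μ : Fin n → ℝ} {i : Fin n} {p q : ℝ} (hx : p ≤ x i ∧ x i ≤ q)
    (hμ : p < μ i ∧ μ i < q) {ε : ℝ} (hε : ε ∈ Ioo (0 : ℝ) 1) :
    p < segPt x μ ε i ∧ segPt x μ ε i < q := by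
  have h3 : 0 ≤ 1 - ε := by linarith [hε.2]
  have h4 := mul_le_mul_of_nonneg_left hx.1 h3
  have h5 := mul_le_mul_of_nonneg_left hx.2 h3
  have h6 := mul_lt_mul_of_pos_left hμ.1 hε.1
  have h7 := mul_lt_mul_of_pos_left hμ.2 hε.1
  unfold segPt
  constructor <;> linarith

theorem eventually_mem_Ioo : ∀ᶠ ε in 𝓝[>] (0 : ℝ), ε ∈ Ioo (0 : ℝ) 1 :=
  Ioo_mem_nhdsGT one_pos

/-- Moving a little towards the generic point `gapCenter` makes all weak inequalities strict, and a
coordinate equal to the forbidden value `a i` leaves it at once. -/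
theorem weakCaustics_subset_closure {a : Fin (n + 1) → ℝ} (ha : StrictMono a)
    (ha0 : ∀ i, 0 < a i) : weakCaustics a ⊆ closure (causticSpace a) := by
  intro x hx
  refine mem_closure_of_tendsto (tendsto_segPt x (gapCenter a)) ?_
  have h1 : ∀ᶠ ε in 𝓝[>] (0 : ℝ), ∀ i, segPt x (gapCenter a) ε i ≠ a i.castSucc :=
    eventually_all.2 fun i => eventually_segPt_ne (gapCenter_mem ha i).1.ne'
  filter_upwards [h1, eventually_mem_Ioo] with ε h2 hε
  refine mem_causticSpace_of_lt ha0 (segPt_strictMono hx.1 (strictMono_gapCenter ha) hε)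
    (fun i => segPt_lt (hx.2 i) ⟨?_, (gapCenter_mem ha i).2⟩ hε) h2
  exact (withZero_lt ha ha0 i).trans (gapCenter_mem ha i).1

theorem closure_causticSpace {a : Fin (n + 1) → ℝ} (ha : StrictMono a) (ha0 : ∀ i, 0 < a i) :
    closure (causticSpace a) = weakCaustics a :=
  (closure_subset_weakCaustics ha ha0).antisymm (weakCaustics_subset_closure ha ha0)

theorem le_of_mem_weakCaustics {a : Fin (n + 1) → ℝ} {x : Fin n → ℝ} (hx : x ∈ weakCaustics a)
    (i k : Fin n) (h : (i : ℕ) + 1 ≤ k) (ha : StrictMono a) : a i.castSucc ≤ x k := by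
  have h1 := (hx.2 k).1
  refine le_trans ?_ h1
  have h2 : k.castSucc.castSucc ≠ (0 : Fin (n + 2)) := by
    intro h0
    have := congrArg Fin.val h0
    simp at this
    omega
  obtain ⟨k', hk'⟩ := Fin.exists_succ_eq.2 h2
  have h3 := congrArg Fin.val hk'
  simp at h3
  rw [← hk']
  simp only [withZero, Fin.cons_succ]
  refine ha.monotone ?_
  rw [Fin.le_def]
  simp
  omega

theorem nonneg_of_mem_weakCaustics {a : Fin (n + 1) → ℝ} (ha0 : ∀ i, 0 < a i) {x : Fin n → ℝ}
    (hx : x ∈ weakCaustics a) (i : Fin n) : 0 ≤ x i := by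
  refine le_trans ?_ (hx.2 i).1
  refine Fin.cases ?_ (fun k => ?_) i.castSucc.castSucc
  · simp [withZero]
  · simpa [withZero] using (ha0 k).le

theorem mem_weakCaustics_of {a : Fin (n + 1) → ℝ} {x : Fin n → ℝ}
    (h1 : Monotone x) (h0 : ∀ i, 0 ≤ x i) (h2 : ∀ i k : Fin n, (i : ℕ) + 1 = k → a i.castSucc ≤ x k)
    (h3 : ∀ i : Fin n, x i ≤ a i.succ) : x ∈ weakCaustics a := by
  refine ⟨h1, fun k => ⟨?_, h3 k⟩⟩
  rcases Nat.eq_zero_or_pos (k : ℕ) with h | h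
  · have : k.castSucc.castSucc = (0 : Fin (n + 2)) := by
      ext
      simp [h]
    rw [this]
    simpa [withZero] using h0 k
  · let i : Fin n := ⟨k - 1, by omega⟩
    have : k.castSucc.castSucc = i.castSucc.succ := by
      ext
      simp [i]
      omega
    rw [this]
    simp only [withZero, Fin.cons_succ]
    exact h2 i k (by simp [i]; omega)

/-- Each closed gap [min (aᵢ, λᵢ), max (aᵢ, λᵢ)] contains its own aᵢ, and these are distinct;
therefore two gaps cannot collapse to the same point, which is `sep`. -/
theorem limBands_of_mem {a : Fin (n + 1) → ℝ} {x : Fin n → ℝ} (ha : StrictMono a)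
    (ha0 : ∀ i, 0 < a i) (hx : x ∈ weakCaustics a) : LimBands (cEven a x) (cOdd a x) where
  zero := rfl
  band j := by
    refine Fin.cases ?_ (fun i => ?_) j
    · refine Fin.lastCases (motive := fun j => j = 0 → cEven a x j ≤ cOdd a x j)
        ?_ (fun k => ?_) (0 : Fin (n + 1)) rfl
      · intro h0
        rw [h0]
        simp only [cEven, Fin.cons_zero]
        rw [← h0]
        simpa [cOdd] using (ha0 _).le
      · intro h0
        simp only [cOdd, Fin.snoc_castSucc]
        rw [h0]
        simp only [cEven, Fin.cons_zero]
        exact le_min (ha0 _).le (nonneg_of_mem_weakCaustics ha0 hx k)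
    · refine Fin.lastCases (motive := fun j => j = i.succ → cEven a x j ≤ cOdd a x j)
        ?_ (fun k => ?_) i.succ rfl
      · intro h0
        rw [h0]
        simp only [cEven, Fin.cons_succ]
        rw [← h0]
        simp only [cOdd, Fin.snoc_last]
        rw [h0]
        exact max_le (ha Fin.castSucc_lt_succ).le (hx.2 i).2
      · intro h0
        simp only [cOdd, Fin.snoc_castSucc]
        rw [h0]
        simp only [cEven, Fin.cons_succ]
        have hik : (i : ℕ) + 1 = k := by
          have := congrArg Fin.val h0
          simp at this
          omega
        refine max_le (le_min (ha Fin.castSucc_lt_succ).le (le_of_mem_weakCaustics hx i k hik.le ha))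
          (le_min (hx.2 i).2 (hx.1 ?_))
        rw [Fin.le_def]
        omega
  gap i := by
    simp only [cEven, cOdd, Fin.snoc_castSucc, Fin.cons_succ]
    exact min_le_max
  pos i := by
    simp only [cEven, Fin.cons_succ]
    exact lt_max_of_lt_left (ha0 _)
  sep i i' h := by
    simp only [cEven, cOdd, Fin.snoc_castSucc, Fin.cons_succ]
    exact (min_le_left _ _).trans_lt ((ha (Fin.castSucc_lt_castSucc_iff.2 h)).trans_le
      (le_max_left _ _))

theorem continuous_cEven (a : Fin (n + 1) → ℝ) : Continuous (cEven a) := by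
  refine continuous_pi fun j => ?_
  refine Fin.cases ?_ (fun i => ?_) j
  · simp only [cEven, Fin.cons_zero]
    exact continuous_const
  · simp only [cEven, Fin.cons_succ]
    fun_prop

theorem continuous_cOdd (a : Fin (n + 1) → ℝ) : Continuous (cOdd a) := by
  refine continuous_pi fun j => ?_
  refine Fin.lastCases ?_ (fun i => ?_) j
  · simp only [cOdd, Fin.snoc_last]
    exact continuous_const
  · simp only [cOdd, Fin.snoc_castSucc]
    fun_prop

theorem tendsto_endpoints {a : Fin (n + 1) → ℝ} (ha : StrictMono a) (ha0 : ∀ i, 0 < a i)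
    (x : Fin n → ℝ) : Tendsto (fun y => (cEven a y, cOdd a y)) (𝓝[causticSpace a] x)
      (nhdsBands (cEven a x, cOdd a x)) := by
  rw [nhdsBands, tendsto_nhdsWithin_iff]
  refine ⟨(((continuous_cEven a).prodMk (continuous_cOdd a)).tendsto x).mono_left
    nhdsWithin_le_nhds, ?_⟩
  filter_upwards [self_mem_nhdsWithin] with y hy
  exact isBands_of_mem ha ha0 hy

theorem exists_tendsto_frequencyMap {a : Fin (n + 1) → ℝ} (ha : StrictMono a) (ha0 : ∀ i, 0 < a i)
    {x : Fin n → ℝ} (hx : x ∈ closure (causticSpace a)) :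
    ∃ w, Tendsto (frequencyMap a) (𝓝[causticSpace a] x) (𝓝 w) := by
  obtain ⟨v, hv⟩ := LimBands.exists_tendsto (c₀ := (cEven a x, cOdd a x))
    (limBands_of_mem ha ha0 (closure_subset_weakCaustics ha ha0 hx))
  refine ⟨fun i => v i.succ, tendsto_pi_nhds.2 fun i => ?_⟩
  have h1 := (tendsto_pi_nhds.1 hv i.succ).comp (tendsto_endpoints ha ha0 x)
  refine h1.congr' ?_
  filter_upwards [self_mem_nhdsWithin] with y hy
  simp [extendedFrequency, frequencyMap_eq ha ha0 hy]

theorem tendsto_extFrequencyMap {a : Fin (n + 1) → ℝ} (ha : StrictMono a) (ha0 : ∀ i, 0 < a i)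
    {x : Fin n → ℝ} (hx : x ∈ closure (causticSpace a)) :
    Tendsto (frequencyMap a) (𝓝[causticSpace a] x) (𝓝 (extFrequencyMap a x)) :=
  tendsto_extendFrom (exists_tendsto_frequencyMap ha ha0 hx)

theorem continuousOn_extFrequencyMap {a : Fin (n + 1) → ℝ} (ha : StrictMono a)
    (ha0 : ∀ i, 0 < a i) : ContinuousOn (extFrequencyMap a) (closure (causticSpace a)) :=
  continuousOn_extendFrom Subset.rfl fun _ hx => exists_tendsto_frequencyMap ha ha0 hx

theorem extFrequencyMap_eq {a : Fin (n + 1) → ℝ} (ha : StrictMono a) (ha0 : ∀ i, 0 < a i) :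
    EqOn (extFrequencyMap a) (frequencyMap a) (causticSpace a) := by
  intro x hx
  have h1 := tendsto_extFrequencyMap ha ha0 (subset_closure hx)
  have h2 : Tendsto (frequencyMap a) (pure x) (𝓝 (frequencyMap a x)) :=
    tendsto_pure_nhds _ _
  exact tendsto_nhds_unique (h1.mono_left (pure_le_nhdsWithin hx)) h2

theorem extFrequencyMap_unique {a : Fin (n + 1) → ℝ} (ha : StrictMono a) (ha0 : ∀ i, 0 < a i)
    {x : Fin n → ℝ} (hx : x ∈ closure (causticSpace a)) {w : Fin n → ℝ}
    (h : Tendsto (frequencyMap a) (𝓝[causticSpace a] x) (𝓝 w)) : extFrequencyMap a x = w := by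
  have := mem_closure_iff_nhdsWithin_neBot.1 hx
  exact tendsto_nhds_unique (tendsto_extFrequencyMap ha ha0 hx) h

/-- Functions continuous on a set containing `x` agree at `x` if they agree on a set having `x`
in its closure. -/
theorem eq_of_mem_closure {X Y : Type*} [TopologicalSpace X] [TopologicalSpace Y] [T2Space Y]
    {f g : X → Y} {A B : Set X} {x : X} (hf : ContinuousWithinAt f B x)
    (hg : ContinuousWithinAt g B x) (hAB : A ⊆ B) (h : EqOn f g A) (hx : x ∈ closure A) :
    f x = g x := by
  have := mem_closure_iff_nhdsWithin_neBot.1 hx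
  refine tendsto_nhds_unique_of_eventuallyEq (hf.mono hAB) (hg.mono hAB) ?_
  exact eventually_of_mem self_mem_nhdsWithin h

/-! ### Regular points -/

theorem analyticAt_cEven {a : Fin (n + 1) → ℝ} {x : Fin n → ℝ} (hx : ∀ i, x i ≠ a i.castSucc)
    (k : Fin (n + 1)) : AnalyticAt ℝ (fun y => cEven a y k) x := by
  refine Fin.cases ?_ (fun i => ?_) k
  · simp only [cEven, Fin.cons_zero]
    exact analyticAt_const
  · simp only [cEven, Fin.cons_succ]
    have h1 : Continuous fun y : Fin n → ℝ => y i := continuous_apply i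
    have h2 : AnalyticAt ℝ (fun y : Fin n → ℝ => y i) x :=
      (ContinuousLinearMap.proj (R := ℝ) (φ := fun _ : Fin n => ℝ) i).analyticAt x
    rcases (hx i).lt_or_gt with h | h
    · refine analyticAt_const.congr (f := fun _ => a i.castSucc) ?_
      filter_upwards [h1.continuousAt.eventually_lt_const h] with y hy
      exact (max_eq_left hy.le).symm
    · refine h2.congr ?_
      filter_upwards [h1.continuousAt.eventually_const_lt h] with y hy
      exact (max_eq_right hy.le).symm

theorem analyticAt_cOdd {a : Fin (n + 1) → ℝ} {x : Fin n → ℝ} (hx : ∀ i, x i ≠ a i.castSucc)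
    (k : Fin (n + 1)) : AnalyticAt ℝ (fun y => cOdd a y k) x := by
  refine Fin.lastCases ?_ (fun i => ?_) k
  · simp only [cOdd, Fin.snoc_last]
    exact analyticAt_const
  · simp only [cOdd, Fin.snoc_castSucc]
    have h1 : Continuous fun y : Fin n → ℝ => y i := continuous_apply i
    have h2 : AnalyticAt ℝ (fun y : Fin n → ℝ => y i) x :=
      (ContinuousLinearMap.proj (R := ℝ) (φ := fun _ : Fin n => ℝ) i).analyticAt x
    rcases (hx i).lt_or_gt with h | h
    · refine h2.congr ?_
      filter_upwards [h1.continuousAt.eventually_lt_const h] with y hy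
      exact (min_eq_right hy.le).symm
    · refine analyticAt_const.congr (f := fun _ => a i.castSucc) ?_
      filter_upwards [h1.continuousAt.eventually_const_lt h] with y hy
      exact (min_eq_left hy.le).symm

theorem regularBands_of_mem {a : Fin (n + 1) → ℝ} {x : Fin n → ℝ} (ha : StrictMono a)
    (ha0 : ∀ i, 0 < a i) (hx : x ∈ weakCaustics a) (hreg : ∀ i, x i ≠ a i.castSucc) :
    RegularBands (cEven a x) (cOdd a x) where
  toWeakBands := (limBands_of_mem ha ha0 hx).toWeakBands
  gap_lt i := by
    simp only [cEven, cOdd, Fin.snoc_castSucc, Fin.cons_succ]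
    exact min_lt_max.2 (hreg i).symm

/-- The frequency divided by the square root of `c₁`, as a function of the caustic parameters. -/
noncomputable def causticScaled (a : Fin (n + 1) → ℝ) (x : Fin n → ℝ) : Fin n → ℝ :=
  scaledFrequency (cEven a x) (cOdd a x)

theorem analyticAt_causticScaled {a : Fin (n + 1) → ℝ} {x : Fin n → ℝ} (ha : StrictMono a)
    (ha0 : ∀ i, 0 < a i) (hx : x ∈ weakCaustics a) (hreg : ∀ i, x i ≠ a i.castSucc) :
    AnalyticAt ℝ (causticScaled a) x :=
  (regularBands_of_mem ha ha0 hx hreg).analyticAt_scaledFrequency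
    (analyticAt_cEven hreg) (analyticAt_cOdd hreg)

theorem bandFrequency_caustics (a : Fin (n + 1) → ℝ) (x : Fin n → ℝ) :
    bandFrequency (cEven a x) (cOdd a x) = √|cOdd a x 0| • causticScaled a x :=
  bandFrequency_eq_smul rfl

theorem continuousAt_bandFrequency {a : Fin (n + 1) → ℝ} {x : Fin n → ℝ} (ha : StrictMono a)
    (ha0 : ∀ i, 0 < a i) (hx : x ∈ weakCaustics a) (hreg : ∀ i, x i ≠ a i.castSucc) :
    ContinuousAt (fun y => bandFrequency (cEven a y) (cOdd a y)) x := by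
  simp_rw [bandFrequency_caustics]
  exact ((analyticAt_cOdd hreg 0).continuousAt.abs.sqrt).smul
    (analyticAt_causticScaled ha ha0 hx hreg).continuousAt

theorem analyticAt_sqrt_abs {x : ℝ} (hx : 0 < x) : AnalyticAt ℝ (fun y : ℝ => √|y|) x := by
  refine ((Real.contDiffAt_sqrt hx.ne' (n := ⊤)).analyticAt).congr ?_
  filter_upwards [lt_mem_nhds hx] with y hy
  rw [abs_of_pos hy]

theorem analyticAt_bandFrequency {a : Fin (n + 1) → ℝ} {x : Fin n → ℝ} (ha : StrictMono a)
    (ha0 : ∀ i, 0 < a i) (hx : x ∈ weakCaustics a) (hreg : ∀ i, x i ≠ a i.castSucc)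
    (h0 : 0 < cOdd a x 0) :
    AnalyticAt ℝ (fun y => bandFrequency (cEven a y) (cOdd a y)) x := by
  simp_rw [bandFrequency_caustics]
  exact (AnalyticAt.fun_comp (g := fun y : ℝ => √|y|)
    (f := fun y => cOdd a y 0) (analyticAt_sqrt_abs h0) (analyticAt_cOdd hreg 0)).smul
    (analyticAt_causticScaled ha ha0 hx hreg)

/-- Off the hyperplanes xᵢ = aᵢ the gaps are open and the formula for the frequency remains
continuous, whichever bands have collapsed. This covers regular and geodesic faces of any
codimension. -/
theorem extFrequencyMap_of_regular {a : Fin (n + 1) → ℝ} {x : Fin n → ℝ} (ha : StrictMono a)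
    (ha0 : ∀ i, 0 < a i) (hx : x ∈ weakCaustics a) (hreg : ∀ i, x i ≠ a i.castSucc) :
    extFrequencyMap a x = bandFrequency (cEven a x) (cOdd a x) := by
  refine extFrequencyMap_unique ha ha0 (weakCaustics_subset_closure ha ha0 hx) ?_
  refine ((continuousAt_bandFrequency ha ha0 hx hreg).tendsto.mono_left
    nhdsWithin_le_nhds).congr' ?_
  filter_upwards [self_mem_nhdsWithin] with y hy
  exact (frequencyMap_eq ha ha0 hy).symm

theorem causticSpace_ne {a : Fin (n + 1) → ℝ} {x : Fin n → ℝ} (hx : x ∈ causticSpace a) (i : Fin n) :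
    x i ≠ a i.castSucc := by
  rcases hx.2.2 i with h | h
  · exact h.2.ne
  · exact h.1.ne'

theorem isOpen_causticSpace (a : Fin (n + 1) → ℝ) : IsOpen (causticSpace a) := by
  have h1 : causticSpace a = (⋂ (i : Fin n) (j : Fin n), {x : Fin n → ℝ | i < j → x i < x j}) ∩
      ⋂ i : Fin n, ({x : Fin n → ℝ | 0 < x i} ∩ (fun x => x i) ⁻¹'
        (Ioo (withZero a i.castSucc.castSucc) (a i.castSucc) ∪ Ioo (a i.castSucc) (a i.succ))) := by
    ext x
    simp only [causticSpace, StrictMono, mem_inter_iff, mem_iInter, mem_ofPred_eq, mem_preimage,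
      forall_and]
  rw [h1]
  refine IsOpen.inter ?_ (isOpen_iInter_of_finite fun i => IsOpen.inter ?_ ?_)
  · refine isOpen_iInter_of_finite fun i => isOpen_iInter_of_finite fun j => ?_
    by_cases hij : i < j
    · simp only [hij, forall_const]
      exact isOpen_lt (continuous_apply i) (continuous_apply j)
    · simp [hij]
  · exact isOpen_lt continuous_const (continuous_apply i)
  · exact (isOpen_Ioo.union isOpen_Ioo).preimage (continuous_apply i)

theorem analyticOnNhd_frequencyMap {a : Fin (n + 1) → ℝ} (ha : StrictMono a) (ha0 : ∀ i, 0 < a i) :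
    AnalyticOnNhd ℝ (frequencyMap a) (causticSpace a) := by
  intro x hx
  have hb := isBands_of_mem ha ha0 hx
  refine (analyticAt_bandFrequency ha ha0 (causticSpace_subset_weakCaustics ha ha0 hx)
    (causticSpace_ne hx) ?_).congr ?_
  · have := hb.band_lt 0
    rw [hb.zero] at this
    exact this
  · filter_upwards [(isOpen_causticSpace a).mem_nhds hx] with y hy
    exact (frequencyMap_eq ha ha0 hy).symm

end EllipsoidBilliard

/-! ### Faces of the border and caustic parameters of sections -/

namespace EllipsoidBilliard

variable {n m : ℕ}

theorem border_eq (a : Fin (n + 1) → ℝ) (ha : StrictMono a) (ha0 : ∀ i, 0 < a i) (k : ℕ) :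
    border a k = {x | (x ∈ weakCaustics a ∧ x ∉ causticSpace a) ∧
      (range x \ range (withZero a)).ncard = k} := by
  simp only [border, frontier, closure_causticSpace ha ha0, (isOpen_causticSpace a).interior_eq,
    Set.mem_sdiff]

theorem notMem_range_withZero {a : Fin (n + 1) → ℝ} (ha : StrictMono a) (ha0 : ∀ i, 0 < a i)
    {x : Fin n → ℝ} (hx : x ∈ causticSpace a) (i : Fin n) : x i ∉ range (withZero a) := by
  rintro ⟨k, hk⟩
  have hm := withZero_mono ha ha0
  have h1 : a i.castSucc = withZero a i.castSucc.succ := by simp [withZero]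
  have h2 : a i.succ = withZero a i.succ.succ := by simp [withZero]
  rcases hx.2.2 i with h | h
  · rw [h1, ← hk] at h
    have h3 := hm.lt_iff_lt.1 h.1
    have h4 := hm.lt_iff_lt.1 h.2
    rw [Fin.lt_def] at h3 h4
    simp at h3 h4
    omega
  · rw [h1, h2, ← hk] at h
    have h3 := hm.lt_iff_lt.1 h.1
    have h4 := hm.lt_iff_lt.1 h.2
    rw [Fin.lt_def] at h3 h4
    simp at h3 h4
    omega

theorem mem_causticSpace_of_notMem {a : Fin (n + 1) → ℝ} (ha0 : ∀ i, 0 < a i)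
    {x : Fin n → ℝ} (hx : x ∈ weakCaustics a) (h1 : StrictMono x)
    (h2 : ∀ i, x i ∉ range (withZero a)) : x ∈ causticSpace a := by
  have h3 : ∀ i k, x i ≠ a k := fun i k h => h2 i ⟨k.succ, by simp [withZero, h]⟩
  refine mem_causticSpace_of_lt ha0 h1 (fun i => ⟨?_, ?_⟩) fun i => h3 i _
  · exact lt_of_le_of_ne (hx.2 i).1 fun h => h2 i ⟨_, h⟩
  · exact lt_of_le_of_ne (hx.2 i).2 (h3 i _)

theorem le_of_mem_weakCaustics' {a : Fin (n + 1) → ℝ} (ha : StrictMono a) {x : Fin n → ℝ}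
    (hx : x ∈ weakCaustics a) {k : Fin n} {i : Fin (n + 1)} (h : (i : ℕ) + 1 ≤ k) : a i ≤ x k := by
  let i' : Fin n := ⟨i, by omega⟩
  exact le_of_mem_weakCaustics hx i' k h ha

theorem le_of_mem_weakCaustics_right {a : Fin (n + 1) → ℝ} (ha : StrictMono a) {x : Fin n → ℝ}
    (hx : x ∈ weakCaustics a) {k : Fin n} {i : Fin (n + 1)} (h : (k : ℕ) + 1 ≤ i) : x k ≤ a i := by
  refine (hx.2 k).2.trans (ha.monotone ?_)
  rw [Fin.le_def]
  simpa using h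

theorem val_succAbove (p : Fin (n + 1)) (i : Fin n) :
    (p.succAbove i : ℕ) = if (i : ℕ) < p then (i : ℕ) else i + 1 := by
  simp only [Fin.succAbove, Fin.lt_def, Fin.val_castSucc]
  split_ifs <;> simp

/-- The inequalities describing the closure compare parameters with axes at neighbouring positions.
Removing an axis and a parameter whose positions differ by at most one shifts both lists almost
simultaneously and preserves these inequalities. -/
theorem weakCaustics_succAbove {a : Fin (m + 2) → ℝ} (ha : StrictMono a) (ha0 : ∀ i, 0 < a i)
    {x : Fin (m + 1) → ℝ} (hx : x ∈ weakCaustics a) {p : Fin (m + 2)} {j : Fin (m + 1)}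
    (h1 : (p : ℕ) ≤ j + 1) (h2 : (j : ℕ) ≤ p + 1) :
    (fun i => x (j.succAbove i)) ∈ weakCaustics fun i => a (p.succAbove i) := by
  refine mem_weakCaustics_of (hx.1.comp j.strictMono_succAbove.monotone)
    (fun i => nonneg_of_mem_weakCaustics ha0 hx _) (fun i k hik => ?_) fun i => ?_
  · refine le_of_mem_weakCaustics' ha hx ?_
    rw [val_succAbove, val_succAbove, Fin.val_castSucc]
    split_ifs <;> omega
  · refine le_of_mem_weakCaustics_right ha hx ?_
    rw [val_succAbove, val_succAbove, Fin.val_succ]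
    split_ifs <;> omega

theorem range_withZero_succAbove (a : Fin (m + 2) → ℝ) (p : Fin (m + 2)) :
    range (withZero fun i => a (p.succAbove i)) ⊆ range (withZero a) := by
  rintro _ ⟨k, rfl⟩
  refine Fin.cases ⟨0, by simp [withZero]⟩ (fun i => ⟨(p.succAbove i).succ, by simp [withZero]⟩) k

/-! ### The border of codimension one -/

theorem range_eq_insert (x : Fin (m + 1) → ℝ) (j : Fin (m + 1)) :
    range x = insert (x j) (range fun i => x (j.succAbove i)) := by
  ext y
  simp only [mem_range, mem_insert_iff]
  constructor
  · rintro ⟨k, rfl⟩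
    rcases Fin.eq_self_or_eq_succAbove j k with rfl | ⟨i, rfl⟩
    · exact Or.inl rfl
    · exact Or.inr ⟨i, rfl⟩
  · rintro (rfl | ⟨i, rfl⟩)
    · exact ⟨j, rfl⟩
    · exact ⟨_, rfl⟩

theorem injective_of_ncard {f : Fin m → ℝ} (h : (range f).ncard = m) : Function.Injective f := by
  have h1 : (Finset.univ.image f).card = (Finset.univ : Finset (Fin m)).card := by
    rw [Finset.card_univ, Fintype.card_fin, ← Set.ncard_coe_finset, Finset.coe_image,
      Finset.coe_univ, image_univ, h]
  have h2 := Finset.card_image_iff.1 h1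
  rwa [Finset.coe_univ, injOn_univ] at h2

/-- The coordinate x_j contributes no new value, so the `m` values outside `A` have to come from the
`m` remaining coordinates. These are therefore distinct and all outside `A`. -/
theorem strictMono_of_ncard {x : Fin (m + 1) → ℝ} (hx : Monotone x) {A : Set ℝ} {j : Fin (m + 1)}
    (hj : x j ∈ A ∨ x j ∈ range fun i => x (j.succAbove i)) (hA : (range x \ A).ncard = m) :
    (∀ i, x (j.succAbove i) ∉ A) ∧ StrictMono fun i => x (j.succAbove i) := by
  have h1 : range x \ A ⊆ range fun i => x (j.succAbove i) := by
    rw [range_eq_insert x j]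
    rintro y ⟨rfl | hy, hyA⟩
    · exact hj.resolve_left hyA
    · exact hy
  have h2 : (range fun i => x (j.succAbove i)).ncard ≤ m := by
    rw [← image_univ]
    refine (ncard_image_le).trans ?_
    simp
  have h3 := Set.eq_of_subset_of_ncard_le h1 (by rw [hA]; exact h2) (finite_range _)
  refine ⟨fun i => ?_, ?_⟩
  · have : x (j.succAbove i) ∈ range x \ A := h3 ▸ mem_range_self i
    exact this.2
  · exact (hx.comp j.strictMono_succAbove.monotone).strictMono_of_injective
      (injective_of_ncard (h3 ▸ hA))

theorem border_of_mem_range {a : Fin (m + 2) → ℝ} (ha : StrictMono a) (ha0 : ∀ i, 0 < a i)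
    {x : Fin (m + 1) → ℝ} (hx : x ∈ border a m) {j : Fin (m + 1)} (hj : x j ∈ range (withZero a)) :
    (∀ i, x (j.succAbove i) ∉ range (withZero a)) ∧ StrictMono fun i => x (j.succAbove i) := by
  rw [border_eq a ha ha0] at hx
  exact strictMono_of_ncard hx.1.1.1 (Or.inl hj) hx.2

theorem border_of_eq {a : Fin (m + 2) → ℝ} (ha : StrictMono a) (ha0 : ∀ i, 0 < a i)
    {x : Fin (m + 1) → ℝ} (hx : x ∈ border a m) {l : Fin m} (hl : x l.castSucc = x l.succ) :
    (∀ i, x (l.succ.succAbove i) ∉ range (withZero a)) ∧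
      StrictMono fun i => x (l.succ.succAbove i) := by
  rw [border_eq a ha ha0] at hx
  exact strictMono_of_ncard hx.1.1.1 (Or.inr ⟨l, by simp [hl]⟩) hx.2

theorem mem_border_of {a : Fin (m + 2) → ℝ} (ha : StrictMono a) (ha0 : ∀ i, 0 < a i)
    {x : Fin (m + 1) → ℝ} (hx : x ∈ weakCaustics a) {j : Fin (m + 1)} (hj : x j ∈ range (withZero a))
    (h1 : ∀ i, x (j.succAbove i) ∉ range (withZero a))
    (h2 : StrictMono fun i => x (j.succAbove i)) : x ∈ border a m := by
  rw [border_eq a ha ha0]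
  refine ⟨⟨hx, fun h => notMem_range_withZero ha ha0 h j hj⟩, ?_⟩
  have h3 : range x \ range (withZero a) = range fun i => x (j.succAbove i) := by
    rw [range_eq_insert x j]
    ext y
    constructor
    · rintro ⟨rfl | hy, hyA⟩
      · exact absurd hj hyA
      · exact hy
    · rintro ⟨i, rfl⟩
      exact ⟨Or.inr ⟨i, rfl⟩, h1 i⟩
  rw [h3, ← image_univ, ncard_image_of_injective _ h2.injective, ncard_univ, Nat.card_fin]

/-- If a coordinate xⱼ equals an axis a_k, interlacing forces |k - j| ≤ 1, which gives the kinds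
`lower`, singular and `upper`; the value 0 gives G. If no coordinate is special, only strict
monotonicity can fail, which is `diag`. -/
theorem border_cases {a : Fin (m + 2) → ℝ} (ha : StrictMono a) (ha0 : ∀ i, 0 < a i)
    {x : Fin (m + 1) → ℝ} (hx : x ∈ border a m) :
    x ∈ geodesicFaces a ∨ (∃ j, x ∈ singularFaces a j) ∨ ∃ F : RegularKind m, x ∈ F.face a := by
  have hx' := hx
  rw [border_eq a ha ha0] at hx'
  obtain ⟨⟨hw, hn⟩, -⟩ := hx'
  by_cases h : ∃ j, x j ∈ range (withZero a)
  · obtain ⟨j, k, hk⟩ := h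
    induction k using Fin.cases with
    | zero =>
      refine Or.inl ⟨hx, le_antisymm ?_ (nonneg_of_mem_weakCaustics ha0 hw _)⟩
      refine (hw.1 (Fin.zero_le j)).trans ?_
      rw [← hk]
      simp [withZero]
    | succ k =>
      simp only [withZero, Fin.cons_succ] at hk
      have h1 : (k : ℕ) ≤ j + 1 := by
        have h2 := (hw.2 j).2
        rw [← hk] at h2
        simpa using Fin.le_def.1 (ha.le_iff_le.1 h2)
      have h2 : (j : ℕ) ≤ k + 1 := by
        by_contra! h3
        have h4 := le_of_mem_weakCaustics' ha hw (k := j) (i := ⟨j - 1, by omega⟩)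
          (by simp only; omega)
        rw [← hk] at h4
        have := Fin.le_def.1 (ha.le_iff_le.1 h4)
        simp only at this
        omega
      rcases Nat.lt_trichotomy k j with h3 | h3 | h3
      · refine Or.inr (Or.inr ⟨RegularKind.lower ⟨k, by omega⟩, hx, ?_⟩)
        have e1 : (⟨k, by omega⟩ : Fin m).succ = j := by
          ext
          simp only [Fin.val_succ]
          omega
        rw [e1, ← hk]
        rfl
      · refine Or.inr (Or.inl ⟨j, hx, ?_⟩)
        rw [← hk]
        congr 1
        ext
        simpa using h3
      · refine Or.inr (Or.inr ⟨RegularKind.upper j, hx, ?_⟩)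
        rw [← hk]
        congr 1
        ext
        simp only [Fin.val_succ]
        omega
  · push Not at h
    have h1 : ¬StrictMono x := fun h1 => hn (mem_causticSpace_of_notMem ha0 hw h1 h)
    rw [Fin.strictMono_iff_lt_succ] at h1
    push Not at h1
    obtain ⟨l, hl⟩ := h1
    exact Or.inr (Or.inr ⟨RegularKind.diag l, hx,
      le_antisymm (hw.1 (Fin.castSucc_lt_succ).le) hl⟩)

theorem mem_range_withZero (a : Fin (n + 1) → ℝ) (k : Fin (n + 1)) : a k ∈ range (withZero a) :=
  ⟨k.succ, by simp [withZero]⟩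

theorem zero_mem_range_withZero (a : Fin (n + 1) → ℝ) : (0 : ℝ) ∈ range (withZero a) :=
  ⟨0, by simp [withZero]⟩

theorem notMem_of_ne {a : Fin (m + 2) → ℝ} (ha : StrictMono a) (ha0 : ∀ i, 0 < a i)
    {x : Fin (m + 1) → ℝ} (hx : x ∈ border a m) {j : Fin (m + 1)} (hj : x j ∈ range (withZero a))
    {i : Fin (m + 1)} (hij : i ≠ j) : x i ∉ range (withZero a) := by
  obtain ⟨k, rfl⟩ := Fin.exists_succAbove_eq hij
  exact (border_of_mem_range ha ha0 hx hj).1 k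

/-- In codimension one the collapse under consideration is the only one, so no further coordinate
can be 0 or an axis; in particular no gap is closed and the first band is open. -/
theorem regular_of_mem_face {a : Fin (m + 2) → ℝ} (ha : StrictMono a) (ha0 : ∀ i, 0 < a i)
    {x : Fin (m + 1) → ℝ} {F : RegularKind m} (hx : x ∈ F.face a) :
    x ∈ border a m ∧ 0 < x 0 ∧ ∀ i, x i ≠ a i.castSucc := by
  have hA : ∀ j, x ∈ border a m → x j ∈ range (withZero a) → x j ≠ 0 → x j ≠ a j.castSucc →
      0 < x 0 ∧ ∀ i, x i ≠ a i.castSucc := by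
    intro j hb hj h0 h1
    have hw := hb
    rw [border_eq a ha ha0] at hw
    refine ⟨lt_of_le_of_ne (nonneg_of_mem_weakCaustics ha0 hw.1.1 0) fun h => ?_, fun i h => ?_⟩
    · by_cases h2 : 0 = j
      · rw [← h2] at h0
        exact h0 h.symm
      · exact notMem_of_ne ha ha0 hb hj h2 (h ▸ zero_mem_range_withZero a)
    · by_cases h2 : i = j
      · rw [← h2] at h1
        exact h1 h
      · exact notMem_of_ne ha ha0 hb hj h2 (h ▸ mem_range_withZero a _)
  cases F with
  | upper l =>
    obtain ⟨hb, hl⟩ := hx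
    refine ⟨hb, hA l hb (hl ▸ mem_range_withZero a _) ?_ ?_⟩
    · rw [hl]
      exact (ha0 _).ne'
    · rw [hl]
      exact (ha Fin.castSucc_lt_succ).ne'
  | lower l =>
    obtain ⟨hb, hl⟩ := hx
    refine ⟨hb, hA l.succ hb (hl ▸ mem_range_withZero a _) ?_ ?_⟩
    · rw [hl]
      exact (ha0 _).ne'
    · rw [hl]
      exact (ha (Fin.castSucc_lt_castSucc_iff.2 Fin.castSucc_lt_succ)).ne
  | diag l =>
    obtain ⟨hb, hl⟩ := hx
    have h1 : ∀ i, x i ∉ range (withZero a) := by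
      intro i hi
      by_cases h2 : i = l.succ
      · have h3 : x l.castSucc ∈ range (withZero a) := by
          rw [hl, ← h2]
          exact hi
        exact notMem_of_ne ha ha0 hb h3 (i := l.succ) (Fin.castSucc_lt_succ).ne'
          (by rw [← hl]; exact h3)
      · obtain ⟨k, rfl⟩ := Fin.exists_succAbove_eq h2
        exact (border_of_eq ha ha0 hb hl).1 k hi
    have hw := hb
    rw [border_eq a ha ha0] at hw
    refine ⟨hb, lt_of_le_of_ne (nonneg_of_mem_weakCaustics ha0 hw.1.1 0) fun h => ?_, fun i h => ?_⟩
    · exact h1 0 (h ▸ zero_mem_range_withZero a)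
    · exact h1 i (h ▸ mem_range_withZero a _)

theorem regularFaces_eq {a : Fin (m + 2) → ℝ} (ha : StrictMono a) (ha0 : ∀ i, 0 < a i) :
    regularFaces a = ⋃ F : RegularKind m, F.face a := by
  ext x
  simp only [regularFaces, Set.mem_sdiff, mem_union, mem_iUnion, not_or, not_exists]
  constructor
  · rintro ⟨hb, hG, hS⟩
    rcases border_cases ha ha0 hb with h | ⟨j, h⟩ | h
    · exact absurd h hG
    · exact absurd h (hS j)
    · exact h
  · rintro ⟨F, hF⟩
    obtain ⟨hb, h0, h1⟩ := regular_of_mem_face ha ha0 hF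
    exact ⟨hb, fun h => h0.ne' h.2, fun j h => h1 j h.2⟩

/-- The closure of a singular face. -/
theorem closure_singularFaces {a : Fin (m + 2) → ℝ} (ha : StrictMono a) (ha0 : ∀ i, 0 < a i)
    (l : Fin (m + 1)) :
    closure (singularFaces a l) = {x | x ∈ weakCaustics a ∧ x l = a l.castSucc} := by
  refine Subset.antisymm (closure_minimal ?_ ?_) ?_
  · rintro x ⟨hb, hl⟩
    rw [border_eq a ha ha0] at hb
    exact ⟨hb.1.1, hl⟩
  · exact (isClosed_weakCaustics a).inter (isClosed_eq (continuous_apply l) continuous_const)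
  · rintro x ⟨hx, hl⟩
    -- The target of the segment lies on the hyperplane of the face and is generic otherwise, so the
    -- whole segment stays on it.
    let μ := Function.update (gapCenter a) l (a l.castSucc)
    have hμl : μ l = a l.castSucc := Function.update_self _ _ _
    have hμ : ∀ i, i ≠ l → μ i = gapCenter a i := fun i hi => Function.update_of_ne hi _ _
    have hle : ∀ i, a i.castSucc ≤ μ i ∧ μ i < a i.succ := by
      intro i
      by_cases hi : i = l
      · rw [hi, hμl]
        exact ⟨le_rfl, ha Fin.castSucc_lt_succ⟩
      · rw [hμ i hi]
        exact ⟨(gapCenter_mem ha i).1.le, (gapCenter_mem ha i).2⟩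
    have hmono : StrictMono μ := by
      intro i j hij
      have h1 : a i.succ ≤ a j.castSucc :=
        ha.monotone (Fin.castSucc_lt_iff_succ_le.1 (Fin.castSucc_lt_castSucc_iff.2 hij))
      linarith [(hle i).2, (hle j).1]
    refine mem_closure_of_tendsto (tendsto_segPt x μ) ?_
    have h1 : ∀ᶠ ε in 𝓝[>] (0 : ℝ), ∀ i, i ≠ l → segPt x μ ε i ≠ a i.castSucc := by
      refine eventually_all.2 fun i => ?_
      by_cases hi : i = l
      · exact Eventually.of_forall fun ε h => absurd hi h
      · refine (eventually_segPt_ne (b := a i.castSucc) ?_).mono fun ε h _ => h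
        rw [hμ i hi]
        exact (gapCenter_mem ha i).1.ne'
    filter_upwards [h1, eventually_mem_Ioo] with ε h2 hε
    have hsl : segPt x μ ε l = a l.castSucc := by
      rw [segPt, hl, hμl]
      ring
    have hsm := segPt_strictMono hx.1 hmono hε
    have hin := fun i => segPt_lt (hx.2 i) ⟨(withZero_lt ha ha0 i).trans_le (hle i).1, (hle i).2⟩ hε
    have hsw : segPt x μ ε ∈ weakCaustics a :=
      ⟨hsm.monotone, fun i => ⟨(hin i).1.le, (hin i).2.le⟩⟩
    refine ⟨mem_border_of ha ha0 hsw (j := l) (hsl ▸ mem_range_withZero a _) (fun i hi => ?_)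
      (hsm.comp l.strictMono_succAbove), hsl⟩
    obtain ⟨k, hk⟩ := hi
    have hm := withZero_mono ha ha0
    set p := l.succAbove i with hp
    have h3 := hin p
    have h4 := h2 p (Fin.succAbove_ne l i)
    have e2 : a p.succ = withZero a p.succ.succ := by simp [withZero]
    have e3 : a p.castSucc = withZero a p.castSucc.succ := by simp [withZero]
    rw [← hk] at h3 h4
    rw [e2] at h3
    rw [e3] at h4
    have h5 := hm.lt_iff_lt.1 h3.1
    have h6 := hm.lt_iff_lt.1 h3.2
    have h7 := hm.injective.ne_iff.1 h4
    rw [Fin.lt_def] at h5 h6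
    rw [Ne, Fin.ext_iff] at h7
    simp at h5 h6 h7
    omega

theorem sectionCaustics_mem_weak {a : Fin (m + 2) → ℝ} (ha : StrictMono a) (ha0 : ∀ i, 0 < a i)
    {x : Fin (m + 1) → ℝ} (hx : x ∈ weakCaustics a) (F : RegularKind m) :
    F.sectionCaustics a x ∈ weakCaustics (F.sectionAxes a) := by
  cases F with
  | upper l =>
    exact weakCaustics_succAbove ha ha0 hx (p := l.succ) (j := l)
      (by simp) (by simp; omega)
  | lower l =>
    exact weakCaustics_succAbove ha ha0 hx (p := l.castSucc.castSucc) (j := l.succ)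
      (by simp; omega) (by simp)
  | diag l =>
    have h1 : Function.update x l.castSucc (a l.castSucc.castSucc) ∈ weakCaustics a := by
      refine mem_weakCaustics_of (Fin.monotone_iff_le_succ.2 fun i => ?_) (fun i => ?_)
        (fun i k hik => ?_) fun i => ?_
      · by_cases hi : i.castSucc = l.castSucc
        · rw [hi, Function.update_self, Function.update_of_ne]
          · refine le_of_mem_weakCaustics' ha hx ?_
            have := congrArg Fin.val hi
            simp at this ⊢
            omega
          · intro h
            have h3 := congrArg Fin.val hi
            have h4 := congrArg Fin.val h
            simp at h3 h4
            omega
        · rw [Function.update_of_ne hi]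
          by_cases hi' : i.succ = l.castSucc
          · rw [hi', Function.update_self]
            refine le_of_mem_weakCaustics_right ha hx ?_
            have := congrArg Fin.val hi'
            simp at this ⊢
            omega
          · rw [Function.update_of_ne hi']
            exact hx.1 Fin.castSucc_lt_succ.le
      · by_cases hi : i = l.castSucc
        · rw [hi, Function.update_self]
          exact (ha0 _).le
        · rw [Function.update_of_ne hi]
          exact nonneg_of_mem_weakCaustics ha0 hx _
      · by_cases hi : k = l.castSucc
        · rw [hi, Function.update_self]
          refine ha.monotone ?_
          have := congrArg Fin.val hi
          rw [Fin.le_def]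
          simp at this ⊢
          omega
        · rw [Function.update_of_ne hi]
          exact le_of_mem_weakCaustics' ha hx (by simp; omega)
      · by_cases hi : i = l.castSucc
        · rw [hi, Function.update_self]
          exact (ha Fin.castSucc_lt_succ).le
        · rw [Function.update_of_ne hi]
          exact (hx.2 i).2
    exact weakCaustics_succAbove ha ha0 h1 (p := l.castSucc.castSucc) (j := l.succ)
      (by simp; omega) (by simp)

theorem strictMono_sectionAxes {a : Fin (m + 2) → ℝ} (ha : StrictMono a) (p : Fin (m + 2)) :
    StrictMono fun i => a (p.succAbove i) := ha.comp p.strictMono_succAbove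

theorem singular_section_mem {a : Fin (m + 2) → ℝ} (ha : StrictMono a) (ha0 : ∀ i, 0 < a i)
    {x : Fin (m + 1) → ℝ} {j : Fin (m + 1)} (hx : x ∈ singularFaces a j) :
    (fun i => x (j.succAbove i)) ∈ causticSpace fun i => a (j.castSucc.succAbove i) := by
  obtain ⟨hb, hj⟩ := hx
  obtain ⟨h1, h2⟩ := border_of_mem_range ha ha0 hb (hj ▸ mem_range_withZero a _)
  have hw := hb
  rw [border_eq a ha ha0] at hw
  exact mem_causticSpace_of_notMem (fun i => ha0 _)
    (weakCaustics_succAbove ha ha0 hw.1.1 (by simp) (by simp)) h2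
    fun i hi => h1 i (range_withZero_succAbove a _ hi)

end EllipsoidBilliard

/-! ### Removing a collapsed band -/

namespace EllipsoidBilliard

variable {n m : ℕ}

/-- Both sides are the product over all indices except `q.succAbove k`. Replacing this one value by
1 makes both the full product and avoids dividing. -/
theorem prod_succAbove_succAbove {M : Type*} [CommMonoid M] (f : Fin (n + 2) → M) (q : Fin (n + 2))
    (k : Fin (n + 1)) : ∏ i, f ((q.succAbove k).succAbove i) =
      f q * ∏ i, f (q.succAbove (k.succAbove i)) := by
  let f' := Function.update f (q.succAbove k) 1
  have h0 : f' (q.succAbove k) = 1 := Function.update_self _ _ _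
  have h1 : ∀ j, j ≠ q.succAbove k → f' j = f j := fun j hj => Function.update_of_ne hj _ _
  have h2 := Fin.prod_univ_succAbove f' (q.succAbove k)
  have h3 := Fin.prod_univ_succAbove f' q
  rw [Fin.prod_univ_succAbove (fun i => f' (q.succAbove i)) k, h0, one_mul,
    h1 q (Fin.succAbove_ne q k).symm] at h3
  rw [h0, one_mul] at h2
  calc _ = ∏ i, f' ((q.succAbove k).succAbove i) :=
        Finset.prod_congr rfl fun i _ => (h1 _ (Fin.succAbove_ne _ _)).symm
    _ = f q * ∏ i, f' (q.succAbove (k.succAbove i)) := by rw [← h2, h3]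
    _ = _ := by
      congr 1
      exact Finset.prod_congr rfl fun i _ =>
        h1 _ fun h => Fin.succAbove_ne k i (Fin.succAbove_right_injective h)

/-- The bands other than the `q`-th one. -/
def removeBand (E : Fin (n + 2) → ℝ) (q : Fin (n + 2)) : Fin (n + 1) → ℝ := fun k => E (q.succAbove k)

variable {E O : Fin (n + 2) → ℝ}

theorem otherProd_succAbove {q : Fin (n + 2)} {v : ℝ} (hE : E q = v) (hO : O q = v)
    (k : Fin (n + 1)) (s : ℝ) : otherProd E O (q.succAbove k) s =
      (v - s) ^ 2 * otherProd (removeBand E q) (removeBand O q) k s := by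
  rw [otherProd, prod_succAbove_succAbove (fun j => (E j - s) * (O j - s)), hE, hO, pow_two]
  rfl

theorem RegularBands.remove (h : RegularBands E O) {q : Fin (n + 2)} (hq : q ≠ 0) :
    RegularBands (removeBand E q) (removeBand O q) where
  zero := by
    obtain ⟨l, rfl⟩ := Fin.exists_succ_eq.2 hq
    simp [removeBand, h.zero]
  band k := h.band _
  gap i := (h.lt_of_lt (q.strictMono_succAbove Fin.castSucc_lt_succ)).le
  pos i := by
    have h1 := h.lt_of_lt (q.strictMono_succAbove (show (0 : Fin (n + 1)) < i.succ from
      Fin.succ_pos i))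
    exact ((h.nonneg _).trans (h.band _)).trans_lt h1
  gap_lt i := h.lt_of_lt (q.strictMono_succAbove Fin.castSucc_lt_succ)

theorem bandPt_removeBand (q : Fin (n + 2)) (k : Fin (n + 1)) (φ : ℝ) :
    bandPt E O (q.succAbove k) φ = bandPt (removeBand E q) (removeBand O q) k φ := rfl

theorem bandWeight_succAbove {q : Fin (n + 2)} {v : ℝ} (hE : E q = v) (hO : O q = v)
    (k : Fin (n + 1)) (s : ℝ) : bandWeight E O (q.succAbove k) s =
      |v - s|⁻¹ * bandWeight (removeBand E q) (removeBand O q) k s := by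
  rw [bandWeight, bandWeight, otherProd_succAbove hE hO, abs_mul, Real.sqrt_mul (abs_nonneg _),
    abs_pow, Real.sqrt_sq (abs_nonneg _), mul_inv]
  ring

/-- The sign of `s - v` on the bands other than the `q`-th one, together with the alternating
sign. -/
theorem RegularBands.sub_sign (h : RegularBands E O) {q : Fin (n + 2)} {v : ℝ} (hE : E q = v)
    (hO : O q = v) (k : Fin (n + 1)) {s : ℝ} (hs : s ∈ Icc (E (q.succAbove k)) (O (q.succAbove k))) :
    s ≠ v ∧ (-1) ^ ((q.succAbove k : Fin (n + 2)) : ℕ) * (s - v) = -((-1) ^ (k : ℕ) * |v - s|) := by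
  rcases lt_or_ge k.castSucc q with hk | hk
  · rw [Fin.succAbove_of_castSucc_lt _ _ hk] at hs ⊢
    have h1 : s < v := hs.2.trans_lt ((h.lt_of_lt hk).trans_eq hE)
    refine ⟨h1.ne, ?_⟩
    rw [abs_of_pos (by linarith), Fin.val_castSucc]
    ring
  · rw [Fin.succAbove_of_le_castSucc _ _ hk] at hs ⊢
    have h1 : v < s := (hO.symm.trans_lt (h.lt_of_lt (Fin.le_castSucc_iff.1 hk))).trans_le hs.1
    refine ⟨h1.ne', ?_⟩
    rw [abs_of_neg (by linarith), Fin.val_succ, pow_succ]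
    ring

open Polynomial in
-- The two coinciding endpoints put |v - s| into the denominator, and the factor X - v cancels it up
-- to sign. That sign is the change of the alternating sign when the bands after the removed one are
-- renumbered.
theorem RegularBands.mom_removeBand (h : RegularBands E O) {q : Fin (n + 2)} (hq : q ≠ 0) {v : ℝ}
    (hE : E q = v) (hO : O q = v) (k : Fin (n + 1)) (p : ℝ[X]) :
    (-1) ^ ((q.succAbove k : Fin (n + 2)) : ℕ) *
      mom (bandMoment E O (q.succAbove k)) ((X - C v) * p) =
      -((-1) ^ (k : ℕ) * mom (bandMoment (removeBand E q) (removeBand O q) k) p) := by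
  have h' := h.remove hq
  rw [(h.freeBand _).mom_eq (h.band _), (h'.freeBand _).mom_eq (h'.band _),
    ← intervalIntegral.integral_const_mul, ← intervalIntegral.integral_const_mul,
    ← intervalIntegral.integral_neg]
  refine intervalIntegral.integral_congr fun φ _ => ?_
  have hs := h.sub_sign hE hO k (bandPt_mem (h.band (q.succAbove k)) φ)
  rw [bandWeight_succAbove hE hO, ← bandPt_removeBand]
  set s := bandPt E O (q.succAbove k) φ
  have h1 : |v - s| ≠ 0 := abs_ne_zero.2 (sub_ne_zero.2 hs.1.symm)
  rw [eval_mul, eval_sub, eval_X, eval_C]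
  calc _ = ((-1) ^ ((q.succAbove k : Fin (n + 2)) : ℕ) * (s - v)) * |v - s|⁻¹ *
        (p.eval s * bandWeight (removeBand E q)
          (removeBand O q) k s) := by ring
    _ = _ := by
      rw [hs.2]
      field_simp

open Polynomial in
-- Test functions divisible by X - v vanish on the collapsed band. What remains is the system of the
-- other bands in one dimension less, whose solution is unique.
theorem RegularBands.extendedFrequency_removeBand (h : RegularBands E O) {q : Fin (n + 2)}
    (hq : q ≠ 0) {v : ℝ} (hE : E q = v) (hO : O q = v) (k : Fin (n + 1)) :
    extendedFrequency E O (q.succAbove k) =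
      extendedFrequency (removeBand E q) (removeBand O q) k := by
  have h' := h.remove hq
  have h0 : extendedFrequency E O (q.succAbove 0) = 1 / 2 := by
    obtain ⟨l, rfl⟩ := Fin.exists_succ_eq.2 hq
    simp [extendedFrequency]
  have hk : IsKernel (bandMoment (removeBand E q)
      (removeBand O q)) (Fin.cons (1 / 2) fun i : Fin n =>
        extendedFrequency E O (q.succAbove i.succ) : Fin (n + 1) → ℝ) := by
    intro i
    have h1 : ((X - C v) * X ^ (i : ℕ) : ℝ[X]).natDegree < n + 1 := by
      refine lt_of_le_of_lt natDegree_mul_le ?_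
      rw [natDegree_X_sub_C, natDegree_X_pow]
      omega
    have h2 := h.isKernel.poly h1
    rw [Fin.sum_univ_succAbove _ q] at h2
    have h3 : mom (bandMoment E O q) ((X - C v) * X ^ (i : ℕ)) = 0 := by
      rw [(h.freeBand q).mom_eq (h.band q)]
      refine (intervalIntegral.integral_congr (g := fun _ => 0) fun φ _ => ?_).trans (by simp)
      have : bandPt E O q φ = v := by rw [bandPt_of_eq (hE.trans hO.symm), hE]
      simp [this]
    rw [h3, mul_zero, zero_add] at h2
    have h4 : ∀ k, (Fin.cons (1 / 2) fun i : Fin n => extendedFrequency E O (q.succAbove i.succ) :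
        Fin (n + 1) → ℝ) k = extendedFrequency E O (q.succAbove k) := by
      intro k
      refine Fin.cases ?_ (fun i => ?_) k
      · rw [Fin.cons_zero, h0]
      · rw [Fin.cons_succ]
    rw [← neg_eq_zero, ← h2, ← Finset.sum_neg_distrib]
    refine Finset.sum_congr rfl fun k _ => ?_
    have h5 := h.mom_removeBand hq hE hO k (X ^ (i : ℕ))
    have h6 : mom (bandMoment (removeBand E q)
        (removeBand O q) k) (X ^ (i : ℕ)) =
        bandMoment (removeBand E q) (removeBand O q) k i := by
      rw [mom_apply, X_pow_eq_monomial, sum_monomial_index _ _ (by simp)]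
      simp
    rw [h6] at h5
    rw [h4]
    linear_combination -extendedFrequency E O (q.succAbove k) * h5
  have h1 := (h'.isKernel_iff _).1 hk
  refine Fin.cases ?_ (fun i => ?_) k
  · rw [h0]
    simp [extendedFrequency]
  · have := congrFun h1 i
    simpa [extendedFrequency] using this

theorem RegularBands.bandFrequency_removeBand (h : RegularBands E O) (l : Fin (n + 1)) {v : ℝ}
    (hE : E l.succ = v) (hO : O l.succ = v) (i : Fin n) :
    bandFrequency E O (l.succAbove i) =
      bandFrequency (removeBand E l.succ) (removeBand O l.succ) i := by
  have h1 := h.extendedFrequency_removeBand (Fin.succ_ne_zero l) hE hO i.succ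
  simpa [extendedFrequency, Fin.succ_succAbove_succ] using h1

/-- The mass of a collapsed band. -/
theorem RegularBands.mom_one_collapsed (h : RegularBands E O) {q : Fin (n + 2)} (hq : q ≠ 0) {v : ℝ}
    (hE : E q = v) (hO : O q = v) : 0 < -rootProd (removeBand E q) (removeBand O q) v ∧
    mom (bandMoment E O q) 1 = Real.pi / √(-rootProd (removeBand E q) (removeBand O q) v) := by
  have h' := h.remove hq
  have hv : 0 < v := by
    obtain ⟨l, rfl⟩ := Fin.exists_succ_eq.2 hq
    rw [← hE]
    exact h.pos l
  have h1 : otherProd E O q v =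
      v * -rootProd (removeBand E q) (removeBand O q) v := by
    have h2 : otherProd E O q v = ∏ k, ((removeBand E q k - v) *
      (removeBand O q k - v)) := rfl
    rw [h2, rootProd, Finset.prod_mul_distrib, Fin.prod_univ_succ, h'.zero]
    ring
  have h2 : 0 < otherProd E O q v := by
    refine Finset.prod_pos fun k _ => ?_
    rcases lt_or_ge k.castSucc q with hk | hk
    · rw [Fin.succAbove_of_castSucc_lt _ _ hk]
      have h3 := h.lt_of_lt hk
      have h4 := h.band k.castSucc
      exact mul_pos_of_neg_of_neg (by linarith) (by linarith)
    · rw [Fin.succAbove_of_le_castSucc _ _ hk]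
      have h3 := h.lt_of_lt (Fin.le_castSucc_iff.1 hk)
      have h4 := h.band k.succ
      exact mul_pos (by linarith) (by linarith)
  have h3 : 0 < -rootProd (removeBand E q) (removeBand O q) v := by
    rw [h1] at h2
    exact (mul_pos_iff_of_pos_left hv).1 h2
  refine ⟨h3, ?_⟩
  rw [(h.freeBand q).mom_eq (h.band q)]
  have h4 : ∀ φ, bandPt E O q φ = v := fun φ => by rw [bandPt_of_eq (hE.trans hO.symm), hE]
  simp_rw [h4]
  rw [intervalIntegral.integral_const, Polynomial.eval_one, one_mul, bandWeight, abs_of_pos h2,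
    abs_of_pos hv, h1, Real.sqrt_mul hv.le, smul_eq_mul]
  have h5 := Real.sqrt_pos.2 hv
  have h6 := Real.sqrt_pos.2 h3
  field_simp
  ring

/-- The frequency of a collapsed band. -/
theorem RegularBands.bandFrequency_collapsed (h : RegularBands E O) (l : Fin (n + 1)) {v : ℝ}
    (hE : E l.succ = v) (hO : O l.succ = v) :
    bandFrequency E O l = (-1) ^ (l : ℕ) *
      (√(-rootProd (removeBand E l.succ) (removeBand O l.succ) v) / (2 * Real.pi)) *
      (mom (bandMoment E O 0) 1 + 2 * ∑ i : Fin n, (-1) ^ ((l.succAbove i : ℕ) + 1) *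
        bandFrequency E O (l.succAbove i) * mom (bandMoment E O (l.succAbove i).succ) 1) := by
  obtain ⟨h1, h2⟩ := h.mom_one_collapsed (Fin.succ_ne_zero l) hE hO
  -- Modulo the multiples of X - v, which determine the other components, p = 1 is the only equation
  -- left; in it the collapsed band has the explicit mass of `mom_one_collapsed`.
  have h3 := h.isKernel.poly (p := 1) (by simp)
  rw [Fin.sum_univ_succ, Fin.sum_univ_succAbove _ l, h2] at h3
  simp only [extendedFrequency, Fin.cons_zero, Fin.cons_succ, Fin.val_zero, pow_zero, one_mul,
    Fin.val_succ] at h3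
  set A := mom (bandMoment E O 0) 1
  set B := ∑ i : Fin n, (-1) ^ ((l.succAbove i : ℕ) + 1) *
        bandFrequency E O (l.succAbove i) * mom (bandMoment E O (l.succAbove i).succ) 1
  set r := √(-rootProd (removeBand E l.succ) (removeBand O l.succ) v) with hr
  have hr0 : 0 < r := Real.sqrt_pos.2 h1
  have hpi := Real.pi_pos
  have h4 : A + 2 * B = (-1) ^ (l : ℕ) * (2 * Real.pi / r) * bandFrequency E O l := by
    rw [pow_succ] at h3
    linear_combination 2 * h3
  have h5 : ((-1 : ℝ) ^ (l : ℕ)) * (-1) ^ (l : ℕ) = 1 := by rw [← mul_pow]; simp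
  rw [h4]
  field_simp
  linear_combination -bandFrequency E O l * h5

end EllipsoidBilliard

/-! ### Sections of the ellipsoid at regular faces -/

namespace EllipsoidBilliard

variable {n m : ℕ}

theorem removeBand_cEven {a : Fin (m + 2) → ℝ} {x : Fin (m + 1) → ℝ} {a' : Fin (m + 1) → ℝ}
    {x' : Fin m → ℝ} {l : Fin (m + 1)}
    (h1 : ∀ i : Fin m, i.castSucc < l →
      max (a' i.castSucc) (x' i) = max (a i.castSucc.castSucc) (x i.castSucc))
    (h2 : ∀ i : Fin m, l ≤ i.castSucc →
      max (a' i.castSucc) (x' i) = max (a i.succ.castSucc) (x i.succ)) :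
    removeBand (cEven a x) l.succ = cEven a' x' := by
  funext k
  rw [removeBand]
  refine Fin.cases ?_ (fun i => ?_) k
  · rw [Fin.succ_succAbove_zero]
    rfl
  · rw [Fin.succ_succAbove_succ]
    simp only [cEven, Fin.cons_succ]
    rcases lt_or_ge i.castSucc l with h | h
    · rw [Fin.succAbove_of_castSucc_lt _ _ h]
      exact (h1 i h).symm
    · rw [Fin.succAbove_of_le_castSucc _ _ h]
      exact (h2 i h).symm

theorem removeBand_cOdd {a : Fin (m + 2) → ℝ} {x : Fin (m + 1) → ℝ} {a' : Fin (m + 1) → ℝ}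
    {x' : Fin m → ℝ} {l : Fin (m + 1)}
    (h1 : ∀ i : Fin m, i.castSucc ≤ l →
      min (a' i.castSucc) (x' i) = min (a i.castSucc.castSucc) (x i.castSucc))
    (h2 : ∀ i : Fin m, l < i.castSucc →
      min (a' i.castSucc) (x' i) = min (a i.succ.castSucc) (x i.succ))
    (h3 : l = Fin.last m →
      a' (Fin.last m) = min (a (Fin.last m).castSucc) (x (Fin.last m)))
    (h4 : l ≠ Fin.last m → a' (Fin.last m) = a (Fin.last (m + 1))) :
    removeBand (cOdd a x) l.succ = cOdd a' x' := by
  funext k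
  rw [removeBand]
  refine Fin.lastCases ?_ (fun i => ?_) k
  · simp only [cOdd, Fin.snoc_last]
    by_cases hl : l = Fin.last m
    · rw [h3 hl, Fin.succAbove_of_castSucc_lt, Fin.snoc_castSucc]
      rw [hl]
      exact Fin.castSucc_lt_succ
    · rw [h4 hl, Fin.succAbove_of_le_castSucc, Fin.succ_last, Fin.snoc_last]
      rw [Fin.succ_le_castSucc_iff]
      exact Fin.lt_last_iff_ne_last.2 hl
  · simp only [cOdd, Fin.snoc_castSucc]
    rcases lt_or_ge l i.castSucc with h | h
    · rw [Fin.succAbove_of_le_castSucc _ _ (Fin.succ_le_castSucc_iff.2 h), Fin.succ_castSucc,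
        Fin.snoc_castSucc]
      exact (h2 i h).symm
    · rw [Fin.succAbove_of_castSucc_lt _ _ (Fin.castSucc_lt_succ_iff.2 h),
        Fin.snoc_castSucc]
      exact (h1 i h).symm

/-- Removing the colliding pair from the ordered list leaves the ordered list of the section. Away
from the collapse this is a renumbering; at the collapse the minima and maxima change partners and
are compared by interlacing. -/
theorem RegularKind.section_bands {a : Fin (m + 2) → ℝ} (ha : StrictMono a) 
    {x : Fin (m + 1) → ℝ} (F : RegularKind m) (hb : x ∈ F.face a) (hx : x ∈ weakCaustics a) :
    removeBand (cEven a x) F.idx.succ = cEven (F.sectionAxes a) (F.sectionCaustics a x) ∧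
    removeBand (cOdd a x) F.idx.succ = cOdd (F.sectionAxes a) (F.sectionCaustics a x) ∧
    cEven a x F.idx.succ = F.value x ∧ cOdd a x F.idx.succ = F.value x := by
  cases F with
  | upper l =>
    have hl : x l = a l.succ := hb.2
    have hlt : a l.castSucc < a l.succ := ha Fin.castSucc_lt_succ
    have eA : (upper l).sectionAxes a = fun i => a (l.succ.succAbove i) := rfl
    simp only [idx, sectionCaustics, value]
    rw [eA]
    have e1 : ∀ i : Fin m, i.castSucc ≤ l → l.succ.succAbove i.castSucc = i.castSucc.castSucc :=
      fun i h => Fin.succAbove_of_castSucc_lt _ _ (Fin.castSucc_lt_succ_iff.2 h)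
    have e2 : ∀ i : Fin m, l < i.castSucc → l.succ.succAbove i.castSucc = i.succ.castSucc :=
      fun i h => by
        rw [Fin.succAbove_of_le_castSucc _ _ (Fin.succ_le_castSucc_iff.2 h), Fin.succ_castSucc]
    have e3 : ∀ i : Fin m, i.castSucc < l → l.succAbove i = i.castSucc :=
      fun i h => Fin.succAbove_of_castSucc_lt _ _ h
    have e4 : ∀ i : Fin m, l ≤ i.castSucc → l.succAbove i = i.succ :=
      fun i h => Fin.succAbove_of_le_castSucc _ _ h
    have e5 : ∀ i : Fin m, l = i.castSucc → a l.succ ≤ x i.succ := fun i h => by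
      rw [← hl, h]
      exact hx.1 Fin.castSucc_lt_succ.le
    refine ⟨removeBand_cEven (fun i h => ?_) fun i h => ?_,
      removeBand_cOdd (fun i h => ?_) (fun i h => ?_) (fun h => ?_) fun h => ?_, ?_, ?_⟩
    · rw [e1 i h.le, e3 i h]
    · rcases h.lt_or_eq with h' | h'
      · rw [e2 i h', e4 i h]
      · rw [e1 i h'.ge, e4 i h, ← h']
        have := e5 i h'
        have h6 : i.succ.castSucc = l.succ := by rw [h', Fin.succ_castSucc]
        rw [h6, max_eq_right this, max_eq_right (hlt.le.trans this)]
    · rcases h.lt_or_eq with h' | h'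
      · rw [e1 i h, e3 i h']
      · have := e5 i h'.symm
        rw [e1 i h, e4 i h'.ge, h', hl, min_eq_left hlt.le, min_eq_left (hlt.le.trans this)]
    · rw [e2 i h, e4 i h.le]
    · subst h
      rw [Fin.succAbove_of_castSucc_lt _ _ Fin.castSucc_lt_succ, hl, min_eq_left hlt.le]
    · rw [Fin.succAbove_of_le_castSucc, Fin.succ_last]
      rw [Fin.succ_le_castSucc_iff]
      exact Fin.lt_last_iff_ne_last.2 h
    · simp only [cEven, Fin.cons_succ]
      rw [hl, max_eq_right hlt.le]
    · by_cases h : l = Fin.last m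
      · subst h
        simp only [cOdd, Fin.succ_last, Fin.snoc_last]
        rw [hl, Fin.succ_last]
      · obtain ⟨i, hi⟩ := Fin.exists_castSucc_eq.2 h
        subst hi
        rw [Fin.succ_castSucc]
        simp only [cOdd, Fin.snoc_castSucc]
        have := e5 i rfl
        rw [hl, ← Fin.succ_castSucc, min_eq_left this]
  | lower l =>
    have hl : x l.succ = a l.castSucc.castSucc := hb.2
    have hlt : a l.castSucc.castSucc < a l.succ.castSucc := ha (by simp [Fin.lt_def])
    have hle : x l.castSucc ≤ a l.castSucc.castSucc := by
      rw [← hl]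
      exact hx.1 Fin.castSucc_lt_succ.le
    have eA : (lower l).sectionAxes a = fun i => a (l.castSucc.castSucc.succAbove i) := rfl
    simp only [idx, sectionCaustics, value]
    rw [eA]
    have e1 : ∀ i : Fin m, i < l →
        l.castSucc.castSucc.succAbove i.castSucc = i.castSucc.castSucc :=
      fun i h => Fin.succAbove_of_castSucc_lt _ _ (Fin.castSucc_lt_castSucc_iff.2
        (Fin.castSucc_lt_castSucc_iff.2 h))
    have e2 : ∀ i : Fin m, l ≤ i → l.castSucc.castSucc.succAbove i.castSucc = i.succ.castSucc :=
      fun i h => by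
        rw [Fin.succAbove_of_le_castSucc _ _ (Fin.castSucc_le_castSucc_iff.2
          (Fin.castSucc_le_castSucc_iff.2 h)), Fin.succ_castSucc]
    have e3 : ∀ i : Fin m, i ≤ l → l.succ.succAbove i = i.castSucc :=
      fun i h => Fin.succAbove_of_castSucc_lt _ _ (Fin.castSucc_lt_succ_iff.2 h)
    have e4 : ∀ i : Fin m, l < i → l.succ.succAbove i = i.succ :=
      fun i h => Fin.succAbove_of_le_castSucc _ _ (Fin.succ_le_castSucc_iff.2 h)
    refine ⟨removeBand_cEven (fun i h => ?_) fun i h => ?_,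
      removeBand_cOdd (fun i h => ?_) (fun i h => ?_) (fun h => ?_) fun h => ?_, ?_, ?_⟩
    · rw [Fin.castSucc_lt_castSucc_iff] at h
      rw [e1 i h, e3 i h.le]
    · rw [Fin.castSucc_le_castSucc_iff] at h
      rcases h.lt_or_eq with h' | rfl
      · rw [e2 i h, e4 i h']
      · rw [e2 l le_rfl, e3 l le_rfl, hl, max_eq_left hlt.le, max_eq_left (hle.trans hlt.le)]
    · rw [Fin.castSucc_le_castSucc_iff] at h
      rcases h.lt_or_eq with h' | rfl
      · rw [e1 i h', e3 i h]
      · rw [e2 i le_rfl, e3 i le_rfl, min_eq_right hle, min_eq_right (hle.trans hlt.le)]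
    · rw [Fin.castSucc_lt_castSucc_iff] at h
      rw [e2 i h.le, e4 i h]
    · exact absurd h (Fin.castSucc_lt_last l).ne
    · rw [Fin.succAbove_of_le_castSucc, Fin.succ_last]
      rw [Fin.castSucc_le_castSucc_iff]
      exact Fin.le_last _
    · simp only [cEven, Fin.cons_succ]
      rw [hl, max_eq_left hle]
    · rw [Fin.succ_castSucc]
      simp only [cOdd, Fin.snoc_castSucc]
      rw [hl, min_eq_right hlt.le]
  | diag l =>
    have hl : x l.castSucc = x l.succ := hb.2
    have hlt : a l.castSucc.castSucc < a l.succ.castSucc := ha (by simp [Fin.lt_def])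
    have hle1 : a l.castSucc.castSucc ≤ x l.succ := le_of_mem_weakCaustics' ha hx (by simp)
    have hle2 : x l.succ ≤ a l.succ.castSucc := by
      rw [← hl]
      exact le_of_mem_weakCaustics_right ha hx (by simp)
    have eA : (diag l).sectionAxes a = fun i => a (l.castSucc.castSucc.succAbove i) := rfl
    simp only [idx, sectionCaustics, value]
    rw [eA]
    have e1 : ∀ i : Fin m, i < l →
        l.castSucc.castSucc.succAbove i.castSucc = i.castSucc.castSucc :=
      fun i h => Fin.succAbove_of_castSucc_lt _ _ (Fin.castSucc_lt_castSucc_iff.2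
        (Fin.castSucc_lt_castSucc_iff.2 h))
    have e2 : ∀ i : Fin m, l ≤ i → l.castSucc.castSucc.succAbove i.castSucc = i.succ.castSucc :=
      fun i h => by
        rw [Fin.succAbove_of_le_castSucc _ _ (Fin.castSucc_le_castSucc_iff.2
          (Fin.castSucc_le_castSucc_iff.2 h)), Fin.succ_castSucc]
    have e3 : ∀ i : Fin m, i < l → Function.update x l.castSucc (a l.castSucc.castSucc)
        (l.succ.succAbove i) = x i.castSucc := fun i h => by
      rw [Fin.succAbove_of_castSucc_lt _ _ (Fin.castSucc_lt_succ_iff.2 h.le),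
        Function.update_of_ne]
      simpa using h.ne
    have e3' : Function.update x l.castSucc (a l.castSucc.castSucc)
        (l.succ.succAbove l) = a l.castSucc.castSucc := by
      rw [Fin.succAbove_of_castSucc_lt _ _ (Fin.castSucc_lt_succ_iff.2 le_rfl),
        Function.update_self]
    have e4 : ∀ i : Fin m, l < i → Function.update x l.castSucc (a l.castSucc.castSucc)
        (l.succ.succAbove i) = x i.succ := fun i h => by
      rw [Fin.succAbove_of_le_castSucc _ _ (Fin.succ_le_castSucc_iff.2 h),
        Function.update_of_ne]
      exact (Fin.castSucc_lt_succ_iff.2 h.le).ne'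
    refine ⟨removeBand_cEven (fun i h => ?_) fun i h => ?_,
      removeBand_cOdd (fun i h => ?_) (fun i h => ?_) (fun h => ?_) fun h => ?_, ?_, ?_⟩
    · rw [Fin.castSucc_lt_castSucc_iff] at h
      rw [e1 i h, e3 i h]
    · rw [Fin.castSucc_le_castSucc_iff] at h
      rcases h.lt_or_eq with h' | rfl
      · rw [e2 i h, e4 i h']
      · rw [e2 l le_rfl, e3', max_eq_left hlt.le, max_eq_left hle2]
    · rw [Fin.castSucc_le_castSucc_iff] at h
      rcases h.lt_or_eq with h' | rfl
      · rw [e1 i h', e3 i h']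
      · rw [e2 i le_rfl, e3', hl, min_eq_right hlt.le, min_eq_left hle1]
    · rw [Fin.castSucc_lt_castSucc_iff] at h
      rw [e2 i h.le, e4 i h]
    · exact absurd h (Fin.castSucc_lt_last l).ne
    · rw [Fin.succAbove_of_le_castSucc, Fin.succ_last]
      rw [Fin.castSucc_le_castSucc_iff]
      exact Fin.le_last _
    · simp only [cEven, Fin.cons_succ]
      rw [hl, max_eq_right hle1]
    · rw [Fin.succ_castSucc]
      simp only [cOdd, Fin.snoc_castSucc]
      rw [min_eq_right hle2]

theorem sectionCaustics_mem {a : Fin (m + 2) → ℝ} (ha : StrictMono a) (ha0 : ∀ i, 0 < a i)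
    {x : Fin (m + 1) → ℝ} {F : RegularKind m} (hx : x ∈ F.face a) :
    F.sectionCaustics a x ∈ causticSpace (F.sectionAxes a) := by
  have hw := (regular_of_mem_face ha ha0 hx).1
  rw [border_eq a ha ha0] at hw
  have hs := sectionCaustics_mem_weak ha ha0 hw.1.1 F
  cases F with
  | upper l =>
    obtain ⟨h1, h2⟩ := border_of_mem_range ha ha0 hx.1 (hx.2 ▸ mem_range_withZero a _)
    exact mem_causticSpace_of_notMem (fun i => ha0 _) hs h2
      fun i hi => h1 i (range_withZero_succAbove a _ hi)
  | lower l =>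
    obtain ⟨h1, h2⟩ := border_of_mem_range ha ha0 hx.1 (hx.2 ▸ mem_range_withZero a _)
    exact mem_causticSpace_of_notMem (fun i => ha0 _) hs h2
      fun i hi => h1 i (range_withZero_succAbove a _ hi)
  | diag l =>
    obtain ⟨h1, h2⟩ := border_of_eq ha ha0 hx.1 hx.2
    have e3' : Function.update x l.castSucc (a l.castSucc.castSucc)
        (l.succ.succAbove l) = a l.castSucc.castSucc := by
      rw [Fin.succAbove_of_castSucc_lt _ _ (Fin.castSucc_lt_succ_iff.2 le_rfl),
        Function.update_self]
    have e4 : ∀ i : Fin m, i ≠ l → Function.update x l.castSucc (a l.castSucc.castSucc)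
        (l.succ.succAbove i) = x (l.succ.succAbove i) := fun i h => by
      rw [Function.update_of_ne]
      intro h3
      refine h (Fin.succAbove_right_injective (p := l.succ) ?_)
      rw [h3, Fin.succAbove_of_castSucc_lt _ _ (Fin.castSucc_lt_succ_iff.2 le_rfl)]
    refine mem_causticSpace_of_notMem (fun i => ha0 _) hs
      (hs.1.strictMono_of_injective fun i k hik => ?_) fun i hi => ?_
    · simp only [RegularKind.sectionCaustics] at hik
      by_contra hne
      by_cases hi : i = l
      · rw [hi, e3', e4 k (fun h => hne (hi.trans h.symm))] at hik
        exact h1 k (hik ▸ mem_range_withZero a _)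
      · by_cases hk : k = l
        · rw [hk, e3', e4 i hi] at hik
          exact h1 i (hik ▸ mem_range_withZero a _)
        · rw [e4 i hi, e4 k hk] at hik
          exact hne (h2.injective hik)
    · simp only [RegularKind.sectionCaustics] at hi
      by_cases hil : i = l
      · rw [hil, e3'] at hi
        obtain ⟨k, hk⟩ := hi
        induction k using Fin.cases with
        | zero => exact (ha0 l.castSucc.castSucc).ne (by simpa [withZero] using hk)
        | succ k =>
          exact Fin.succAbove_ne _ _ (ha.injective (show a (Fin.succAbove _ k) = _ from hk))
      · rw [e4 i hil] at hi
        exact h1 i (range_withZero_succAbove a _ hi)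

theorem continuous_sectionCaustics (a : Fin (m + 2) → ℝ) (F : RegularKind m) :
    Continuous fun x => F.sectionCaustics a x := by
  cases F with
  | upper l =>
    exact continuous_pi fun i => continuous_apply _
  | lower l =>
    exact continuous_pi fun i => continuous_apply _
  | diag l =>
    refine continuous_pi fun i => ?_
    exact (continuous_apply (l.succ.succAbove i)).comp
      (continuous_id.update l.castSucc continuous_const)

theorem face_subset_closure {a : Fin (m + 2) → ℝ} (ha : StrictMono a) (ha0 : ∀ i, 0 < a i)
    (F : RegularKind m) : F.face a ⊆ closure (causticSpace a) := fun x hx => by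
  have := (regular_of_mem_face ha ha0 hx).1
  rw [border_eq a ha ha0] at this
  exact weakCaustics_subset_closure ha ha0 this.1.1

/-- Combine `section_bands` with the results on collapsed bands. On a face of codimension one the
section is nonsingular, so its frequency and the integrals in its original variable are available.
-/
theorem extFrequencyMap_of_mem_face {a : Fin (m + 2) → ℝ} (ha : StrictMono a) (ha0 : ∀ i, 0 < a i)
    {x : Fin (m + 1) → ℝ} {F : RegularKind m} (hx : x ∈ F.face a) :
    (fun i => extFrequencyMap a x (F.idx.succAbove i)) =
      extFrequencyMap (F.sectionAxes a) (F.sectionCaustics a x) ∧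
    extFrequencyMap a x F.idx =
      F.collapsedComponent a x (fun i => extFrequencyMap a x (F.idx.succAbove i)) := by
  obtain ⟨hb, h0, hreg⟩ := regular_of_mem_face ha ha0 hx
  rw [border_eq a ha ha0] at hb
  have hB := regularBands_of_mem ha ha0 hb.1.1 hreg
  obtain ⟨hE, hO, hEv, hOv⟩ := F.section_bands ha hx hb.1.1
  have hs := sectionCaustics_mem ha ha0 hx
  have ha' : StrictMono (F.sectionAxes a) := strictMono_sectionAxes ha F.hyperplane
  have ha0' : ∀ i, 0 < F.sectionAxes a i := fun i => ha0 _
  have hI := isBands_of_mem ha' ha0' hs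
  rw [extFrequencyMap_of_regular ha ha0 hb.1.1 hreg]
  constructor
  · rw [extFrequencyMap_eq ha' ha0' hs, frequencyMap_eq ha' ha0' hs]
    funext i
    rw [hB.bandFrequency_removeBand F.idx hEv hOv, hE, hO]
  · rw [hB.bandFrequency_collapsed F.idx hEv hOv, RegularKind.collapsedComponent, hE, hO,
      ← T_eq_rootProd]
    have hJ : ∀ k : Fin (m + 1), mom (bandMoment (cEven a x) (cOdd a x) (F.idx.succ.succAbove k)) 1 =
        ∫ s in (cEven (F.sectionAxes a) (F.sectionCaustics a x) k)..(cOdd (F.sectionAxes a)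
          (F.sectionCaustics a x) k), 1 / (|F.value x - s| *
            √(T (F.sectionAxes a) (F.sectionCaustics a x) s)) := by
      intro k
      have h1 := integral_band_eq hI.toWeakBands (hI.band_lt k) fun s => |F.value x - s|⁻¹
      have h2 : ∀ s ∈ uIcc (cEven (F.sectionAxes a) (F.sectionCaustics a x) k)
          (cOdd (F.sectionAxes a) (F.sectionCaustics a x) k),
          1 / (|F.value x - s| * √(T (F.sectionAxes a) (F.sectionCaustics a x) s)) =
          |F.value x - s|⁻¹ / √|rootProd (cEven (F.sectionAxes a) (F.sectionCaustics a x))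
            (cOdd (F.sectionAxes a) (F.sectionCaustics a x)) s| := by
        intro s hs
        rw [uIcc_of_le (hI.band k)] at hs
        rw [T_eq_rootProd, abs_of_nonneg (hI.rootProd_nonneg hs), one_div, mul_inv, div_eq_mul_inv]
      rw [intervalIntegral.integral_congr h2, h1, (hB.freeBand _).mom_eq (hB.band _)]
      refine intervalIntegral.integral_congr fun φ _ => ?_
      rw [bandWeight_succAbove hEv hOv, bandPt_removeBand, hE, hO, Polynomial.eval_one, one_mul]
    have hJ0 := hJ 0
    have hJs := fun i : Fin m => hJ i.succ
    rw [Fin.succ_succAbove_zero] at hJ0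
    simp_rw [Fin.succ_succAbove_succ] at hJs
    simp only [hJ0, hJs]

theorem mem_closure_face {a : Fin (m + 2) → ℝ} (ha : StrictMono a) (ha0 : ∀ i, 0 < a i)
    {x : Fin (m + 1) → ℝ} {F : RegularKind m} (hx : x ∈ closure (F.face a)) :
    F.sectionCaustics a x ∈ closure (causticSpace (F.sectionAxes a)) ∧
    (fun i => extFrequencyMap a x (F.idx.succAbove i)) =
      extFrequencyMap (F.sectionAxes a) (F.sectionCaustics a x) := by
  have hsub := face_subset_closure ha ha0 F
  have hmaps : MapsTo (fun x => F.sectionCaustics a x) (closure (causticSpace a))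
      (closure (causticSpace (F.sectionAxes a))) := fun y hy => by
    rw [closure_causticSpace ha ha0] at hy
    exact weakCaustics_subset_closure (strictMono_sectionAxes ha _) (fun i => ha0 _)
      (sectionCaustics_mem_weak ha ha0 hy F)
  have hxc : x ∈ closure (causticSpace a) := closure_minimal hsub isClosed_closure hx
  have h1 := continuousOn_extFrequencyMap ha ha0 x hxc
  have h2 : ContinuousWithinAt (fun x => extFrequencyMap (F.sectionAxes a) (F.sectionCaustics a x))
      (closure (causticSpace a)) x :=
    ((continuousOn_extFrequencyMap (a := F.sectionAxes a) (strictMono_sectionAxes ha _)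
      (fun i => ha0 _)).comp (continuous_sectionCaustics a F).continuousOn hmaps) x hxc
  refine ⟨hmaps hxc, eq_of_mem_closure (f := fun x i => extFrequencyMap a x (F.idx.succAbove i))
    (continuousWithinAt_pi.2 fun i => continuousWithinAt_pi.1 h1 _) h2 hsub
    (fun y hy => (extFrequencyMap_of_mem_face ha ha0 hy).1) hx⟩

theorem tendsto_collapsedComponent {a : Fin (m + 2) → ℝ} (ha : StrictMono a) (ha0 : ∀ i, 0 < a i)
    {x : Fin (m + 1) → ℝ} {F : RegularKind m} (hx : x ∈ closure (F.face a)) :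
    Tendsto (fun y => F.collapsedComponent a y
      (fun i => extFrequencyMap a y (F.idx.succAbove i)))
      (𝓝[F.face a] x) (𝓝 (extFrequencyMap a x F.idx)) := by
  have hsub := face_subset_closure ha ha0 F
  have hxc : x ∈ closure (causticSpace a) := closure_minimal hsub isClosed_closure hx
  have h1 := continuousWithinAt_pi.1 (continuousOn_extFrequencyMap ha ha0 x hxc) F.idx
  refine Tendsto.congr' ?_ (h1.mono hsub)
  filter_upwards [self_mem_nhdsWithin] with y hy
  exact (extFrequencyMap_of_mem_face ha ha0 hy).2

/-! ### Asymptotics at the regular faces -/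

theorem isBigO_of_analyticAt {E F : Type*} [NormedAddCommGroup E] [NormedSpace ℝ E]
    [NormedAddCommGroup F] [NormedSpace ℝ F] {f : E → F} {x : E} (h : AnalyticAt ℝ f x) :
    (fun y => f y - f x) =O[𝓝 x] fun y => y - x :=
  h.differentiableAt.isBigO_sub

/-- At these points c₁ > 0 and no gap is closed, so the formula for the frequency is analytic in a
full neighbourhood of the point. -/
theorem isBigO_regularFaces {a : Fin (m + 2) → ℝ} (ha : StrictMono a) (ha0 : ∀ i, 0 < a i)
    {x : Fin (m + 1) → ℝ} (hx : x ∈ regularFaces a) :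
    (fun y => frequencyMap a y - extFrequencyMap a x) =O[𝓝[causticSpace a] x] fun y => y - x := by
  rw [regularFaces_eq ha ha0, mem_iUnion] at hx
  obtain ⟨F, hF⟩ := hx
  obtain ⟨hb, h0, hreg⟩ := regular_of_mem_face ha ha0 hF
  rw [border_eq a ha ha0] at hb
  have h1 : 0 < cOdd a x 0 := by
    rw [← Fin.castSucc_zero]
    simp only [cOdd, Fin.snoc_castSucc]
    exact lt_min (ha0 _) h0
  have h2 := (isBigO_of_analyticAt (analyticAt_bandFrequency ha ha0 hb.1.1 hreg h1)).mono
    (nhdsWithin_le_nhds (s := causticSpace a))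
  rw [extFrequencyMap_of_regular ha ha0 hb.1.1 hreg]
  refine h2.congr' ?_ EventuallyEq.rfl
  filter_upwards [self_mem_nhdsWithin] with y hy
  rw [frequencyMap_eq ha ha0 hy]

/-! ### The geodesic faces -/

theorem cOdd_zero {a : Fin (m + 2) → ℝ} {x : Fin (m + 1) → ℝ} : cOdd a x 0 = min (a 0) (x 0) := by
  rw [← Fin.castSucc_zero]
  simp only [cOdd, Fin.snoc_castSucc]

theorem regular_of_mem_geodesicFaces {a : Fin (m + 2) → ℝ} (ha : StrictMono a) (ha0 : ∀ i, 0 < a i)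
    {x : Fin (m + 1) → ℝ} (hx : x ∈ geodesicFaces a) :
    x ∈ weakCaustics a ∧ ∀ i, x i ≠ a i.castSucc := by
  have hb := hx.1
  rw [border_eq a ha ha0] at hb
  refine ⟨hb.1.1, fun i h => ?_⟩
  by_cases hi : i = 0
  · rw [hi, hx.2] at h
    exact (ha0 _).ne h
  · exact notMem_of_ne ha ha0 hx.1 (j := 0) (hx.2 ▸ zero_mem_range_withZero a) hi
      (h ▸ mem_range_withZero a _)

theorem extFrequencyMap_of_mem_closure_geodesicFaces {a : Fin (m + 2) → ℝ} (ha : StrictMono a)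
    (ha0 : ∀ i, 0 < a i) {x : Fin (m + 1) → ℝ} (hx : x ∈ closure (geodesicFaces a)) :
    extFrequencyMap a x = 0 := by
  have hsub : geodesicFaces a ⊆ closure (causticSpace a) := fun y hy =>
    weakCaustics_subset_closure ha ha0 (regular_of_mem_geodesicFaces ha ha0 hy).1
  have hxc : x ∈ closure (causticSpace a) := closure_minimal hsub isClosed_closure hx
  refine eq_of_mem_closure (g := fun _ => 0) (continuousOn_extFrequencyMap ha ha0 x hxc)
    continuousWithinAt_const hsub (fun y hy => ?_) hx
  obtain ⟨hw, hreg⟩ := regular_of_mem_geodesicFaces ha ha0 hy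
  rw [extFrequencyMap_of_regular ha ha0 hw hreg, bandFrequency_caustics, cOdd_zero, hy.2,
    min_eq_right (ha0 0).le]
  simp

theorem analyticAt_cons_zero (x : Fin m → ℝ) :
    AnalyticAt ℝ (fun y : Fin m → ℝ => (Fin.cons 0 y : Fin (m + 1) → ℝ)) x := by
  refine AnalyticAt.pi fun k => ?_
  refine Fin.cases ?_ (fun i => ?_) k
  · simp only [Fin.cons_zero]
    exact analyticAt_const
  · simp only [Fin.cons_succ]
    exact (ContinuousLinearMap.proj (R := ℝ) (φ := fun _ : Fin m => ℝ) i).analyticAt x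

/-- Near G one has c₁ = λ₁, so the frequency is √λ₁ times `causticScaled`, which is analytic across
λ₁ = 0. The coefficient is its value at λ₁ = 0, and the error is √λ₁ · O(λ₁). -/
theorem exists_geodesic_asymptotics {a : Fin (m + 2) → ℝ} (ha : StrictMono a) (ha0 : ∀ i, 0 < a i) :
    ∃ kG : (Fin m → ℝ) → (Fin (m + 1) → ℝ),
      AnalyticOnNhd ℝ kG (geodesicSpace a) ∧
      (∀ x ∈ geodesicSpace a, ∀ i, 0 < kG x i) ∧
      ∀ x ∈ geodesicSpace a,
        (fun t : ℝ => frequencyMap a (Fin.cons t x) - t ^ (1 / 2 : ℝ) • kG x)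
          =O[𝓝[>] 0] fun t : ℝ => t ^ (3 / 2 : ℝ) := by
  refine ⟨fun x => causticScaled a (Fin.cons 0 x), fun x hx => ?_, fun x hx i => ?_, fun x hx => ?_⟩
  · obtain ⟨hw, hreg⟩ := regular_of_mem_geodesicFaces ha ha0 hx
    exact AnalyticAt.fun_comp (g := causticScaled a)
      (analyticAt_causticScaled ha ha0 hw hreg) (analyticAt_cons_zero x)
  · obtain ⟨hw, hreg⟩ := regular_of_mem_geodesicFaces ha ha0 hx
    exact (regularBands_of_mem ha ha0 hw hreg).scaledFrequency_pos i
  · obtain ⟨hw, hreg⟩ := regular_of_mem_geodesicFaces ha ha0 hx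
    have h1 := isBigO_of_analyticAt (analyticAt_causticScaled ha ha0 hw hreg)
    have hc : Continuous fun t : ℝ => (Fin.cons t x : Fin (m + 1) → ℝ) := by
      refine continuous_pi fun k => ?_
      refine Fin.cases ?_ (fun i => ?_) k
      · simp only [Fin.cons_zero]
        exact continuous_id
      · simp only [Fin.cons_succ]
        exact continuous_const
    have h2 := h1.comp_tendsto ((hc.tendsto 0).mono_left (nhdsWithin_le_nhds (s := Ioi 0)))
    have h3 : (fun t : ℝ => (Fin.cons t x - Fin.cons 0 x : Fin (m + 1) → ℝ)) =O[𝓝[>] 0]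
        fun t : ℝ => t := by
      refine isBigO_pi.2 fun k => ?_
      refine Fin.cases ?_ (fun i => ?_) k
      · simpa using isBigO_refl _ _
      · simpa using isBigO_zero _ _
    have h4 := (isBigO_refl (fun t : ℝ => t ^ (1 / 2 : ℝ)) (𝓝[>] 0)).smul (h2.trans h3)
    have hm : ∀ᶠ t in 𝓝[>] (0 : ℝ), (Fin.cons t x : Fin (m + 1) → ℝ) ∈ causticSpace a ∧ t < a 0 := by
      obtain ⟨h5, h6⟩ := border_of_mem_range ha ha0 hx.1 (j := 0)
        (hx.2 ▸ zero_mem_range_withZero a)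
      simp only [Fin.succAbove_zero, Fin.cons_succ] at h5 h6
      have h7 : ∀ i, 0 < x i := fun i => by
        have h8 := nonneg_of_mem_weakCaustics ha0 hw i.succ
        rw [Fin.cons_succ] at h8
        exact lt_of_le_of_ne h8 fun h => h5 i (h ▸ zero_mem_range_withZero a)
      have h8 : ∀ᶠ t in 𝓝[>] (0 : ℝ), ∀ i, t < x i :=
        eventually_all.2 fun i => nhdsWithin_le_nhds (gt_mem_nhds (h7 i))
      filter_upwards [h8, self_mem_nhdsWithin, nhdsWithin_le_nhds (gt_mem_nhds (ha0 0))]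
        with t h9 ht0 hta
      have ht0 : 0 < t := ht0
      have hs : StrictMono (Fin.cons t x : Fin (m + 1) → ℝ) := by
        intro i k hik
        obtain ⟨k', rfl⟩ := Fin.exists_succ_eq.2 (Fin.ne_zero_of_lt hik)
        induction i using Fin.cases with
        | zero => simpa using h9 k'
        | succ i => simpa using h6 (Fin.succ_lt_succ_iff.1 hik)
      refine ⟨mem_causticSpace_of_notMem ha0 ⟨hs.monotone, fun i => ?_⟩ hs fun i => ?_, hta⟩
      · induction i using Fin.cases with
        | zero =>
          simp only [Fin.castSucc_zero, Fin.cons_zero]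
          exact ⟨by simpa [withZero] using ht0.le, (hta.trans (ha (Fin.succ_pos 0))).le⟩
        | succ i => simpa using hw.2 i.succ
      · induction i using Fin.cases with
        | zero =>
          rintro ⟨k, hk⟩
          rw [Fin.cons_zero] at hk
          induction k using Fin.cases with
          | zero => exact ht0.ne (by simpa [withZero] using hk)
          | succ k =>
            rw [withZero, Fin.cons_succ] at hk
            exact (hta.trans_le (ha.monotone (Fin.zero_le k))).ne' hk
        | succ i => simpa using h5 i
    refine h4.congr' ?_ ?_
    · filter_upwards [hm, self_mem_nhdsWithin] with t ht ht0
      have ht0 : 0 < t := ht0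
      rw [frequencyMap_eq ha ha0 ht.1, bandFrequency_caustics, cOdd_zero, Fin.cons_zero,
        min_eq_right ht.2.le, abs_of_pos ht0, Real.sqrt_eq_rpow, ← smul_sub]
      rfl
    · filter_upwards [self_mem_nhdsWithin] with t ht0
      have ht0 : 0 < t := ht0
      rw [smul_eq_mul, ← Real.rpow_add_one ht0.ne']
      norm_num

end EllipsoidBilliard

namespace EllipsoidBilliard

variable {n m : ℕ}

/-! ### Pinching a band -/

/-- The bands other than the `l`-th and the next one. -/
def skipPair (l : Fin (m + 1)) (j : Fin m) : Fin (m + 2) := l.succ.succAbove (l.succAbove j)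

theorem castSucc_succAbove_succAbove (l : Fin (m + 1)) (j : Fin m) :
    l.castSucc.succAbove (l.succAbove j) = skipPair l j := by
  rw [skipPair]
  ext
  simp only [val_succAbove, Fin.val_castSucc, Fin.val_succ]
  split_ifs <;> omega

theorem succ_succAbove_self (l : Fin (m + 1)) : l.succ.succAbove l = l.castSucc :=
  Fin.succAbove_of_castSucc_lt _ _ Fin.castSucc_lt_succ

theorem castSucc_succAbove_self' (l : Fin (m + 1)) : l.castSucc.succAbove l = l.succ :=
  Fin.succAbove_of_le_castSucc _ _ le_rfl

theorem sum_skipPair (l : Fin (m + 1)) (f : Fin (m + 2) → ℝ) :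
    ∑ k, f k = f l.castSucc + (f l.succ + ∑ j, f (skipPair l j)) := by
  rw [Fin.sum_univ_succAbove _ l.succ, Fin.sum_univ_succAbove _ l, succ_succAbove_self,
    add_left_comm]
  rfl

theorem skipPair_cases (l : Fin (m + 1)) {p : Fin (m + 2) → Prop} (h1 : p l.castSucc) (h2 : p l.succ)
    (h3 : ∀ j, p (skipPair l j)) (k : Fin (m + 2)) : p k := by
  rcases Fin.eq_self_or_eq_succAbove l.succ k with rfl | ⟨k', rfl⟩
  · exact h2
  · rcases Fin.eq_self_or_eq_succAbove l k' with rfl | ⟨j, rfl⟩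
    · rwa [succ_succAbove_self]
    · exact h3 j

/-- The left endpoints after the `l`-th band has been divided into two, the second of which starts
at `v`. -/
def pinchLeft (l : Fin (m + 1)) (E : Fin (m + 1) → ℝ) (v : ℝ) : Fin (m + 2) → ℝ :=
  l.succ.insertNth (α := fun _ => ℝ) v E

/-- The right endpoints after the `l`-th band has been divided into two, the first of which ends
at `u`. -/
def pinchRight (l : Fin (m + 1)) (O : Fin (m + 1) → ℝ) (u : ℝ) : Fin (m + 2) → ℝ :=
  l.castSucc.insertNth (α := fun _ => ℝ) u O

variable (l : Fin (m + 1)) (E O : Fin (m + 1) → ℝ) (u v : ℝ)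

@[simp] theorem pinchLeft_succ : pinchLeft l E v l.succ = v := Fin.insertNth_apply_same _ _ _

@[simp] theorem pinchLeft_succAbove (k : Fin (m + 1)) :
    pinchLeft l E v (l.succ.succAbove k) = E k := Fin.insertNth_apply_succAbove _ _ _ _

@[simp] theorem pinchLeft_castSucc : pinchLeft l E v l.castSucc = E l := by
  rw [← succ_succAbove_self, pinchLeft_succAbove]

@[simp] theorem pinchLeft_skipPair (j : Fin m) : pinchLeft l E v (skipPair l j) = E (l.succAbove j) :=
  pinchLeft_succAbove _ _ _ _

@[simp] theorem pinchRight_castSucc : pinchRight l O u l.castSucc = u :=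
  Fin.insertNth_apply_same _ _ _

@[simp] theorem pinchRight_succAbove (k : Fin (m + 1)) :
    pinchRight l O u (l.castSucc.succAbove k) = O k := Fin.insertNth_apply_succAbove _ _ _ _

@[simp] theorem pinchRight_succ : pinchRight l O u l.succ = O l := by
  rw [← castSucc_succAbove_self', pinchRight_succAbove]

@[simp] theorem pinchRight_skipPair (j : Fin m) :
    pinchRight l O u (skipPair l j) = O (l.succAbove j) := by
  rw [← castSucc_succAbove_succAbove, pinchRight_succAbove]

theorem pinchLeft_zero (h : E 0 = 0) : pinchLeft l E v 0 = 0 := by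
  have := pinchLeft_succAbove l E v 0
  rwa [Fin.succ_succAbove_zero, h] at this

theorem pinchLeft_succ_succAbove (j : Fin m) :
    pinchLeft l E v (l.succAbove j).succ = E j.succ := by
  rw [← Fin.succ_succAbove_succ, pinchLeft_succAbove]

theorem pinchRight_castSucc_succAbove (j : Fin m) :
    pinchRight l O u (l.succAbove j).castSucc = O j.castSucc := by
  rw [← Fin.castSucc_succAbove_castSucc, pinchRight_succAbove]

variable {l E O u v}

theorem IsBands.weakBands_pinch (h : IsBands E O) (hu : E l ≤ u) (huv : u ≤ v) (hv : v ≤ O l)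
    (hv0 : 0 < v) : LimBands (pinchLeft l E v) (pinchRight l O u) where
  zero := pinchLeft_zero l E v h.zero
  band := skipPair_cases l (by simpa using hu) (by simpa using hv) fun j => by simpa using h.band _
  gap i := by
    rcases Fin.eq_self_or_eq_succAbove l i with rfl | ⟨j, rfl⟩
    · simpa using huv
    · rw [pinchLeft_succ_succAbove, pinchRight_castSucc_succAbove]
      exact h.gap j
  pos i := by
    rcases Fin.eq_self_or_eq_succAbove l i with rfl | ⟨j, rfl⟩
    · simpa using hv0
    · rw [pinchLeft_succ_succAbove]
      exact h.pos j
  sep i k hik := by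
    rcases Fin.eq_self_or_eq_succAbove l i with rfl | ⟨j, rfl⟩
    · obtain ⟨j, rfl⟩ := Fin.exists_succAbove_eq hik.ne'
      rw [pinchLeft_succ_succAbove, pinchRight_castSucc]
      refine (huv.trans hv).trans_lt (h.lt_of_lt ?_)
      rw [Fin.lt_def] at hik ⊢
      rw [val_succAbove] at hik
      simp
      split_ifs at hik <;> omega
    · rcases Fin.eq_self_or_eq_succAbove l k with rfl | ⟨j', rfl⟩
      · rw [pinchLeft_succ, pinchRight_castSucc_succAbove]
        refine (h.lt_of_lt ?_).trans_le (hu.trans huv)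
        rw [Fin.lt_def] at hik ⊢
        rw [val_succAbove] at hik
        simp
        split_ifs at hik <;> omega
      · rw [pinchLeft_succ_succAbove, pinchRight_castSucc_succAbove]
        refine h.lt_of_lt ?_
        have := l.strictMono_succAbove.lt_iff_lt.1 hik
        rw [Fin.lt_def] at this ⊢
        simp
        omega

theorem IsBands.pinch (h : IsBands E O) (hu : E l < u) (huv : u < v) (hv : v < O l) :
    IsBands (pinchLeft l E v) (pinchRight l O u) where
  toWeakBands := (h.weakBands_pinch hu.le huv.le hv.le
    (((h.nonneg l).trans_lt hu).trans huv)).toWeakBands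
  gap_lt i := by
    rcases Fin.eq_self_or_eq_succAbove l i with rfl | ⟨j, rfl⟩
    · simpa using huv
    · rw [pinchLeft_succ_succAbove, pinchRight_castSucc_succAbove]
      exact h.gap_lt j
  band_lt := skipPair_cases l (by simpa using hu) (by simpa using hv)
    fun j => by simpa using h.band_lt _

theorem IsBands.freeBand_pinch (h : IsBands E O) (hu : E l ≤ u) (huv : u ≤ v) (hv : v ≤ O l)
    (hv0 : 0 < v) (j : Fin m) : FreeBand (pinchLeft l E v) (pinchRight l O u) (skipPair l j) := by
  refine FreeBand.of_gaps (h.weakBands_pinch hu huv hv hv0).toWeakBands fun i hi => ?_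
  rcases Fin.eq_self_or_eq_succAbove l i with rfl | ⟨j', rfl⟩
  · exfalso
    rcases hi with hi | hi
    · rw [← castSucc_succAbove_succAbove] at hi
      exact Fin.succAbove_ne _ _ hi.symm
    · exact Fin.succAbove_ne _ _ hi.symm
  · rw [pinchLeft_succ_succAbove, pinchRight_castSucc_succAbove]
    exact h.gap_lt j'

theorem otherProd_skipPair (j : Fin m) (s : ℝ) :
    otherProd (pinchLeft l E v) (pinchRight l O u) (skipPair l j) s =
      (v - s) * (u - s) * otherProd E O (l.succAbove j) s := by
  have h1 : otherProd (pinchLeft l E v) (pinchRight l O u) (skipPair l j) s =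
      (∏ i, (pinchLeft l E v ((skipPair l j).succAbove i) - s)) *
        ∏ i, (pinchRight l O u ((skipPair l j).succAbove i) - s) := by
    rw [otherProd, Finset.prod_mul_distrib]
  rw [h1, skipPair, prod_succAbove_succAbove (fun k => pinchLeft l E v k - s), ← skipPair,
    ← castSucc_succAbove_succAbove, prod_succAbove_succAbove (fun k => pinchRight l O u k - s),
    otherProd, Finset.prod_mul_distrib]
  simp only [pinchLeft_succ, pinchLeft_succAbove, pinchRight_castSucc, pinchRight_succAbove]
  ring

theorem otherProd_pinch_succ (s : ℝ) :
    otherProd (pinchLeft l E v) (pinchRight l O u) l.succ s =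
      (E l - s) * (u - s) * otherProd E O l s := by
  rw [otherProd, Fin.prod_univ_succAbove _ l, succ_succAbove_self, pinchLeft_castSucc,
    pinchRight_castSucc, otherProd]
  congr 1
  refine Finset.prod_congr rfl fun i _ => ?_
  rw [← skipPair, pinchLeft_skipPair, pinchRight_skipPair]

theorem bandWeight_skipPair (j : Fin m) (s : ℝ) :
    bandWeight (pinchLeft l E v) (pinchRight l O v) (skipPair l j) s =
      |v - s|⁻¹ * bandWeight E O (l.succAbove j) s := by
  rw [bandWeight, bandWeight, otherProd_skipPair, ← pow_two, abs_mul, Real.sqrt_mul (abs_nonneg _),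
    abs_pow, Real.sqrt_sq (abs_nonneg _), mul_inv]
  ring

theorem bandPt_skipPair (j : Fin m) (φ : ℝ) :
    bandPt (pinchLeft l E v) (pinchRight l O u) (skipPair l j) φ = bandPt E O (l.succAbove j) φ := by
  rw [bandPt, bandPt, pinchLeft_skipPair, pinchRight_skipPair]

/-- The combination of moments belonging to `(s - c) s ^ i`. -/
def shiftMoment (c : ℝ) (α : ℕ → ℝ) (i : ℕ) : ℝ := α (i + 1) - c * α i

theorem mom_X_pow (α : ℕ → ℝ) (i : ℕ) : mom α (Polynomial.X ^ i) = α i := by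
  rw [mom_apply, Polynomial.X_pow_eq_monomial, Polynomial.sum_monomial_index _ _ (by simp), one_mul]

theorem mom_shift (c : ℝ) (α : ℕ → ℝ) (i : ℕ) :
    mom α (Polynomial.X ^ (i + 1) - Polynomial.C c * Polynomial.X ^ i) = shiftMoment c α i := by
  rw [map_sub, ← Polynomial.smul_eq_C_mul, map_smul, mom_X_pow, mom_X_pow, smul_eq_mul, shiftMoment]

theorem FreeBand.shiftMoment_eq {E O : Fin (n + 1) → ℝ} {j : Fin (n + 1)}
    (hf : FreeBand E O j) (h : E j ≤ O j) (c : ℝ) (i : ℕ) :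
    shiftMoment c (bandMoment E O j) i = ∫ φ in (0 : ℝ)..(Real.pi / 2),
      (bandPt E O j φ - c) * bandPt E O j φ ^ i * bandWeight E O j (bandPt E O j φ) := by
  rw [← mom_shift, hf.mom_eq h]
  refine intervalIntegral.integral_congr fun φ _ => ?_
  simp only [Polynomial.eval_sub, Polynomial.eval_mul, Polynomial.eval_pow, Polynomial.eval_X,
    Polynomial.eval_C]
  ring

/-- At the moment of the pinch both new endpoints equal α and put |α - s| into the denominator on
all other bands; the factor s - α cancels it up to a sign, which the renumbering of the bands
explains. -/
theorem IsBands.shiftMoment_pinch (h : IsBands E O) {α : ℝ} (hα : α ∈ Ioo (E l) (O l)) (j : Fin m)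
    (i : ℕ) : (-1) ^ (skipPair l j : ℕ) * shiftMoment α
      (bandMoment (pinchLeft l E α) (pinchRight l O α) (skipPair l j)) i =
      -((-1) ^ (l.succAbove j : ℕ) * bandMoment E O (l.succAbove j) i) := by
  have h0 : 0 < α := (h.nonneg l).trans_lt hα.1
  have hw := h.weakBands_pinch hα.1.le le_rfl hα.2.le h0
  rw [(h.freeBand_pinch hα.1.le le_rfl hα.2.le h0 j).shiftMoment_eq (hw.band _), bandMoment,
    ← intervalIntegral.integral_const_mul, ← intervalIntegral.integral_const_mul,
    ← intervalIntegral.integral_neg]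
  refine intervalIntegral.integral_congr fun φ _ => ?_
  rw [bandWeight_skipPair, bandPt_skipPair]
  have hs := bandPt_mem (h.band (l.succAbove j)) φ
  set s := bandPt E O (l.succAbove j) φ
  have h1 : s ≠ α ∧ (-1) ^ (skipPair l j : ℕ) * (s - α) =
      -((-1) ^ (l.succAbove j : ℕ) * |α - s|) := by
    rcases lt_or_gt_of_ne (Fin.succAbove_ne l j) with hk | hk
    · have h2 : s < α := hs.2.trans_lt ((h.lt_of_lt hk).trans hα.1)
      refine ⟨h2.ne, ?_⟩
      have h3 : (skipPair l j : ℕ) = (l.succAbove j : ℕ) := by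
        rw [skipPair, val_succAbove, if_pos]
        rw [Fin.val_succ]
        rw [Fin.lt_def] at hk
        omega
      rw [h3, abs_of_pos (by linarith)]
      ring
    · have h2 : α < s := (hα.2.trans (h.lt_of_lt hk)).trans_le hs.1
      refine ⟨h2.ne', ?_⟩
      have h3 : (skipPair l j : ℕ) = (l.succAbove j : ℕ) + 1 := by
        rw [skipPair, val_succAbove, if_neg]
        rw [Fin.val_succ]
        rw [Fin.lt_def] at hk
        omega
      rw [h3, abs_of_neg (by linarith), pow_succ]
      ring
  have h2 : |α - s| ≠ 0 := abs_ne_zero.2 (sub_ne_zero.2 h1.1.symm)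
  calc _ = ((-1) ^ (skipPair l j : ℕ) * (s - α)) * |α - s|⁻¹ *
        (s ^ i * bandWeight E O (l.succAbove j) s) := by ring
    _ = _ := by
      rw [h1.2]
      field_simp

/-! ### Moments on the negative half line -/

/-- The moments on the negative half line after the substitution `s = 1 - 1 / x²`. -/
theorem negMoment_eq_integral (E O : Fin (n + 1) → ℝ) {i : ℕ} (hi : i < n) : negMoment E O i = ∫ x in (0 : ℝ)..1,
      2 * (-1) ^ i * x ^ (2 * (n - 1 - i)) * (1 - x ^ 2) ^ i *
        (√|(∏ k, (O k * x ^ 2 + (1 - x ^ 2))) * ∏ k : Fin n, (E k.succ * x ^ 2 + (1 - x ^ 2))|)⁻¹ := by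
  have himg : (fun x : ℝ => 1 - (x ^ 2)⁻¹) '' Ioo 0 1 = Iio 0 := by
    ext s
    simp only [mem_image, mem_Ioo, mem_Iio]
    constructor
    · rintro ⟨x, ⟨h0, h1⟩, rfl⟩
      have : 1 < (x ^ 2)⁻¹ := (one_lt_inv₀ (by positivity)).2 (by nlinarith)
      linarith
    · intro hs
      have h1 : 1 < √(1 - s) := by
        rw [Real.lt_sqrt zero_le_one]
        linarith
      refine ⟨(√(1 - s))⁻¹, ⟨by positivity, inv_lt_one_of_one_lt₀ h1⟩, ?_⟩
      rw [inv_pow, Real.sq_sqrt (by linarith), inv_inv]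
      ring
  rw [negMoment, ← himg, MeasureTheory.integral_image_eq_integral_abs_deriv_smul measurableSet_Ioo
    (f' := fun x => 2 * (x ^ 3)⁻¹), intervalIntegral.integral_of_le zero_le_one,
    MeasureTheory.integral_Ioc_eq_integral_Ioo]
  · refine MeasureTheory.setIntegral_congr_fun measurableSet_Ioo fun x hx => ?_
    have hx0 : 0 < x := hx.1
    have h1 : ∀ c : ℝ, c - (1 - (x ^ 2)⁻¹) = (c * x ^ 2 + (1 - x ^ 2)) * (x ^ 2)⁻¹ := by
      intro c
      field_simp
      ring
    have h2 : rootProd E O (1 - (x ^ 2)⁻¹) = ((∏ k, (O k * x ^ 2 + (1 - x ^ 2))) *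
        ∏ k : Fin n, (E k.succ * x ^ 2 + (1 - x ^ 2))) * ((x ^ (2 * n + 1))⁻¹) ^ 2 := by
      rw [rootProd]
      simp_rw [h1, Finset.prod_mul_distrib, Finset.prod_const, Finset.card_univ, Fintype.card_fin]
      ring
    simp only [smul_eq_mul, density]
    rw [h2, abs_of_pos (by positivity : 0 < 2 * (x ^ 3)⁻¹), abs_mul _ (_ ^ 2),
      Real.sqrt_mul (abs_nonneg _), abs_pow _ 2, Real.sqrt_sq (abs_nonneg _),
      abs_of_pos (by positivity : 0 < (x ^ (2 * n + 1))⁻¹), mul_inv, inv_inv]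
    have h3 : 1 - (x ^ 2)⁻¹ = -((1 - x ^ 2) * (x ^ 2)⁻¹) := by
      field_simp
      ring
    rw [h3, neg_pow, mul_pow]
    have h4 : x ^ (2 * n + 1) = x ^ (2 * (n - 1 - i)) * (x ^ 2) ^ i * x ^ 3 := by
      rw [← pow_mul, ← pow_add, ← pow_add]
      congr 1
      omega
    rw [h4]
    field_simp
    rw [mul_assoc, ← mul_pow, one_div_mul_cancel (by positivity), one_pow, mul_one]
  · intro x hx
    have hx0 : x ≠ 0 := hx.1.ne'
    have h1 := (((hasDerivAt_id x).pow 2).inv (by simpa using hx0)).const_sub 1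
    refine (h1.congr_deriv ?_).hasDerivWithinAt
    simp only [id, Pi.pow_apply]
    field_simp
    try ring
  · intro x hx y hy hxy
    have h1 : x ^ 2 = y ^ 2 := by
      have : (x ^ 2)⁻¹ = (y ^ 2)⁻¹ := by
        dsimp only at hxy
        linarith
      exact inv_injective this
    exact (sq_eq_sq₀ hx.1.le hy.1.le).1 h1

end EllipsoidBilliard

namespace EllipsoidBilliard

variable {n m : ℕ}

section Negative

variable {V : Type*} [NormedAddCommGroup V] [NormedSpace ℝ V] {y₀ : V}

theorem line_pos {c x : ℝ} (hc : 0 < c) (hx : x ∈ Icc (0 : ℝ) 1) : 0 < c * x ^ 2 + (1 - x ^ 2) := by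
  have h1 : x ^ 2 ≤ 1 := pow_le_one₀ hx.1 hx.2
  rcases h1.lt_or_eq with h | h
  · have := sq_nonneg x
    nlinarith
  · rw [h]
    linarith

/-- In the variable x the polynomial under the root is positive on the compact interval [0, 1],
including the end corresponding to infinity, so the general lemma on N / √|Q| applies. -/
theorem analyticAt_negMoment {E O : V → Fin (n + 1) → ℝ}
    (hE : ∀ k, AnalyticAt ℝ (fun y => E y k) y₀) (hO : ∀ k, AnalyticAt ℝ (fun y => O y k) y₀)
    (hO0 : ∀ k, 0 < O y₀ k) (hE0 : ∀ k : Fin n, 0 < E y₀ k.succ) {i : ℕ} (hi : i < n) :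
    AnalyticAt ℝ (fun y => negMoment (E y) (O y) i) y₀ := by
  simp_rw [negMoment_eq_integral _ _ hi]
  let xs : C(Icc (0 : ℝ) 1, ℝ) := ⟨fun x => (x : ℝ) ^ 2, by fun_prop⟩
  let xt : C(Icc (0 : ℝ) 1, ℝ) := ⟨fun x => 1 - (x : ℝ) ^ 2, by fun_prop⟩
  let N : C(Icc (0 : ℝ) 1, ℝ) :=
    ⟨fun x => 2 * (-1) ^ i * (x : ℝ) ^ (2 * (n - 1 - i)) * (1 - (x : ℝ) ^ 2) ^ i, by fun_prop⟩
  refine analyticAt_integral_rsqrt zero_le_one (N := fun _ => N)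
    (Q := fun y => (∏ k, (algebraMap ℝ _ (O y k) * xs + xt)) *
      ∏ k : Fin n, (algebraMap ℝ _ (E y k.succ) * xs + xt)) analyticAt_const ?_ (fun x => ?_) ?_
  · refine AnalyticAt.mul ?_ ?_
    · exact Finset.analyticAt_fun_prod _ fun k _ =>
        ((analyticAt_algebraMap (hO k)).mul analyticAt_const).add analyticAt_const
    · exact Finset.analyticAt_fun_prod _ fun k _ =>
        ((analyticAt_algebraMap (hE k.succ)).mul analyticAt_const).add analyticAt_const
  · rw [ContinuousMap.mul_apply, ContinuousMap.prod_apply, ContinuousMap.prod_apply]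
    exact mul_ne_zero (Finset.prod_ne_zero_iff.2 fun k _ => (line_pos (hO0 k) x.2).ne')
      (Finset.prod_ne_zero_iff.2 fun k _ => (line_pos (hE0 k) x.2).ne')
  · refine Eventually.of_forall fun y x => ?_
    rw [ContinuousMap.mul_apply, ContinuousMap.prod_apply, ContinuousMap.prod_apply]
    rfl

end Negative

theorem integrand_negMoment_continuous {E O : Fin (n + 1) → ℝ}
    (hO0 : ∀ k, 0 < O k) (hE0 : ∀ k : Fin n, 0 < E k.succ) :
    ContinuousOn (fun x : ℝ => (√|(∏ k, (O k * x ^ 2 + (1 - x ^ 2))) *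
      ∏ k : Fin n, (E k.succ * x ^ 2 + (1 - x ^ 2))|)⁻¹) (Icc 0 1) := by
  refine ContinuousOn.inv₀ (by fun_prop) fun x hx => ?_
  refine (Real.sqrt_pos.2 (abs_pos.2 (mul_ne_zero ?_ ?_))).ne'
  · exact Finset.prod_ne_zero_iff.2 fun k _ => (line_pos (hO0 k) hx).ne'
  · exact Finset.prod_ne_zero_iff.2 fun k _ => (line_pos (hE0 k) hx).ne'

variable {l : Fin (m + 1)} {E O : Fin (m + 1) → ℝ} {u v α : ℝ}

theorem pinchRight_pos (hO : ∀ k, 0 < O k) (hu : 0 < u) (k : Fin (m + 2)) :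
    0 < pinchRight l O u k := by
  rcases Fin.eq_self_or_eq_succAbove l.castSucc k with rfl | ⟨k', rfl⟩
  · simpa using hu
  · simpa using hO k'

theorem pinchLeft_succ_pos (hE : ∀ k : Fin m, 0 < E k.succ) (hv : 0 < v) (k : Fin (m + 1)) :
    0 < pinchLeft l E v k.succ := by
  rcases Fin.eq_self_or_eq_succAbove l k with rfl | ⟨j, rfl⟩
  · simpa using hv
  · rw [pinchLeft_succ_succAbove]
    exact hE j

theorem IsBands.right_pos {E O : Fin (n + 1) → ℝ} (h : IsBands E O) (k : Fin (n + 1)) : 0 < O k :=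
  (h.nonneg k).trans_lt (h.band_lt k)

theorem IsBands.shiftMoment_neg_pinch (h : IsBands E O) (hα : 0 < α) {i : ℕ} (hi : i < m) :
    shiftMoment α (negMoment (pinchLeft l E α) (pinchRight l O α)) i = -negMoment E O i := by
  have hc := integrand_negMoment_continuous (pinchRight_pos (l := l) h.right_pos hα)
    (pinchLeft_succ_pos (l := l) h.pos hα)
  rw [shiftMoment, negMoment_eq_integral _ _ (show i + 1 < m + 1 by omega),
    negMoment_eq_integral _ _ (hi.trans (Nat.lt_succ_self m)), negMoment_eq_integral _ _ hi,
    ← intervalIntegral.integral_const_mul, ← intervalIntegral.integral_sub,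
    ← intervalIntegral.integral_neg]
  · refine intervalIntegral.integral_congr fun x hx => ?_
    rw [uIcc_of_le zero_le_one] at hx
    have h1 : (∏ k, (pinchRight l O α k * x ^ 2 + (1 - x ^ 2))) *
        ∏ k : Fin (m + 1), (pinchLeft l E α k.succ * x ^ 2 + (1 - x ^ 2)) =
        ((∏ k, (O k * x ^ 2 + (1 - x ^ 2))) * ∏ k : Fin m, (E k.succ * x ^ 2 + (1 - x ^ 2))) *
          (α * x ^ 2 + (1 - x ^ 2)) ^ 2 := by
      -- The double root at α becomes the square of α x² + 1 - x²; this is x² (α - s), so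
      -- multiplication by s - α cancels its square root.
      rw [Fin.prod_univ_succAbove _ l.castSucc, Fin.prod_univ_succAbove
        (fun k : Fin (m + 1) => pinchLeft l E α k.succ * x ^ 2 + (1 - x ^ 2)) l]
      simp only [pinchRight_castSucc, pinchRight_succAbove, pinchLeft_succ, pinchLeft_succ_succAbove]
      ring
    have h2 := line_pos hα hx
    rw [h1, abs_mul _ (_ ^ 2), Real.sqrt_mul (abs_nonneg _), abs_pow _ 2,
      Real.sqrt_sq (abs_nonneg _), abs_of_pos h2, mul_inv]
    have h3 : m + 1 - 1 - (i + 1) = m - 1 - i := by omega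
    have h4 : 2 * (m + 1 - 1 - i) = 2 * (m - 1 - i) + 2 := by omega
    rw [h3, h4]
    generalize (√|(∏ k, (O k * x ^ 2 + (1 - x ^ 2))) *
      ∏ k : Fin m, (E k.succ * x ^ 2 + (1 - x ^ 2))|)⁻¹ = r
    calc _ = -(2 * (-1) ^ i * x ^ (2 * (m - 1 - i)) * (1 - x ^ 2) ^ i * r) *
          ((α * x ^ 2 + (1 - x ^ 2)) * (α * x ^ 2 + (1 - x ^ 2))⁻¹) := by ring
      _ = _ := by rw [mul_inv_cancel₀ h2.ne', mul_one]
  · refine ContinuousOn.intervalIntegrable ?_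
    rw [uIcc_of_le zero_le_one]
    exact ContinuousOn.mul (by fun_prop) hc
  · refine ContinuousOn.intervalIntegrable ?_
    rw [uIcc_of_le zero_le_one]
    exact continuousOn_const.mul (ContinuousOn.mul (by fun_prop) hc)

/-! ### Moments of the other bands -/

theorem analyticAt_bandMoment_of_pos {V : Type*} [NormedAddCommGroup V] [NormedSpace ℝ V] {y₀ : V}
    {E O : V → Fin (n + 1) → ℝ} (hE : ∀ k, AnalyticAt ℝ (fun y => E y k) y₀)
    (hO : ∀ k, AnalyticAt ℝ (fun y => O y k) y₀) (h0 : ∀ y, E y 0 = 0) (hpos : 0 < O y₀ 0)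
    (hE0 : ∀ k : Fin n, 0 < E y₀ k.succ) {j : Fin (n + 1)} (hj : E y₀ j ≤ O y₀ j)
    (hf : FreeBand (E y₀) (O y₀) j) (i : ℕ) :
    AnalyticAt ℝ (fun y => bandMoment (E y) (O y) j i) y₀ := by
  induction j using Fin.cases with
  | zero =>
    simp_rw [bandMoment_zero (h0 _)]
    exact (AnalyticAt.fun_comp (g := fun y : ℝ => √|y|) (f := fun y => O y 0)
      (analyticAt_sqrt_abs hpos) (hO 0)).mul (analyticAt_firstMoment hE hO hj hf i)
  | succ j => exact analyticAt_bandMoment hE hO hj (hE0 j) hf i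

end EllipsoidBilliard

namespace EllipsoidBilliard

/-! ### A logarithmically divergent integral -/

theorem one_sub_cos_le_sin {φ : ℝ} (hφ : φ ∈ Icc 0 (Real.pi / 2)) :
    0 ≤ Real.sin φ ∧ 0 ≤ Real.cos φ ∧ 1 - Real.cos φ ≤ Real.sin φ := by
  have h1 : 0 ≤ Real.sin φ := Real.sin_nonneg_of_nonneg_of_le_pi hφ.1 (by linarith [hφ.2, Real.pi_pos])
  have h2 : 0 ≤ Real.cos φ := Real.cos_nonneg_of_mem_Icc ⟨by linarith [hφ.1, Real.pi_pos], hφ.2⟩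
  refine ⟨h1, h2, ?_⟩
  nlinarith [Real.sin_sq_add_cos_sq φ, Real.sin_le_one φ, Real.cos_le_one φ]

theorem quad_pos {δ M φ : ℝ} (hδ : 0 < δ) (hM : 0 < M) : 0 < δ + M * Real.sin φ ^ 2 := by
  have := sq_nonneg (Real.sin φ)
  positivity

/-- The factor cos φ makes the integral elementary, and since cos 0 = 1 it serves as the model for
densities that do not vanish at φ = 0. -/
theorem integral_cos_rsqrt {δ M : ℝ} (hδ : 0 < δ) (hM : 0 < M) :
    ∫ φ in (0 : ℝ)..(Real.pi / 2), Real.cos φ * (√(δ + M * Real.sin φ ^ 2))⁻¹ =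
      (√M)⁻¹ * (Real.log (√M + √(δ + M)) - Real.log δ / 2) := by
  have hsM : 0 < √M := Real.sqrt_pos.2 hM
  have hD : ∀ φ ∈ uIcc (0 : ℝ) (Real.pi / 2), HasDerivAt (fun φ => (√M)⁻¹ *
      Real.log (√M * Real.sin φ + √(δ + M * Real.sin φ ^ 2)))
      (Real.cos φ * (√(δ + M * Real.sin φ ^ 2))⁻¹) φ := by
    intro φ hφ
    rw [uIcc_of_le (by positivity)] at hφ
    have hQ := quad_pos (φ := φ) hδ hM
    have hsQ := Real.sqrt_pos.2 hQ
    have hs := (one_sub_cos_le_sin hφ).1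
    have h1 := (((Real.hasDerivAt_sin φ).pow 2).const_mul M).const_add δ
    have h2 := ((Real.hasDerivAt_sin φ).const_mul (√M)).add (h1.sqrt hQ.ne')
    have h3 := (h2.log (by simp only [Pi.add_apply, Pi.pow_apply]; positivity)).const_mul (√M)⁻¹
    refine h3.congr_deriv ?_
    simp only [Pi.add_apply, Pi.pow_apply]
    have h4 : M = √M * √M := (Real.mul_self_sqrt hM.le).symm
    set r := √(δ + M * Real.sin φ ^ 2)
    generalize √M = q at *
    have h5 : q * Real.sin φ + r ≠ 0 := by positivity
    rw [h4]
    field_simp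
    ring
  have hc : Continuous fun φ => Real.cos φ * (√(δ + M * Real.sin φ ^ 2))⁻¹ := by
    refine Real.continuous_cos.mul (Continuous.inv₀ (by fun_prop) fun φ => ?_)
    exact (Real.sqrt_pos.2 (quad_pos hδ hM)).ne'
  rw [intervalIntegral.integral_eq_sub_of_hasDerivAt hD (hc.intervalIntegrable _ _)]
  simp only [Real.sin_pi_div_two, Real.sin_zero]
  rw [← Real.log_sqrt hδ.le]
  ring_nf

theorem tendsto_cos_mass {ι : Type*} {F : Filter ι} {δ M : ι → ℝ} {M₀ : ℝ}
    (hδ : Tendsto δ F (𝓝[>] 0)) (hM : Tendsto M F (𝓝 M₀)) (hM₀ : 0 < M₀) :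
    Tendsto (fun t => (∫ φ in (0 : ℝ)..(Real.pi / 2),
      Real.cos φ * (√(δ t + M t * Real.sin φ ^ 2))⁻¹) / Real.log (δ t)) F
      (𝓝 (-(1 / (2 * √M₀)))) := by
  have hlog : Tendsto (fun t => Real.log (δ t)) F atBot := Real.tendsto_log_nhdsGT_zero.comp hδ
  have hδ0 : Tendsto δ F (𝓝 0) := hδ.mono_right nhdsWithin_le_nhds
  have hs0 : 0 < √M₀ := Real.sqrt_pos.2 hM₀
  have h1 : Tendsto (fun t => Real.log (√(M t) + √(δ t + M t))) F
      (𝓝 (Real.log (√M₀ + √(0 + M₀)))) :=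
    (hM.sqrt.add (hδ0.add hM).sqrt).log (by positivity)
  have h2 : Tendsto (fun t => (√(M t))⁻¹ * (Real.log (√(M t) + √(δ t + M t)) / Real.log (δ t) - 1 / 2))
      F (𝓝 ((√M₀)⁻¹ * (0 - 1 / 2))) :=
    (hM.sqrt.inv₀ hs0.ne').mul ((h1.div_atBot hlog).sub tendsto_const_nhds)
  have h3 : (√M₀)⁻¹ * (0 - 1 / 2) = -(1 / (2 * √M₀)) := by
    field_simp
    ring
  rw [h3] at h2
  refine h2.congr' ?_
  filter_upwards [hδ.eventually self_mem_nhdsWithin, hM.eventually (lt_mem_nhds hM₀),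
    hlog.eventually_lt_atBot 0] with t ht1 ht2 ht3
  rw [integral_cos_rsqrt ht1 ht2]
  have := ht3.ne
  field_simp

/-- The logarithm comes from φ near 0, where `g` is close to g₀; compare with g₀ cos φ. The part of
the error bounded by a multiple of sin φ contributes a bounded integral, since sin φ / √(δ + M sin²
φ) ≤ 1 / √M, and disappears after division by log δ. -/
theorem tendsto_log_mass {ι : Type*} {F : Filter ι} {g : ι → ℝ → ℝ} {δ M : ι → ℝ} {M₀ g₀ : ℝ}
    (hδ : Tendsto δ F (𝓝[>] 0)) (hM : Tendsto M F (𝓝 M₀)) (hM₀ : 0 < M₀)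
    (hg : ∀ ε > 0, ∃ C, ∀ᶠ t in F, ∀ φ ∈ Icc 0 (Real.pi / 2), |g t φ - g₀| ≤ ε + C * Real.sin φ)
    (hgc : ∀ᶠ t in F, ContinuousOn (g t) (Icc 0 (Real.pi / 2))) :
    Tendsto (fun t => (∫ φ in (0 : ℝ)..(Real.pi / 2),
      g t φ * (√(δ t + M t * Real.sin φ ^ 2))⁻¹) / Real.log (δ t)) F
      (𝓝 (-(g₀ / (2 * √M₀)))) := by
  have hpi : (0 : ℝ) ≤ Real.pi / 2 := by positivity
  have hJ := tendsto_cos_mass hδ hM hM₀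
  have hlog : Tendsto (fun t => Real.log (δ t)) F atBot := Real.tendsto_log_nhdsGT_zero.comp hδ
  have hs0 : 0 < √M₀ := Real.sqrt_pos.2 hM₀
  set J : ι → ℝ := fun t => ∫ φ in (0 : ℝ)..(Real.pi / 2),
    Real.cos φ * (√(δ t + M t * Real.sin φ ^ 2))⁻¹ with hJdef
  set c := 1 / (2 * √M₀) with hc
  have hc0 : 0 < c := by positivity
  suffices h : Tendsto (fun t => (∫ φ in (0 : ℝ)..(Real.pi / 2),
      (g t φ - g₀ * Real.cos φ) * (√(δ t + M t * Real.sin φ ^ 2))⁻¹) / Real.log (δ t)) F (𝓝 0) by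
    have h1 := h.add (hJ.const_mul g₀)
    have h2 : 0 + g₀ * -c = -(g₀ / (2 * √M₀)) := by
      rw [hc]
      ring
    rw [h2] at h1
    refine h1.congr' ?_
    filter_upwards [hδ.eventually self_mem_nhdsWithin, hM.eventually (lt_mem_nhds hM₀), hgc]
      with t ht1 ht2 ht3
    have hr : Continuous fun φ => (√(δ t + M t * Real.sin φ ^ 2))⁻¹ :=
      Continuous.inv₀ (by fun_prop) fun φ => (Real.sqrt_pos.2 (quad_pos ht1 ht2)).ne'
    rw [← mul_div_assoc, ← add_div]
    rw [← intervalIntegral.integral_const_mul, ← intervalIntegral.integral_add]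
    · congr 1
      refine intervalIntegral.integral_congr fun φ _ => ?_
      ring
    · refine ContinuousOn.intervalIntegrable ?_
      rw [uIcc_of_le hpi]
      exact (ht3.sub (by fun_prop)).mul hr.continuousOn
    · exact (continuous_const.mul (Real.continuous_cos.mul hr)).intervalIntegrable _ _
  rw [Metric.tendsto_nhds]
  intro η hη
  -- As |J / log δ| is eventually below c + 1, this choice makes the ε-part at most η / 4, and the
  -- bounded part is below η / 2.
  obtain ⟨C, hC⟩ := hg (η / (4 * (c + 1))) (by positivity)
  set ε := η / (4 * (c + 1)) with hε
  have hε0 : 0 < ε := by positivity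
  set C' := |C| + |g₀| + ε with hC'
  have h1 : ∀ᶠ t in F, |J t / Real.log (δ t)| < c + 1 := by
    have h2 := hJ.abs
    rw [abs_neg, abs_of_pos hc0] at h2
    exact h2.eventually (gt_mem_nhds (by linarith))
  have h2 : ∀ᶠ t in F, |C' * (Real.pi / 2) * (√(M t))⁻¹ / Real.log (δ t)| < η / 2 := by
    have h3 : Tendsto (fun t => C' * (Real.pi / 2) * (√(M t))⁻¹ / Real.log (δ t)) F (𝓝 0) :=
      ((hM.sqrt.inv₀ hs0.ne').const_mul _).div_atBot hlog
    have h4 := h3.abs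
    rw [abs_zero] at h4
    exact h4.eventually (gt_mem_nhds (by linarith))
  filter_upwards [hδ.eventually self_mem_nhdsWithin, hM.eventually (lt_mem_nhds hM₀), hgc, hC, h1,
    h2, hlog.eventually_lt_atBot 0] with t ht1 ht2 ht3 ht4 ht5 ht6 ht7
  have ht1 : 0 < δ t := ht1
  have hr : Continuous fun φ => (√(δ t + M t * Real.sin φ ^ 2))⁻¹ :=
    Continuous.inv₀ (by fun_prop) fun φ => (Real.sqrt_pos.2 (quad_pos ht1 ht2)).ne'
  rw [Real.dist_eq, sub_zero]
  have hsM : 0 < √(M t) := Real.sqrt_pos.2 ht2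
  have hb : |∫ φ in (0 : ℝ)..(Real.pi / 2), (g t φ - g₀ * Real.cos φ) *
      (√(δ t + M t * Real.sin φ ^ 2))⁻¹| ≤ ε * J t + C' * (Real.pi / 2) * (√(M t))⁻¹ := by
    have h5 : ε * J t + C' * (Real.pi / 2) * (√(M t))⁻¹ = ∫ φ in (0 : ℝ)..(Real.pi / 2),
        (ε * (Real.cos φ * (√(δ t + M t * Real.sin φ ^ 2))⁻¹) + C' * (√(M t))⁻¹) := by
      rw [intervalIntegral.integral_add, intervalIntegral.integral_const_mul,
        intervalIntegral.integral_const, smul_eq_mul, sub_zero]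
      · ring
      · exact (continuous_const.mul (Real.continuous_cos.mul hr)).intervalIntegrable _ _
      · exact intervalIntegrable_const
    rw [h5, ← Real.norm_eq_abs]
    refine intervalIntegral.norm_integral_le_of_norm_le hpi (Eventually.of_forall fun φ hφ => ?_) ?_
    · have hφ' : φ ∈ Icc 0 (Real.pi / 2) := Ioc_subset_Icc_self hφ
      obtain ⟨s1, s2, s3⟩ := one_sub_cos_le_sin hφ'
      have hQ := Real.sqrt_pos.2 (quad_pos (φ := φ) ht1 ht2)
      rw [Real.norm_eq_abs, abs_mul, abs_of_pos (inv_pos.2 hQ)]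
      have h6 : |g t φ - g₀ * Real.cos φ| ≤ ε * Real.cos φ + C' * Real.sin φ := by
        have h7 : |g t φ - g₀ * Real.cos φ| ≤ |g t φ - g₀| + |g₀ * (1 - Real.cos φ)| := by
          refine le_trans (le_of_eq ?_) (abs_add_le _ _)
          congr 1
          ring
        rw [abs_mul, abs_of_nonneg (by linarith [Real.cos_le_one φ] : 0 ≤ 1 - Real.cos φ)] at h7
        have h8 := ht4 φ hφ'
        have h9 := mul_le_mul_of_nonneg_left s3 (abs_nonneg g₀)
        have h10 := mul_le_mul_of_nonneg_left s3 hε0.le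
        have h11 := mul_le_mul_of_nonneg_right (le_abs_self C) s1
        rw [hC']
        linarith
      have h7 : Real.sin φ * (√(δ t + M t * Real.sin φ ^ 2))⁻¹ ≤ (√(M t))⁻¹ := by
        rw [← div_eq_mul_inv, div_le_iff₀ hQ, ← div_eq_inv_mul, le_div_iff₀ hsM]
        refine Real.le_sqrt_of_sq_le ?_
        rw [mul_pow, Real.sq_sqrt ht2.le]
        linarith
      calc _ ≤ (ε * Real.cos φ + C' * Real.sin φ) * (√(δ t + M t * Real.sin φ ^ 2))⁻¹ := by gcongr
        _ = ε * (Real.cos φ * (√(δ t + M t * Real.sin φ ^ 2))⁻¹) +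
          C' * (Real.sin φ * (√(δ t + M t * Real.sin φ ^ 2))⁻¹) := by ring
        _ ≤ _ := by gcongr
    · exact ((continuous_const.mul (Real.continuous_cos.mul hr)).add
        continuous_const).intervalIntegrable _ _
  rw [abs_div, div_lt_iff₀ (abs_pos.2 ht7.ne)]
  rw [abs_div, div_lt_iff₀ (abs_pos.2 ht7.ne)] at ht5 ht6
  have h8 := le_abs_self (J t)
  have h9 := le_abs_self (C' * (Real.pi / 2) * (√(M t))⁻¹)
  have h10 : ε * J t ≤ ε * ((c + 1) * |Real.log (δ t)|) :=
    mul_le_mul_of_nonneg_left (h8.trans ht5.le) hε0.le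
  have h11 : ε * ((c + 1) * |Real.log (δ t)|) = η / 4 * |Real.log (δ t)| := by
    rw [hε]
    field_simp
  have h12 : 0 < |Real.log (δ t)| := abs_pos.2 ht7.ne
  have h13 := mul_pos hη h12
  calc _ ≤ _ := hb
    _ < _ := by linarith

end EllipsoidBilliard

namespace EllipsoidBilliard

variable {n m : ℕ} {l : Fin (m + 1)} {E O : Fin (m + 1) → ℝ} {u v α : ℝ}

/-! ### The moments of a pinched band -/

/-- The part of the density on the second half of a pinched band that stays regular. -/
noncomputable def pinchWeight (l : Fin (m + 1)) (E O : Fin (m + 1) → ℝ) (s : ℝ) : ℝ :=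
  2 * (√|s| * (√|(E l - s) * otherProd E O l s|)⁻¹)

/-- A point of the second half of a pinched band. -/
noncomputable def pinchPt (l : Fin (m + 1)) (O : Fin (m + 1) → ℝ) (v φ : ℝ) : ℝ :=
  v + (O l - v) * Real.sin φ ^ 2

theorem bandPt_pinch_succ (φ : ℝ) :
    bandPt (pinchLeft l E v) (pinchRight l O u) l.succ φ = pinchPt l O v φ := by
  rw [bandPt, pinchLeft_succ, pinchRight_succ, pinchPt]

theorem bandWeight_pinch_succ (s : ℝ) :
    bandWeight (pinchLeft l E v) (pinchRight l O u) l.succ s =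
      pinchWeight l E O s * (√|u - s|)⁻¹ := by
  rw [bandWeight, otherProd_pinch_succ, pinchWeight, mul_right_comm, abs_mul _ (u - s),
    Real.sqrt_mul (abs_nonneg _), mul_inv]
  ring

theorem pinchPt_mem (hv : v ≤ O l) (φ : ℝ) : pinchPt l O v φ ∈ Icc v (O l) := by
  have h1 := sq_nonneg (Real.sin φ)
  have h2 := Real.sin_sq_le_one φ
  have h3 : 0 ≤ O l - v := sub_nonneg.2 hv
  unfold pinchPt
  constructor
  · nlinarith
  · nlinarith

theorem IsBands.pinchProd_ne_zero (h : IsBands E O) {s : ℝ} (hs : s ∈ Ioc (E l) (O l)) :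
    (E l - s) * otherProd E O l s ≠ 0 :=
  mul_ne_zero (sub_ne_zero.2 hs.1.ne) (h.freeBand l s (Ioc_subset_Icc_self hs))

theorem continuous_otherProd' (E O : Fin (n + 1) → ℝ) (j : Fin (n + 1)) :
    Continuous fun s => otherProd E O j s := by
  unfold otherProd
  fun_prop

theorem IsBands.continuousOn_pinchWeight (h : IsBands E O) :
    ContinuousOn (pinchWeight l E O) (Ioc (E l) (O l)) := by
  have h1 := continuous_otherProd' E O l
  unfold pinchWeight
  refine ContinuousOn.mul continuousOn_const (ContinuousOn.mul (by fun_prop)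
    (ContinuousOn.inv₀ (by fun_prop) fun s hs => ?_))
  exact (Real.sqrt_pos.2 (abs_pos.2 (h.pinchProd_ne_zero hs))).ne'

theorem IsBands.exists_pinchWeight_le (h : IsBands E O) (hα : E l < α) :
    ∃ C, 0 ≤ C ∧ ∀ s ∈ Icc α (O l), |pinchWeight l E O s| ≤ C := by
  obtain ⟨C, hC⟩ := isCompact_Icc.exists_bound_of_continuousOn
    (h.continuousOn_pinchWeight.mono fun s hs => ⟨hα.trans_le hs.1, hs.2⟩)
  exact ⟨max C 0, le_max_right _ _, fun s hs => (hC s hs).trans (le_max_left _ _)⟩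

/-- The limit of the moments `(s - α) s ^ i` on the second half of a band pinched at `α`. -/
noncomputable def pinchShift (l : Fin (m + 1)) (E O : Fin (m + 1) → ℝ) (α : ℝ) (i : ℕ) : ℝ :=
  ∫ φ in (0 : ℝ)..(Real.pi / 2), √(O l - α) *
    (Real.sin φ * (pinchPt l O α φ ^ i * pinchWeight l E O (pinchPt l O α φ)))

theorem tendsto_max_min (α : ℝ) : Tendsto (fun t => max α t) (𝓝[≠] α) (𝓝 α) ∧
    Tendsto (fun t => min α t) (𝓝[≠] α) (𝓝 α) := by
  have h1 : Continuous fun t => max α t := by fun_prop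
  have h2 : Continuous fun t => min α t := by fun_prop
  have h3 := h1.tendsto α
  have h4 := h2.tendsto α
  rw [max_self] at h3
  rw [min_self] at h4
  exact ⟨h3.mono_left nhdsWithin_le_nhds, h4.mono_left nhdsWithin_le_nhds⟩

theorem eventually_pinch (hα : α ∈ Ioo (E l) (O l)) : ∀ᶠ t in 𝓝[≠] α,
    E l < min α t ∧ min α t < max α t ∧ max α t < O l := by
  filter_upwards [(tendsto_max_min α).1.eventually (gt_mem_nhds hα.2),
    (tendsto_max_min α).2.eventually (lt_mem_nhds hα.1), self_mem_nhdsWithin] with t h1 h2 h3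
  exact ⟨h2, min_lt_max.2 (Ne.symm h3), h1⟩

theorem max_sub_min (α t : ℝ) : max α t - min α t = |α - t| := by
  rw [max_sub_min_eq_abs, abs_sub_comm]

/-- The factor s - α removes the logarithmic divergence: with u ≤ α ≤ s one has (s - α) / √(s - u) ≤
√(s - u), which gives a constant majorant. -/
theorem IsBands.tendsto_pinchShift (h : IsBands E O) (hα : α ∈ Ioo (E l) (O l)) (i : ℕ) :
    Tendsto (fun t => shiftMoment α
      (bandMoment (pinchLeft l E (max α t)) (pinchRight l O (min α t)) l.succ) i) (𝓝[≠] α)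
      (𝓝 (pinchShift l E O α i)) := by
  obtain ⟨C, hC0, hC⟩ := h.exists_pinchWeight_le hα.1
  obtain ⟨ht1, ht2⟩ := tendsto_max_min α
  have hpi : (0 : ℝ) ≤ Real.pi / 2 := by positivity
  have hev := eventually_pinch hα
  have hα0 : 0 ≤ α := (h.nonneg l).trans hα.1.le
  have h1 : ∀ᶠ t in 𝓝[≠] α, shiftMoment α
      (bandMoment (pinchLeft l E (max α t)) (pinchRight l O (min α t)) l.succ) i =
      ∫ φ in (0 : ℝ)..(Real.pi / 2), (pinchPt l O (max α t) φ - α) * pinchPt l O (max α t) φ ^ i *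
        (pinchWeight l E O (pinchPt l O (max α t) φ) *
          (√|min α t - pinchPt l O (max α t) φ|)⁻¹) := by
    filter_upwards [hev] with t ht
    have hb := h.pinch ht.1 ht.2.1 ht.2.2
    rw [(hb.freeBand _).shiftMoment_eq (hb.band _)]
    simp_rw [bandWeight_pinch_succ, bandPt_pinch_succ]
  have hpt : ∀ φ, Tendsto (fun t => pinchPt l O (max α t) φ) (𝓝[≠] α) (𝓝 (pinchPt l O α φ)) := by
    intro φ
    unfold pinchPt
    exact ht1.add ((tendsto_const_nhds.sub ht1).mul_const _)
  refine Tendsto.congr' (h1.mono fun t ht => ht.symm) ?_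
  refine intervalIntegral.tendsto_integral_filter_of_dominated_convergence
    (fun _ => √(O l) * O l ^ i * C) ?_ ?_ intervalIntegrable_const ?_
  · filter_upwards [hev] with t ht
    refine Measurable.aestronglyMeasurable ?_
    unfold pinchPt pinchWeight otherProd
    fun_prop
  · filter_upwards [hev] with t ht
    refine Eventually.of_forall fun φ _ => ?_
    have hm := pinchPt_mem (l := l) (O := O) ht.2.2.le φ
    have hmα : α ≤ max α t := le_max_left _ _
    have hmα' : min α t ≤ α := min_le_left _ _
    have hE0 := h.nonneg l
    set s := pinchPt l O (max α t) φ
    have hs0 : 0 ≤ s := hα0.trans (hmα.trans hm.1)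
    rw [Real.norm_eq_abs, abs_mul, abs_mul, abs_mul, abs_of_nonneg (by linarith [hm.1] : 0 ≤ s - α),
      abs_of_nonneg (pow_nonneg hs0 i), abs_of_neg (by linarith [hm.1, ht.2.1] : min α t - s < 0)]
    have hr : 0 < √(-(min α t - s)) := Real.sqrt_pos.2 (by linarith [hm.1, ht.2.1])
    rw [abs_of_pos (inv_pos.2 hr)]
    have h2 : (s - α) * (√(-(min α t - s)))⁻¹ ≤ √(O l) := by
      rw [← div_eq_mul_inv, div_le_iff₀ hr]
      have h3 : √(-(min α t - s)) ≤ √(O l) := Real.sqrt_le_sqrt (by linarith [hm.2, ht.1])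
      have h4 := Real.mul_self_sqrt (by linarith [hm.1, ht.2.1] : 0 ≤ -(min α t - s))
      have h5 := mul_le_mul_of_nonneg_right h3 hr.le
      linarith
    have h3 : s ^ i ≤ O l ^ i := pow_le_pow_left₀ hs0 hm.2 i
    have h4 := hC s ⟨hmα.trans hm.1, hm.2⟩
    have h5 := mul_nonneg (by linarith [hm.1] : 0 ≤ s - α) (inv_pos.2 hr).le
    have h6 : 0 ≤ O l ^ i := (pow_nonneg hs0 i).trans h3
    have h7 := Real.sqrt_nonneg (O l)
    have h8 := pow_nonneg hs0 i
    calc _ = ((s - α) * (√(-(min α t - s)))⁻¹) * s ^ i * |pinchWeight l E O s| := by ring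
      _ ≤ _ := by gcongr
  · refine Eventually.of_forall fun φ hφ => ?_
    rw [uIoc_of_le hpi] at hφ
    have hs : 0 < Real.sin φ := Real.sin_pos_of_pos_of_lt_pi hφ.1 (by linarith [hφ.2, Real.pi_pos])
    have hOα : 0 < O l - α := sub_pos.2 hα.2
    have hsub : pinchPt l O α φ - α = (O l - α) * Real.sin φ ^ 2 := by
      rw [pinchPt]
      ring
    have hm := pinchPt_mem (l := l) (O := O) hα.2.le φ
    have hw : ContinuousAt (fun p : ℝ × ℝ => pinchWeight l E O p.1 * (√|p.2 - p.1|)⁻¹)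
        (pinchPt l O α φ, α) := by
      have h1 := continuous_otherProd' E O l
      have h2 := h.pinchProd_ne_zero (l := l) (s := pinchPt l O α φ) ⟨hα.1.trans_le hm.1, hm.2⟩
      have h3 : α - pinchPt l O α φ ≠ 0 := by
        have : 0 < (O l - α) * Real.sin φ ^ 2 := by positivity
        intro h4
        linarith
      unfold pinchWeight
      refine ContinuousAt.mul (continuousAt_const.mul (ContinuousAt.mul (by fun_prop)
        (ContinuousAt.inv₀ (by fun_prop) ?_))) (ContinuousAt.inv₀ (by fun_prop) ?_)
      · exact (Real.sqrt_pos.2 (abs_pos.2 h2)).ne'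
      · exact (Real.sqrt_pos.2 (abs_pos.2 h3)).ne'
    have h2 := ((((hpt φ).sub_const α).mul ((hpt φ).pow i))).mul
      (hw.tendsto.comp ((hpt φ).prodMk_nhds ht2))
    convert h2 using 2
    · rfl
    have h3 : |α - pinchPt l O α φ| = (√(O l - α) * Real.sin φ) ^ 2 := by
      rw [abs_sub_comm, hsub, abs_of_nonneg (by positivity), mul_pow, Real.sq_sqrt hOα.le]
    have h4 : 0 < √(O l - α) := Real.sqrt_pos.2 hOα
    rw [h3, Real.sqrt_sq (by positivity), hsub]
    have h5 : O l - α = √(O l - α) * √(O l - α) := (Real.mul_self_sqrt hOα.le).symm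
    generalize √(O l - α) = r at *
    rw [h5]
    field_simp

/-- The coefficient of the logarithm in the mass of the second half of a pinched band. -/
noncomputable def pinchRate (l : Fin (m + 1)) (E O : Fin (m + 1) → ℝ) (α : ℝ) : ℝ :=
  pinchWeight l E O α / (2 * √(O l - α))

theorem IsBands.pinchRate_pos (h : IsBands E O) (hα : α ∈ Ioo (E l) (O l)) :
    0 < pinchRate l E O α := by
  have h1 := Real.sqrt_pos.2 (abs_pos.2 (h.pinchProd_ne_zero ⟨hα.1, hα.2.le⟩))
  have h2 := Real.sqrt_pos.2 (sub_pos.2 hα.2)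
  have h3 : 0 < √|α| := Real.sqrt_pos.2 (abs_pos.2 ((h.nonneg l).trans_lt hα.1).ne')
  unfold pinchRate pinchWeight
  positivity

theorem tendsto_abs_sub (α : ℝ) : Tendsto (fun t => |α - t|) (𝓝[≠] α) (𝓝[>] 0) := by
  refine tendsto_nhdsWithin_iff.2 ⟨?_, ?_⟩
  · have h1 : Continuous fun t => |α - t| := by fun_prop
    have h2 := h1.tendsto α
    rw [sub_self, abs_zero] at h2
    exact h2.mono_left nhdsWithin_le_nhds
  · filter_upwards [self_mem_nhdsWithin] with t ht
    exact abs_pos.2 (sub_ne_zero.2 (Ne.symm ht))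

/-- On the right half the distance to the right end of the left half is |α - t| + (O_l - max (α, t))
sin² φ, so `tendsto_log_mass` applies with δ the width of the gap. -/
theorem IsBands.tendsto_pinchMass (h : IsBands E O) (hα : α ∈ Ioo (E l) (O l)) :
    Tendsto (fun t => bandMoment (pinchLeft l E (max α t)) (pinchRight l O (min α t)) l.succ 0 /
      Real.log |α - t|) (𝓝[≠] α) (𝓝 (-pinchRate l E O α)) := by
  obtain ⟨C, hC0, hC⟩ := h.exists_pinchWeight_le hα.1
  obtain ⟨ht1, ht2⟩ := tendsto_max_min α
  have hpi : (0 : ℝ) ≤ Real.pi / 2 := by positivity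
  have hev := eventually_pinch hα
  have hOα : 0 < O l - α := sub_pos.2 hα.2
  have h1 := tendsto_log_mass (g := fun t φ => pinchWeight l E O (pinchPt l O (max α t) φ))
    (M := fun t => O l - max α t) (g₀ := pinchWeight l E O α) (tendsto_abs_sub α)
    (tendsto_const_nhds.sub ht1) hOα ?_ ?_
  · refine h1.congr' ?_
    filter_upwards [hev] with t ht
    rw [bandMoment]
    congr 1
    refine intervalIntegral.integral_congr fun φ _ => ?_
    rw [bandWeight_pinch_succ, bandPt_pinch_succ, pow_zero, one_mul]
    have hm := pinchPt_mem (l := l) (O := O) ht.2.2.le φ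
    have h2 : |min α t - pinchPt l O (max α t) φ| =
        |α - t| + (O l - max α t) * Real.sin φ ^ 2 := by
      have h3 : min α t - pinchPt l O (max α t) φ < 0 := by linarith [hm.1, ht.2.1]
      rw [abs_of_neg h3, ← max_sub_min, pinchPt]
      ring
    rw [h2]
  · intro ε hε
    have hcont : ContinuousAt (pinchWeight l E O) α :=
      h.continuousOn_pinchWeight.continuousAt (Ioc_mem_nhds hα.1 hα.2)
    obtain ⟨η, hη, hηe⟩ := Metric.continuousAt_iff.1 hcont ε hε
    -- If the point is at least η away from α while the half band starts within η / 2 of it, then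
    -- (O_l - α) sin φ ≥ η / 2; so far away the trivial bound 2C is at most (2C / c₀) sin φ.
    set c₀ := min 1 (η / 2 / (O l - α)) with hc₀
    have hc₀0 : 0 < c₀ := by positivity
    refine ⟨2 * C / c₀, ?_⟩
    filter_upwards [hev, ht1.eventually (gt_mem_nhds (by linarith : α < α + η / 2))]
      with t ht htη φ hφ
    have hm := pinchPt_mem (l := l) (O := O) ht.2.2.le φ
    have hmα : α ≤ max α t := le_max_left _ _
    have hsin := (one_sub_cos_le_sin hφ).1
    have hsin1 := Real.sin_le_one φ
    have hnn : 0 ≤ 2 * C / c₀ := by positivity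
    by_cases hs : |pinchPt l O (max α t) φ - α| < η
    · have h2 := hηe (by rwa [Real.dist_eq])
      rw [Real.dist_eq] at h2
      have := mul_nonneg hnn hsin
      linarith
    · rw [not_lt, abs_of_nonneg (by linarith [hm.1])] at hs
      have h2 : c₀ ≤ Real.sin φ := by
        have h3 : η / 2 ≤ (O l - α) * Real.sin φ := by
          have h4 : pinchPt l O (max α t) φ ≤ max α t + (O l - α) * Real.sin φ := by
            rw [pinchPt]
            have h5 : Real.sin φ ^ 2 ≤ Real.sin φ := by nlinarith
            have h6 : (O l - max α t) * Real.sin φ ^ 2 ≤ (O l - α) * Real.sin φ :=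
              mul_le_mul (by linarith) h5 (sq_nonneg _) hOα.le
            linarith
          linarith
        refine (min_le_right _ _).trans ?_
        rw [div_le_iff₀ hOα]
        linarith
      have h3 := hC _ ⟨hmα.trans hm.1, hm.2⟩
      have h4 := hC α ⟨le_rfl, hα.2.le⟩
      have h5 : 2 * C ≤ 2 * C / c₀ * Real.sin φ := by
        rw [div_mul_eq_mul_div, le_div_iff₀ hc₀0]
        exact mul_le_mul_of_nonneg_left h2 (by positivity)
      have h6 := abs_sub (pinchWeight l E O (pinchPt l O (max α t) φ)) (pinchWeight l E O α)
      linarith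
  · filter_upwards [hev] with t ht
    refine h.continuousOn_pinchWeight.comp (by unfold pinchPt; fun_prop) fun φ _ => ?_
    have hm := pinchPt_mem (l := l) (O := O) ht.2.2.le φ
    exact ⟨(hα.1.trans_le (le_max_left _ _)).trans_le hm.1, hm.2⟩

end EllipsoidBilliard

namespace EllipsoidBilliard

variable {n m : ℕ} {l : Fin (m + 1)} {E O : Fin (m + 1) → ℝ} {α : ℝ}

/-! ### The frequency near a pinched band -/

theorem continuous_pinchLeft (l : Fin (m + 1)) (E : Fin (m + 1) → ℝ) :
    Continuous (pinchLeft l E) := by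
  refine continuous_pi fun k => ?_
  rcases Fin.eq_self_or_eq_succAbove l.succ k with rfl | ⟨k', rfl⟩
  · simpa using continuous_id'
  · simpa using continuous_const

theorem continuous_pinchRight (l : Fin (m + 1)) (O : Fin (m + 1) → ℝ) :
    Continuous (pinchRight l O) := by
  refine continuous_pi fun k => ?_
  rcases Fin.eq_self_or_eq_succAbove l.castSucc k with rfl | ⟨k', rfl⟩
  · simpa using continuous_id'
  · simpa using continuous_const

section Analytic

variable {V : Type*} [NormedAddCommGroup V] [NormedSpace ℝ V] {y₀ : V}

theorem analyticAt_pinchLeft {E : V → Fin (m + 1) → ℝ} {v : V → ℝ}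
    (hE : ∀ k, AnalyticAt ℝ (fun y => E y k) y₀) (hv : AnalyticAt ℝ v y₀) (k : Fin (m + 2)) :
    AnalyticAt ℝ (fun y => pinchLeft l (E y) (v y) k) y₀ := by
  rcases Fin.eq_self_or_eq_succAbove l.succ k with rfl | ⟨k', rfl⟩
  · simpa using hv
  · simpa using hE k'

theorem analyticAt_pinchRight {O : V → Fin (m + 1) → ℝ} {u : V → ℝ}
    (hO : ∀ k, AnalyticAt ℝ (fun y => O y k) y₀) (hu : AnalyticAt ℝ u y₀) (k : Fin (m + 2)) :
    AnalyticAt ℝ (fun y => pinchRight l (O y) (u y) k) y₀ := by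
  rcases Fin.eq_self_or_eq_succAbove l.castSucc k with rfl | ⟨k', rfl⟩
  · simpa using hu
  · simpa using hO k'

theorem IsBands.analyticAt_bandMoment_pinch {E O : V → Fin (m + 1) → ℝ} {u v : V → ℝ}
    (h : IsBands (E y₀) (O y₀))
    (hE : ∀ k, AnalyticAt ℝ (fun y => E y k) y₀) (hO : ∀ k, AnalyticAt ℝ (fun y => O y k) y₀)
    (hE0 : ∀ y, E y 0 = 0) (hu : AnalyticAt ℝ u y₀) (hv : AnalyticAt ℝ v y₀)
    (hα : α ∈ Ioo (E y₀ l) (O y₀ l)) (huα : u y₀ = α) (hvα : v y₀ = α) (j : Fin m) (i : ℕ) :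
    AnalyticAt ℝ (fun y => bandMoment (pinchLeft l (E y) (v y)) (pinchRight l (O y) (u y))
      (skipPair l j) i) y₀ := by
  have h0 : 0 < α := (h.nonneg l).trans_lt hα.1
  have hw := h.weakBands_pinch hα.1.le le_rfl hα.2.le h0
  have hf := h.freeBand_pinch hα.1.le le_rfl hα.2.le h0 j
  refine analyticAt_bandMoment_of_pos (analyticAt_pinchLeft hE hv) (analyticAt_pinchRight hO hu)
    (fun y => pinchLeft_zero l _ _ (hE0 y)) ?_ ?_ ?_ ?_ i
  · rw [huα]
    exact pinchRight_pos h.right_pos h0 0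
  · rw [hvα]
    exact pinchLeft_succ_pos h.pos h0
  · rw [huα, hvα]
    exact hw.band _
  · rw [huα, hvα]
    exact hf

theorem IsBands.analyticAt_negMoment_pinch {E O : V → Fin (m + 1) → ℝ} {u v : V → ℝ}
    (h : IsBands (E y₀) (O y₀))
    (hE : ∀ k, AnalyticAt ℝ (fun y => E y k) y₀) (hO : ∀ k, AnalyticAt ℝ (fun y => O y k) y₀)
    (hu : AnalyticAt ℝ u y₀) (hv : AnalyticAt ℝ v y₀)
    (hα : 0 < α) (huα : u y₀ = α) (hvα : v y₀ = α) {i : ℕ} (hi : i < m + 1) :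
    AnalyticAt ℝ (fun y => negMoment (pinchLeft l (E y) (v y)) (pinchRight l (O y) (u y)) i) y₀ := by
  refine analyticAt_negMoment (analyticAt_pinchLeft hE hv) (analyticAt_pinchRight hO hu) ?_ ?_ hi
  · rw [huα]
    exact pinchRight_pos h.right_pos hα
  · rw [hvα]
    exact pinchLeft_succ_pos h.pos hα

end Analytic

/-- The endpoints max (α, t) and min (α, t) are only Lipschitz in `t` at α. So analyticity is used
in the pair of endpoints, and the Lipschitz bound afterwards. -/
theorem isBigO_pinch {f : ℝ × ℝ → ℝ} (hf : AnalyticAt ℝ f (α, α)) :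
    (fun t => f (max α t, min α t) - f (α, α)) =O[𝓝[≠] α] fun t => |α - t| := by
  have h1 := (isBigO_of_analyticAt hf).comp_tendsto
    ((tendsto_max_min α).1.prodMk_nhds (tendsto_max_min α).2)
  refine h1.trans (isBigO_of_le _ fun t => ?_)
  simp only [Function.comp_apply, Prod.mk_sub_mk, Prod.norm_mk, Real.norm_eq_abs, abs_abs]
  refine max_le ?_ ?_
  · rcases le_total α t with h | h
    · rw [max_eq_right h, abs_sub_comm]
    · rw [max_eq_left h, sub_self, abs_zero]
      exact abs_nonneg _
  · rcases le_total α t with h | h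
    · rw [min_eq_left h, sub_self, abs_zero]
      exact abs_nonneg _
    · rw [min_eq_right h, abs_sub_comm]

theorem IsBands.isBigO_bandMoment (h : IsBands E O) (hα : α ∈ Ioo (E l) (O l)) (j : Fin m) (i : ℕ) :
    (fun t => bandMoment (pinchLeft l E (max α t)) (pinchRight l O (min α t)) (skipPair l j) i -
      bandMoment (pinchLeft l E α) (pinchRight l O α) (skipPair l j) i) =O[𝓝[≠] α]
      fun t => |α - t| :=
  isBigO_pinch (f := fun p => bandMoment (pinchLeft l E p.1) (pinchRight l O p.2) (skipPair l j) i)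
    (IsBands.analyticAt_bandMoment_pinch (E := fun _ => E) (O := fun _ => O) (y₀ := (α, α)) h
      (fun _ => analyticAt_const) (fun _ => analyticAt_const) (fun _ => h.zero) analyticAt_snd
      analyticAt_fst hα rfl rfl j i)

theorem IsBands.isBigO_negMoment (h : IsBands E O) (hα : α ∈ Ioo (E l) (O l)) {i : ℕ}
    (hi : i < m + 1) :
    (fun t => negMoment (pinchLeft l E (max α t)) (pinchRight l O (min α t)) i -
      negMoment (pinchLeft l E α) (pinchRight l O α) i) =O[𝓝[≠] α] fun t => |α - t| :=
  isBigO_pinch (f := fun p => negMoment (pinchLeft l E p.1) (pinchRight l O p.2) i)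
    (IsBands.analyticAt_negMoment_pinch (E := fun _ => E) (O := fun _ => O) (y₀ := (α, α)) h
      (fun _ => analyticAt_const) (fun _ => analyticAt_const) analyticAt_snd
      analyticAt_fst ((h.nonneg l).trans_lt hα.1) rfl rfl hi)

theorem isBigO_shiftMoment {μ : ℝ → ℕ → ℝ} {μ₀ : ℕ → ℝ} {i : ℕ} {F : Filter ℝ} {f : ℝ → ℝ}
    (h1 : (fun t => μ t i - μ₀ i) =O[F] f) (h2 : (fun t => μ t (i + 1) - μ₀ (i + 1)) =O[F] f) :
    (fun t => shiftMoment α (μ t) i - shiftMoment α μ₀ i) =O[F] f := by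
  refine (h2.sub (h1.const_mul_left α)).congr_left fun t => ?_
  simp only [shiftMoment]
  ring

theorem tendsto_of_isBigO {f : ℝ → ℝ} {c : ℝ}
    (h : (fun t => f t - c) =O[𝓝[≠] α] fun t => |α - t|) : Tendsto f (𝓝[≠] α) (𝓝 c) := by
  have h1 := h.trans_tendsto ((tendsto_abs_sub α).mono_right nhdsWithin_le_nhds)
  simpa using h1.add_const c

theorem tendsto_log_mul_of_isBigO {f : ℝ → ℝ}
    (h : f =O[𝓝[≠] α] fun t => |α - t|) :
    Tendsto (fun t => Real.log |α - t| * f t) (𝓝[≠] α) (𝓝 0) := by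
  have h1 : Tendsto (fun t => Real.log |α - t| * |α - t|) (𝓝[≠] α) (𝓝 0) := by
    have h2 := (tendsto_log_mul_rpow_nhdsGT_zero one_pos).comp (tendsto_abs_sub α)
    simpa [Function.comp_def] using h2
  exact ((isBigO_refl _ _).mul h).trans_tendsto h1

/-- The frequency of the pinched system. -/
noncomputable def pinchFrequency (l : Fin (m + 1)) (E O : Fin (m + 1) → ℝ) (α t : ℝ) :
    Fin (m + 2) → ℝ :=
  extendedFrequency (pinchLeft l E (max α t)) (pinchRight l O (min α t))

theorem IsBands.tendsto_pinch (h : IsBands E O) (hα : α ∈ Ioo (E l) (O l)) :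
    Tendsto (fun t => ((pinchLeft l E (max α t), pinchRight l O (min α t)) : Endpoints (m + 1)))
      (𝓝[≠] α) (nhdsBands (pinchLeft l E α, pinchRight l O α)) := by
  rw [nhdsBands, tendsto_nhdsWithin_iff]
  refine ⟨?_, (eventually_pinch hα).mono fun t ht => h.pinch ht.1 ht.2.1 ht.2.2⟩
  exact (((continuous_pinchLeft l E).tendsto α).comp (tendsto_max_min α).1).prodMk_nhds
    (((continuous_pinchRight l O).tendsto α).comp (tendsto_max_min α).2)

theorem IsBands.tendsto_pinchFrequency_sub (h : IsBands E O) (hα : α ∈ Ioo (E l) (O l)) :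
    Tendsto (fun t => pinchFrequency l E O α t l.succ - pinchFrequency l E O α t l.castSucc)
      (𝓝[≠] α) (𝓝 0) := by
  have hw := h.weakBands_pinch hα.1.le le_rfl hα.2.le ((h.nonneg l).trans_lt hα.1)
  have hl : l ∈ closedGaps (pinchLeft l E α) (pinchRight l O α) := mem_closedGaps.2 (by simp)
  have h1 := LimBands.tendsto_sub (c₀ := (pinchLeft l E α, pinchRight l O α)) hw hl
  exact (h1.comp (h.tendsto_pinch hα)).congr fun t => rfl

theorem natDegree_shift (c : ℝ) {i : ℕ} (hi : i < m) :
    (Polynomial.X ^ (i + 1) - Polynomial.C c * Polynomial.X ^ i).natDegree < m + 1 := by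
  refine lt_of_le_of_lt (Polynomial.natDegree_sub_le _ _) (max_lt ?_ ?_)
  · rw [Polynomial.natDegree_X_pow]
    omega
  · refine lt_of_le_of_lt (Polynomial.natDegree_C_mul_X_pow_le _ _) ?_
    omega

/-- The defect in the linear system of the section. -/
noncomputable def pinchDefect (l : Fin (m + 1)) (E O : Fin (m + 1) → ℝ) (α t : ℝ) (i : ℕ) : ℝ :=
  ∑ j : Fin m, (-1) ^ (skipPair l j : ℕ) *
    (pinchFrequency l E O α t (skipPair l j) - pinchFrequency l E O α t l.castSucc) *
    (shiftMoment α (bandMoment (pinchLeft l E (max α t)) (pinchRight l O (min α t))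
      (skipPair l j)) i -
      shiftMoment α (bandMoment (pinchLeft l E α) (pinchRight l O α) (skipPair l j)) i) -
  pinchFrequency l E O α t l.castSucc *
    (shiftMoment α (negMoment (pinchLeft l E (max α t)) (pinchRight l O (min α t))) i -
      shiftMoment α (negMoment (pinchLeft l E α) (pinchRight l O α)) i)

/-- Test with (s - α) sⁱ and subtract the frequency of the left half, which removes that half. At t
= α the moments of the other bands and of the half line are, up to sign, those of the section, and
the relation of the section eliminates the subtracted constant. What remains is the contribution of
the right half, proportional to the jump of the frequency, and the variation of moments analytic in
the endpoints. -/
theorem IsBands.pinch_row (h : IsBands E O) (hα : α ∈ Ioo (E l) (O l)) {t : ℝ}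
    (ht : E l < min α t ∧ min α t < max α t ∧ max α t < O l) {i : ℕ} (hi : i < m) :
    ∑ k : Fin (m + 1), (-1) ^ (k : ℕ) * (pinchFrequency l E O α t (l.succ.succAbove k) -
      extendedFrequency E O k) * bandMoment E O k i =
    (-1) ^ ((l : ℕ) + 1) *
      (pinchFrequency l E O α t l.succ - pinchFrequency l E O α t l.castSucc) *
      shiftMoment α (bandMoment (pinchLeft l E (max α t)) (pinchRight l O (min α t)) l.succ) i +
      pinchDefect l E O α t i := by
  have hb := h.pinch ht.1 ht.2.1 ht.2.2
  have h1 := hb.sum_sub_mul (natDegree_shift α hi) (pinchFrequency l E O α t l.castSucc)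
  simp_rw [mom_shift] at h1
  rw [show extendedFrequency (pinchLeft l E (max α t)) (pinchRight l O (min α t)) =
    pinchFrequency l E O α t from rfl] at h1
  have h2 := h.negMoment_add hi
  have h3 : ∑ k : Fin (m + 1), (-1) ^ (k : ℕ) * extendedFrequency E O k * bandMoment E O k i = 0 :=
    h.isKernel ⟨i, hi⟩
  have h4 := h.shiftMoment_neg_pinch (l := l) ((h.nonneg l).trans_lt hα.1) hi
  rw [sum_skipPair l, Fin.val_succ] at h1
  rw [Fin.sum_univ_succAbove _ l] at h2 h3 ⊢
  simp only [pinchDefect, h4, succ_succAbove_self]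
  have h5 : ∑ j : Fin m, (-1) ^ (l.succAbove j : ℕ) * (pinchFrequency l E O α t
      (l.succ.succAbove (l.succAbove j)) - extendedFrequency E O (l.succAbove j)) *
        bandMoment E O (l.succAbove j) i =
      ∑ j : Fin m, (-1) ^ (l.succAbove j : ℕ) * pinchFrequency l E O α t (skipPair l j) *
        bandMoment E O (l.succAbove j) i -
      ∑ j : Fin m, (-1) ^ (l.succAbove j : ℕ) * extendedFrequency E O (l.succAbove j) *
        bandMoment E O (l.succAbove j) i := by
    rw [← Finset.sum_sub_distrib]
    exact Finset.sum_congr rfl fun j _ => by rw [skipPair]; ring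
  have h6 : ∑ j : Fin m, (-1) ^ (skipPair l j : ℕ) *
      (pinchFrequency l E O α t (skipPair l j) - pinchFrequency l E O α t l.castSucc) *
      (shiftMoment α (bandMoment (pinchLeft l E (max α t)) (pinchRight l O (min α t))
      (skipPair l j)) i -
      shiftMoment α (bandMoment (pinchLeft l E α) (pinchRight l O α) (skipPair l j)) i) =
      ∑ j : Fin m, (-1) ^ (skipPair l j : ℕ) *
      (pinchFrequency l E O α t (skipPair l j) - pinchFrequency l E O α t l.castSucc) *
      shiftMoment α (bandMoment (pinchLeft l E (max α t)) (pinchRight l O (min α t))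
      (skipPair l j)) i + ∑ j : Fin m, (-1) ^ (l.succAbove j : ℕ) *
        pinchFrequency l E O α t (skipPair l j) * bandMoment E O (l.succAbove j) i -
        pinchFrequency l E O α t l.castSucc *
          ∑ j : Fin m, (-1) ^ (l.succAbove j : ℕ) * bandMoment E O (l.succAbove j) i := by
    rw [Finset.mul_sum, ← Finset.sum_add_distrib, ← Finset.sum_sub_distrib]
    refine Finset.sum_congr rfl fun j _ => ?_
    have h7 := h.shiftMoment_pinch hα j i
    linear_combination (pinchFrequency l E O α t l.castSucc -
      pinchFrequency l E O α t (skipPair l j)) * h7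
  rw [h5, h6]
  linear_combination -h1 - h3 + pinchFrequency l E O α t l.castSucc * h2

theorem IsBands.eventually_pinchFrequency_mem (h : IsBands E O) (hα : α ∈ Ioo (E l) (O l)) :
    ∀ᶠ t in 𝓝[≠] α, ∀ k, pinchFrequency l E O α t k ∈ Icc (0 : ℝ) (1 / 2) :=
  (eventually_pinch hα).mono fun _ ht k => (h.pinch ht.1 ht.2.1 ht.2.2).extendedFrequency_mem k

/-- The frequencies are bounded by 1/2, and each difference of moments is O(|α - t|) by
`isBigO_pinch`. -/
theorem IsBands.isBigO_pinchDefect (h : IsBands E O) (hα : α ∈ Ioo (E l) (O l)) {i : ℕ}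
    (hi : i < m) : (fun t => pinchDefect l E O α t i) =O[𝓝[≠] α] fun t => |α - t| := by
  have hb : ∀ k, (fun t => pinchFrequency l E O α t k) =O[𝓝[≠] α] fun _ => (1 : ℝ) := by
    intro k
    refine IsBigO.of_bound 1 ((h.eventually_pinchFrequency_mem hα).mono fun t ht => ?_)
    rw [Real.norm_eq_abs, abs_of_nonneg (ht k).1, norm_one, one_mul]
    linarith [(ht k).2]
  have hmul : ∀ {f g : ℝ → ℝ}, f =O[𝓝[≠] α] (fun _ => (1 : ℝ)) →
      g =O[𝓝[≠] α] (fun t => |α - t|) → (fun t => f t * g t) =O[𝓝[≠] α] fun t => |α - t| := by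
    intro f g hf hg
    simpa using hf.mul hg
  unfold pinchDefect
  refine IsBigO.sub (IsBigO.fun_sum fun j _ => ?_) ?_
  · exact hmul (((hb _).sub (hb _)).const_mul_left _) (isBigO_shiftMoment
      (h.isBigO_bandMoment hα j i) (h.isBigO_bandMoment hα j (i + 1)))
  · exact hmul (hb _) (isBigO_shiftMoment
      (h.isBigO_negMoment hα (hi.trans (Nat.lt_succ_self m)))
      (h.isBigO_negMoment hα (Nat.succ_lt_succ hi)))

/-- The right hand side of the linear system of the section. -/
noncomputable def pinchRow (l : Fin (m + 1)) (E O : Fin (m + 1) → ℝ) (α t : ℝ) (i : Fin m) : ℝ :=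
  (-1) ^ ((l : ℕ) + 1) *
      (pinchFrequency l E O α t l.succ - pinchFrequency l E O α t l.castSucc) *
      shiftMoment α (bandMoment (pinchLeft l E (max α t)) (pinchRight l O (min α t)) l.succ) i +
      pinchDefect l E O α t i

theorem pinchFrequency_zero (t : ℝ) : pinchFrequency l E O α t 0 = 1 / 2 := rfl

/-- Both systems have the value 1/2 at the index 0, so this column drops out and the matrix of the
section, which does not depend on `t`, can be inverted. -/
theorem IsBands.pinch_solve (h : IsBands E O) (hα : α ∈ Ioo (E l) (O l)) {t : ℝ}
    (ht : E l < min α t ∧ min α t < max α t ∧ max α t < O l) (j : Fin m) :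
    pinchFrequency l E O α t (l.succ.succAbove j.succ) - extendedFrequency E O j.succ =
      (freqMatrix (bandMoment E O))⁻¹.mulVec (pinchRow l E O α t) j := by
  have h1 : (freqMatrix (bandMoment E O)).mulVec (fun j => pinchFrequency l E O α t
      (l.succ.succAbove j.succ) - extendedFrequency E O j.succ) = pinchRow l E O α t := by
    funext i
    have h2 := h.pinch_row hα ht i.2
    rw [Fin.sum_univ_succ, Fin.succ_succAbove_zero] at h2
    have h3 : pinchFrequency l E O α t 0 - extendedFrequency E O 0 = 0 := by
      rw [pinchFrequency_zero]
      simp [extendedFrequency]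
    rw [h3, mul_zero, zero_mul, zero_add] at h2
    rw [pinchRow, ← h2]
    simp only [Matrix.mulVec, dotProduct, freqMatrix, Matrix.of_apply, Fin.val_succ]
    exact Finset.sum_congr rfl fun j _ => by ring
  rw [← h1, Matrix.mulVec_mulVec, Matrix.nonsing_inv_mul _ (isUnit_iff_ne_zero.2 h.det_ne_zero),
    Matrix.one_mulVec]

theorem tendsto_mulVec {ι : Type*} {F : Filter ι} {k : ℕ} (M : Matrix (Fin k) (Fin k) ℝ)
    {f : ι → Fin k → ℝ} {c : Fin k → ℝ} (hf : ∀ i, Tendsto (fun t => f t i) F (𝓝 (c i))) (j : Fin k) :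
    Tendsto (fun t => M.mulVec (f t) j) F (𝓝 (M.mulVec c j)) := by
  simp only [Matrix.mulVec, dotProduct]
  exact tendsto_finsetSum _ fun i _ => (hf i).const_mul _

/-- The frequencies of the bands of the section converge. -/
theorem IsBands.tendsto_pinchFrequency (h : IsBands E O) (hα : α ∈ Ioo (E l) (O l))
    (k : Fin (m + 1)) : Tendsto (fun t => pinchFrequency l E O α t (l.succ.succAbove k)) (𝓝[≠] α)
      (𝓝 (extendedFrequency E O k)) := by
  induction k using Fin.cases with
  | zero =>
    rw [Fin.succ_succAbove_zero]
    simp only [pinchFrequency_zero, extendedFrequency, Fin.cons_zero]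
    exact tendsto_const_nhds
  | succ j =>
    have h1 : ∀ i : Fin m, Tendsto (fun t => pinchRow l E O α t i) (𝓝[≠] α) (𝓝 0) := by
      intro i
      have h2 := ((h.tendsto_pinchFrequency_sub hα).const_mul ((-1) ^ ((l : ℕ) + 1))).mul
        (h.tendsto_pinchShift hα i)
      have h3 := (h.isBigO_pinchDefect hα i.2).trans_tendsto
        ((tendsto_abs_sub α).mono_right nhdsWithin_le_nhds)
      simpa [pinchRow] using h2.add h3
    have h2 := tendsto_mulVec (freqMatrix (bandMoment E O))⁻¹ (c := 0) h1 j
    rw [Matrix.mulVec_zero] at h2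
    have h3 := h2.add_const (extendedFrequency E O j.succ)
    rw [Pi.zero_apply, zero_add] at h3
    refine h3.congr' ((eventually_pinch hα).mono fun t ht => ?_)
    rw [← h.pinch_solve hα ht]
    ring

theorem IsBands.tendsto_pinchFrequency_succ (h : IsBands E O) (hα : α ∈ Ioo (E l) (O l)) :
    Tendsto (fun t => pinchFrequency l E O α t l.succ) (𝓝[≠] α) (𝓝 (extendedFrequency E O l)) := by
  have h1 := h.tendsto_pinchFrequency hα l
  rw [succ_succAbove_self] at h1
  simpa using (h.tendsto_pinchFrequency_sub hα).add h1

/-- The coefficient in the asymptotics of the difference of the frequencies of the two halves of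
a pinched band. -/
noncomputable def pinchJump (l : Fin (m + 1)) (E O : Fin (m + 1) → ℝ) (α : ℝ) : ℝ :=
  (-1) ^ (l : ℕ) * (extendedFrequency E O l * negMoment (pinchLeft l E α) (pinchRight l O α) 0 -
    ∑ j : Fin m, (-1) ^ (skipPair l j : ℕ) *
      (extendedFrequency E O (l.succAbove j) - extendedFrequency E O l) *
        bandMoment (pinchLeft l E α) (pinchRight l O α) (skipPair l j) 0) / pinchRate l E O α

/-- The test function p = 1 expresses the jump as a convergent quantity divided by the mass of the
right half, and this mass divided by log |α - t| tends to -`pinchRate`. -/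
theorem IsBands.tendsto_pinchJump (h : IsBands E O) (hα : α ∈ Ioo (E l) (O l)) :
    Tendsto (fun t => Real.log |α - t| *
      (pinchFrequency l E O α t l.succ - pinchFrequency l E O α t l.castSucc))
      (𝓝[≠] α) (𝓝 (pinchJump l E O α)) := by
  have hρ := h.pinchRate_pos hα
  have hl := h.tendsto_pinchFrequency hα l
  rw [succ_succAbove_self] at hl
  have h1 : Tendsto (fun t => pinchFrequency l E O α t l.castSucc *
      negMoment (pinchLeft l E (max α t)) (pinchRight l O (min α t)) 0 -
      ∑ j : Fin m, (-1) ^ (skipPair l j : ℕ) *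
        (pinchFrequency l E O α t (skipPair l j) - pinchFrequency l E O α t l.castSucc) *
        bandMoment (pinchLeft l E (max α t)) (pinchRight l O (min α t)) (skipPair l j) 0)
      (𝓝[≠] α) (𝓝 (extendedFrequency E O l * negMoment (pinchLeft l E α) (pinchRight l O α) 0 -
      ∑ j : Fin m, (-1) ^ (skipPair l j : ℕ) *
        (extendedFrequency E O (l.succAbove j) - extendedFrequency E O l) *
        bandMoment (pinchLeft l E α) (pinchRight l O α) (skipPair l j) 0)) := by
    refine (hl.mul (tendsto_of_isBigO (h.isBigO_negMoment hα (Nat.succ_pos m)))).sub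
      (tendsto_finsetSum _ fun j _ => ?_)
    exact (((h.tendsto_pinchFrequency hα (l.succAbove j)).sub hl).const_mul _).mul
      (tendsto_of_isBigO (h.isBigO_bandMoment hα j 0))
  have h2 := (h1.const_mul ((-1) ^ ((l : ℕ) + 1))).div (h.tendsto_pinchMass hα)
    (neg_ne_zero.2 hρ.ne')
  have h3 : ∀ q : ℝ, (-1) ^ ((l : ℕ) + 1) * q / -pinchRate l E O α =
      (-1) ^ (l : ℕ) * q / pinchRate l E O α := by
    intro q
    rw [pow_succ]
    field_simp
  rw [h3] at h2
  refine h2.congr' ?_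
  have h4 := (h.tendsto_pinchMass hα).eventually_ne (neg_ne_zero.2 hρ.ne')
  filter_upwards [h4, eventually_pinch hα] with t ht4 ht
  have hb := h.pinch ht.1 ht.2.1 ht.2.2
  have h5 := hb.sum_sub_mul (p := 1) (by simp) (pinchFrequency l E O α t l.castSucc)
  rw [show extendedFrequency (pinchLeft l E (max α t)) (pinchRight l O (min α t)) =
    pinchFrequency l E O α t from rfl] at h5
  have h6 : ∀ μ : ℕ → ℝ, mom μ 1 = μ 0 := fun μ => by rw [← pow_zero Polynomial.X, mom_X_pow]
  simp_rw [h6] at h5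
  rw [sum_skipPair l, sub_self, mul_zero, zero_mul, zero_add, Fin.val_succ] at h5
  have h7 : bandMoment (pinchLeft l E (max α t)) (pinchRight l O (min α t)) l.succ 0 ≠ 0 ∧
      Real.log |α - t| ≠ 0 := ⟨fun h => ht4 (by rw [h, zero_div]), fun h => ht4 (by rw [h, div_zero])⟩
  simp only [Pi.div_apply]
  rw [← h5, add_sub_cancel_right]
  have h8 : ((-1 : ℝ) ^ ((l : ℕ) + 1)) * (-1) ^ ((l : ℕ) + 1) = 1 := by rw [← mul_pow]; simp
  obtain ⟨h9, h10⟩ := h7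
  rw [div_div_eq_mul_div, div_eq_iff h9]
  linear_combination (pinchFrequency l E O α t l.succ - pinchFrequency l E O α t l.castSucc) *
    bandMoment (pinchLeft l E (max α t)) (pinchRight l O (min α t)) l.succ 0 *
    Real.log |α - t| * h8

/-- The coefficients in the asymptotics of the frequencies of the bands of the section. -/
noncomputable def pinchSlope (l : Fin (m + 1)) (E O : Fin (m + 1) → ℝ) (α : ℝ) : Fin (m + 1) → ℝ :=
  Fin.cons 0 ((freqMatrix (bandMoment E O))⁻¹.mulVec fun i : Fin m =>
    (-1) ^ ((l : ℕ) + 1) * pinchJump l E O α * pinchShift l E O α i)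

/-- Multiply the linear system by log |α - t|: the jump then converges by `tendsto_pinchJump`, and
the defect, being O(|α - t|), still tends to 0. -/
theorem IsBands.tendsto_pinchSlope (h : IsBands E O) (hα : α ∈ Ioo (E l) (O l))
    (k : Fin (m + 1)) : Tendsto (fun t => Real.log |α - t| *
      (pinchFrequency l E O α t (l.succ.succAbove k) - extendedFrequency E O k)) (𝓝[≠] α)
      (𝓝 (pinchSlope l E O α k)) := by
  induction k using Fin.cases with
  | zero =>
    rw [Fin.succ_succAbove_zero]
    simp only [pinchFrequency_zero, extendedFrequency, Fin.cons_zero, pinchSlope, sub_self, mul_zero]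
    exact tendsto_const_nhds
  | succ j =>
    have h1 : ∀ i : Fin m, Tendsto (fun t => (Real.log |α - t| • pinchRow l E O α t) i) (𝓝[≠] α)
        (𝓝 ((-1) ^ ((l : ℕ) + 1) * pinchJump l E O α * pinchShift l E O α i)) := by
      intro i
      have h2 := ((h.tendsto_pinchJump hα).const_mul ((-1) ^ ((l : ℕ) + 1))).mul
        (h.tendsto_pinchShift hα i)
      have h3 := tendsto_log_mul_of_isBigO (h.isBigO_pinchDefect hα i.2)
      have h4 := h2.add h3
      rw [add_zero] at h4
      refine h4.congr fun t => ?_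
      rw [Pi.smul_apply, smul_eq_mul, pinchRow]
      ring
    have h2 := tendsto_mulVec (freqMatrix (bandMoment E O))⁻¹ h1 j
    rw [pinchSlope, Fin.cons_succ]
    refine h2.congr' ((eventually_pinch hα).mono fun t ht => ?_)
    have h3 := h.pinch_solve hα ht j
    simp only [extendedFrequency, Fin.cons_succ] at h3 ⊢
    rw [h3]
    exact (congrFun (Matrix.mulVec_smul _ _ _) j)

/-- The limit of the frequency of a pinched system. -/
theorem IsBands.tendsto_pinchFrequency_pi (h : IsBands E O) (hα : α ∈ Ioo (E l) (O l)) :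
    Tendsto (fun t => pinchFrequency l E O α t) (𝓝[≠] α)
      (𝓝 (pinchLeft l (extendedFrequency E O) (extendedFrequency E O l))) := by
  refine tendsto_pi_nhds.2 fun k => ?_
  rcases Fin.eq_self_or_eq_succAbove l.succ k with rfl | ⟨k', rfl⟩
  · rw [pinchLeft_succ]
    exact h.tendsto_pinchFrequency_succ hα
  · rw [pinchLeft_succAbove]
    exact h.tendsto_pinchFrequency hα k'

/-- The logarithmic asymptotics of the frequency of a pinched system. -/
theorem IsBands.tendsto_log_mul_pinchFrequency (h : IsBands E O) (hα : α ∈ Ioo (E l) (O l))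
    (k : Fin (m + 2)) : Tendsto (fun t => Real.log |α - t| * (pinchFrequency l E O α t k -
      pinchLeft l (extendedFrequency E O) (extendedFrequency E O l) k)) (𝓝[≠] α)
      (𝓝 (pinchLeft l (pinchSlope l E O α) (pinchSlope l E O α l + pinchJump l E O α) k)) := by
  rcases Fin.eq_self_or_eq_succAbove l.succ k with rfl | ⟨k', rfl⟩
  · rw [pinchLeft_succ, pinchLeft_succ]
    have h1 := (h.tendsto_pinchSlope hα l).add (h.tendsto_pinchJump hα)
    rw [succ_succAbove_self] at h1
    refine h1.congr fun t => ?_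
    ring
  · rw [pinchLeft_succAbove, pinchLeft_succAbove]
    exact h.tendsto_pinchSlope hα k'

end EllipsoidBilliard

namespace EllipsoidBilliard

variable {m : ℕ}

/-! ### The singular faces -/

/-- Moving x_j near a_j only moves the cut inside the j-th band of the section, from min (a_j, t) to
max (a_j, t). -/
theorem cEven_update (a : Fin (m + 2) → ℝ) (x : Fin (m + 1) → ℝ) (j : Fin (m + 1)) (t : ℝ) :
    cEven a (Function.update x j t) = pinchLeft j (cEven (fun i => a (j.castSucc.succAbove i))
      fun i => x (j.succAbove i)) (max (a j.castSucc) t) := by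
  funext k
  refine Fin.cases ?_ (fun i => ?_) k
  · rw [pinchLeft_zero _ _ _ rfl]
    rfl
  · rcases Fin.eq_self_or_eq_succAbove j i with rfl | ⟨i, rfl⟩
    · simp [cEven]
    · rw [pinchLeft_succ_succAbove]
      simp [cEven, Fin.succAbove_ne]

theorem cOdd_update (a : Fin (m + 2) → ℝ) (x : Fin (m + 1) → ℝ) (j : Fin (m + 1)) (t : ℝ) :
    cOdd a (Function.update x j t) = pinchRight j (cOdd (fun i => a (j.castSucc.succAbove i))
      fun i => x (j.succAbove i)) (min (a j.castSucc) t) := by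
  funext k
  refine Fin.lastCases ?_ (fun i => ?_) k
  · have h : j.castSucc.succAbove (Fin.last m) = Fin.last (m + 1) :=
      Fin.succAbove_ne_last_last (Fin.castSucc_lt_last j).ne
    have h1 := pinchRight_succAbove j (cOdd (fun i => a (j.castSucc.succAbove i))
      fun i => x (j.succAbove i)) (min (a j.castSucc) t) (Fin.last m)
    rw [h] at h1
    rw [h1]
    simp [cOdd, h]
  · rcases Fin.eq_self_or_eq_succAbove j i with rfl | ⟨i, rfl⟩
    · simp [cOdd]
    · rw [pinchRight_castSucc_succAbove]
      simp [cOdd, Fin.succAbove_ne]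

theorem cEven_ne {n : ℕ} {a : Fin (n + 1) → ℝ} {x : Fin n → ℝ} {b : ℝ} (h0 : b ≠ 0)
    (h1 : ∀ i, a i ≠ b) (h2 : ∀ i, x i ≠ b) (k : Fin (n + 1)) : cEven a x k ≠ b := by
  refine Fin.cases h0.symm (fun i => ?_) k
  simp only [cEven, Fin.cons_succ]
  rcases max_choice (a i.castSucc) (x i) with h | h <;> rw [h]
  exacts [h1 _, h2 _]

theorem cOdd_ne {n : ℕ} {a : Fin (n + 1) → ℝ} {x : Fin n → ℝ} {b : ℝ}
    (h1 : ∀ i, a i ≠ b) (h2 : ∀ i, x i ≠ b) (k : Fin (n + 1)) : cOdd a x k ≠ b := by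
  refine Fin.lastCases ?_ (fun i => ?_) k
  · simpa [cOdd] using h1 _
  simp only [cOdd, Fin.snoc_castSucc]
  rcases min_choice (a i.castSucc) (x i) with h | h <;> rw [h]
  exacts [h1 _, h2 _]

section

variable {a : Fin (m + 2) → ℝ} {x : Fin (m + 1) → ℝ} {j : Fin (m + 1)}

theorem notMem_of_singular (ha : StrictMono a) (ha0 : ∀ i, 0 < a i) (hx : x ∈ singularFaces a j)
    {i : Fin (m + 1)} (hij : i ≠ j) : x i ∉ range (withZero a) :=
  notMem_of_ne ha ha0 hx.1 (hx.2 ▸ mem_range_withZero a _) hij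

theorem singularFaces_subset_weakCaustics (ha : StrictMono a) (ha0 : ∀ i, 0 < a i)
    (hx : x ∈ singularFaces a j) : x ∈ weakCaustics a :=
  ((closure_singularFaces ha ha0 j).subset (subset_closure hx)).1

/-- The weak order of the full list places a_j in the j-th band of the section, and no other axis or
parameter equals it, so it is an interior point. -/
theorem singular_mem_Ioo (ha : StrictMono a) (ha0 : ∀ i, 0 < a i) (hx : x ∈ singularFaces a j) :
    a j.castSucc ∈ Ioo
      (cEven (fun i => a (j.castSucc.succAbove i)) (fun i => x (j.succAbove i)) j)
      (cOdd (fun i => a (j.castSucc.succAbove i)) (fun i => x (j.succAbove i)) j) := by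
  have hl := limBands_of_mem ha ha0 (singularFaces_subset_weakCaustics ha ha0 hx)
  have hE := cEven_update a x j (x j)
  have hO := cOdd_update a x j (x j)
  rw [Function.update_eq_self, hx.2, max_self] at hE
  rw [Function.update_eq_self, hx.2, min_self] at hO
  have h1 := hl.band j.castSucc
  have h2 := hl.band j.succ
  rw [hE, hO, pinchLeft_castSucc, pinchRight_castSucc] at h1
  rw [hE, hO, pinchLeft_succ, pinchRight_succ] at h2
  have hA : ∀ i, a (j.castSucc.succAbove i) ≠ a j.castSucc := fun i h =>
    Fin.succAbove_ne _ _ (ha.injective h)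
  have hX : ∀ i, x (j.succAbove i) ≠ a j.castSucc := fun i h =>
    notMem_of_singular ha ha0 hx (Fin.succAbove_ne j i) (h ▸ mem_range_withZero a _)
  exact ⟨lt_of_le_of_ne h1 (cEven_ne (ha0 _).ne' hA hX j),
    lt_of_le_of_ne h2 (cOdd_ne hA hX j).symm⟩

/-- Near a point of a singular face all points off the face are nonsingular. -/
theorem eventually_mem_causticSpace (ha : StrictMono a) (ha0 : ∀ i, 0 < a i)
    (hx : x ∈ singularFaces a j) :
    ∀ᶠ y in 𝓝 x, (∀ i, i ≠ j → y i ≠ a i.castSucc) ∧ (y j ≠ a j.castSucc → y ∈ causticSpace a) := by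
  have hw := singularFaces_subset_weakCaustics ha ha0 hx
  have hn := fun i => notMem_of_singular ha ha0 hx (i := i)
  have h1 : ∀ p q : Fin (m + 1), p < q → x p < x q := by
    intro p q hpq
    refine lt_of_le_of_ne (hw.1 hpq.le) fun h => ?_
    rcases eq_or_ne p j with rfl | hp
    · exact hn q hpq.ne' (h ▸ hx.2 ▸ mem_range_withZero a _)
    · rcases eq_or_ne q j with rfl | hq
      · exact hn p hp (h ▸ hx.2 ▸ mem_range_withZero a _)
      · obtain ⟨p, rfl⟩ := Fin.exists_succAbove_eq hp
        obtain ⟨q, rfl⟩ := Fin.exists_succAbove_eq hq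
        have h2 := (singular_section_mem ha ha0 hx).1
        exact hpq.ne (congrArg _ (h2.injective h))
  have h2 : ∀ i : Fin (m + 1), withZero a i.castSucc.castSucc < x i ∧ x i < a i.succ := by
    intro i
    rcases eq_or_ne i j with rfl | hi
    · rw [hx.2]
      exact ⟨withZero_lt ha ha0 i, ha Fin.castSucc_lt_succ⟩
    · exact ⟨lt_of_le_of_ne (hw.2 i).1 fun h => hn i hi ⟨_, h⟩,
        lt_of_le_of_ne (hw.2 i).2 fun h => hn i hi (h ▸ mem_range_withZero a _)⟩
  have hc : ∀ i : Fin (m + 1), Tendsto (fun y : Fin (m + 1) → ℝ => y i) (𝓝 x) (𝓝 (x i)) :=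
    fun i => (continuous_apply i).tendsto x
  have e1 : ∀ᶠ y in 𝓝 x, ∀ p q : Fin (m + 1), p < q → y p < y q :=
    eventually_all.2 fun p => eventually_all.2 fun q => by
      by_cases h : p < q
      · exact ((hc p).eventually_lt (hc q) (h1 p q h)).mono fun y hy _ => hy
      · exact Eventually.of_forall fun y h' => absurd h' h
  have e2 : ∀ᶠ y in 𝓝 x, ∀ i : Fin (m + 1), withZero a i.castSucc.castSucc < y i ∧ y i < a i.succ :=
    eventually_all.2 fun i => ((hc i).eventually_const_lt (h2 i).1).and
      ((hc i).eventually_lt_const (h2 i).2)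
  have e3 : ∀ᶠ y in 𝓝 x, ∀ i : Fin (m + 1), i ≠ j → y i ≠ a i.castSucc :=
    eventually_all.2 fun i => by
      by_cases h : i = j
      · exact Eventually.of_forall fun y h' => absurd h h'
      · exact ((hc i).eventually_ne fun h' => hn i h (h' ▸ mem_range_withZero a _)).mono
          fun y hy _ => hy
  filter_upwards [e1, e2, e3] with y y1 y2 y3
  refine ⟨y3, fun hy => mem_causticSpace_of_lt ha0 (fun p q => y1 p q) y2 fun i => ?_⟩
  rcases eq_or_ne i j with rfl | hi
  · exact hy
  · exact y3 i hi

theorem tendsto_update (hx : x j = a j.castSucc) :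
    Tendsto (fun t => Function.update x j t) (𝓝[≠] (a j.castSucc)) (𝓝 x) := by
  have h1 : Continuous fun t => Function.update x j t := continuous_const.update j continuous_id
  have h2 := h1.tendsto (a j.castSucc)
  rw [← hx, Function.update_eq_self] at h2
  rw [← hx]
  exact h2.mono_left nhdsWithin_le_nhds

theorem eventually_update_mem (ha : StrictMono a) (ha0 : ∀ i, 0 < a i)
    (hx : x ∈ singularFaces a j) :
    ∀ᶠ t in 𝓝[≠] (a j.castSucc), Function.update x j t ∈ causticSpace a := by
  filter_upwards [(tendsto_update hx.2).eventually (eventually_mem_causticSpace ha ha0 hx),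
    self_mem_nhdsWithin] with t ht ht'
  exact ht.2 (by simpa using ht')

theorem frequencyMap_update (ha : StrictMono a) (ha0 : ∀ i, 0 < a i) {t : ℝ}
    (ht : Function.update x j t ∈ causticSpace a) (i : Fin (m + 1)) :
    frequencyMap a (Function.update x j t) i = pinchFrequency j
      (cEven (fun i => a (j.castSucc.succAbove i)) fun i => x (j.succAbove i))
      (cOdd (fun i => a (j.castSucc.succAbove i)) fun i => x (j.succAbove i))
      (a j.castSucc) t i.succ := by
  rw [frequencyMap_eq ha ha0 ht, cEven_update, cOdd_update]
  rfl

theorem extFrequencyMap_of_mem_singularFaces (ha : StrictMono a) (ha0 : ∀ i, 0 < a i)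
    (hx : x ∈ singularFaces a j) (i : Fin (m + 1)) :
    extFrequencyMap a x i = pinchLeft j (extendedFrequency
      (cEven (fun i => a (j.castSucc.succAbove i)) fun i => x (j.succAbove i))
      (cOdd (fun i => a (j.castSucc.succAbove i)) fun i => x (j.succAbove i))) (extendedFrequency
      (cEven (fun i => a (j.castSucc.succAbove i)) fun i => x (j.succAbove i))
      (cOdd (fun i => a (j.castSucc.succAbove i)) fun i => x (j.succAbove i)) j) i.succ := by
  have hb := isBands_of_mem (strictMono_sectionAxes ha j.castSucc) (fun _ => ha0 _)
    (singular_section_mem ha ha0 hx)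
  have h1 := tendsto_pi_nhds.1 (hb.tendsto_pinchFrequency_pi (singular_mem_Ioo ha ha0 hx)) i.succ
  have h2 := tendsto_extFrequencyMap ha ha0 (weakCaustics_subset_closure ha ha0
    (singularFaces_subset_weakCaustics ha ha0 hx))
  have h3 := tendsto_pi_nhds.1 (h2.comp (tendsto_nhdsWithin_iff.2
    ⟨tendsto_update hx.2, eventually_update_mem ha ha0 hx⟩)) i
  refine tendsto_nhds_unique h3 (h1.congr' ?_)
  filter_upwards [eventually_update_mem ha ha0 hx] with t ht
  exact (frequencyMap_update ha ha0 ht i).symm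

theorem extFrequencyMap_singular_succAbove (ha : StrictMono a) (ha0 : ∀ i, 0 < a i)
    (hx : x ∈ singularFaces a j) :
    (fun i => extFrequencyMap a x (j.succAbove i)) =
      extFrequencyMap (fun i => a (j.castSucc.succAbove i)) fun i => x (j.succAbove i) := by
  have hs := singular_section_mem ha ha0 hx
  have ha' := strictMono_sectionAxes ha j.castSucc
  funext i
  rw [extFrequencyMap_of_mem_singularFaces ha ha0 hx, pinchLeft_succ_succAbove,
    extFrequencyMap_eq ha' (fun _ => ha0 _) hs, frequencyMap_eq ha' (fun _ => ha0 _) hs]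
  rfl

theorem singularFaces_subset_closure (ha : StrictMono a) (ha0 : ∀ i, 0 < a i) :
    singularFaces a j ⊆ closure (causticSpace a) := fun _ hx =>
  weakCaustics_subset_closure ha ha0 (singularFaces_subset_weakCaustics ha ha0 hx)

theorem mem_closure_singularFaces (ha : StrictMono a) (ha0 : ∀ i, 0 < a i)
    (hx : x ∈ closure (singularFaces a j)) :
    (fun i => x (j.succAbove i)) ∈ closure (causticSpace (fun i => a (j.castSucc.succAbove i))) ∧
      (fun i => extFrequencyMap a x (j.succAbove i)) =
        extFrequencyMap (fun i => a (j.castSucc.succAbove i)) (fun i => x (j.succAbove i)) := by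
  have ha' := strictMono_sectionAxes ha j.castSucc
  have hmaps : MapsTo (fun (x : Fin (m + 1) → ℝ) i => x (j.succAbove i)) (closure (causticSpace a))
      (closure (causticSpace fun i => a (j.castSucc.succAbove i))) := fun y hy =>
    weakCaustics_subset_closure ha' (fun _ => ha0 _) (weakCaustics_succAbove ha ha0
      (closure_subset_weakCaustics ha ha0 hy) (by simp) (by simp))
  have hxc := closure_minimal (singularFaces_subset_closure ha ha0) isClosed_closure hx
  refine ⟨hmaps hxc, ?_⟩
  refine eq_of_mem_closure (f := fun x i => extFrequencyMap a x (j.succAbove i))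
    (g := fun x => extFrequencyMap (fun i => a (j.castSucc.succAbove i)) fun i => x (j.succAbove i))
    ?_ ?_ (singularFaces_subset_closure ha ha0)
    (fun y hy => extFrequencyMap_singular_succAbove ha ha0 hy) hx
  · exact (continuous_pi fun i => continuous_apply (j.succAbove i)).continuousAt.comp_continuousWithinAt
      (continuousOn_extFrequencyMap ha ha0 x hxc)
  · exact ((continuousOn_extFrequencyMap ha' fun _ => ha0 _) _ (hmaps hxc)).comp
      (continuous_pi fun i => continuous_apply _).continuousWithinAt hmaps

/-- The left half of the pinched band is the first band, whose coefficient is ω₀ = 1/2. -/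
theorem extFrequencyMap_closure_singularFaces_zero (ha : StrictMono a) (ha0 : ∀ i, 0 < a i)
    (hx : x ∈ closure (singularFaces a 0)) : extFrequencyMap a x 0 = 1 / 2 := by
  have hxc := closure_minimal (singularFaces_subset_closure ha ha0) isClosed_closure hx
  refine eq_of_mem_closure (f := fun x => extFrequencyMap a x 0) (g := fun _ => 1 / 2)
    ((continuous_apply 0).continuousAt.comp_continuousWithinAt
    (continuousOn_extFrequencyMap ha ha0 x hxc)) continuousWithinAt_const
    (singularFaces_subset_closure ha ha0) (fun y hy => ?_) hx
  beta_reduce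
  rw [extFrequencyMap_of_mem_singularFaces ha ha0 hy, pinchLeft_succ]
  rfl

theorem extFrequencyMap_closure_singularFaces_succ {l : Fin m} (ha : StrictMono a)
    (ha0 : ∀ i, 0 < a i) (hx : x ∈ closure (singularFaces a l.succ)) :
    extFrequencyMap a x l.succ = extFrequencyMap a x l.castSucc := by
  have hxc := closure_minimal (singularFaces_subset_closure ha ha0) isClosed_closure hx
  have hc : ∀ i, ContinuousWithinAt (fun x => extFrequencyMap a x i) (closure (causticSpace a)) x :=
    fun i => (continuous_apply i).continuousAt.comp_continuousWithinAt
      (continuousOn_extFrequencyMap ha ha0 x hxc)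
  refine eq_of_mem_closure (hc l.succ) (hc l.castSucc) (singularFaces_subset_closure ha ha0)
    (fun y hy => ?_) hx
  beta_reduce
  rw [extFrequencyMap_of_mem_singularFaces ha ha0 hy, extFrequencyMap_of_mem_singularFaces ha ha0 hy,
    pinchLeft_succ, Fin.succ_castSucc, pinchLeft_castSucc]

end

end EllipsoidBilliard

namespace EllipsoidBilliard

variable {m : ℕ} {l : Fin (m + 1)} {α : ℝ}

/-! ### Analytic dependence of the coefficients at a singular face -/

section Analytic

variable {V : Type*} [NormedAddCommGroup V] [NormedSpace ℝ V] {y₀ : V}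

theorem AnalyticAt.sqrt_of_pos {f : V → ℝ} (hf : AnalyticAt ℝ f y₀) (h : 0 < f y₀) :
    AnalyticAt ℝ (fun y => √(f y)) y₀ :=
  AnalyticAt.fun_comp (g := Real.sqrt) ((Real.contDiffAt_sqrt h.ne' (n := ⊤)).analyticAt) hf

theorem AnalyticAt.sqrt_abs_of_ne {f : V → ℝ} (hf : AnalyticAt ℝ f y₀) (h : f y₀ ≠ 0) :
    AnalyticAt ℝ (fun y => √|f y|) y₀ := by
  rcases h.lt_or_gt with h | h
  · refine (AnalyticAt.fun_comp (g := fun s : ℝ => √|s|) (f := fun y => -f y)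
      (analyticAt_sqrt_abs (neg_pos.2 h)) hf.neg).congr (Eventually.of_forall fun y => ?_)
    simp
  · exact AnalyticAt.fun_comp (g := fun s : ℝ => √|s|) (analyticAt_sqrt_abs h) hf

variable {E O : V → Fin (m + 1) → ℝ}

theorem IsBands.analyticAt_pinchShift
    (h : IsBands (E y₀) (O y₀)) (hE : ∀ k, AnalyticAt ℝ (fun y => E y k) y₀)
    (hO : ∀ k, AnalyticAt ℝ (fun y => O y k) y₀) (hα : α ∈ Ioo (E y₀ l) (O y₀ l)) (i : ℕ) :
    AnalyticAt ℝ (fun y => pinchShift l (E y) (O y) α i) y₀ := by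
  have hα0 : 0 < α := (h.nonneg l).trans_lt hα.1
  have hp := analyticAt_bandMap (E := fun _ _ => α) (fun _ => analyticAt_const) hO l
  let si : C(Icc (0 : ℝ) (Real.pi / 2), ℝ) := ⟨fun φ => 2 * Real.sin φ, by fun_prop⟩
  have hpt : ∀ y (φ : Icc (0 : ℝ) (Real.pi / 2)),
      bandMap (fun _ => α) (O y) l φ = pinchPt l (O y) α φ := fun _ _ => rfl
  have hprod : ∀ y (φ : Icc (0 : ℝ) (Real.pi / 2)),
      (∏ k : Fin m, ((algebraMap ℝ _ (E y (l.succAbove k)) - bandMap (fun _ => α) (O y) l) *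
        (algebraMap ℝ _ (O y (l.succAbove k)) - bandMap (fun _ => α) (O y) l))) φ =
      otherProd (E y) (O y) l (pinchPt l (O y) α φ) := by
    intro y φ
    rw [ContinuousMap.prod_apply, otherProd]
    rfl
  unfold pinchShift
  simp_rw [intervalIntegral.integral_const_mul]
  refine (AnalyticAt.sqrt_of_pos ((hO l).sub analyticAt_const) (sub_pos.2 hα.2)).mul ?_
  refine analyticAt_integral_rsqrt (by positivity)
    -- The additional power of s in the numerator and the factor s under the root together replace
    -- √s, as for the band moments.
    (N := fun y => si * bandMap (fun _ => α) (O y) l ^ (i + 1))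
    (Q := fun y => bandMap (fun _ => α) (O y) l *
      ((algebraMap ℝ _ (E y l) - bandMap (fun _ => α) (O y) l) *
      ∏ k : Fin m, ((algebraMap ℝ _ (E y (l.succAbove k)) - bandMap (fun _ => α) (O y) l) *
        (algebraMap ℝ _ (O y (l.succAbove k)) - bandMap (fun _ => α) (O y) l))))
    (analyticAt_const.mul (hp.pow _)) (hp.mul (((analyticAt_algebraMap (hE l)).sub hp).mul
      (Finset.analyticAt_fun_prod _ fun k _ => ((analyticAt_algebraMap (hE _)).sub hp).mul
        ((analyticAt_algebraMap (hO _)).sub hp)))) (fun t => ?_) ?_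
  · rw [ContinuousMap.mul_apply, ContinuousMap.mul_apply, hprod, hpt]
    have hm := pinchPt_mem (l := l) (O := O y₀) hα.2.le t
    exact mul_ne_zero (hα0.trans_le hm.1).ne' (h.pinchProd_ne_zero ⟨hα.1.trans_le hm.1, hm.2⟩)
  · filter_upwards [(hO l).continuousAt.eventually_const_lt hα.2] with y hy t
    have hs : 0 < pinchPt l (O y) α t := hα0.trans_le (pinchPt_mem hy.le _).1
    rw [ContinuousMap.mul_apply, ContinuousMap.mul_apply, ContinuousMap.mul_apply, hprod,
      ContinuousMap.pow_apply, hpt, abs_mul, Real.sqrt_mul (abs_nonneg _), mul_inv, pinchWeight]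
    have h1 : si t = 2 * Real.sin t := rfl
    have h2 : (algebraMap ℝ C(Icc (0 : ℝ) (Real.pi / 2), ℝ) (E y l) -
      bandMap (fun _ => α) (O y) l) t = E y l - pinchPt l (O y) α t := rfl
    rw [h1, h2]
    have h3 : (√|pinchPt l (O y) α t|) ≠ 0 := (Real.sqrt_pos.2 (abs_pos.2 hs.ne')).ne'
    have h4 : pinchPt l (O y) α t * (√|pinchPt l (O y) α t|)⁻¹ = √|pinchPt l (O y) α t| := by
      rw [← div_eq_mul_inv, div_eq_iff h3, Real.mul_self_sqrt (abs_nonneg _), abs_of_pos hs]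
    rw [pow_succ]
    linear_combination (-2 * Real.sin t * pinchPt l (O y) α t ^ i *
      (√|(E y l - pinchPt l (O y) α t) * otherProd (E y) (O y) l (pinchPt l (O y) α t)|)⁻¹) * h4

theorem IsBands.analyticAt_pinchRate
    (h : IsBands (E y₀) (O y₀)) (hE : ∀ k, AnalyticAt ℝ (fun y => E y k) y₀)
    (hO : ∀ k, AnalyticAt ℝ (fun y => O y k) y₀) (hα : α ∈ Ioo (E y₀ l) (O y₀ l)) : AnalyticAt ℝ (fun y => pinchRate l (E y) (O y) α) y₀ := by
  unfold pinchRate pinchWeight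
  have h1 := h.pinchProd_ne_zero ⟨hα.1, hα.2.le⟩
  have h2 : AnalyticAt ℝ (fun y => √(O y l - α)) y₀ :=
    AnalyticAt.sqrt_of_pos ((hO l).sub analyticAt_const) (sub_pos.2 hα.2)
  refine AnalyticAt.fun_div (analyticAt_const.mul (analyticAt_const.mul (AnalyticAt.fun_inv ?_
    (Real.sqrt_pos.2 (abs_pos.2 h1)).ne'))) (analyticAt_const.mul h2)
    (mul_pos two_pos (Real.sqrt_pos.2 (sub_pos.2 hα.2))).ne'
  refine AnalyticAt.sqrt_abs_of_ne (((hE l).sub analyticAt_const).mul ?_) h1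
  unfold otherProd
  exact Finset.analyticAt_fun_prod _ fun k _ => ((hE _).sub analyticAt_const).mul
    ((hO _).sub analyticAt_const)

theorem IsBands.analyticAt_extendedFrequency
    (h : IsBands (E y₀) (O y₀)) (hE : ∀ k, AnalyticAt ℝ (fun y => E y k) y₀)
    (hO : ∀ k, AnalyticAt ℝ (fun y => O y k) y₀) (hE0 : ∀ y, E y 0 = 0) (k : Fin (m + 1)) :
    AnalyticAt ℝ (fun y => extendedFrequency (E y) (O y) k) y₀ := by
  refine Fin.cases ?_ (fun i => ?_) k
  · simp only [extendedFrequency, Fin.cons_zero]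
    exact analyticAt_const
  · simp only [extendedFrequency, Fin.cons_succ]
    simp_rw [bandFrequency_eq_smul (hE0 _)]
    exact (AnalyticAt.sqrt_abs_of_ne (hO 0) (h.right_pos 0).ne').mul
      (analyticAt_pi_iff.1 (h.toRegularBands.analyticAt_scaledFrequency hE hO) i)

theorem IsBands.analyticAt_pinchJump
    (h : IsBands (E y₀) (O y₀)) (hE : ∀ k, AnalyticAt ℝ (fun y => E y k) y₀)
    (hO : ∀ k, AnalyticAt ℝ (fun y => O y k) y₀) (hα : α ∈ Ioo (E y₀ l) (O y₀ l))
    (hE0 : ∀ y, E y 0 = 0) : AnalyticAt ℝ (fun y => pinchJump l (E y) (O y) α) y₀ := by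
  have hf := h.analyticAt_extendedFrequency hE hO hE0
  refine AnalyticAt.div (analyticAt_const.mul (((hf l).mul (h.analyticAt_negMoment_pinch hE hO
    analyticAt_const analyticAt_const ((h.nonneg l).trans_lt hα.1) rfl rfl (Nat.succ_pos m))).sub
    (Finset.analyticAt_fun_sum _ fun j _ => ?_)))
    (h.analyticAt_pinchRate hE hO hα) (h.pinchRate_pos hα).ne'
  exact (analyticAt_const.mul ((hf _).sub (hf _))).mul (h.analyticAt_bandMoment_pinch hE hO hE0
    analyticAt_const analyticAt_const hα rfl rfl j 0)

theorem IsBands.analyticAt_pinchSlope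
    (h : IsBands (E y₀) (O y₀)) (hE : ∀ k, AnalyticAt ℝ (fun y => E y k) y₀)
    (hO : ∀ k, AnalyticAt ℝ (fun y => O y k) y₀) (hα : α ∈ Ioo (E y₀ l) (O y₀ l))
    (hE0 : ∀ y, E y 0 = 0) (k : Fin (m + 1)) :
    AnalyticAt ℝ (fun y => pinchSlope l (E y) (O y) α k) y₀ := by
  refine Fin.cases ?_ (fun i => ?_) k
  · simp only [pinchSlope, Fin.cons_zero]
    exact analyticAt_const
  · simp only [pinchSlope, Fin.cons_succ]
    refine analyticAt_pi_iff.1 (analyticAt_inv_mulVec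
      (M := fun y => freqMatrix (bandMoment (E y) (O y))) (fun p q => ?_) (fun p => ?_)
      h.det_ne_zero) i
    · simp only [freqMatrix, Matrix.of_apply]
      have h1 := analyticAt_bandMoment_of_pos hE hO hE0 (h.right_pos 0) h.pos (h.band q.succ)
        (h.freeBand q.succ) p
      exact analyticAt_const.mul h1
    · exact (analyticAt_const.mul (h.analyticAt_pinchJump hE hO hα hE0)).mul
        (h.analyticAt_pinchShift hE hO hα p)

end Analytic

/-! ### Asymptotics at the singular faces -/

/-- The coefficient of the logarithmic term of the frequency at the face `x j = a j`. -/
noncomputable def singularSlope (a : Fin (m + 2) → ℝ) (j : Fin (m + 1)) (x : Fin (m + 1) → ℝ) :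
    Fin (m + 1) → ℝ :=
  let E := cEven (fun i => a (j.castSucc.succAbove i)) fun i => x (j.succAbove i)
  let O := cOdd (fun i => a (j.castSucc.succAbove i)) fun i => x (j.succAbove i)
  fun i => pinchLeft j (pinchSlope j E O (a j.castSucc))
    (pinchSlope j E O (a j.castSucc) j + pinchJump j E O (a j.castSucc)) i.succ

variable {a : Fin (m + 2) → ℝ} {x : Fin (m + 1) → ℝ} {j : Fin (m + 1)}

theorem analyticAt_singularSlope (ha : StrictMono a) (ha0 : ∀ i, 0 < a i)
    (hx : x ∈ singularFaces a j) : AnalyticAt ℝ (singularSlope a j) x := by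
  have hs := singular_section_mem ha ha0 hx
  have hb := isBands_of_mem (strictMono_sectionAxes ha j.castSucc) (fun _ => ha0 _) hs
  have hα := singular_mem_Ioo ha ha0 hx
  have hp : AnalyticAt ℝ (fun (y : Fin (m + 1) → ℝ) i => y (j.succAbove i)) x :=
    AnalyticAt.pi fun i =>
      (ContinuousLinearMap.proj (R := ℝ) (φ := fun _ : Fin (m + 1) => ℝ) (j.succAbove i)).analyticAt x
  have hE : ∀ k, AnalyticAt ℝ (fun y : Fin (m + 1) → ℝ =>
      cEven (fun i => a (j.castSucc.succAbove i)) (fun i => y (j.succAbove i)) k) x := fun k =>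
    AnalyticAt.fun_comp (g := fun z => cEven (fun i => a (j.castSucc.succAbove i)) z k)
      (analyticAt_cEven (causticSpace_ne hs) k) hp
  have hO : ∀ k, AnalyticAt ℝ (fun y : Fin (m + 1) → ℝ =>
      cOdd (fun i => a (j.castSucc.succAbove i)) (fun i => y (j.succAbove i)) k) x := fun k =>
    AnalyticAt.fun_comp (g := fun z => cOdd (fun i => a (j.castSucc.succAbove i)) z k)
      (analyticAt_cOdd (causticSpace_ne hs) k) hp
  have h1 := IsBands.analyticAt_pinchSlope (y₀ := x) hb hE hO hα fun _ => rfl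
  have h2 := IsBands.analyticAt_pinchJump (y₀ := x) hb hE hO hα fun _ => rfl
  exact AnalyticAt.pi fun i => analyticAt_pinchLeft h1 ((h1 j).add h2) i.succ

theorem isLittleO_singularFaces (ha : StrictMono a) (ha0 : ∀ i, 0 < a i)
    (hx : x ∈ singularFaces a j) :
    (fun t : ℝ => frequencyMap a (Function.update x j t) - extFrequencyMap a x
      - (1 / Real.log |a j.castSucc - t|) • singularSlope a j x)
      =o[𝓝[≠] (a j.castSucc)] fun t : ℝ => 1 / Real.log |a j.castSucc - t| := by
  have hb := isBands_of_mem (strictMono_sectionAxes ha j.castSucc) (fun _ => ha0 _)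
    (singular_section_mem ha ha0 hx)
  have hα := singular_mem_Ioo ha ha0 hx
  refine isLittleO_pi.2 fun i => ?_
  have h1 := hb.tendsto_log_mul_pinchFrequency hα i.succ
  have h2 := (Real.tendsto_log_nhdsGT_zero.comp (tendsto_abs_sub (a j.castSucc))).eventually (eventually_lt_atBot 0)
  rw [isLittleO_iff_tendsto']
  · have h3 := h1.sub_const (singularSlope a j x i)
    rw [singularSlope, sub_self] at h3
    refine h3.congr' ?_
    filter_upwards [h2, eventually_update_mem ha ha0 hx] with t ht ht'
    have ht : Real.log |a j.castSucc - t| < 0 := ht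
    simp only [Pi.sub_apply, Pi.smul_apply, smul_eq_mul]
    rw [frequencyMap_update ha ha0 ht', extFrequencyMap_of_mem_singularFaces ha ha0 hx,
      singularSlope, div_div_eq_mul_div, div_one, sub_mul, one_div, mul_comm _⁻¹, mul_assoc,
      inv_mul_cancel₀ ht.ne, mul_one]
    ring
  · filter_upwards [h2] with t ht h3
    exact absurd h3 (one_div_ne_zero ht.ne)

open Classical in
-- The faces S_j are disjoint, and near a point of one of them no point belongs to another, so the
-- coefficients of the single faces combine to one map analytic along the union.
theorem exists_singular_asymptotics (ha : StrictMono a) (ha0 : ∀ i, 0 < a i) :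
    ∃ kS : (Fin (m + 1) → ℝ) → (Fin (m + 1) → ℝ),
      AnalyticAlong kS (⋃ j, singularFaces a j) ∧
      ∀ j : Fin (m + 1), ∀ x ∈ singularFaces a j,
        (fun t : ℝ => frequencyMap a (Function.update x j t) - extFrequencyMap a x
            - (1 / Real.log |a j.castSucc - t|) • kS x)
          =o[𝓝[≠] (a j.castSucc)] fun t : ℝ => 1 / Real.log |a j.castSucc - t| := by
  let kS : (Fin (m + 1) → ℝ) → (Fin (m + 1) → ℝ) := fun x =>
    if h : ∃ j, x ∈ singularFaces a j then singularSlope a h.choose x else 0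
  have hk : ∀ {j x}, x ∈ singularFaces a j → kS x = singularSlope a j x := by
    intro j x hx
    have h : ∃ j, x ∈ singularFaces a j := ⟨j, hx⟩
    have h1 : h.choose = j := by
      by_contra h1
      refine notMem_of_singular ha ha0 hx h1 ?_
      rw [h.choose_spec.2]
      exact mem_range_withZero a _
    rw [show kS x = _ from dif_pos h, h1]
  refine ⟨kS, fun x hx => ?_, fun j x hx => ?_⟩
  · obtain ⟨j, hj⟩ := mem_iUnion.1 hx
    refine ⟨_, analyticAt_singularSlope ha ha0 hj, ?_⟩
    filter_upwards [self_mem_nhdsWithin,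
      (eventually_mem_causticSpace ha ha0 hj).filter_mono nhdsWithin_le_nhds] with y hy hy'
    obtain ⟨k, hk'⟩ := mem_iUnion.1 hy
    have : k = j := by
      by_contra h
      exact hy'.1 k h hk'.2
    exact hk (this ▸ hk')
  · rw [hk hx]
    exact isLittleO_singularFaces ha ha0 hx

end EllipsoidBilliard

namespace EllipsoidBilliard

variable {n m : ℕ}

/-! ### Analyticity on the border -/

/-- The points with the same coordinates as `x` whenever these are squared semi-axes or zero. -/
def fixedCoordinates (a : Fin (n + 1) → ℝ) (x : Fin n → ℝ) : Set (Fin n → ℝ) :=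
  {y | ∀ i, x i ∈ range (withZero a) → y i = x i}

/-- Nearby, distinct coordinates stay distinct and nonspecial coordinates stay nonspecial, so the k
nonspecial values of `x` produce k nonspecial values of `y`. A coordinate leaving a special value
would produce one more, exceeding the number k for this stratum. -/
theorem eventually_mem_fixedCoordinates (a : Fin (m + 2) → ℝ) {x : Fin (m + 1) → ℝ} {k : ℕ}
    (hx : x ∈ border a k) : ∀ᶠ y in 𝓝[border a k] x, y ∈ fixedCoordinates a x := by
  have hc : ∀ i : Fin (m + 1), Tendsto (fun y : Fin (m + 1) → ℝ => y i) (𝓝 x) (𝓝 (x i)) :=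
    fun i => (continuous_apply i).tendsto x
  have h1 : ∀ᶠ y in 𝓝 x, ∀ i j, x i ≠ x j → y i ≠ y j :=
    eventually_all.2 fun i => eventually_all.2 fun j => by
      by_cases h : x i = x j
      · exact Eventually.of_forall fun y h' => absurd h h'
      · exact (((hc i).sub (hc j)).eventually_ne (sub_ne_zero.2 h)).mono
          fun y hy _ => sub_ne_zero.1 hy
  have h2 : ∀ᶠ y in 𝓝 x, ∀ i, y i ∉ range (withZero a) \ {x i} :=
    eventually_all.2 fun i => (hc i).eventually (((finite_range (withZero a)).subset
      sdiff_subset).isClosed.isOpen_compl.mem_nhds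
      (show x i ∉ range (withZero a) \ {x i} from fun h => h.2 rfl))
  filter_upwards [self_mem_nhdsWithin, h1.filter_mono nhdsWithin_le_nhds,
    h2.filter_mono nhdsWithin_le_nhds] with y hy y1 y2 i hi
  by_contra hne
  have hyi : y i ∈ range y \ range (withZero a) := ⟨⟨i, rfl⟩, fun h => y2 i ⟨h, hne⟩⟩
  have hinv : ∀ v ∈ range x, x (Function.invFun x v) = v := fun v hv => Function.invFun_eq hv
  have h3 : (fun v => y (Function.invFun x v)) '' (range x \ range (withZero a)) ⊆
      range y \ range (withZero a) := by
    rintro _ ⟨v, hv, rfl⟩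
    refine ⟨⟨_, rfl⟩, fun h => y2 _ ⟨h, fun h' => hv.2 ?_⟩⟩
    rw [← hinv v hv.1, ← h']
    exact h
  have h4 : InjOn (fun v => y (Function.invFun x v)) (range x \ range (withZero a)) := by
    intro v hv w hw h
    by_contra hvw
    rw [← hinv v hv.1, ← hinv w hw.1] at hvw
    exact y1 _ _ hvw h
  have h5 := eq_of_subset_of_ncard_le h3 (by rw [h4.ncard_image, hx.2, hy.2])
    ((finite_range y).subset sdiff_subset)
  rw [← h5] at hyi
  obtain ⟨v, hv, h6⟩ := hyi
  refine y1 _ i (fun h => hv.2 ?_) h6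
  rw [← hinv v hv.1, h]
  exact hi

theorem exists_analyticAt_of_regular {a : Fin (n + 1) → ℝ} (ha : StrictMono a) (ha0 : ∀ i, 0 < a i)
    {x : Fin n → ℝ} (hx : x ∈ weakCaustics a) (hreg : ∀ i, x i ≠ a i.castSucc) (i : Fin n) :
    ∃ g : (Fin n → ℝ) → ℝ, AnalyticAt ℝ g x ∧
      ∀ᶠ y in 𝓝[weakCaustics a ∩ fixedCoordinates a x] x, extFrequencyMap a y i = g y := by
  have h1 : ∀ᶠ y in 𝓝[weakCaustics a ∩ fixedCoordinates a x] x,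
      extFrequencyMap a y = bandFrequency (cEven a y) (cOdd a y) := by
    have h2 : ∀ᶠ y in 𝓝 x, ∀ i, y i ≠ a i.castSucc :=
      eventually_all.2 fun i => ((continuous_apply i).tendsto x).eventually_ne (hreg i)
    filter_upwards [self_mem_nhdsWithin, h2.filter_mono nhdsWithin_le_nhds] with y hy hy'
    exact extFrequencyMap_of_regular ha ha0 hy.1 hy'
  obtain ⟨m, rfl⟩ : ∃ m, n = m + 1 := ⟨n - 1, by have := i.2; omega⟩
  -- The factor √c₁ is not analytic at c₁ = 0; but if x₁ = 0 the fixed coordinates force y₁ = 0 as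
  -- well, where the frequency vanishes.
  rcases (nonneg_of_mem_weakCaustics ha0 hx 0).eq_or_lt with h0 | h0
  · refine ⟨fun _ => 0, analyticAt_const, ?_⟩
    filter_upwards [h1, self_mem_nhdsWithin] with y hy hy'
    have h2 := hy'.2 0 (h0 ▸ zero_mem_range_withZero a)
    rw [hy, bandFrequency_caustics, cOdd_zero, h2, ← h0, min_eq_right (ha0 0).le]
    simp
  · refine ⟨_, analyticAt_pi_iff.1 (analyticAt_bandFrequency ha ha0 hx hreg ?_) i,
      h1.mono fun y hy => congrFun hy i⟩
    rw [cOdd_zero]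
    exact lt_min (ha0 0) h0

/-- Induction on the dimension. If x_l = a_l, the points with the same fixed coordinates lie in the
closure of S_l. There all components but ω_l are those of a section of lower dimension, and ω_l
equals its predecessor, or 1/2 if l is the first index. -/
theorem exists_analyticAt_fixedCoordinates {a : Fin (n + 1) → ℝ} (ha : StrictMono a)
    (ha0 : ∀ i, 0 < a i) {x : Fin n → ℝ} (hx : x ∈ weakCaustics a) (i : Fin n) :
    ∃ g : (Fin n → ℝ) → ℝ, AnalyticAt ℝ g x ∧
      ∀ᶠ y in 𝓝[weakCaustics a ∩ fixedCoordinates a x] x, extFrequencyMap a y i = g y := by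
  induction n with
  | zero => exact i.elim0
  | succ m ih =>
    by_cases hreg : ∀ i, x i ≠ a i.castSucc
    · exact exists_analyticAt_of_regular ha ha0 hx hreg i
    push Not at hreg
    obtain ⟨l, hl⟩ := hreg
    have hmem : ∀ {y}, y ∈ weakCaustics a ∩ fixedCoordinates a x → y ∈ closure (singularFaces a l) :=
      fun {y} hy => (closure_singularFaces ha ha0 l).superset
        ⟨hy.1, (hy.2 l (hl ▸ mem_range_withZero a _)).trans hl⟩
    let p : (Fin (m + 1) → ℝ) →L[ℝ] (Fin m → ℝ) :=
      ContinuousLinearMap.pi fun i => ContinuousLinearMap.proj (l.succAbove i)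
    have hw : ∀ {y}, y ∈ weakCaustics a → p y ∈ weakCaustics fun i => a (l.castSucc.succAbove i) :=
      fun {y} hy => weakCaustics_succAbove ha ha0 hy (by simp) (by simp)
    have h1 : ∀ k : Fin m, ∃ g : (Fin (m + 1) → ℝ) → ℝ, AnalyticAt ℝ g x ∧
        ∀ᶠ y in 𝓝[weakCaustics a ∩ fixedCoordinates a x] x,
          extFrequencyMap a y (l.succAbove k) = g y := by
      intro k
      obtain ⟨g, hg, hge⟩ := ih (strictMono_sectionAxes ha l.castSucc) (fun _ => ha0 _) (hw hx) k
      refine ⟨fun y => g (p y), hg.fun_comp (p.analyticAt x), ?_⟩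
      have h2 : Tendsto p (𝓝[weakCaustics a ∩ fixedCoordinates a x] x)
          (𝓝[weakCaustics (fun i => a (l.castSucc.succAbove i)) ∩
            fixedCoordinates (fun i => a (l.castSucc.succAbove i)) (p x)] (p x)) :=
        p.continuous.continuousWithinAt.tendsto_nhdsWithin fun y hy =>
          ⟨hw hy.1, fun i hi => hy.2 _ (range_withZero_succAbove a _ hi)⟩
      filter_upwards [h2.eventually hge, self_mem_nhdsWithin] with y hy hy'
      rw [← hy]
      exact congrFun (mem_closure_singularFaces ha ha0 (hmem hy')).2 k
    rcases Fin.eq_self_or_eq_succAbove l i with rfl | ⟨k, rfl⟩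
    · rcases Fin.eq_zero_or_eq_succ i with rfl | ⟨k, rfl⟩
      · refine ⟨fun _ => 1 / 2, analyticAt_const, ?_⟩
        filter_upwards [self_mem_nhdsWithin] with y hy
        exact extFrequencyMap_closure_singularFaces_zero ha ha0 (hmem hy)
      · obtain ⟨g, hg, hge⟩ := h1 k
        refine ⟨g, hg, ?_⟩
        filter_upwards [hge, self_mem_nhdsWithin] with y hy hy'
        rw [← hy, Fin.succAbove_of_castSucc_lt _ _ Fin.castSucc_lt_succ]
        exact extFrequencyMap_closure_singularFaces_succ ha ha0 (hmem hy')
    · exact h1 k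

/-- Near each of its points a stratum lies in the set with fixed special coordinates, to which the
local result applies. Connectedness plays no role. -/
theorem analyticAlong_border {a : Fin (m + 2) → ℝ} (ha : StrictMono a) (ha0 : ∀ i, 0 < a i)
    {k : ℕ} {A : Set (Fin (m + 1) → ℝ)} (hA : A ⊆ border a k) :
    AnalyticAlong (extFrequencyMap a) A := by
  intro x hx
  have hb := hA hx
  have hw : border a k ⊆ weakCaustics a := fun y hy => by
    rw [border_eq a ha ha0] at hy
    exact hy.1.1
  choose g hg hge using exists_analyticAt_fixedCoordinates ha ha0 (hw hb)
  refine ⟨fun y i => g i y, AnalyticAt.pi hg, ?_⟩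
  have h1 : 𝓝[A] x ≤ 𝓝[weakCaustics a ∩ fixedCoordinates a x] x := by
    refine le_trans (nhdsWithin_mono x hA) (nhdsWithin_le_iff.2 ?_)
    filter_upwards [self_mem_nhdsWithin, eventually_mem_fixedCoordinates a hb] with y hy hy'
    exact ⟨hw hy, hy'⟩
  filter_upwards [(eventually_all.2 hge).filter_mono h1] with y hy
  exact funext hy

end EllipsoidBilliard

/-! ### The theorem -/

open EllipsoidBilliard in
theorem theorem6p1 (m : ℕ) (a : Fin (m + 2) → ℝ) (ha : StrictMono a) (ha0 : ∀ i, 0 < a i) :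
    -- the frequency map is well defined
    (∀ lam ∈ causticSpace a, ∃! w, IsFrequency a lam w) ∧
    -- it is analytic
    AnalyticOnNhd ℝ (frequencyMap a) (causticSpace a) ∧
    -- it extends continuously to the border
    (ContinuousOn (extFrequencyMap a) (closure (causticSpace a)) ∧
      EqOn (extFrequencyMap a) (frequencyMap a) (causticSpace a)) ∧
    -- the extension vanishes on the closure of `G`
    (∀ lam ∈ closure (geodesicFaces a), extFrequencyMap a lam = 0) ∧
    -- `R` consists of the faces of the simple regular collapses
    regularFaces a = ⋃ F : RegularKind m, F.face a ∧
    -- one component is an explicit function of the other ones on the closure of `R`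
    (∀ F : RegularKind m,
      (∀ lam ∈ F.face a, extFrequencyMap a lam F.idx =
        F.collapsedComponent a lam (fun i => extFrequencyMap a lam (F.idx.succAbove i))) ∧
      ∀ lam ∈ closure (F.face a),
        Tendsto (fun mu => F.collapsedComponent a mu
          (fun i => extFrequencyMap a mu (F.idx.succAbove i)))
          (𝓝[F.face a] lam) (𝓝 (extFrequencyMap a lam F.idx))) ∧
    -- components on the closures of the singular faces
    (∀ lam ∈ closure (singularFaces a 0), extFrequencyMap a lam 0 = 1 / 2) ∧
    (∀ l : Fin m, ∀ lam ∈ closure (singularFaces a l.succ),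
      extFrequencyMap a lam l.succ = extFrequencyMap a lam l.castSucc) ∧
    -- the free components are the extended frequency of a coordinate section
    (∀ F : RegularKind m, ∀ lam ∈ closure (F.face a),
      F.sectionCaustics a lam ∈ closure (causticSpace (F.sectionAxes a)) ∧
      (fun i => extFrequencyMap a lam (F.idx.succAbove i)) =
        extFrequencyMap (F.sectionAxes a) (F.sectionCaustics a lam)) ∧
    (∀ j : Fin (m + 1), ∀ lam ∈ closure (singularFaces a j),
      (fun i => lam (j.succAbove i)) ∈
        closure (causticSpace (fun i => a (j.castSucc.succAbove i))) ∧
      (fun i => extFrequencyMap a lam (j.succAbove i)) =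
        extFrequencyMap (fun i => a (j.castSucc.succAbove i)) (fun i => lam (j.succAbove i))) ∧
    -- analyticity on the connected components of the `k`-dimensional border
    (∀ k : ℕ, 1 ≤ k → k ≤ m → ∀ x ∈ border a k,
      AnalyticAlong (extFrequencyMap a) (connectedComponentIn (border a k) x)) ∧
    -- asymptotics at `G`
    (∃ kG : (Fin m → ℝ) → (Fin (m + 1) → ℝ),
      AnalyticOnNhd ℝ kG (geodesicSpace a) ∧
      (∀ x ∈ geodesicSpace a, ∀ i, 0 < kG x i) ∧
      ∀ x ∈ geodesicSpace a,
        (fun t : ℝ => frequencyMap a (Fin.cons t x) - t ^ (1 / 2 : ℝ) • kG x)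
          =O[𝓝[>] 0] fun t : ℝ => t ^ (3 / 2 : ℝ)) ∧
    -- asymptotics at `S`
    (∃ kS : (Fin (m + 1) → ℝ) → (Fin (m + 1) → ℝ),
      AnalyticAlong kS (⋃ j, singularFaces a j) ∧
      ∀ j : Fin (m + 1), ∀ x ∈ singularFaces a j,
        (fun t : ℝ => frequencyMap a (Function.update x j t) - extFrequencyMap a x
            - (1 / Real.log |a j.castSucc - t|) • kS x)
          =o[𝓝[≠] (a j.castSucc)] fun t : ℝ => 1 / Real.log |a j.castSucc - t|) ∧
    -- asymptotics at `R`
    (∀ x ∈ regularFaces a,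
      (fun lam => frequencyMap a lam - extFrequencyMap a x)
        =O[𝓝[causticSpace a] x] fun lam => lam - x) := by
  exact ⟨fun _ h => existsUnique_isFrequency ha ha0 h, analyticOnNhd_frequencyMap ha ha0,
    ⟨continuousOn_extFrequencyMap ha ha0, extFrequencyMap_eq ha ha0⟩,
    fun _ h => extFrequencyMap_of_mem_closure_geodesicFaces ha ha0 h, regularFaces_eq ha ha0,
    fun _ => ⟨fun _ h => (extFrequencyMap_of_mem_face ha ha0 h).2,
      fun _ h => tendsto_collapsedComponent ha ha0 h⟩,
    fun _ h => extFrequencyMap_closure_singularFaces_zero ha ha0 h,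
    fun _ _ h => extFrequencyMap_closure_singularFaces_succ ha ha0 h,
    fun _ _ h => mem_closure_face ha ha0 h, fun _ _ h => mem_closure_singularFaces ha ha0 h,
    fun _ _ _ _ _ => analyticAlong_border ha ha0 (connectedComponentIn_subset _ _),
    exists_geodesic_asymptotics ha ha0, exists_singular_asymptotics ha ha0,
    fun _ h => isBigO_regularFaces ha ha0 h⟩
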